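/- **Setting.** Let $\mathcal C=(C,x,y)$ be a spectral curve: $C$ is a reduced analytic curve over $\mathbb C$ with normalisation $\pi:\tilde C\to C$, $x,y$ are meromorphic functions on $C$ ($x$ being well defined as a map $C\to\mathbb P^1$), and all fibres of $x$ are finite. Put $\tilde x=x\circ\pi$, $\tilde y=y\circ\pi$. Let $\mathfrak b\subset\mathbb C$ be the set of points $b$ having a neighbourhood $U$ such that $|x^{-1}(b')|$ is constant for $b'\in U\setminus\{b\}$ and strictly larger than $|x^{-1}(b)|$; assume $\mathfrak b$ finite. Put $\mathfrak a=x^{-1}(\mathfrak b)$, $\tilde{\mathfrak a}=\tilde x^{-1}(\mathfrak b)$, $\tilde{\mathfrak a}_\alpha=\pi^{-1}(\alpha)$ for $\alpha\in\mathfrak a$. At each $\mu\in\tilde{\mathfrak a}_\alpha$ fix a local coordinate $\zeta$ centred at $\mu$ with $\tilde x=x(\alpha)+\zeta^{r_\mu}$, and write $$\tilde y\,\mathrm d\tilde x=\sum_{k\in\mathbb Z}F_{0,1}\big[\begin{smallmatrix}\mu\\-k\end{smallmatrix}\big]\zeta^{k-1}\mathrm d\zeta,\qquad s_\mu=\min\{k: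 F_{0,1}\big[\begin{smallmatrix}\mu\\-k\end{smallmatrix}\big]\ne0\}\in\mathbb Z\cup\{+\infty\},\qquad t_\mu=-\tfrac1{r_\mu}F_{0,1}\big[\begin{smallmatrix}\mu\\-s_\mu\end{smallmatrix}\big].$$ Let $r_\alpha=\sum_{\mu\in\tilde{\mathfrak a}_\alpha}r_\mu$. Assume that $\tilde y\,\mathrm d\tilde x$ is holomorphic at the points of $\tilde{\mathfrak a}$, i.e. $s_\mu\ge1$ for all $\mu$, and that for every $\alpha\in\mathfrak a$ none of the following holds: (i) $s_\mu=s_\nu=+\infty$ for some distinct $\mu,\nu\in\tilde{\mathfrak a}_\alpha$; (ii) $s_\mu=+\infty$ and $r_\mu>1$ for some $\mu\in\tilde{\mathfrak a}_\alpha$; (iii) there are distinct $\mu,\nu\in\tilde{\mathfrak a}_\alpha$ with $s_\mu,s_\nu$ finite, $\frac{r_\mu}{s_\mu}=\frac{r_\nu}{s_\nu}$ and $t_\mu^{r_\nu}=t_\nu^{r_\nu}$; (iv) there is $\mu\in\tilde{\mathfrak a}_\alpha$ with $s_\mu$ finite and $\gcd(r_\mu,s_\mu)>1$. Fix on each $\tilde{\mathfrak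 a}_\alpha$ a total order such that $\mu\prec\nu$ implies $\frac{r_\mu}{s_\mu}\ge\frac{r_\nu}{s_\nu}$. For $1\le i\le r_\alpha$ write $i=\sum_{\nu\prec\lambda}r_\nu+i'$ with $\lambda\in\tilde{\mathfrak a}_\alpha$, $1\le i'\le r_\lambda$, and put $\mathfrak d_\alpha(i)=-\big\lfloor\frac{s_\lambda(i'-1)}{r_\lambda}\big\rfloor-\sum_{\nu\prec\lambda}s_\nu+\delta_{i',1}$ (the floor being $0$ for $i'=1$). **Correlators.** A family of correlators is a family $\boldsymbol\omega=(\omega_{g,n})_{g\in\frac12\mathbb N,\,n\ge1}$ of multidifferentials on $\tilde C^n$ such that $\omega_{0,1}=\tilde y\,\mathrm d\tilde x$; $\omega_{0,2}$ is a symmetric bidifferential, holomorphic except for a double pole of biresidue $1$ on the diagonal; $\omega_{\frac12,1}$ is a meromorphic differential with at most simple poles on $\tilde{\mathfrak a}$ and $\sum_{\mu\in\tilde{\mathfrak a}_\alpha}\mathrm{Res}_\mu\,\omega_{\frac12,1}=0$ for all $\alpha$; and for $2g-2+n>0$, $\omega_{g,n}$ is symmetric and meromorphic with poles only where some variable is in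 $\tilde{\mathfrak a}$. It satisfies the projection property if for $2g-2+n>0$ $$\omega_{g,n}(z_1,z_2,\dots,z_n)=\sum_{\mu\in\tilde{\mathfrak a}}\mathop{\mathrm{Res}}_{z=\mu}\Big(\int_\mu^z\omega_{0,2}(\cdot,z_1)\Big)\omega_{g,n}(z,z_2,\dots,z_n).$$ Let $$\mathcal W_{g,m,n}(z_{[m]};w_{[n]})=\sum\prod_{L\in\mathbf L}\omega_{g_L,|L|+|N_L|}(z_L,w_{N_L}),$$ the sum being over set partitions $\mathbf L$ of $[m]$, decompositions $[n]=\bigsqcup_{L\in\mathbf L}N_L$ and $(g_L)_{L\in\mathbf L}$ in $\frac12\mathbb N$ with $m+\sum_L(g_L-1)=g$. For $x_0\ne x(\alpha)$ close to $x(\alpha)$ let $\mathfrak f_\alpha(x_0)$ be the set of the $r_\alpha$ points of $\tilde x^{-1}(x_0)$ close to $\tilde{\mathfrak a}_\alpha$. The abstract loop equations say that for all $g\in\frac12\mathbb N$, $n\ge0$ with $2g-2+(n+1)>0$, all $\alpha\in\mathfrak a$ and $1\le i\le r_\alpha$, as $x_0\to x(\alpha)$, $$\sum_{Z\subseteq\mathfrak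 f_\alpha(x_0),\,|Z|=i}\mathcal W_{g,i,n}(Z;w_{[n]})=\mathcal O\Big((x_0-x(\alpha))^{-(\mathfrak d_\alpha(i)-1-\delta_{i,1})}\Big(\frac{\mathrm dx_0}{x_0-x(\alpha)}\Big)^i\Big).$$ **Operators.** Define $Q_\mu=\mathrm{Res}_\mu\,\omega_{\frac12,1}$; $F_{\frac12,1}\big[\begin{smallmatrix}\mu\\-k\end{smallmatrix}\big]$ ($k>0$) as the coefficient of $\zeta^{k-1}\mathrm d\zeta$ in $\omega_{\frac12,1}$ at $\mu$; $F_{0,2}\big[\begin{smallmatrix}\mu&\nu\\-k&-l\end{smallmatrix}\big]$ ($k,l>0$) as the coefficient of $\zeta_1^{k-1}\zeta_2^{l-1}\mathrm d\zeta_1\mathrm d\zeta_2$ in $\omega_{0,2}-\delta_{\mu,\nu}\frac{\mathrm d\zeta_1\mathrm d\zeta_2}{(\zeta_1-\zeta_2)^2}$ at $(\mu,\nu)$; and $\mathrm d\xi^\mu_{-k}(z)=\mathrm{Res}_{z'=\mu}\big(\int_\mu^{z'}\omega_{0,2}(\cdot,z)\big)\frac{\mathrm d\zeta(z')}{\zeta(z')^{k+1}}$.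 Let $J^\mu_k=\hbar\partial_{x^\mu_k}$ and $J^\mu_{-k}=k\,x^\mu_k$ for $k>0$, and $J^\mu_0=\hbar^{1/2}Q_\mu$. With $\theta=e^{2\pi\mathbf i/r}$ let $$\Psi^{(j)}_r(a_{2j+1},\dots,a_i)=\frac1{i!}\sum_{\substack{0\le m_1,\dots,m_i\le r-1\\\text{distinct}}}\ \prod_{l=1}^j\frac{\theta^{m_{2l-1}+m_{2l}}}{(\theta^{m_{2l}}-\theta^{m_{2l-1}})^2}\prod_{l=2j+1}^i\theta^{-m_la_l},$$ $$W^\mu_{i,k}=\frac1{r_\mu}\sum_{j=0}^{\lfloor i/2\rfloor}\frac{i!\,\hbar^j}{2^jj!(i-2j)!}\sum_{\substack{p_{2j+1},\dots,p_i\in\mathbb Z\\ \sum_lp_l=r_\mu k}}\Psi^{(j)}_{r_\mu}(p_{2j+1},\dots,p_i)\,{:}\prod_{l}J^\mu_{p_l}{:}\,,$$ $$W_{\alpha;i,k}=\sum_{M\subseteq\tilde{\mathfrak a}_\alpha}\ \sum_{\substack{1\le i_\mu\le r_\mu\ (\mu\in M)\\ \sum i_\mu=i}}\ \sum_{\substack{\mathbf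 k\in\mathbb Z^M\\ \sum k_\mu=k}}\ \prod_{\mu\in M}\frac{W^\mu_{i_\mu,k_\mu}}{r_\mu^{i_\mu-1}},\qquad H_{\alpha;i,k}=\hat\Phi\,\hat T\,W_{\alpha;i,k}\,\hat T^{-1}\hat\Phi^{-1},$$ $$\hat T=\exp\Big(\sum_{\mu,\,k>0}\big(\hbar^{-1}F_{0,1}\big[\begin{smallmatrix}\mu\\-k\end{smallmatrix}\big]+\hbar^{-\frac12}F_{\frac12,1}\big[\begin{smallmatrix}\mu\\-k\end{smallmatrix}\big]\big)\tfrac{J^\mu_k}k\Big),\qquad \hat\Phi=\exp\Big(\frac1{2\hbar}\sum_{\mu,\nu,\,k,l>0}F_{0,2}\big[\begin{smallmatrix}\mu&\nu\\-k&-l\end{smallmatrix}\big]\tfrac{J^\mu_kJ^\nu_l}{kl}\Big).$$ Let $\mathcal I$ be the set of $(\alpha,i,k)$ with $\alpha\in\mathfrak a$, $1\le i\le r_\alpha$, $k\in\mathbb Z$ and $k\ge\mathfrak d_\alpha(i)-\delta_{i,1}$. **Proposition.** Let $\boldsymbol\omega$ be a family of correlators satisfying the projection property. Then for $2g-2+n>0$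 there are finite decompositions $$\omega_{g,n}(z_1,\dots,z_n)=\sum_{\mu_i\in\tilde{\mathfrak a},\,k_i>0}F_{g,n}\big[\begin{smallmatrix}\mu_1&\cdots&\mu_n\\k_1&\cdots&k_n\end{smallmatrix}\big]\prod_{i=1}^n\mathrm d\xi^{\mu_i}_{-k_i}(z_i),$$ and, with $F=\sum_{2g-2+n>0,\ n\ge1}\frac{\hbar^{g-1}}{n!}\sum_{\mu_i,k_i}F_{g,n}\big[\begin{smallmatrix}\mu_1&\cdots&\mu_n\\k_1&\cdots&k_n\end{smallmatrix}\big]\prod_{i}x^{\mu_i}_{k_i}$ (so that $Z=e^F$ is the partition function), the abstract loop equations for $\boldsymbol\omega$ are equivalent to $$\forall(\alpha,i,k)\in\mathcal I,\qquad e^{-F}H_{\alpha;i,k}\,e^F\cdot1=0 .$$ -/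

import Mathlib

open Filter Topology Complex
open scoped Manifold ContDiff

noncomputable section

namespace WLoop

/-! ## Residues and Laurent coefficients in one complex variable -/

/-- The residue at `0` of the differential `f(w) dw`, for `f` meromorphic at `0`: the integral over
a circle of radius `ρ` divided by `2πi`, which does not depend on `ρ` once `ρ` is small. -/
def residue (f : ℂ → ℂ) : ℂ :=
  limUnder (𝓝[>] (0 : ℝ)) fun ρ => (2 * (Real.pi : ℂ) * I)⁻¹ * ∮ w in C(0, ρ), f w

/-- The coefficient of `w ^ k` in the Laurent expansion of `f` at `0`. -/
def laurentCoeff (f : ℂ → ℂ) (k : ℤ) : ℂ :=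
  residue fun w => f w * w ^ (-k - 1)

/-! ## Riemann surfaces, meromorphic functions, multidifferentials -/

/-- The finite part of a point of the Riemann sphere (with value `0` at `∞`). -/
def finPart (z : OnePoint ℂ) : ℂ := z.elim 0 id

section Surface

variable (S : Type*) [TopologicalSpace S] [ChartedSpace ℂ S]

/-- The local coordinates of the Riemann surface `S`. -/
abbrev coordinates : Set (OpenPartialHomeomorph S ℂ) := IsManifold.maximalAtlas 𝓘(ℂ) ω S

/-- The tangent bundle of `S`; its elements are pairs (point, tangent vector at this point). -/
abbrev TB := TangentBundle 𝓘(ℂ) S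

/-- Multidifferentials on `S ^ n`: a multilinear form on `T_{p 0} S × ⋯ × T_{p (n-1)} S` for every
`p`. The regularity (and the locus where the value is meaningful) is imposed separately. -/
abbrev MultiForm (n : ℕ) :=
  ∀ p : Fin n → S, MultilinearMap ℂ (fun i => TangentSpace 𝓘(ℂ) (p i)) ℂ

variable {S}

/-- A meromorphic function on `S`, as a map to the Riemann sphere. -/
structure IsMeromorphicMap (f : S → OnePoint ℂ) : Prop where
  continuous : Continuous f
  isolated_poles : ∀ p, ∀ᶠ q in 𝓝[≠] p, f q ≠ OnePoint.infty
  meromorphicAt : ∀ p, ∀ e ∈ coordinates S, p ∈ e.source →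
    MeromorphicAt (fun w => finPart (f (e.symm w))) (e p)

/-- Evaluation of a multidifferential on a tuple of tangent vectors. -/
def ev {n : ℕ} (η : MultiForm S n) (t : Fin n → TB S) : ℂ :=
  η (fun i => (t i).proj) (fun i => (t i).2)

/-- Evaluation on a family of tangent vectors indexed by an arbitrary finite type. It is used for
symmetric multidifferentials only, for which the chosen enumeration does not matter. -/
def evFam (η : ∀ n, MultiForm S n) {ι : Type*} [Fintype ι] (t : ι → TB S) : ℂ :=
  ev (η (Fintype.card ι)) (fun i => t ((Fintype.equivFin ι).symm i))

/-- The coordinate tangent vector `∂/∂w` of a local coordinate `e`, at the point of coordinate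
`w`. -/
def coordVec (e : OpenPartialHomeomorph S ℂ) (w : ℂ) : TB S :=
  tangentMap 𝓘(ℂ) 𝓘(ℂ) e.symm ⟨w, (1 : ℂ)⟩

/-- `η` is a section of `(K(* A))^{⊠ n}` on `S ^ n`: it is holomorphic away from the locus where
some variable lies in `A`, and meromorphic with poles along this locus. -/
def IsMeromorphicForm (A : Set S) {n : ℕ} (η : MultiForm S n) : Prop :=
  ∀ (p : Fin n → S) (e : Fin n → OpenPartialHomeomorph S ℂ),
    (∀ i, e i ∈ coordinates S ∧ p i ∈ (e i).source) →
    ∃ (N : ℕ) (f : (Fin n → ℂ) → ℂ), AnalyticAt ℂ f (fun i => e i (p i)) ∧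
      ∀ᶠ w in 𝓝 (fun i => e i (p i)), (∀ i, p i ∈ A → w i ≠ e i (p i)) →
        (∏ i, open Classical in if p i ∈ A then (w i - e i (p i)) ^ N else 1) *
          ev η (fun i => coordVec (e i) (w i)) = f w

/-- Fundamental bidifferentials of the second kind: symmetric, holomorphic away from the diagonal,
with a double pole of biresidue `1` along the diagonal. -/
structure IsFundamentalBidifferential (B : MultiForm S 2) : Prop where
  symm : ∀ t u : TB S, t.proj ≠ u.proj → ev B ![t, u] = ev B ![u, t]
  holomorphic : ∀ p q : S, p ≠ q → ∀ e ∈ coordinates S, ∀ e' ∈ coordinates S,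
    p ∈ e.source → q ∈ e'.source →
    AnalyticAt ℂ (fun u : ℂ × ℂ => ev B ![coordVec e u.1, coordVec e' u.2]) (e p, e' q)
  diagonal : ∀ p : S, ∀ e ∈ coordinates S, p ∈ e.source →
    ∃ f : ℂ × ℂ → ℂ, AnalyticAt ℂ f (e p, e p) ∧ (∀ᶠ w in 𝓝 (e p), f (w, w) = 1) ∧
      ∀ᶠ u in 𝓝 (e p, e p), u.1 ≠ u.2 →
        ev B ![coordVec e u.1, coordVec e u.2] = f u / (u.1 - u.2) ^ 2

/-- The `m`-disconnected, `n`-connected correlators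
`𝓦_{g,m,n}(z_{[m]}; w_{[n]})`, where `h = 2 g`, the family `z` is indexed by a finite set `A` with
`m` elements and `w` is indexed by a finite set `B` with `n` elements. The sum runs over the
partitions `P` of `A`, the maps `N : B → P` (`N_L` is the fibre of `N` at the block `L`) and the
families `(g_L)` with `m + ∑_L (g_L - 1) = g`. Such families satisfy `g_L ≤ g`. -/
def disconnected (η : ∀ _ n : ℕ, MultiForm S n) (h : ℕ) {A B : Type*} [Fintype A] [Fintype B]
    (z : A → TB S) (w : B → TB S) : ℂ :=
  open Classical in
  ∑ P : Finpartition (Finset.univ : Finset A), ∑ N : B → {L // L ∈ P.parts},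
    ∑ g : {L // L ∈ P.parts} → Fin (h + 1),
      if 2 * Fintype.card A + ∑ L, (g L : ℕ) = h + 2 * P.parts.card then
        ∏ L : {L // L ∈ P.parts},
          evFam (η (g L)) (Sum.elim (fun a : {a // a ∈ L.1} => z a) (fun b : {b // N b = L} => w b))
      else 0

end Surface

/-! ## Spectral curves -/

/-- A spectral curve `(C, x, y)`, given together with the normalisation `π : S → C`. Here `S` is a
Riemann surface, and `C` is obtained from it by identifications over a discrete set of points, as
the underlying space of a reduced analytic curve is obtained from its normalisation. Meromorphic
functions on a reduced curve are those of its normalisation; `x` has moreover to be well-defined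
as a map on `C`. -/
structure SpectralCurve (S C : Type*) [TopologicalSpace S] [ChartedSpace ℂ S]
    [TopologicalSpace C] where
  π : S → C
  π_proper : IsProperMap π
  π_surjective : Function.Surjective π
  π_finite : ∀ c, (π ⁻¹' {c}).Finite
  π_generic : ∀ p, ∀ᶠ q in 𝓝[≠] p, π ⁻¹' {π q} = {q}
  x : C → OnePoint ℂ
  /-- the function `ỹ = y ∘ π` on the normalisation -/
  y : S → OnePoint ℂ
  meromorphic_x : IsMeromorphicMap (x ∘ π)
  meromorphic_y : IsMeromorphicMap y
  fibre_finite : ∀ b, (x ⁻¹' {b}).Finite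
  branch_finite : {b : ℂ | ∃ U ∈ 𝓝 b, ∃ c : ℕ,
    (∀ b' ∈ U \ {b}, (x ⁻¹' {(b' : OnePoint ℂ)}).ncard = c) ∧
      (x ⁻¹' {(b : OnePoint ℂ)}).ncard < c}.Finite

namespace SpectralCurve

variable {S C : Type*} [TopologicalSpace S] [ChartedSpace ℂ S] [TopologicalSpace C]
  (𝒞 : SpectralCurve S C)

/-- The set `𝔟 ⊂ ℂ` of points at which the cardinality of the fibre of `x` drops. -/
def branch : Set ℂ :=
  {b : ℂ | ∃ U ∈ 𝓝 b, ∃ c : ℕ,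
    (∀ b' ∈ U \ {b}, (𝒞.x ⁻¹' {(b' : OnePoint ℂ)}).ncard = c) ∧
      (𝒞.x ⁻¹' {(b : OnePoint ℂ)}).ncard < c}

/-- The function `x̃ = x ∘ π`. -/
def xt (p : S) : OnePoint ℂ := 𝒞.x (𝒞.π p)

/-- The `ℂ`-valued function underlying `x̃`. -/
def xf (p : S) : ℂ := finPart (𝒞.xt p)

/-- `𝔞 = x⁻¹(𝔟)`. -/
def ram : Set C := {c | ∃ b ∈ 𝒞.branch, 𝒞.x c = (b : OnePoint ℂ)}

/-- `𝔞̃ = x̃⁻¹(𝔟)`. -/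
def ramT : Set S := {p | ∃ b ∈ 𝒞.branch, 𝒞.xt p = (b : OnePoint ℂ)}

theorem fibreT_finite (b : OnePoint ℂ) : {p : S | 𝒞.xt p = b}.Finite := by
  have h : {p : S | 𝒞.xt p = b} = ⋃ c ∈ 𝒞.x ⁻¹' {b}, 𝒞.π ⁻¹' {c} := by
    ext p
    simp [xt]
  rw [h]
  exact (𝒞.fibre_finite b).biUnion fun c _ => 𝒞.π_finite c

theorem ramT_finite : 𝒞.ramT.Finite := by
  have h : 𝒞.ramT = ⋃ b ∈ 𝒞.branch, {p : S | 𝒞.xt p = (b : OnePoint ℂ)} := by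
    ext p
    simp [ramT]
  rw [h]
  exact 𝒞.branch_finite.biUnion fun b _ => 𝒞.fibreT_finite b

instance : Fintype 𝒞.ramT := 𝒞.ramT_finite.fintype

/-- `𝔞̃_α = π⁻¹(α)`. -/
def above (α : 𝒞.ram) : Finset 𝒞.ramT :=
  open Classical in Finset.univ.filter fun μ => 𝒞.π μ = α

end SpectralCurve

/-! ## Local coordinates at the ramification points and the local invariants of the curve -/

/-- The choice, at every `μ ∈ 𝔞̃`, of a local coordinate `ζ` centred at `μ` such that
`x̃ = x̃(μ) + ζ ^ r_μ`. This determines the ramification order `r_μ`. -/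
structure LocalCoords {S C : Type*} [TopologicalSpace S] [ChartedSpace ℂ S] [TopologicalSpace C]
    (𝒞 : SpectralCurve S C) where
  r : 𝒞.ramT → ℕ
  ζ : 𝒞.ramT → OpenPartialHomeomorph S ℂ
  r_pos : ∀ μ, 1 ≤ r μ
  ζ_mem : ∀ μ, ζ μ ∈ coordinates S
  mem_source : ∀ μ, (μ : S) ∈ (ζ μ).source
  ζ_center : ∀ μ, ζ μ μ = 0
  xt_eq : ∀ μ, ∀ p ∈ (ζ μ).source, 𝒞.xt p = ((𝒞.xf μ + ζ μ p ^ r μ : ℂ) : OnePoint ℂ)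

/-- Indices `(μ, k)`, `k ≥ 1`, of the formal variables `x_k^μ`. -/
abbrev Idx {S C : Type*} [TopologicalSpace S] [ChartedSpace ℂ S] [TopologicalSpace C]
    (𝒞 : SpectralCurve S C) := 𝒞.ramT × ℕ+

namespace LocalCoords

variable {S C : Type*} [TopologicalSpace S] [ChartedSpace ℂ S] [TopologicalSpace C]
  {𝒞 : SpectralCurve S C} (D : LocalCoords 𝒞)

/-- The degree `r_α`, the sum of the `r_μ` over `μ ∈ 𝔞̃_α`. -/
def rTot (α : 𝒞.ram) : ℕ := ∑ μ ∈ 𝒞.above α, D.r μ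

/-- `F01 μ k` is the coefficient `F_{0,1}[μ; -k]`, `k ∈ ℤ`: the expansion of `ỹ` at `μ` is
`∑_k (1 / r_μ) F_{0,1}[μ; -k] ζ ^ (k - r_μ)`, so that
`ỹ dx̃ = ∑_k F_{0,1}[μ; -k] ζ ^ (k - 1) dζ`. -/
def F01 (μ : 𝒞.ramT) (k : ℤ) : ℂ :=
  D.r μ * laurentCoeff (fun w => finPart (𝒞.y ((D.ζ μ).symm w))) (k - D.r μ)

/-- `s_μ = min {k | F_{0,1}[μ; -k] ≠ 0} ∈ ℤ ∪ {+∞}`. -/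
def s (μ : 𝒞.ramT) : WithTop ℤ :=
  open Classical in
  if ∀ k, D.F01 μ k = 0 then ⊤ else ((sInf {k : ℤ | D.F01 μ k ≠ 0} : ℤ) : WithTop ℤ)

/-- The integer `s_μ` when it is finite, and `0` otherwise. -/
def sInt (μ : 𝒞.ramT) : ℤ := (D.s μ).untopD 0

/-- `t_μ = - F_{0,1}[μ; -s_μ] / r_μ`, for finite `s_μ`. -/
def t (μ : 𝒞.ramT) : ℂ := -(1 / (D.r μ : ℂ)) * D.F01 μ (D.sInt μ)

/-- The ratio `r_μ / s_μ`, equal to `0` for `s_μ = +∞`. -/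
def ratio (μ : 𝒞.ramT) : ℚ := (D.r μ : ℚ) / (D.sInt μ : ℚ)

/-- None of the four degeneracies occurs at any `α ∈ 𝔞`. -/
structure NonDegenerate : Prop where
  not_i : ¬ ∃ μ ν : 𝒞.ramT, μ ≠ ν ∧ 𝒞.π μ = 𝒞.π ν ∧ D.s μ = ⊤ ∧ D.s ν = ⊤
  not_ii : ¬ ∃ μ : 𝒞.ramT, D.s μ = ⊤ ∧ 1 < D.r μ
  not_iii : ¬ ∃ μ ν : 𝒞.ramT, μ ≠ ν ∧ 𝒞.π μ = 𝒞.π ν ∧ D.s μ ≠ ⊤ ∧ D.s ν ≠ ⊤ ∧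
    D.ratio μ = D.ratio ν ∧ D.t μ ^ D.r ν = D.t ν ^ D.r ν
  not_iv : ¬ ∃ μ : 𝒞.ramT, D.s μ ≠ ⊤ ∧ 1 < Int.gcd (D.r μ) (D.sInt μ)

/-- The points of the fibre of `x̃` above `x₀` that lie in the neighbourhood of `𝔞̃_α` formed by the
coordinate patches. For `x₀ ≠ x(α)` close to `x(α)` these are the `r_α` points of `x̃⁻¹(x₀)` which
are close to `𝔞̃_α`. -/
def fibre (α : 𝒞.ram) (x₀ : ℂ) : Finset S :=
  Set.Finite.toFinset (s := {p : S | 𝒞.xt p = (x₀ : OnePoint ℂ) ∧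
    ∃ μ ∈ 𝒞.above α, p ∈ (D.ζ μ).source})
    ((𝒞.fibreT_finite x₀).subset fun _ hp => hp.1)

end LocalCoords

/-- A choice, for every `α ∈ 𝔞`, of a (strict) total order `≺` on `𝔞̃_α` such that `μ ≺ ν` implies
`r_μ / s_μ ≥ r_ν / s_ν`. Points with different images in `C` are not compared. -/
structure BranchOrder {S C : Type*} [TopologicalSpace S] [ChartedSpace ℂ S] [TopologicalSpace C]
    {𝒞 : SpectralCurve S C} (D : LocalCoords 𝒞) where
  prec : 𝒞.ramT → 𝒞.ramT → Prop
  prec_above : ∀ μ ν : 𝒞.ramT, prec μ ν → 𝒞.π μ = 𝒞.π ν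
  prec_irrefl : ∀ μ, ¬ prec μ μ
  prec_trans : ∀ μ ν κ, prec μ ν → prec ν κ → prec μ κ
  prec_total : ∀ μ ν : 𝒞.ramT, 𝒞.π μ = 𝒞.π ν → μ ≠ ν → prec μ ν ∨ prec ν μ
  prec_ratio : ∀ μ ν, prec μ ν → D.ratio ν ≤ D.ratio μ

namespace BranchOrder

variable {S C : Type*} [TopologicalSpace S] [ChartedSpace ℂ S] [TopologicalSpace C]
  {𝒞 : SpectralCurve S C} {D : LocalCoords 𝒞} (o : BranchOrder D)

/-- The segment `[lam) = {ν | ν ≺ lam}`. -/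
def below (lam : 𝒞.ramT) : Finset 𝒞.ramT :=
  open Classical in Finset.univ.filter fun ν => o.prec ν lam

/-- `𝐫_{[lam)}`. -/
def rBelow (lam : 𝒞.ramT) : ℕ := ∑ ν ∈ o.below lam, D.r ν

/-- `𝐬_{[lam)}`. -/
def sBelow (lam : 𝒞.ramT) : ℤ := ∑ ν ∈ o.below lam, D.sInt ν

/-- The integer `𝔡_α(i)`, for `1 ≤ i ≤ r_α`: it is equal to
`- ⌊s_lam (i' - 1) / r_lam⌋ - 𝐬_{[lam)} + δ_{i',1}`, where `i = 𝐫_{[lam)} + i'` for the unique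
`lam ∈ 𝔞̃_α` such that `𝐫_{[lam)} < i ≤ 𝐫_{[lam)} + r_lam`. -/
def dExp (α : 𝒞.ram) (i : ℕ) : ℤ :=
  ∑ lam ∈ 𝒞.above α,
    if o.rBelow lam < i ∧ i ≤ o.rBelow lam + D.r lam then
      -⌊((D.sInt lam : ℚ) * ((i : ℚ) - o.rBelow lam - 1)) / (D.r lam : ℚ)⌋ - o.sBelow lam
        + (if i = o.rBelow lam + 1 then 1 else 0)
    else 0

/-- The index set `𝓘` of the differential constraints. -/
def modeSet : Set (𝒞.ram × ℕ × ℤ) :=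
  {a | 1 ≤ a.2.1 ∧ a.2.1 ≤ D.rTot a.1 ∧
    o.dExp a.1 a.2.1 - (if a.2.1 = 1 then 1 else 0) ≤ a.2.2}

end BranchOrder

/-! ## Correlators -/

/-- A family of correlators; `form h n` is `ω_{g,n}` with `g = h / 2 ∈ ½ℕ` and `n ≥ 1` (the
components with `n = 0` play no role). -/
structure Correlators {S C : Type*} [TopologicalSpace S] [ChartedSpace ℂ S] [TopologicalSpace C]
    {𝒞 : SpectralCurve S C} (D : LocalCoords 𝒞) where
  form : ∀ _ n : ℕ, MultiForm S n
  /-- `ω_{0,1} = ỹ dx̃` -/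
  form01 : ∀ t : TB S, 𝒞.xt t.proj ≠ OnePoint.infty → 𝒞.y t.proj ≠ OnePoint.infty →
    ev (form 0 1) ![t] = finPart (𝒞.y t.proj) *
      (show ℂ from mfderiv 𝓘(ℂ) 𝓘(ℂ) 𝒞.xf t.proj t.2)
  form02 : IsFundamentalBidifferential (form 0 2)
  /-- `ω_{1/2,1}` is a crosscap differential: it is meromorphic, it has at most simple poles at the
  points of `𝔞̃`, and its residues at the points of `𝔞̃_α` add up to `0`. -/
  form11_meromorphic : ∀ p, ∀ e ∈ coordinates S, p ∈ e.source →
    MeromorphicAt (fun w => ev (form 1 1) ![coordVec e w]) (e p)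
  form11_pole : ∀ μ, (-1 : ℤ) ≤
    meromorphicOrderAt (fun w => ev (form 1 1) ![coordVec (D.ζ μ) w]) 0
  form11_residue : ∀ α : 𝒞.ram,
    ∑ μ ∈ 𝒞.above α, residue (fun w => ev (form 1 1) ![coordVec (D.ζ μ) w]) = 0
  form_meromorphic : ∀ h n, 1 ≤ n → 2 < h + n → IsMeromorphicForm 𝒞.ramT (form h n)
  form_symm : ∀ h n, 1 ≤ n → 2 < h + n → ∀ t : Fin n → TB S, (∀ i, (t i).proj ∉ 𝒞.ramT) →
    ∀ τ : Equiv.Perm (Fin n), ev (form h n) (t ∘ τ) = ev (form h n) t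

namespace Correlators

variable {S C : Type*} [TopologicalSpace S] [ChartedSpace ℂ S] [TopologicalSpace C]
  {𝒞 : SpectralCurve S C} {D : LocalCoords 𝒞} (W : Correlators D)

/-- `∫_μ^z ω_{0,2}(·, t)`, the point `z` being given by its coordinate `w` at `μ`; the integral is
along the segment from `0` to `w`. -/
def kernel (μ : 𝒞.ramT) (t : TB S) (w : ℂ) : ℂ :=
  ∫ τ in (0 : ℝ)..1, w * ev (W.form 0 2) ![coordVec (D.ζ μ) (τ * w), t]

/-- The projection property. -/
def ProjectionProperty : Prop :=
  ∀ h n : ℕ, 2 < h + (n + 1) → ∀ (t₁ : TB S) (t : Fin n → TB S),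
    t₁.proj ∉ 𝒞.ramT → (∀ i, (t i).proj ∉ 𝒞.ramT) →
    ev (W.form h (n + 1)) (Fin.cons t₁ t) =
      ∑ μ : 𝒞.ramT, residue fun w =>
        W.kernel μ t₁ w * ev (W.form h (n + 1)) (Fin.cons (coordVec (D.ζ μ) w) t)

/-- The tangent vector `v` at `p` with `dx̃(v) = 1`; it is used at points where `dx̃ ≠ 0`. -/
def liftVec (_ : Correlators D) (p : S) : TB S :=
  ⟨p, (mfderiv 𝓘(ℂ) 𝓘(ℂ) 𝒞.xf p).inverse (1 : ℂ)⟩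

/-- `𝓔^{(i)}_{α;g,n}(x₀; w_{[n]})`, with `h = 2 g`: more precisely, this is the coefficient of
`(dx₀)^i`, evaluated on the tangent vectors `w` in the last `n` variables. -/
def loopDifferential (α : 𝒞.ram) (i h : ℕ) {n : ℕ} (x₀ : ℂ) (w : Fin n → TB S) : ℂ :=
  ∑ Z ∈ (D.fibre α x₀).powersetCard i,
    disconnected W.form h (fun p : {p // p ∈ Z} => W.liftVec p) w

/-- The abstract loop equations
`𝓔^{(i)}_{α;g,n}(x₀; w_{[n]}) = O((x₀ - x(α))^{-(𝔡_α(i) - 1 - δ_{i,1})} (dx₀ / (x₀ - x(α)))^i)`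
as `x₀ → x(α)`, for `2 g - 2 + (n + 1) > 0` and `1 ≤ i ≤ r_α`. -/
def AbstractLoopEquations (o : BranchOrder D) : Prop :=
  ∀ h n : ℕ, 2 < h + (n + 1) → ∀ (α : 𝒞.ram) (i : ℕ), 1 ≤ i → i ≤ D.rTot α →
    ∀ w : Fin n → TB S, (∀ j, (w j).proj ∉ 𝒞.ramT) →
      (fun x₀ : ℂ => W.loopDifferential α i h x₀ w)
        =O[𝓝[≠] (finPart (𝒞.x α))] fun x₀ : ℂ =>
          (x₀ - finPart (𝒞.x α)) ^
            (-(o.dExp α i - 1 - (if i = 1 then 1 else 0)) - (i : ℤ))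

/-! ### Expansion coefficients -/

/-- `Q_μ`, the residue of `ω_{1/2,1}` at `μ`. -/
def Q (μ : 𝒞.ramT) : ℂ := residue fun w => ev (W.form 1 1) ![coordVec (D.ζ μ) w]

/-- `F_{1/2,1}[μ; -k]`: the coefficient of `ζ ^ (k - 1) dζ` in the expansion of `ω_{1/2,1}` at
`μ`. -/
def F11 (a : Idx 𝒞) : ℂ :=
  laurentCoeff (fun w => ev (W.form 1 1) ![coordVec (D.ζ a.1) w]) ((a.2 : ℤ) - 1)

/-- `F_{0,2}[μ, ν; -k, -l]`: the coefficient of `ζ₁ ^ (k - 1) ζ₂ ^ (l - 1) dζ₁ dζ₂` in the expansion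
of `ω_{0,2} - ω_{0,2}^{std}` at `(μ, ν)`. -/
def F02 (a b : Idx 𝒞) : ℂ :=
  open Classical in
  laurentCoeff (fun w₁ => laurentCoeff (fun w₂ =>
    ev (W.form 0 2) ![coordVec (D.ζ a.1) w₁, coordVec (D.ζ b.1) w₂] -
      (if a.1 = b.1 then 1 / (w₁ - w₂) ^ 2 else 0)) ((b.2 : ℤ) - 1)) ((a.2 : ℤ) - 1)

/-- The differential `dξ^μ_{-k}(z) = Res_{z' = μ} (∫_μ^{z'} ω_{0,2}(·, z)) dζ(z') / ζ(z')^{k+1}`,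
evaluated on a tangent vector. -/
def dxi (a : Idx 𝒞) (t : TB S) : ℂ :=
  residue fun w => W.kernel a.1 t w * w ^ (-((a.2 : ℕ) : ℤ) - 1)

/-- `F` is the family of coefficients in the finite decompositions
`ω_{g,n} = ∑ F_{g,n}[μ₁ … μ_n; k₁ … k_n] ∏_i dξ^{μ_i}_{-k_i}(z_i)`, for `2 g - 2 + n > 0`. -/
def IsDecomposition (F : ∀ _ n : ℕ, (Fin n → Idx 𝒞) →₀ ℂ) : Prop :=
  ∀ h n : ℕ, 1 ≤ n → 2 < h + n → ∀ t : Fin n → TB S, (∀ i, (t i).proj ∉ 𝒞.ramT) →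
    ev (W.form h n) t = (F h n).sum fun a c => c * ∏ i, W.dxi (a i) (t i)

end Correlators

/-! ## The differential operators -/

/-- `ℂ[ħ^{1/2}, ħ^{-1/2}]`. -/
abbrev HRing := LaurentPolynomial ℂ

/-- `ħ ^ (j / 2)`. -/
def hb (j : ℤ) : HRing := LaurentPolynomial.T j

/-- Complex scalars. -/
def sc (c : ℂ) : HRing := LaurentPolynomial.C c

/-- Polynomials in the variables `x_k^μ` with coefficients in `ℂ[ħ^{1/2}, ħ^{-1/2}]`. -/
abbrev Poly {S C : Type*} [TopologicalSpace S] [ChartedSpace ℂ S] [TopologicalSpace C]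
    (𝒞 : SpectralCurve S C) := MvPolynomial (Idx 𝒞) HRing

/-- A family of endomorphisms is locally finite if all but finitely many of them vanish on any
given element. -/
def LocFinite {R M ι : Type*} [Semiring R] [AddCommMonoid M] [Module R M]
    (A : ι → Module.End R M) : Prop :=
  ∀ f, (Function.support fun j => A j f).Finite

/-- The sum of a locally finite family of endomorphisms (and `0` if it is not locally finite). -/
def locSum {R M ι : Type*} [Semiring R] [AddCommMonoid M] [Module R M]
    (A : ι → Module.End R M) : Module.End R M :=
  open Classical in
  if hA : LocFinite A then
    { toFun := fun f => ∑ᶠ j, A j f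
      map_add' := fun f g => by
        simp only [map_add]
        exact finsum_add_distrib (hA f) (hA g)
      map_smul' := fun c f => by
        simp only [map_smul, RingHom.id_apply]
        exact (smul_finsum' c (hA f)).symm }
  else 0

/-- The exponential `∑_n A^n / n!` of a locally nilpotent endomorphism. -/
def locExp {M : Type*} [AddCommMonoid M] [Module HRing M] (A : Module.End HRing M) :
    Module.End HRing M :=
  locSum fun n : ℕ => sc (1 / (n.factorial : ℂ)) • A ^ n

/-- `Ψ_r^{(j)}(a_{2j+1}, …, a_{2j+q})`. The summation indices `m_1, …, m_{2j+q}` are pairwise distinct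
elements of `{0, …, r - 1}`; for `l < j`, `m (inl (inl l))` is `m_{2l+1}`, `m (inl (inr l))` is
`m_{2l+2}`, and `m (inr l)` is `m_{2j+1+l}`. -/
def psi (r j : ℕ) {q : ℕ} (a : Fin q → ℤ) : ℂ :=
  (1 / ((2 * j + q).factorial : ℂ)) *
    ∑ m : ((Fin j ⊕ Fin j) ⊕ Fin q) ↪ Fin r,
      (∏ l : Fin j,
        Complex.exp (2 * Real.pi * I / r) ^
            ((m (.inl (.inl l)) : ℕ) + (m (.inl (.inr l)) : ℕ)) /
          (Complex.exp (2 * Real.pi * I / r) ^ (m (.inl (.inr l)) : ℕ) -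
            Complex.exp (2 * Real.pi * I / r) ^ (m (.inl (.inl l)) : ℕ)) ^ 2) *
      ∏ l : Fin q, Complex.exp (2 * Real.pi * I / r) ^ (-((m (.inr l) : ℕ) : ℤ) * a l)

namespace Correlators

variable {S C : Type*} [TopologicalSpace S] [ChartedSpace ℂ S] [TopologicalSpace C]
  {𝒞 : SpectralCurve S C} {D : LocalCoords 𝒞} (W : Correlators D)

/-- The Heisenberg generators: `J^μ_k = ħ ∂_{x^μ_k}` for `k > 0`, `J^μ_0 = ħ^{1/2} Q_μ`, and
`J^μ_{-k}` is the multiplication by `k x^μ_k` for `k > 0`. -/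
def J (μ : 𝒞.ramT) : ℤ → Module.End HRing (Poly 𝒞)
  | .ofNat 0 => (hb 1 * sc (W.Q μ)) • 1
  | .ofNat (k + 1) => hb 2 • (MvPolynomial.pderiv (μ, k.succPNat)).toLinearMap
  | .negSucc k => LinearMap.mulLeft HRing
      (((k : HRing) + 1) • (MvPolynomial.X (μ, k.succPNat) : Poly 𝒞))

/-- The normally ordered product of `J^μ_{p 0}, …, J^μ_{p (q-1)}`: those with positive index act
first. -/
def normalOrdered (μ : 𝒞.ramT) {q : ℕ} (p : Fin q → ℤ) : Module.End HRing (Poly 𝒞) :=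
  (((List.ofFn p).filter fun a => a ≤ 0).map (W.J μ)).prod *
    (((List.ofFn p).filter fun a => 0 < a).map (W.J μ)).prod

/-- The modes `W^μ_{i,k}` attached to a cycle of length `r_μ`. -/
def cycleMode (μ : 𝒞.ramT) (i : ℕ) (k : ℤ) : Module.End HRing (Poly 𝒞) :=
  sc (1 / (D.r μ : ℂ)) • ∑ j ∈ Finset.range (i / 2 + 1),
    (sc ((i.factorial : ℂ) / (2 ^ j * j.factorial * (i - 2 * j).factorial)) * hb (2 * j)) •
      locSum fun p : {p : Fin (i - 2 * j) → ℤ // ∑ l, p l = D.r μ * k} =>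
        sc (psi (D.r μ) j p.1) • W.normalOrdered μ p.1

/-- The twisted modes `W_{α;i,k}` of the `W(gl_{r_α})`-algebra, for a twist with cycles of lengths
`r_μ`, `μ ∈ 𝔞̃_α`. Operators attached to different `μ` commute, so that the order in the products
does not matter. -/
def twistedMode (α : 𝒞.ram) (i : ℕ) (k : ℤ) : Module.End HRing (Poly 𝒞) :=
  open Classical in
  ∑ M ∈ (𝒞.above α).powerset,
    ∑ im ∈ (Fintype.piFinset fun μ : {μ // μ ∈ M} => Finset.Icc 1 (D.r μ)) with ∑ μ, im μ = i,
      locSum fun km : {km : {μ // μ ∈ M} → ℤ // ∑ μ, km μ = k} =>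
        ((Finset.univ : Finset {μ // μ ∈ M}).toList.map fun (μ : {μ // μ ∈ M}) =>
          sc (1 / (D.r μ : ℂ) ^ (im μ - 1)) • W.cycleMode μ (im μ) (km.1 μ)).prod

/-- The exponent of the dilaton shift,
`∑_{μ, k > 0} (ħ⁻¹ F_{0,1}[μ; -k] + ħ^{-1/2} F_{1/2,1}[μ; -k]) J^μ_k / k`. -/
def dilatonExponent : Module.End HRing (Poly 𝒞) :=
  locSum fun a : Idx 𝒞 =>
    ((hb (-2) * sc (D.F01 a.1 a.2) + hb (-1) * sc (W.F11 a)) * sc (1 / ((a.2 : ℕ) : ℂ))) •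
      W.J a.1 a.2

/-- The exponent of the change of polarisation,
`(1 / 2ħ) ∑_{μ, ν, k, l > 0} F_{0,2}[μ, ν; -k, -l] J^μ_k J^ν_l / (k l)`. -/
def polarisationExponent : Module.End HRing (Poly 𝒞) :=
  (sc (1 / 2) * hb (-2)) • locSum fun a : Idx 𝒞 × Idx 𝒞 =>
    sc (W.F02 a.1 a.2 / (((a.1.2 : ℕ) : ℂ) * ((a.2.2 : ℕ) : ℂ))) •
      (W.J a.1.1 a.1.2 * W.J a.2.1 a.2.2)

/-- The operators `H_{α;i,k} = Φ̂ T̂ W_{α;i,k} T̂⁻¹ Φ̂⁻¹`. -/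
def H (α : 𝒞.ram) (i : ℕ) (k : ℤ) : Module.End HRing (Poly 𝒞) :=
  locExp W.polarisationExponent * locExp W.dilatonExponent * W.twistedMode α i k *
    locExp (-W.dilatonExponent) * locExp (-W.polarisationExponent)

end Correlators

/-! ## Formal functions and the partition function -/

section Formal

variable {S C : Type*} [TopologicalSpace S] [ChartedSpace ℂ S] [TopologicalSpace C]
  {𝒞 : SpectralCurve S C}

/-- Formal functions of the variables `ħ^{1/2}` and `x_k^μ`, for the grading
`deg ħ^{1/2} = deg x_k^μ = 1`: the coefficient of index `d` of the power series is the component of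
degree `d` of the function (it is a polynomial). -/
abbrev Formal {S C : Type*} [TopologicalSpace S] [ChartedSpace ℂ S] [TopologicalSpace C]
    (𝒞 : SpectralCurve S C) := PowerSeries (Poly 𝒞)

/-- The component of degree `d` of a polynomial, for `deg ħ^{1/2} = deg x_k^μ = 1`. -/
def degPart (d : ℤ) (f : Poly 𝒞) : Poly 𝒞 :=
  ∑ m ∈ f.support, MvPolynomial.monomial m
    (sc ((f.coeff m).coeff (d - m.degree)) * hb (d - m.degree))

/-- The action on formal functions of an operator all of whose components have degree `≥ 0`: it acts
on each homogeneous component, and the results are sorted by degree. -/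
def act (A : Module.End HRing (Poly 𝒞)) (Z : Formal 𝒞) : Formal 𝒞 :=
  PowerSeries.mk fun d => ∑ d' ∈ Finset.range (d + 1),
    degPart (d : ℤ) (A (PowerSeries.coeff d' Z))

/-- The free energy
`F = ∑_{2g-2+n > 0} (ħ^{g-1} / n!) ∑ F_{g,n}[μ₁ … μ_n; k₁ … k_n] ∏_i x^{μ_i}_{k_i}`, where `h = 2 g`.
The summand of index `(g, n)` has degree `2 g - 2 + n`. -/
def freeEnergy (F : ∀ _ n : ℕ, (Fin n → Idx 𝒞) →₀ ℂ) : Formal 𝒞 :=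
  PowerSeries.mk fun d => if d = 0 then 0 else
    ∑ hn ∈ Finset.HasAntidiagonal.antidiagonal (d + 2), if hn.2 = 0 then 0 else
      (F hn.1 hn.2).sum fun a c =>
        (hb ((hn.1 : ℤ) - 2) * sc (c / (hn.2.factorial : ℂ))) • ∏ i, MvPolynomial.X (a i)

/-- The exponential of a formal function without component of degree `0`. -/
def fexp (F : Formal 𝒞) : Formal 𝒞 := (PowerSeries.exp ℚ).subst F

end Formal

end WLoop

end

set_option linter.unusedSectionVars false
set_option linter.unusedSimpArgs false

noncomputable section

namespace WLoop

open Finset hiding sum_apply mem_sdiff mem_map map_sdiff mem_sup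
open MvPolynomial (C X C_mul' pderiv mkDerivation smul_eq_C_mul mkDerivation_X pderiv_X pderiv_X_of_ne algebraMap_eq
  pderiv_eq_zero_of_notMem_vars aeval_X derivation_C derivation_ext coeff_sum coeff_zero coeff_C_mul
  coeff_add)
open Module
open LinearMap (mulLeft mulLeft_apply)
open Function
open Derivation (leibniz)
open PowerSeries (coeff)
open Asymptotics

variable {S Y : Type*} [TopologicalSpace S] [ChartedSpace ℂ S] [TopologicalSpace Y] {Γ : SpectralCurve S Y}
  {D : LocalCoords Γ} (W : Correlators D)

/-! ## Sums over set partitions -/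

section PartitionSum

variable {ι R : Type*} [DecidableEq ι] [CommSemiring R]

/-- The sum over the partitions of `Z` of the product of the weights of the blocks. -/
def partSum (f : Finset ι → R) (Z : Finset ι) : R := ∑ P : Finpartition Z, ∏ L ∈ P.parts, f L

lemma partSum_empty (f : Finset ι → R) : partSum f ∅ = 1 := by
  have : (univ : Finset (Finpartition (∅ : Finset ι))) = {⊥} := by
    ext P
    simp only [mem_univ, mem_singleton, true_iff]
    exact Subsingleton.elim (α := Finpartition (⊥ : Finset ι)) _ _
  unfold partSum
  rw [this, sum_singleton]
  have h : (⊥ : Finpartition (∅ : Finset ι)).parts = ∅ := by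
    rw [Finpartition.parts_eq_empty_iff]; rfl
  rw [h, prod_empty]

/-- The partition obtained by removing the block of an element. -/
def removeBlock {Z V : Finset ι} {a : ι} (ha : a ∉ Z) (P : Finpartition (insert a Z)) (h : insert a V ∈ P.parts) : Finpartition (Z \ V) :=
  Finpartition.ofErase (P.parts.erase (insert a V)) (P.supIndep.subset (erase_subset _ _)) (by
      ext x
      simp only [Finset.mem_sup, mem_erase, id, Finset.mem_sdiff]
      constructor
      · rintro ⟨L, ⟨hL, hLP⟩, hx⟩
        have hd := P.disjoint hLP h hL
        have hxa : x ∉ insert a V := fun hxx => (disjoint_left.mp hd) hx hxx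
        rw [mem_insert, not_or] at hxa
        have := P.subset hLP hx
        rw [mem_insert] at this
        exact ⟨this.resolve_left hxa.1, hxa.2⟩
      · rintro ⟨hx, hxV⟩
        obtain ⟨L, hL, hxL⟩ := P.exists_mem (mem_insert_of_mem hx : x ∈ insert a Z)
        refine ⟨L, ⟨?_, hL⟩, hxL⟩
        rintro rfl
        rw [mem_insert] at hxL
        rcases hxL with rfl | h'
        · exact ha hx
        · exact hxV h')

lemma partSum_insert (f : Finset ι → R) {Z : Finset ι} {a : ι} (ha : a ∉ Z) : partSum f (insert a Z) =
      ∑ V ∈ Z.powerset, f (insert a V) * partSum f (Z \ V) := by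
  unfold partSum
  simp_rw [mul_sum]
  rw [sum_sigma']
  symm
  have key : ∀ x : (Σ V : Finset ι, Finpartition (Z \ V)), x.1 ⊆ Z → Disjoint (Z \ x.1) (insert a x.1) ∧ (Z \ x.1) ⊔ insert a x.1 = insert a Z := by
    intro x hx
    constructor
    · rw [disjoint_left]
      intro y hy hy'
      simp only [Finset.mem_sdiff, mem_insert] at hy hy'
      rcases hy' with rfl | h
      · exact ha hy.1
      · exact hy.2 h
    · ext y
      simp only [sup_eq_union, mem_union, Finset.mem_sdiff, mem_insert]
      have := @hx y
      tauto
  refine sum_bij' (i := fun x hx => Finpartition.extend x.2 (b := insert a x.1) (insert_nonempty a x.1).ne_empty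
      (key x (mem_powerset.1 (mem_sigma.1 hx).1)).1 (key x (mem_powerset.1 (mem_sigma.1 hx).1)).2)
    (j := fun P _ => ⟨(P.part a).erase a, removeBlock ha P (by
        rw [insert_erase (P.mem_part_self.2 (mem_insert_self a Z))]
        exact P.part_mem.2 (mem_insert_self a Z))⟩) ?_ ?_ ?_ ?_ ?_
  · intros; exact mem_univ _
  · intro P _
    rw [mem_sigma]
    refine ⟨mem_powerset.2 ?_, mem_univ _⟩
    intro x hx
    rw [mem_erase] at hx
    exact (mem_insert.1 (P.part_subset a hx.2)).resolve_left hx.1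
  · rintro ⟨V, Q⟩ hx
    have hV : V ⊆ Z := mem_powerset.1 (mem_sigma.1 hx).1
    have haV : a ∉ V := fun h => ha (hV h)
    have hpart : ∀ P : Finpartition (insert a Z), insert a V ∈ P.parts → (P.part a).erase a = V := by
      intro P hP
      rw [P.part_eq_of_mem hP (mem_insert_self a V), erase_insert haV]
    have hmem : insert a V ∉ Q.parts := by
      intro h
      have := Q.subset h (mem_insert_self a V)
      exact ha (Finset.mem_sdiff.1 this).1
    generalize_proofs _ p1 p2 p3 p4 p5
    have h1 : ((Q.extend p1 p2 p3).part a).erase a = V := hpart _ (by simp)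
    refine Sigma.ext h1 ?_
    have : ∀ (V' : Finset ι) (hV' : V' = V) (Q' : Finpartition (Z \ V')), Q'.parts = Q.parts → HEq Q' Q := by
      rintro V' rfl Q' h
      exact heq_of_eq (Finpartition.ext h)
    refine this _ h1 _ ?_
    simp only [removeBlock, Finpartition.ofErase, Finpartition.extend_parts]
    have hb : (∅ : Finset ι) ∉ Q.parts := Q.empty_notMem_parts
    simp only [h1]
    rw [erase_insert hmem]
    exact erase_eq_of_notMem Q.bot_notMem
  · intro P _
    ext1
    simp only [removeBlock, Finpartition.ofErase, Finpartition.extend_parts]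
    rw [insert_erase (P.mem_part_self.2 (mem_insert_self a Z))]
    have : ⊥ ∉ P.parts.erase (P.part a) := fun h => P.bot_notMem (mem_of_mem_erase h)
    rw [erase_eq_of_notMem this, insert_erase (P.part_mem.2 (mem_insert_self a Z))]
  · rintro ⟨V, Q⟩ hx
    have hmem : insert a V ∉ Q.parts := by
      intro h
      have := Q.subset h (mem_insert_self a V)
      exact ha (Finset.mem_sdiff.1 this).1
    simp only [Finpartition.extend_parts]
    rw [prod_insert hmem]

lemma partSum_congr {f g : Finset ι → R} {Z : Finset ι} (h : ∀ L ⊆ Z, L.Nonempty → f L = g L) : partSum f Z = partSum g Z :=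
  sum_congr rfl fun P _ => prod_congr rfl fun _ hL => h _ (P.subset hL) (P.nonempty_of_mem_parts hL)

lemma map_partSum {S F : Type*} [CommSemiring S] [FunLike F R S] [RingHomClass F R S] (φ : F) (f : Finset ι → R) (Z : Finset ι) :
    φ (partSum f Z) = partSum (fun L => φ (f L)) Z := by
  simp [partSum, map_sum, map_prod]

lemma sum_powerset_sdiff_comm {M : Type*} [AddCommMonoid M] (Z : Finset ι) (h : Finset ι → Finset ι → M) :
    ∑ V ∈ Z.powerset, ∑ U ∈ (Z \ V).powerset, h V U = ∑ U ∈ Z.powerset, ∑ V ∈ (Z \ U).powerset, h V U := by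
  refine sum_comm' fun V U => ?_
  simp only [mem_powerset, subset_sdiff]
  constructor
  · rintro ⟨h1, h2, h3⟩; exact ⟨⟨h1, h3.symm⟩, h2⟩
  · rintro ⟨⟨h1, h3⟩, h2⟩; exact ⟨h1, h2, h3.symm⟩

lemma sum_powerset_insert' {M : Type*} [AddCommMonoid M] {Z : Finset ι} {a : ι} (ha : a ∉ Z) (h : Finset ι → M) :
    ∑ V ∈ (insert a Z).powerset, h V = ∑ V ∈ Z.powerset, h V + ∑ V ∈ Z.powerset, h (insert a V) :=
  sum_powerset_insert ha h

lemma insert_sdiff_of_notMem' {Z V : Finset ι} {a : ι} (ha : a ∉ Z) (hV : V ⊆ Z) : insert a Z \ V = insert a (Z \ V) :=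
  insert_sdiff_of_notMem Z fun h => ha (hV h)

lemma insert_sdiff_insert' {Z V : Finset ι} {a : ι} (ha : a ∉ Z) : insert a Z \ insert a V = Z \ V := by
  ext x
  simp only [Finset.mem_sdiff, mem_insert]
  constructor
  · rintro ⟨h1, h2⟩
    rw [not_or] at h2
    exact ⟨h1.resolve_left h2.1, h2.2⟩
  · rintro ⟨h1, h2⟩
    refine ⟨Or.inr h1, ?_⟩
    rintro (rfl | h)
    · exact ha h1
    · exact h2 h

lemma partSum_add (f g : Finset ι → R) (Z : Finset ι) : partSum (fun L => f L + g L) Z = ∑ Y ∈ Z.powerset, partSum f Y * partSum g (Z \ Y) := by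
  induction Z using strongInduction with
  | H Z ih =>
    rcases Z.eq_empty_or_nonempty with rfl | ⟨a, haZ⟩
    · simp [partSum_empty]
    obtain ⟨Y, haY, rfl⟩ : ∃ Y, a ∉ Y ∧ insert a Y = Z := ⟨Z.erase a, notMem_erase a Z, insert_erase haZ⟩
    rw [partSum_insert _ haY, sum_powerset_insert' haY]
    have hlt : ∀ V ∈ Y.powerset, Y \ V ⊂ insert a Y := fun V _ => lt_of_le_of_lt sdiff_subset (ssubset_insert haY)
    rw [sum_congr rfl fun V hV => by rw [ih _ (hlt V hV)]]
    have e1 : ∀ V ∈ Y.powerset, partSum f V * partSum g (insert a Y \ V) =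
        ∑ U ∈ (Y \ V).powerset, partSum f V * (g (insert a U) * partSum g ((Y \ V) \ U)) := by
      intro V hV
      rw [insert_sdiff_of_notMem' haY (mem_powerset.1 hV), partSum_insert _
        (fun h => haY (Finset.mem_sdiff.1 h).1), mul_sum]
    have e2 : ∀ V ∈ Y.powerset, partSum f (insert a V) * partSum g (insert a Y \ insert a V)
        = ∑ U ∈ V.powerset, f (insert a U) * partSum f (V \ U) * partSum g (Y \ V) := by
      intro V hV
      rw [insert_sdiff_insert' haY, partSum_insert _ (fun h => haY (mem_powerset.1 hV h)), sum_mul]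
    rw [sum_congr rfl e1, sum_congr rfl e2, sum_powerset_sdiff_comm Y]
    have e3 : ∑ V ∈ Y.powerset, ∑ U ∈ V.powerset, f (insert a U) * partSum f (V \ U) * partSum g (Y \ V) = ∑ U ∈ Y.powerset, ∑ V ∈ (Y \ U).powerset,
          f (insert a U) * partSum f V * partSum g ((Y \ U) \ V) := by
      rw [sum_sigma', sum_sigma']
      refine sum_bij' (i := fun x _ => ⟨x.2, x.1 \ x.2⟩) (j := fun x _ => ⟨x.1 ∪ x.2, x.1⟩)
        ?_ ?_ ?_ ?_ ?_
      · rintro ⟨V, U⟩ h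
        simp only [mem_sigma, mem_powerset] at h ⊢
        exact ⟨h.2.trans h.1, sdiff_subset_sdiff h.1 le_rfl⟩
      · rintro ⟨U, V⟩ h
        simp only [mem_sigma, mem_powerset] at h ⊢
        exact ⟨union_subset h.1 (h.2.trans sdiff_subset), subset_union_left⟩
      · rintro ⟨V, U⟩ h
        simp only [mem_sigma, mem_powerset] at h ⊢
        rw [union_sdiff_of_subset h.2]
      · rintro ⟨U, V⟩ h
        simp only [mem_sigma, mem_powerset, subset_sdiff] at h ⊢
        rw [union_sdiff_cancel_left h.2.2.symm]
      · rintro ⟨V, U⟩ h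
        simp only [mem_sigma, mem_powerset] at h ⊢
        rw [sdiff_sdiff_left, sup_eq_union, union_sdiff_of_subset h.2]
    rw [e3, ← sum_add_distrib]
    refine sum_congr rfl fun U _ => ?_
    rw [← sum_add_distrib, mul_sum]
    refine sum_congr rfl fun V _ => ?_
    rw [sdiff_sdiff_comm]
    ring

lemma partSum_map {κ : Type*} [DecidableEq κ] (e : κ ↪ ι) (f : Finset ι → R)
    (Z : Finset κ) : partSum f (Z.map e) = partSum (fun L => f (L.map e)) Z := by
  induction Z using strongInduction with
  | H Z ih =>
    rcases Z.eq_empty_or_nonempty with rfl | ⟨a, haZ⟩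
    · simp [partSum_empty]
    obtain ⟨Y, haY, rfl⟩ : ∃ Y, a ∉ Y ∧ insert a Y = Z := ⟨Z.erase a, notMem_erase a Z, insert_erase haZ⟩
    rw [map_insert, partSum_insert _ (by simpa using haY), partSum_insert _ haY]
    symm
    refine sum_bij (i := fun V _ => V.map e) ?_ ?_ ?_ ?_
    · intro V hV
      rw [mem_powerset] at hV ⊢
      exact map_subset_map.2 hV
    · intro V _ V' _ h
      exact map_injective e h
    · intro V hV
      rw [mem_powerset, subset_map_iff] at hV
      obtain ⟨u, hu, rfl⟩ := hV
      exact ⟨u, mem_powerset.2 hu, rfl⟩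
    · intro V hV
      rw [← ih _ (lt_of_le_of_lt sdiff_subset (ssubset_insert haY)), map_insert, Finset.map_sdiff]

lemma derivation_partSum {k A : Type*} [CommRing k] [CommRing A] [Algebra k A]
    (δ : Derivation k A A) (f : Finset ι → A) (h0 : f ∅ = 0) (Z : Finset ι) : δ (partSum f Z) = ∑ V ∈ Z.powerset, δ (f V) * partSum f (Z \ V) := by
  induction Z using strongInduction with
  | H Z ih =>
    rcases Z.eq_empty_or_nonempty with rfl | ⟨a, haZ⟩
    · simp [partSum_empty, h0]
    obtain ⟨Y, haY, rfl⟩ : ∃ Y, a ∉ Y ∧ insert a Y = Z := ⟨Z.erase a, notMem_erase a Z, insert_erase haZ⟩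
    rw [partSum_insert _ haY, sum_powerset_insert' haY, map_sum]
    have hlt : ∀ V ∈ Y.powerset, Y \ V ⊂ insert a Y := fun V _ => lt_of_le_of_lt sdiff_subset (ssubset_insert haY)
    have e0 : ∀ V ∈ Y.powerset, δ (f (insert a V) * partSum f (Y \ V)) = δ (f (insert a V)) * partSum f (Y \ V) + ∑ U ∈ (Y \ V).powerset,
          f (insert a V) * (δ (f U) * partSum f ((Y \ V) \ U)) := by
      intro V hV
      rw [leibniz, ih _ (hlt V hV), ← mul_sum, smul_eq_mul, smul_eq_mul]
      ring
    have e1 : ∀ V ∈ Y.powerset, δ (f V) * partSum f (insert a Y \ V) =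
        ∑ U ∈ (Y \ V).powerset, δ (f V) * (f (insert a U) * partSum f ((Y \ V) \ U)) := by
      intro V hV
      rw [insert_sdiff_of_notMem' haY (mem_powerset.1 hV), partSum_insert _
        (fun h => haY (Finset.mem_sdiff.1 h).1), mul_sum]
    rw [sum_congr rfl e0, sum_add_distrib, sum_congr rfl e1, sum_powerset_sdiff_comm Y, add_comm]
    congr 1
    · refine sum_congr rfl fun U _ => sum_congr rfl fun V _ => ?_
      rw [sdiff_sdiff_comm]; ring
    · refine sum_congr rfl fun V _ => ?_
      rw [insert_sdiff_insert' haY]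

end PartitionSum

/-! ## Squarefree coefficients -/

section SquareFree

variable {σ R : Type*} [DecidableEq σ] [CommSemiring R]

/-- The exponent of the squarefree monomial with set of variables `U`. -/
def sqf (U : Finset σ) : σ →₀ ℕ := ∑ u ∈ U, Finsupp.single u 1

lemma sqf_apply (U : Finset σ) (v : σ) : sqf U v = if v ∈ U then 1 else 0 := by
  simp [sqf, Finsupp.finsetSum_apply, Finsupp.single_apply]

lemma sqf_injective : Injective (sqf : Finset σ → σ →₀ ℕ) := by
  intro U V h
  ext v
  have := DFunLike.congr_fun h v
  rw [sqf_apply, sqf_apply] at this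
  by_cases h1 : v ∈ U <;> by_cases h2 : v ∈ V <;> simp_all

lemma sqf_insert {U : Finset σ} {u : σ} (hu : u ∉ U) : sqf (insert u U) = sqf U + Finsupp.single u 1 := by
  rw [sqf, sum_insert hu, add_comm]; rfl

lemma sqf_empty : sqf (∅ : Finset σ) = 0 := sum_empty

lemma coeff_sqf_insert {U : Finset σ} {u : σ} (hu : u ∉ U) (f : MvPolynomial σ R) : f.coeff (sqf (insert u U)) = (pderiv u f).coeff (sqf U) := by
  rw [MvPolynomial.coeff_pderiv, sqf_insert hu, sqf_apply, if_neg hu]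
  simp

lemma prod_X_eq_monomial {τ : Type*} [Fintype τ] (v : τ → σ) : ∏ j, (X (v j) : MvPolynomial σ R) =
      MvPolynomial.monomial (∑ j, Finsupp.single (v j) 1) 1 := by
  simp only [X]
  rw [MvPolynomial.monomial_sum_one]

lemma sum_single_eq_sqf_iff {τ : Type*} [Fintype τ] (v : τ → σ) (U : Finset σ) :
    ∑ j, Finsupp.single (v j) 1 = sqf U ↔ Injective v ∧ univ.image v = U := by
  constructor
  · intro h
    have h' : ∀ u, #{j | v j = u} = if u ∈ U then 1 else 0 := by
      intro u
      have := DFunLike.congr_fun h u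
      rw [sqf_apply] at this
      rw [← this]
      simp [Finsupp.finsetSum_apply, Finsupp.single_apply]
    constructor
    · intro a b hab
      have h1 := h' (v a)
      have : #{j | v j = v a} ≤ 1 := by rw [h1]; split_ifs <;> simp
      exact card_le_one.1 this a (by simp) b (by simp [hab])
    · ext u
      rw [mem_image]
      have h1 := h' u
      constructor
      · rintro ⟨j, -, rfl⟩
        by_contra hn
        rw [if_neg hn, card_eq_zero] at h1
        exact absurd (h1 ▸ (by simp : j ∈ ({j' | v j' = v j} : Finset τ))) (notMem_empty j)
      · intro hu
        rw [if_pos hu] at h1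
        obtain ⟨j, hj⟩ := card_eq_one.1 h1
        have : j ∈ ({j | v j = u} : Finset τ) := by rw [hj]; simp
        exact ⟨j, mem_univ _, by simpa using this⟩
  · rintro ⟨hv, rfl⟩
    rw [sqf, sum_image fun a _ b _ h => hv h]

lemma coeff_sqf_prod_X {τ : Type*} [Fintype τ] (v : τ → σ) (U : Finset σ) : (∏ j, (X (v j) : MvPolynomial σ R)).coeff (sqf U) =
      open Classical in if Injective v ∧ univ.image v = U then 1 else 0 := by
  rw [prod_X_eq_monomial, MvPolynomial.coeff_monomial]
  simp_rw [sum_single_eq_sqf_iff]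

/-- Squarefree coefficients of a product: every variable is attributed to one of the factors. -/
lemma coeff_sqf_prod {κ : Type*} [Fintype κ] [DecidableEq κ] [Fintype σ] (g : κ → MvPolynomial σ R) : (∏ L, g L).coeff (sqf univ) =
      ∑ N : σ → κ, ∏ L, (g L).coeff (sqf ({b | N b = L} : Finset σ)) := by
  have h := MvPowerSeries.coeff_prod (fun L => (g L : MvPowerSeries σ R)) (sqf univ) univ
  have h2 : (∏ L, (g L : MvPowerSeries σ R)) = ((∏ L, g L : MvPolynomial σ R) : MvPowerSeries σ R) := by
    exact (map_prod (MvPolynomial.coeToMvPowerSeries.ringHom (σ := σ) (R := R)) g univ).symm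
  rw [h2, MvPolynomial.coeff_coe] at h
  rw [h]
  symm
  refine sum_bij (i := fun N _ => Finsupp.equivFunOnFinite.symm fun L => sqf {b | N b = L})
    ?_ ?_ ?_ ?_
  · intro N _
    rw [mem_finsuppAntidiag]
    refine ⟨?_, subset_univ _⟩
    ext b
    rw [Finsupp.finsetSum_apply]
    simp [sqf_apply]
  · intro N _ N' _ hNN
    funext b
    have h1 := DFunLike.congr_fun (DFunLike.congr_fun hNN (N b)) b
    simp only [Finsupp.coe_equivFunOnFinite_symm, sqf_apply, mem_filter_univ, if_true] at h1
    by_contra hne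
    rw [if_neg (fun h => hne h.symm)] at h1
    exact one_ne_zero h1
  · intro l hl
    rw [mem_finsuppAntidiag] at hl
    have h1 : ∀ b, ∑ L, l L b = 1 := by
      intro b
      have := DFunLike.congr_fun hl.1 b
      rw [Finsupp.finsetSum_apply, sqf_apply, if_pos (mem_univ b)] at this
      exact this
    have h2 : ∀ b, ∃ L, l L b = 1 ∧ ∀ L' ≠ L, l L' b = 0 := by
      intro b
      obtain ⟨L, hL⟩ : ∃ L, l L b ≠ 0 := by
        by_contra hcon
        push Not at hcon
        have := h1 b
        simp [hcon] at this
      have h3 := h1 b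
      rw [← add_sum_erase _ _ (mem_univ L)] at h3
      have h4 : ∑ L' ∈ univ.erase L, l L' b = 0 := by omega
      refine ⟨L, by omega, fun L' hL' => ?_⟩
      exact (sum_eq_zero_iff.1 h4) L' (mem_erase.2 ⟨hL', mem_univ _⟩)
    choose N hN hN' using h2
    refine ⟨N, mem_univ _, ?_⟩
    ext L b
    simp only [Finsupp.coe_equivFunOnFinite_symm, sqf_apply, mem_filter_univ]
    split_ifs with h
    · rw [← h, hN]
    · rw [hN' b L (fun h' => h h'.symm)]
  · intro N _
    simp

end SquareFree

/-! ## Sums over embeddings and sums over pairings -/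

section Pairings

variable {κ : Type*} [DecidableEq κ]

/-- The weight of a block which is non-zero on pairs only. -/
def pairWeight {R : Type*} [CommRing R] [Algebra ℂ R] (c : κ → κ → R) (L : Finset κ) : R :=
  if #L = 2 then (1 / 2 : ℂ) • ∑ x ∈ L.offDiag, c x.1 x.2 else 0

lemma pairWeight_pair {R : Type*} [CommRing R] [Algebra ℂ R] {c : κ → κ → R}
    (hc : ∀ a b, c a b = c b a) {a b : κ} (hab : a ≠ b) : pairWeight c {a, b} = c a b := by
  have h : ({a, b} : Finset κ).offDiag = {(a, b), (b, a)} := by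
    ext ⟨x, y⟩
    simp only [mem_offDiag, mem_insert, mem_singleton, Prod.mk.injEq]
    constructor
    · rintro ⟨rfl | rfl, rfl | rfl, h⟩ <;> simp_all
    · rintro (⟨rfl, rfl⟩ | ⟨rfl, rfl⟩)
      · exact ⟨Or.inl rfl, Or.inr rfl, hab⟩
      · exact ⟨Or.inr rfl, Or.inl rfl, hab.symm⟩
  rw [pairWeight, if_pos (card_pair hab), h, sum_pair (by simp [hab]), hc b a, ← two_smul ℂ, smul_smul]
  norm_num

lemma pairWeight_of_card_ne {R : Type*} [CommRing R] [Algebra ℂ R] (c : κ → κ → R) {L : Finset κ} (h : #L ≠ 2) : pairWeight c L = 0 := if_neg h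

lemma partSum_pairWeight_insert {R : Type*} [CommRing R] [Algebra ℂ R] {c : κ → κ → R}
    (hc : ∀ a b, c a b = c b a) {Z : Finset κ} {a : κ} (ha : a ∉ Z) : partSum (pairWeight c) (insert a Z) =
      ∑ b ∈ Z, c a b * partSum (pairWeight c) (Z.erase b) := by
  rw [partSum_insert _ ha]
  symm
  refine sum_of_injOn (fun b => ({b} : Finset κ)) (fun _ _ _ _ h => singleton_injective h) ?_ ?_ ?_
  · intro b hb
    simpa using hb
  · intro V hV hV'
    rw [pairWeight_of_card_ne, zero_mul]
    intro h
    rw [mem_powerset] at hV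
    rw [card_insert_of_notMem (fun h => ha (hV h))] at h
    obtain ⟨b, rfl⟩ := card_eq_one.1 (Nat.succ_injective h)
    exact hV' ⟨b, by simpa using hV, rfl⟩
  · intro b hb
    have hab : a ≠ b := fun h => ha (h ▸ hb)
    rw [show insert a ({b} : Finset κ) = {a, b} from rfl, pairWeight_pair hc hab, sdiff_singleton_eq_erase]

variable [Fintype κ]

lemma coeff_sqf_sum_embedding {R : Type*} [CommSemiring R] {τ : Type*} [Fintype τ] [DecidableEq τ] (w : (τ → κ) → R) (S : Finset κ) :
    (∑ v : τ → κ, C (w v) * ∏ j, (X (v j) : MvPolynomial κ R)).coeff (sqf S)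
      = ∑ e : τ ↪ κ with univ.map e = S, w e := by
  classical
  rw [coeff_sum]
  simp_rw [coeff_C_mul, coeff_sqf_prod_X, mul_ite, mul_one, mul_zero]
  rw [← sum_filter]
  symm
  refine sum_bij (i := fun e _ => e) ?_ ?_ ?_ ?_
  · intro e he
    simp only [mem_filter_univ] at he ⊢
    exact ⟨e.injective, by rw [← he, map_eq_image]⟩
  · intro e _ e' _ h
    exact DFunLike.coe_injective h
  · intro v hv
    simp only [mem_filter_univ] at hv
    refine ⟨⟨v, hv.1⟩, ?_, rfl⟩
    simp only [mem_filter_univ]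
    exact (map_eq_image _ _).trans hv.2
  · intro e _
    rfl

lemma coeff_sqf_pow_pairs {c : κ → κ → ℂ} (hc : ∀ a b, c a b = c b a) (j : ℕ) (S : Finset κ) : ((∑ a, ∑ b, C (c a b) * (X a * X b) :
      MvPolynomial κ ℂ) ^ j).coeff (sqf S) = if #S = 2 * j then 2 ^ j * j.factorial * partSum (pairWeight c) S else 0 := by
  set q : MvPolynomial κ ℂ := ∑ a, ∑ b, C (c a b) * (X a * X b) with hq
  have hd : ∀ u, pderiv u q = 2 * ∑ b, C (c u b) * X b := by
    intro u
    have h1 : ∀ a b : κ, pderiv u (C (c a b) * (X a * X b) : MvPolynomial κ ℂ) = (if u = a then C (c u b) * X b else 0) +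
        (if u = b then C (c u a) * X a else 0) := by
      intro a b
      rw [MvPolynomial.pderiv_C_mul, MvPolynomial.pderiv_mul, pderiv_X, pderiv_X]
      by_cases h1 : u = a <;> by_cases h2 : u = b
      · subst h1; subst h2; simp; ring
      · subst h1; simp [Pi.single_apply, Ne.symm h2, h2]
      · subst h2; simp [Pi.single_apply, Ne.symm h1, h1, hc]
      · simp [Pi.single_apply, Ne.symm h1, h1, Ne.symm h2, h2]
    rw [hq, map_sum]
    simp_rw [map_sum, h1, sum_add_distrib]
    rw [two_mul]
    congr 1
    · simp_rw [sum_ite_irrel, sum_const_zero]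
      simp
    · simp
  induction j generalizing S with
  | zero =>
    rw [pow_zero, MvPolynomial.coeff_one]
    have : (0 : κ →₀ ℕ) = sqf S ↔ #S = 2 * 0 := by
      rw [← sqf_empty, sqf_injective.eq_iff, mul_zero, card_eq_zero, eq_comm]
    simp only [this]
    by_cases h : #S = 2 * 0
    · rw [if_pos h, if_pos h]
      rw [mul_zero, card_eq_zero] at h
      rw [h, partSum_empty]; simp
    · rw [if_neg h, if_neg h]
  | succ j ih =>
    rcases S.eq_empty_or_nonempty with rfl | ⟨a, haS⟩
    · rw [if_neg (by simp), sqf_empty, ← MvPolynomial.constantCoeff_eq, map_pow]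
      have : MvPolynomial.constantCoeff q = 0 := by
        rw [hq]; simp
      rw [this, zero_pow (by simp)]
    obtain ⟨Y, haY, rfl⟩ : ∃ Y, a ∉ Y ∧ insert a Y = S := ⟨S.erase a, notMem_erase a S, insert_erase haS⟩
    rw [coeff_sqf_insert haY, MvPolynomial.pderiv_pow, hd, Nat.add_sub_cancel]
    have e1 : ((j + 1 : ℕ) : MvPolynomial κ ℂ) * q ^ j * (2 * ∑ b, C (c a b) * X b)
        = ∑ b, C (2 * (j + 1) * c a b) * (q ^ j * X b) := by
      rw [mul_sum, mul_sum]
      refine sum_congr rfl fun b _ => ?_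
      simp only [map_mul, map_add, map_natCast, map_one]
      push_cast
      have : (C (2 : ℂ) : MvPolynomial κ ℂ) = 2 := rfl
      rw [this]
      ring
    rw [e1, coeff_sum]
    simp_rw [coeff_C_mul, MvPolynomial.coeff_mul_X']
    have e2 : ∀ b, (if b ∈ (sqf Y).support then (q ^ j).coeff (sqf Y - Finsupp.single b 1) else 0) =
        if b ∈ Y then (if #Y = 2 * j + 1 then 2 ^ j * j.factorial * partSum (pairWeight c) (Y.erase b) else 0) else 0 := by
      intro b
      have hb : b ∈ (sqf Y).support ↔ b ∈ Y := by
        rw [Finsupp.mem_support_iff, sqf_apply]; simp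
      simp only [hb]
      split_ifs with h1 h2
      · have : sqf Y - Finsupp.single b 1 = sqf (Y.erase b) := by
          conv_lhs => rw [← insert_erase h1, sqf_insert (notMem_erase b Y)]
          simp
        rw [this, ih, if_pos (by rw [card_erase_of_mem h1]; omega)]
      · have : sqf Y - Finsupp.single b 1 = sqf (Y.erase b) := by
          conv_lhs => rw [← insert_erase h1, sqf_insert (notMem_erase b Y)]
          simp
        have h3 : 0 < #Y := card_pos.2 ⟨b, h1⟩
        rw [this, ih, if_neg (by rw [card_erase_of_mem h1]; omega)]
      · rfl
    simp_rw [e2, card_insert_of_notMem haY]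
    by_cases h : #Y = 2 * j + 1
    · rw [if_pos (by omega), partSum_pairWeight_insert hc haY]
      simp only [if_pos h, mul_ite, mul_zero]
      rw [sum_ite_mem, univ_inter, mul_sum]
      refine sum_congr rfl fun b _ => ?_
      rw [Nat.factorial_succ]
      push_cast
      ring
    · rw [if_neg (by omega)]
      simp [h]

lemma coeff_sqf_pow_sum_X (q : ℕ) (Y : Finset κ) : ((∑ a, X a : MvPolynomial κ ℂ) ^ q).coeff (sqf Y) = if #Y = q then (q.factorial : ℂ) else 0 := by
  induction q generalizing Y with
  | zero =>
    rw [pow_zero, MvPolynomial.coeff_one]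
    have : (0 : κ →₀ ℕ) = sqf Y ↔ #Y = 0 := by
      rw [← sqf_empty, sqf_injective.eq_iff, card_eq_zero, eq_comm]
    simp [this]
  | succ q ih =>
    rcases Y.eq_empty_or_nonempty with rfl | ⟨a, haS⟩
    · rw [if_neg (by simp), sqf_empty, ← MvPolynomial.constantCoeff_eq, map_pow]
      simp
    obtain ⟨Z, haY, rfl⟩ : ∃ Z, a ∉ Z ∧ insert a Z = Y := ⟨Y.erase a, notMem_erase a Y, insert_erase haS⟩
    rw [coeff_sqf_insert haY, MvPolynomial.pderiv_pow, Nat.add_sub_cancel, map_sum]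
    have : ∑ x, pderiv a (X x : MvPolynomial κ ℂ) = 1 := by
      simp [pderiv_X, Pi.single_apply]
    rw [this, mul_one, ← map_natCast (C : ℂ →+* MvPolynomial κ ℂ), coeff_C_mul, ih, card_insert_of_notMem haY]
    by_cases h : #Z = q
    · rw [if_pos h, if_pos (by omega), Nat.factorial_succ]; push_cast; ring
    · rw [if_neg h, if_neg (by omega), mul_zero]

lemma sum_embedding_pairs {c : κ → κ → ℂ} (hc : ∀ a b, c a b = c b a) (j : ℕ) (S : Finset κ) :
    ∑ e : (Fin j ⊕ Fin j) ↪ κ with univ.map e = S, ∏ l, c (e (.inl l)) (e (.inr l)) =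
      if #S = 2 * j then 2 ^ j * j.factorial * partSum (pairWeight c) S else 0 := by
  rw [← coeff_sqf_pow_pairs hc, ← coeff_sqf_sum_embedding fun v : Fin j ⊕ Fin j → κ => ∏ l, c (v (.inl l)) (v (.inr l))]
  congr 1
  have h : (∑ a, ∑ b, C (c a b) * (X a * X b) : MvPolynomial κ ℂ) = ∑ x : κ × κ, C (c x.1 x.2) * (X x.1 * X x.2) := by
    rw [Fintype.sum_prod_type]
  rw [h, Fintype.sum_pow]
  refine Fintype.sum_equiv ((Equiv.sumArrowEquivProdArrow _ _ _).trans
    (Equiv.arrowProdEquivProdArrow _ _ _).symm) _ _ fun v => ?_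
  simp only [prod_mul_distrib, Fintype.prod_sum_type, map_prod]
  rfl

lemma card_embedding_map_eq (q : ℕ) (Y : Finset κ) : (#{e : Fin q ↪ κ | univ.map e = Y} : ℂ) = if #Y = q then (q.factorial : ℂ) else 0 := by
  rw [← coeff_sqf_pow_sum_X, card_eq_sum_ones, Nat.cast_sum]
  push_cast
  rw [← coeff_sqf_sum_embedding fun _ : Fin q → κ => (1 : ℂ), Fintype.sum_pow]
  simp

/-- Sums over the families of `2 j + q` distinct elements, the first ones grouped into pairs, in
terms of sums over subsets. -/
lemma sum_embedding_pairs_singles {M : Type*} [AddCommGroup M] [Module ℂ M] {c : κ → κ → ℂ} (hc : ∀ a b, c a b = c b a) (Ξ : Finset κ → M) (i : ℕ) :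
    ∑ j ∈ range (i / 2 + 1), (1 / (2 ^ j * j.factorial * (i - 2 * j).factorial) : ℂ) • ∑ m : ((Fin j ⊕ Fin j) ⊕ Fin (i - 2 * j)) ↪ κ,
        (∏ l, c (m (.inl (.inl l))) (m (.inl (.inr l)))) • Ξ (univ.map (Embedding.inr.trans m)) =
    ∑ Z ∈ powersetCard i univ, ∑ Y ∈ Z.powerset, partSum (pairWeight c) (Z \ Y) • Ξ Y := by
  classical
  have h0 : ∀ S : Finset κ, #S % 2 = 1 → partSum (pairWeight c) S = 0 := by
    intro S
    induction S using strongInduction with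
    | H S ih =>
      intro hS
      rcases S.eq_empty_or_nonempty with rfl | ⟨a, haS⟩
      · simp at hS
      obtain ⟨Y, haY, rfl⟩ : ∃ Y, a ∉ Y ∧ insert a Y = S := ⟨S.erase a, notMem_erase a S, insert_erase haS⟩
      rw [partSum_pairWeight_insert hc haY]
      refine sum_eq_zero fun b hb => ?_
      rw [ih (Y.erase b) (lt_of_le_of_lt (erase_subset _ _) (ssubset_insert haY)), mul_zero]
      rw [card_insert_of_notMem haY] at hS
      have : 0 < #Y := card_pos.2 ⟨b, hb⟩
      rw [card_erase_of_mem hb]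
      omega
  have h1 : ∀ j ∈ range (i / 2 + 1), (1 / (2 ^ j * j.factorial * (i - 2 * j).factorial) : ℂ) • ∑ m : ((Fin j ⊕ Fin j) ⊕ Fin (i - 2 * j)) ↪ κ,
        (∏ l, c (m (.inl (.inl l))) (m (.inl (.inr l)))) • Ξ (univ.map (Embedding.inr.trans m)) =
      ∑ S : Finset κ, ∑ Y : Finset κ, if Disjoint S Y ∧ #S = 2 * j ∧ #Y = i - 2 * j then
        partSum (pairWeight c) S • Ξ Y else 0 := by
    intro j hj
    set q := i - 2 * j
    have e1 : ∑ m : ((Fin j ⊕ Fin j) ⊕ Fin q) ↪ κ, (∏ l, c (m (.inl (.inl l))) (m (.inl (.inr l)))) • Ξ (univ.map (Embedding.inr.trans m)) =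
        ∑ f : {f : ((Fin j ⊕ Fin j) ↪ κ) × (Fin q ↪ κ) // Disjoint (Set.range f.1) (Set.range f.2)},
          (∏ l, c (f.1.1 (.inl l)) (f.1.1 (.inr l))) • Ξ (univ.map f.1.2) :=
      Fintype.sum_equiv Equiv.sumEmbeddingEquivProdEmbeddingDisjoint _ _ fun m => rfl
    have e2 : ∑ f : {f : ((Fin j ⊕ Fin j) ↪ κ) × (Fin q ↪ κ) //
          Disjoint (Set.range f.1) (Set.range f.2)},
          (∏ l, c (f.1.1 (.inl l)) (f.1.1 (.inr l))) • Ξ (univ.map f.1.2) =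
        ∑ f : ((Fin j ⊕ Fin j) ↪ κ) × (Fin q ↪ κ), if Disjoint (univ.map f.1) (univ.map f.2) then
            (∏ l, c (f.1 (.inl l)) (f.1 (.inr l))) • Ξ (univ.map f.2) else 0 := by
      rw [← sum_filter, ← sum_subtype_eq_sum_filter]
      refine sum_nbij' (i := fun f => ⟨f.1, ?_⟩) (j := fun f => ⟨f.1, ?_⟩) ?_ ?_ ?_ ?_ ?_
      · have := f.2
        rw [← disjoint_coe]
        simpa using this
      · have := f.2
        rw [← disjoint_coe] at this
        simpa using this
      all_goals simp
    have e3 : ∑ f : ((Fin j ⊕ Fin j) ↪ κ) × (Fin q ↪ κ), (if Disjoint (univ.map f.1) (univ.map f.2) then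
            (∏ l, c (f.1 (.inl l)) (f.1 (.inr l))) • Ξ (univ.map f.2) else 0) =
        ∑ S : Finset κ, ∑ Y : Finset κ, if Disjoint S Y then
          (∑ e : (Fin j ⊕ Fin j) ↪ κ with univ.map e = S, ∏ l, c (e (.inl l)) (e (.inr l))) •
            ((#{e : Fin q ↪ κ | univ.map e = Y} : ℂ) • Ξ Y) else 0 := by
      rw [Fintype.sum_prod_type, ← sum_fiberwise univ (fun e : (Fin j ⊕ Fin j) ↪ κ => univ.map e)]
      refine sum_congr rfl fun S _ => ?_
      simp_rw [← sum_fiberwise univ (fun e : Fin q ↪ κ => univ.map e)]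
      rw [sum_comm]
      refine sum_congr rfl fun Y _ => ?_
      by_cases h : Disjoint S Y
      · rw [if_pos h, sum_smul]
        refine sum_congr rfl fun e he => ?_
        rw [Nat.cast_smul_eq_nsmul, ← sum_const, smul_sum]
        refine sum_congr rfl fun y hy => ?_
        simp only [mem_filter_univ] at he hy
        rw [he, hy, if_pos h]
      · rw [if_neg h]
        refine sum_eq_zero fun e he => sum_eq_zero fun y hy => ?_
        simp only [mem_filter_univ] at he hy
        rw [he, hy, if_neg h]
    rw [e1, e2, e3, smul_sum]
    refine sum_congr rfl fun S _ => ?_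
    rw [smul_sum]
    refine sum_congr rfl fun Y _ => ?_
    rw [sum_embedding_pairs hc, card_embedding_map_eq]
    have hf1 : (j.factorial : ℂ) ≠ 0 := mod_cast j.factorial_ne_zero
    have hf2 : (q.factorial : ℂ) ≠ 0 := mod_cast q.factorial_ne_zero
    by_cases hd : Disjoint S Y <;> by_cases hS : #S = 2 * j <;> by_cases hY : #Y = q <;>
      simp only [hd, hS, hY, if_true, if_false, zero_smul, smul_zero, and_true, and_false, true_and, false_and]
    rw [smul_smul, smul_smul]
    congr 1
    field_simp
  rw [sum_congr rfl h1, sum_comm]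
  have h2 : ∀ S : Finset κ, ∑ j ∈ range (i / 2 + 1), ∑ Y : Finset κ, (if Disjoint S Y ∧ #S = 2 * j ∧ #Y = i - 2 * j then
        partSum (pairWeight c) S • Ξ Y else 0) =
      ∑ Y : Finset κ, if Disjoint S Y ∧ #S + #Y = i then
        partSum (pairWeight c) S • Ξ Y else 0 := by
    intro S
    rw [sum_comm]
    refine sum_congr rfl fun Y _ => ?_
    by_cases hS : #S % 2 = 1
    · simp [h0 S hS]
    by_cases h : Disjoint S Y ∧ #S + #Y = i
    · rw [if_pos h, sum_eq_single (#S / 2), if_pos ⟨h.1, by omega, by omega⟩]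
      · intro j _ hj
        rw [if_neg]
        rintro ⟨-, h3, -⟩
        omega
      · intro hn
        rw [mem_range] at hn
        omega
    · rw [if_neg h]
      refine sum_eq_zero fun j hj => if_neg ?_
      rw [mem_range] at hj
      rintro ⟨h3, h4, h5⟩
      exact h ⟨h3, by omega⟩
  rw [sum_congr rfl fun S _ => h2 S, sum_comm]
  simp_rw [← sum_filter]
  rw [sum_sigma', sum_sigma']
  refine sum_bij' (i := fun x _ => ⟨x.2 ∪ x.1, x.1⟩) (j := fun x _ => ⟨x.2, x.1 \ x.2⟩)
    ?_ ?_ ?_ ?_ ?_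
  · rintro ⟨Y, S⟩ h
    simp only [mem_sigma, mem_filter, mem_univ, true_and, mem_powersetCard, mem_powerset] at h ⊢
    exact ⟨⟨subset_univ _, by rw [card_union_of_disjoint h.1, h.2]⟩, subset_union_right⟩
  · rintro ⟨Z, Y⟩ h
    simp only [mem_sigma, mem_filter, mem_univ, true_and, mem_powersetCard, mem_powerset] at h ⊢
    refine ⟨sdiff_disjoint, ?_⟩
    rw [card_sdiff_add_card_eq_card h.2, h.1.2]
  · rintro ⟨Y, S⟩ h
    simp only [mem_sigma, mem_filter, mem_univ, true_and] at h ⊢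
    rw [union_sdiff_cancel_right h.1]
  · rintro ⟨Z, Y⟩ h
    simp only [mem_sigma, mem_powersetCard, mem_powerset] at h ⊢
    rw [sdiff_union_of_subset h.2]
  · rintro ⟨Y, S⟩ h
    simp only [mem_sigma, mem_filter, mem_univ, true_and] at h ⊢
    rw [union_sdiff_cancel_right h.1]

end Pairings

/-! ## Normally ordered products of first order differential operators -/

section NormalOrder

variable {κ A : Type*} [DecidableEq κ] [CommRing A] [Algebra ℂ A]

lemma sum_powerset_powerset {ι M : Type*} [DecidableEq ι] [AddCommMonoid M] (Y : Finset ι) (h : Finset ι → Finset ι → M) :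
    ∑ U ∈ Y.powerset, ∑ V ∈ U.powerset, h V (U \ V) = ∑ V ∈ Y.powerset, ∑ W ∈ (Y \ V).powerset, h V W := by
  rw [sum_sigma', sum_sigma']
  refine sum_bij' (i := fun x _ => ⟨x.2, x.1 \ x.2⟩) (j := fun x _ => ⟨x.1 ∪ x.2, x.1⟩)
    ?_ ?_ ?_ ?_ ?_
  · rintro ⟨V, U⟩ h
    simp only [mem_sigma, mem_powerset] at h ⊢
    exact ⟨h.2.trans h.1, sdiff_subset_sdiff h.1 le_rfl⟩
  · rintro ⟨U, V⟩ h
    simp only [mem_sigma, mem_powerset] at h ⊢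
    exact ⟨union_subset h.1 (h.2.trans sdiff_subset), subset_union_left⟩
  · rintro ⟨V, U⟩ h
    simp only [mem_sigma, mem_powerset] at h ⊢
    rw [union_sdiff_of_subset h.2]
  · rintro ⟨U, V⟩ h
    simp only [mem_sigma, mem_powerset, subset_sdiff] at h ⊢
    rw [union_sdiff_cancel_left h.2.2.symm]
  · rintro ⟨V, U⟩ h
    rfl

lemma pairwise_commute {D : κ → Derivation ℂ A A} (hD : ∀ s s', Commute (D s : A →ₗ[ℂ] A) (D s' : A →ₗ[ℂ] A)) (U : Finset κ) :
    (U : Set κ).Pairwise (onFun Commute fun s => (D s : A →ₗ[ℂ] A)) :=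
  fun s _ s' _ _ => hD s s'

/-- Iterated derivatives along a finite set of commuting derivations. -/
def iterD (D : κ → Derivation ℂ A A) (hD : ∀ s s', Commute (D s : A →ₗ[ℂ] A) (D s' : A →ₗ[ℂ] A)) (U : Finset κ) : End ℂ A :=
  U.noncommProd (fun s => (D s : A →ₗ[ℂ] A)) (pairwise_commute hD U)

section

variable {D : κ → Derivation ℂ A A}
  (hD : ∀ s s', Commute (D s : A →ₗ[ℂ] A) (D s' : A →ₗ[ℂ] A))

@[simp] lemma iterD_empty (f : A) : iterD D hD ∅ f = f := by
  rw [iterD, noncommProd_empty]; rfl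

lemma iterD_insert {U : Finset κ} {s : κ} (hs : s ∉ U) (f : A) : iterD D hD (insert s U) f = iterD D hD U (D s f) := by
  rw [iterD, noncommProd_insert_of_notMem' _ _ _ _ hs]; rfl

lemma iterD_singleton (s : κ) (f : A) : iterD D hD {s} f = D s f := by
  rw [← insert_empty_eq, iterD_insert hD (notMem_empty s), iterD_empty]

lemma commute_iterD (δ : End ℂ A) (h : ∀ s, Commute δ (D s : A →ₗ[ℂ] A)) (U : Finset κ) (f : A) : δ (iterD D hD U f) = iterD D hD U (δ f) := by
  have : Commute δ (iterD D hD U) := noncommProd_commute _ _ _ _ fun s _ => h s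
  exact LinearMap.congr_fun this f

lemma iterD_mul (U : Finset κ) (f h : A) : iterD D hD U (f * h) = ∑ V ∈ U.powerset, iterD D hD V f * iterD D hD (U \ V) h := by
  induction U using Finset.induction_on generalizing f h with
  | empty => simp
  | insert s U hs ih =>
    rw [iterD_insert hD hs, leibniz, smul_eq_mul, smul_eq_mul, map_add, ih, mul_comm h, ih, sum_powerset_insert hs]
    congr 1
    · refine sum_congr rfl fun V hV => ?_
      rw [insert_sdiff_of_notMem' hs (mem_powerset.1 hV), iterD_insert hD (fun h => hs (Finset.mem_sdiff.1 h).1)]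
    · refine sum_congr rfl fun V hV => ?_
      rw [insert_sdiff_insert' hs, iterD_insert hD (fun h => hs (mem_powerset.1 hV h))]

end

/-- The weight of a block which is non-zero on singletons only. -/
def singleWeight (g : κ → A) (L : Finset κ) : A := if #L = 1 then ∑ s ∈ L, g s else 0

omit [DecidableEq κ] [Algebra ℂ A] in
lemma singleWeight_singleton (g : κ → A) (s : κ) : singleWeight g {s} = g s := by
  simp [singleWeight]

/-- First order operators, decomposed in two parts: `annih` is the part consisting of the
annihilation operators, and the remaining part is `der + mult`. -/
structure OpFamily (κ A : Type*) [CommRing A] [Algebra ℂ A] where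
  der : κ → Derivation ℂ A A
  mult : κ → A
  annih : κ → Derivation ℂ A A
  der_der : ∀ s s', Commute (der s : A →ₗ[ℂ] A) (der s' : A →ₗ[ℂ] A)
  annih_annih : ∀ s s', Commute (annih s : A →ₗ[ℂ] A) (annih s' : A →ₗ[ℂ] A)
  der_annih : ∀ s s', Commute (der s : A →ₗ[ℂ] A) (annih s' : A →ₗ[ℂ] A)
  contraction_symm : ∀ s s', der s (mult s') = der s' (mult s)
  der_contraction : ∀ u s s', der u (der s (mult s')) = 0

namespace OpFamily

variable (K : OpFamily κ A)

/-- The creation part of the operator. -/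
def left (s : κ) : End ℂ A := (K.der s : A →ₗ[ℂ] A) + mulLeft ℂ (K.mult s)

/-- The annihilation part of the operator. -/
def right (s : κ) : End ℂ A := (K.annih s : A →ₗ[ℂ] A)

/-- The total derivation. -/
def tot (s : κ) : Derivation ℂ A A := K.der s + K.annih s

lemma tot_tot (s s' : κ) : Commute (K.tot s : A →ₗ[ℂ] A) (K.tot s' : A →ₗ[ℂ] A) := by
  have h : ∀ s, (K.tot s : A →ₗ[ℂ] A) = (K.der s : A →ₗ[ℂ] A) + (K.annih s : A →ₗ[ℂ] A) := fun s => rfl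
  rw [h, h]
  exact ((K.der_der s s').add_right (K.der_annih s s')).add_left
    ((K.der_annih s' s).symm.add_right (K.annih_annih s s'))

/-- The normally ordered product of the sums `left s + right s`. -/
def ordered : List κ → End ℂ A
  | [] => 1
  | s :: l => K.left s * ordered l + ordered l * K.right s

lemma left_left (s s' : κ) : Commute (K.left s) (K.left s') := by
  refine LinearMap.ext fun f => ?_
  have h := LinearMap.congr_fun (K.der_der s s') f
  have hc := K.contraction_symm s s'
  simp only [End.mul_apply, Derivation.coeFn_coe] at h
  simp only [left, End.mul_apply, LinearMap.add_apply, Derivation.coeFn_coe, mulLeft_apply, map_add, leibniz, smul_eq_mul, h, hc]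
  ring

lemma ordered_perm {l l' : List κ} (h : l.Perm l') : K.ordered l = K.ordered l' := by
  induction h with
  | nil => rfl
  | cons s _ ih => simp only [ordered, ih]
  | swap a b l =>
    have hl := (K.left_left a b).eq
    have hr : K.right a * K.right b = K.right b * K.right a := (K.annih_annih a b).eq
    simp only [ordered, mul_add, add_mul]
    have e1 : K.left b * (K.left a * K.ordered l) = K.left a * (K.left b * K.ordered l) := by
      rw [← mul_assoc, ← mul_assoc, hl]
    have e2 : K.ordered l * K.right a * K.right b = K.ordered l * K.right b * K.right a := by
      rw [mul_assoc, mul_assoc, hr]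
    rw [e1, e2, mul_assoc (K.left b)]
    simp only [mul_assoc]
    abel
  | trans _ _ ih1 ih2 => rw [ih1, ih2]

lemma commute_ordered {B : End ℂ A} {l : List κ} (hl : ∀ s ∈ l, Commute B (K.left s))
    (hr : ∀ s ∈ l, Commute B (K.right s)) : Commute B (K.ordered l) := by
  induction l with
  | nil => exact Commute.one_right B
  | cons s l ih =>
    have h := ih (fun s' hs' => hl s' (List.mem_cons_of_mem s hs')) (fun s' hs' => hr s' (List.mem_cons_of_mem s hs'))
    exact ((hl s List.mem_cons_self).mul_right h).add_right
      (h.mul_right (hr s List.mem_cons_self))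

lemma ordered_append {l l' : List κ} (h : ∀ s ∈ l, ∀ s' ∈ l', Commute (K.right s) (K.left s')) :
    K.ordered (l ++ l') = K.ordered l * K.ordered l' := by
  induction l with
  | nil => simp [ordered]
  | cons s l ih =>
    have ih' := ih fun s' hs' => h s' (List.mem_cons_of_mem s hs')
    have hc : Commute (K.right s) (K.ordered l') := K.commute_ordered (fun s' hs' => h s List.mem_cons_self s' hs')
        fun s' _ => K.annih_annih s s'
    simp only [List.cons_append, ordered, ih', add_mul, mul_assoc]
    rw [hc.eq]

/-- The normally ordered product over a finite set. -/
def orderedSet (Y : Finset κ) : End ℂ A := K.ordered Y.toList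

lemma orderedSet_eq {l : List κ} (hl : l.Nodup) : K.ordered l = K.orderedSet l.toFinset := K.ordered_perm (List.toFinset_toList hl).symm

/-- The weights of the blocks in the action of normally ordered products on exponentials. -/
def blockWeight (F : A) (L : Finset κ) : A := if L = ∅ then 0 else iterD K.tot K.tot_tot L F + singleWeight K.mult L +
    pairWeight (fun s s' => K.der s (K.mult s')) L

lemma partSum_blockWeight_insert (F : A) {Y : Finset κ} {s : κ} (hs : s ∉ Y) : partSum (K.blockWeight F) (insert s Y) =
      (K.der s F + K.mult s) * partSum (K.blockWeight F) Y + K.der s (partSum (K.blockWeight F) Y) +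
      ∑ W ∈ Y.powerset, iterD K.tot K.tot_tot W (K.annih s F) * partSum (K.blockWeight F) (Y \ W) := by
  rw [partSum_insert _ hs, derivation_partSum _ _ (by simp [blockWeight])]
  have h0 : (K.der s F + K.mult s) * partSum (K.blockWeight F) Y = ∑ W ∈ Y.powerset, (if W = ∅ then K.der s F + K.mult s else 0) *
        partSum (K.blockWeight F) (Y \ W) := by
    simp_rw [ite_mul, zero_mul]
    rw [sum_ite_eq' Y.powerset ∅, if_pos (empty_mem_powerset Y), sdiff_empty]
  rw [h0, ← sum_add_distrib, ← sum_add_distrib]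
  refine sum_congr rfl fun W hW => ?_
  rw [← add_mul, ← add_mul]
  congr 1
  have hsW : s ∉ W := fun h => hs (mem_powerset.1 hW h)
  have hder : K.der s (iterD K.tot K.tot_tot W F) = iterD K.tot K.tot_tot W (K.der s F) := commute_iterD K.tot_tot (K.der s : A →ₗ[ℂ] A)
      (fun s' => (K.der_der s s').add_right (K.der_annih s s')) W F
  have htot : K.tot s F = K.der s F + K.annih s F := rfl
  rcases W.eq_empty_or_nonempty with rfl | hW0
  · simp only [blockWeight, if_true, map_zero, iterD_empty, insert_empty_eq, singleton_ne_empty, if_false, iterD_singleton, singleWeight_singleton]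
    rw [pairWeight_of_card_ne _ (by simp), htot]
    ring
  · rw [if_neg hW0.ne_empty]
    simp only [blockWeight, (insert_nonempty s W).ne_empty, hW0.ne_empty, if_false]
    rw [iterD_insert K.tot_tot hsW, htot, map_add, map_add, map_add, hder]
    have e1 : singleWeight K.mult (insert s W) = 0 := by
      rw [singleWeight, if_neg]
      rw [card_insert_of_notMem hsW]
      have := hW0.card_pos
      omega
    have e2 : K.der s (pairWeight (fun s s' => K.der s (K.mult s')) W) = 0 := by
      rw [pairWeight]
      split_ifs
      · rw [Derivation.map_smul, map_sum]
        simp [K.der_contraction]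
      · simp
    have e3 : pairWeight (fun s s' => K.der s (K.mult s')) (insert s W) = K.der s (singleWeight K.mult W) := by
      by_cases h1 : #W = 1
      · obtain ⟨u, rfl⟩ := card_eq_one.1 h1
        have hsu : s ≠ u := by simpa using hsW
        rw [show insert s ({u} : Finset κ) = {s, u} from rfl, pairWeight_pair (fun a b => K.contraction_symm a b) hsu, singleWeight_singleton]
      · rw [pairWeight_of_card_ne, singleWeight, if_neg h1, map_zero]
        rw [card_insert_of_notMem hsW]
        omega
    rw [e1, e2, e3]
    ring

lemma ordered_apply {E F : A} (hder : ∀ s, K.der s E = K.der s F * E)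
    (hann : ∀ s, K.annih s E = K.annih s F * E) {l : List κ} (hl : l.Nodup) (f : A) :
    K.ordered l (f * E) = (∑ U ∈ l.toFinset.powerset, iterD K.tot K.tot_tot U f * partSum (K.blockWeight F) (l.toFinset \ U)) * E := by
  induction l generalizing f with
  | nil => simp [ordered, partSum_empty]
  | cons s l ih =>
    have hs : s ∉ l.toFinset := by simpa using (List.nodup_cons.1 hl).1
    have ih := ih (List.nodup_cons.1 hl).2
    set Y := l.toFinset
    set X := partSum (K.blockWeight F) with hX
    rw [List.toFinset_cons]
    have h1 : K.ordered (s :: l) (f * E) = K.left s (K.ordered l (f * E)) + K.ordered l ((K.annih s f + f * K.annih s F) * E) := by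
      simp only [ordered, LinearMap.add_apply, End.mul_apply]
      congr 2
      change K.annih s (f * E) = _
      rw [leibniz, hann, smul_eq_mul, smul_eq_mul]
      ring
    rw [h1, ih, ih]
    have h2 : ∀ x : A, K.left s (x * E) = (K.der s x + (K.der s F + K.mult s) * x) * E := by
      intro x
      simp only [left, LinearMap.add_apply, Derivation.coeFn_coe, mulLeft_apply, leibniz, smul_eq_mul, hder]
      ring
    rw [h2, ← add_mul]
    congr 1
    rw [sum_powerset_insert hs]
    have e1 : ∀ U ∈ Y.powerset, iterD K.tot K.tot_tot (insert s U) f * X (insert s Y \ insert s U) = K.der s (iterD K.tot K.tot_tot U f) * X (Y \ U) +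
          iterD K.tot K.tot_tot U (K.annih s f) * X (Y \ U) := by
      intro U hU
      have hder : K.der s (iterD K.tot K.tot_tot U f) = iterD K.tot K.tot_tot U (K.der s f) := commute_iterD K.tot_tot (K.der s : A →ₗ[ℂ] A)
          (fun s' => (K.der_der s s').add_right (K.der_annih s s')) U f
      rw [insert_sdiff_insert' hs, iterD_insert K.tot_tot (fun h => hs (mem_powerset.1 hU h)),
        show K.tot s f = K.der s f + K.annih s f from rfl, map_add, hder, add_mul]
    have e2 : ∀ U ∈ Y.powerset, iterD K.tot K.tot_tot U f * X (insert s Y \ U) =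
        iterD K.tot K.tot_tot U f * ((K.der s F + K.mult s) * X (Y \ U) + K.der s (X (Y \ U))) + ∑ W ∈ (Y \ U).powerset, iterD K.tot K.tot_tot U f *
          (iterD K.tot K.tot_tot W (K.annih s F) * X ((Y \ U) \ W)) := by
      intro U hU
      rw [insert_sdiff_of_notMem' hs (mem_powerset.1 hU), hX, K.partSum_blockWeight_insert F (fun h => hs (Finset.mem_sdiff.1 h).1), ← mul_sum]
      ring
    have e3 : ∑ U ∈ Y.powerset, iterD K.tot K.tot_tot U (f * K.annih s F) * X (Y \ U) =
        ∑ U ∈ Y.powerset, ∑ W ∈ (Y \ U).powerset, iterD K.tot K.tot_tot U f * (iterD K.tot K.tot_tot W (K.annih s F) * X ((Y \ U) \ W)) := by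
      rw [← sum_powerset_powerset Y fun U W => iterD K.tot K.tot_tot U f * (iterD K.tot K.tot_tot W (K.annih s F) * X ((Y \ U) \ W))]
      refine sum_congr rfl fun U _ => ?_
      rw [iterD_mul, sum_mul]
      refine sum_congr rfl fun V hV => ?_
      have : (Y \ V) \ (U \ V) = Y \ U := by
        ext x
        have : x ∈ V → x ∈ U := fun h => mem_powerset.1 hV h
        simp only [Finset.mem_sdiff]
        tauto
      rw [this]
      ring
    rw [sum_congr rfl e1, sum_congr rfl e2, map_sum, mul_sum, sum_add_distrib, sum_add_distrib]
    simp_rw [map_add, add_mul, sum_add_distrib]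
    rw [e3]
    have e4 : ∑ U ∈ Y.powerset, K.der s (iterD K.tot K.tot_tot U f * X (Y \ U)) = ∑ U ∈ Y.powerset, iterD K.tot K.tot_tot U f * K.der s (X (Y \ U)) +
        ∑ U ∈ Y.powerset, K.der s (iterD K.tot K.tot_tot U f) * X (Y \ U) := by
      rw [← sum_add_distrib]
      refine sum_congr rfl fun U _ => ?_
      rw [leibniz, smul_eq_mul, smul_eq_mul]
      ring
    rw [e4]
    have e5 : ∑ U ∈ Y.powerset, iterD K.tot K.tot_tot U f * ((K.der s F * X (Y \ U) + K.mult s * X (Y \ U)) + K.der s (X (Y \ U))) =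
        ∑ U ∈ Y.powerset, (K.der s F * (iterD K.tot K.tot_tot U f * X (Y \ U)) + K.mult s * (iterD K.tot K.tot_tot U f * X (Y \ U))) +
        ∑ U ∈ Y.powerset, iterD K.tot K.tot_tot U f * K.der s (X (Y \ U)) := by
      rw [← sum_add_distrib]
      refine sum_congr rfl fun U _ => ?_
      ring
    rw [e5, sum_add_distrib]
    abel

lemma orderedSet_apply {E F : A} (hder : ∀ s, K.der s E = K.der s F * E) (hann : ∀ s, K.annih s E = K.annih s F * E) (Y : Finset κ) :
    K.orderedSet Y E = partSum (K.blockWeight F) Y * E := by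
  have h := K.ordered_apply hder hann Y.nodup_toList 1
  rw [one_mul, toList_toFinset] at h
  rw [orderedSet, h]
  congr 1
  rw [sum_eq_single ∅]
  · simp
  · intro U _ hU
    have : iterD K.tot K.tot_tot U 1 = 0 := by
      obtain ⟨s, hs⟩ := nonempty_iff_ne_empty.2 hU
      rw [← insert_erase hs, iterD_insert K.tot_tot (notMem_erase s U)]
      simp
    rw [this, zero_mul]
  · simp

/-- Normally ordered products supplemented with pair contractions. -/
def contracted (c : κ → κ → A) (Z : Finset κ) : End ℂ A := ∑ Y ∈ Z.powerset, mulLeft ℂ (partSum (pairWeight c) (Z \ Y)) * K.orderedSet Y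

lemma contracted_apply {E F : A} (hder : ∀ s, K.der s E = K.der s F * E) (hann : ∀ s, K.annih s E = K.annih s F * E) (c : κ → κ → A) (Z : Finset κ) :
    K.contracted c Z E = partSum (fun L => K.blockWeight F L + pairWeight c L) Z * E := by
  rw [partSum_add, contracted, LinearMap.sum_apply, sum_mul]
  refine sum_congr rfl fun Y _ => ?_
  rw [End.mul_apply, K.orderedSet_apply hder hann, mulLeft_apply]
  ring

end OpFamily

end NormalOrder

/-! ## Locally finite sums of endomorphisms -/

lemma exists_pnat_eq {p : ℤ} (h : 0 < p) : ∃ k : ℕ+, p = k := ⟨⟨p.toNat, by omega⟩, by simp only [PNat.mk_coe]; omega⟩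

lemma exists_pnat_eq_neg {p : ℤ} (h : p < 0) : ∃ k : ℕ+, p = -(k : ℤ) := (exists_pnat_eq (neg_pos.2 h)).imp fun _ h => by omega

section LocSum

variable {R M ι : Type*} [Semiring R] [AddCommMonoid M] [Module R M]

lemma locSum_apply {A : ι → End R M} (hA : LocFinite A) (f : M) : locSum A f = ∑ᶠ j, A j f := by
  rw [locSum, dif_pos hA]; rfl

lemma locSum_apply_eq_sum {A : ι → End R M} (hA : LocFinite A) {f : M} (s : Finset ι)
    (hs : ∀ j, j ∉ s → A j f = 0) : locSum A f = ∑ j ∈ s, A j f := by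
  rw [locSum_apply hA]
  refine finsum_eq_sum_of_support_subset _ fun j hj => ?_
  by_contra h
  exact hj (hs j h)

lemma locSum_subtype_apply {P : ι → Prop} [DecidablePred P] [DecidableEq ι] {A : ι → End R M}
    (hA : LocFinite fun p : {p // P p} => A p) {f : M} (s : Finset ι) (hs : ∀ p, P p → p ∉ s → A p f = 0) :
    locSum (fun p : {p // P p} => A p) f = ∑ p ∈ s with P p, A p f := by
  rw [locSum_apply_eq_sum hA (s.subtype P) fun j hj => hs j j.2 (by simpa using hj)]
  exact sum_subtype_eq_sum_filter (fun p => A p f)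

lemma commute_locSum {A : ι → End R M} {B : End R M} (h : ∀ j, Commute B (A j)) : Commute B (locSum A) := by
  by_cases hA : LocFinite A
  · refine LinearMap.ext fun f => ?_
    have h1 : ∀ j, B (A j f) = A j (B f) := fun j => LinearMap.congr_fun (h j) f
    rw [End.mul_apply, End.mul_apply, locSum_apply hA, locSum_apply hA]
    rw [(B : M →+ M).map_finsum (hA f) |> (show B (∑ᶠ j, A j f) = _ from ·)]
    exact finsum_congr h1
  · rw [locSum, dif_neg hA]
    exact Commute.zero_right B

end LocSum

/-! ## Scalars -/

section Scalars

variable {M : Type*} [AddCommGroup M] [Module HRing M] [Module ℂ M] [IsScalarTower ℂ HRing M]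

lemma sc_smul (c : ℂ) (f : M) : sc c • f = c • f := by
  rw [sc, LaurentPolynomial.C_eq_algebraMap, algebraMap_smul]

lemma hb_add (a b : ℤ) : hb (a + b) = hb a * hb b := LaurentPolynomial.T_add a b

lemma hb_zero : hb 0 = 1 := LaurentPolynomial.T_zero

lemma hb_pow (a : ℤ) (n : ℕ) : hb a ^ n = hb (n * a) := LaurentPolynomial.T_pow a n

end Scalars

/-! ## Truncated modes -/

section Box

section Generic

variable {Ω Ω' : Type*} [Semiring Ω] [Algebra ℂ Ω] [Semiring Ω'] [Algebra ℂ Ω']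

/-- The integers between `-B` and `B`. -/
abbrev box (B : ℕ) : Finset ℤ := Finset.Icc (-(B : ℤ)) B

/-- Normally ordered products of the elements of a family. -/
def orderedModes (O : ℤ → Ω) {q : ℕ} (p : Fin q → ℤ) : Ω := (((List.ofFn p).filter fun a => a ≤ 0).map O).prod *
    (((List.ofFn p).filter fun a => 0 < a).map O).prod

/-- The modes of a cycle of length `r`, with indices truncated to a box. -/
def cycleBox (O : ℤ → Ω) (ħ : Ω) (B r i : ℕ) (k : ℤ) : Ω := (1 / (r : ℂ)) • ∑ j ∈ range (i / 2 + 1),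
    ((i.factorial : ℂ) / (2 ^ j * j.factorial * (i - 2 * j).factorial)) •
      (ħ ^ j * ∑ p ∈ (Fintype.piFinset fun _ : Fin (i - 2 * j) => box B) with ∑ l, p l = r * k, psi r j p • orderedModes O p)

/-- The twisted modes, with indices truncated to a box. -/
def twistedBox (D : LocalCoords Γ) (O : Γ.ramT → ℤ → Ω) (ħ : Ω) (B : ℕ) (α : Γ.ram) (i : ℕ) (k : ℤ) : Ω := open Classical in
  ∑ M ∈ (Γ.above α).powerset, ∑ im ∈ (Fintype.piFinset fun μ : {μ // μ ∈ M} => Finset.Icc 1 (D.r μ)) with ∑ μ, im μ = i,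
      ∑ km ∈ (Fintype.piFinset fun _ : {μ // μ ∈ M} => box B) with ∑ μ, km μ = k, ((univ : Finset {μ // μ ∈ M}).toList.map fun (μ : {μ // μ ∈ M}) =>
          (1 / (D.r μ : ℂ) ^ (im μ - 1)) • cycleBox (O μ) ħ B (D.r μ) (im μ) (km μ)).prod

lemma map_orderedModes (φ : Ω →ₐ[ℂ] Ω') (O : ℤ → Ω) {q : ℕ} (p : Fin q → ℤ) : φ (orderedModes O p) = orderedModes (fun a => φ (O a)) p := by
  simp only [orderedModes, map_mul, map_list_prod, List.map_map, comp_def]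

lemma map_cycleBox (φ : Ω →ₐ[ℂ] Ω') (O : ℤ → Ω) (ħ : Ω) (B r i : ℕ) (k : ℤ) :
    φ (cycleBox O ħ B r i k) = cycleBox (fun a => φ (O a)) (φ ħ) B r i k := by
  simp only [cycleBox, map_smul, map_sum, map_mul, map_pow, map_orderedModes]

lemma map_twistedBox (φ : Ω →ₐ[ℂ] Ω') (D : LocalCoords Γ) (O : Γ.ramT → ℤ → Ω) (ħ : Ω) (B : ℕ) (α : Γ.ram) (i : ℕ) (k : ℤ) :
    φ (twistedBox D O ħ B α i k) = twistedBox D (fun μ a => φ (O μ a)) (φ ħ) B α i k := by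
  simp only [twistedBox, map_sum, map_list_prod, List.map_map, comp_def, map_smul, map_cycleBox]

end Generic

lemma derivation_comm {σ R : Type*} [CommRing R] (D₁ D₂ : Derivation R (MvPolynomial σ R) (MvPolynomial σ R))
    (h : ∀ i, D₁ (D₂ (X i)) = D₂ (D₁ (X i))) (f : MvPolynomial σ R) : D₁ (D₂ f) = D₂ (D₁ f) := by
  have : ⁅D₁, D₂⁆ = 0 := derivation_ext fun i => by
    rw [Derivation.commutator_apply, h, sub_self]; rfl
  have h2 := DFunLike.congr_fun this f
  rw [Derivation.commutator_apply] at h2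
  exact sub_eq_zero.1 h2

lemma pderiv_comm {σ R : Type*} [CommRing R] (i j : σ) (f : MvPolynomial σ R) : pderiv i (pderiv j f) = pderiv j (pderiv i f) := by
  classical
  refine derivation_comm _ _ (fun l => ?_) f
  rw [pderiv_X, pderiv_X, Pi.single_apply, Pi.single_apply]
  split_ifs <;> simp

namespace Correlators

lemma normalOrdered_eq (μ : Γ.ramT) {q : ℕ} (p : Fin q → ℤ) : W.normalOrdered μ p = orderedModes (W.J μ) p := rfl

lemma J_pos_apply (μ : Γ.ramT) (k : ℕ+) (f : Poly Γ) : W.J μ k f = hb 2 • pderiv (μ, k) f := by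
  obtain ⟨n, rfl⟩ : ∃ n : ℕ, n.succPNat = k := ⟨k.natPred, PNat.succPNat_natPred k⟩
  rfl

lemma J_zero_apply (μ : Γ.ramT) (f : Poly Γ) : W.J μ 0 f = (hb 1 * sc (W.Q μ)) • f := rfl

lemma J_neg_apply (μ : Γ.ramT) (k : ℕ+) (f : Poly Γ) : W.J μ (-(k : ℤ)) f = ((k : ℕ) : HRing) • (X (μ, k) * f) := by
  obtain ⟨n, rfl⟩ : ∃ n : ℕ, n.succPNat = k := ⟨k.natPred, PNat.succPNat_natPred k⟩
  change (((n : HRing) + 1) • (X (μ, n.succPNat) : Poly Γ)) * f = _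
  rw [Nat.succPNat_coe, Nat.succ_eq_add_one, Nat.cast_add, Nat.cast_one, smul_mul_assoc]

lemma int_cases (p : ℤ) : (∃ k : ℕ+, p = k) ∨ p = 0 ∨ ∃ k : ℕ+, p = -(k : ℤ) := by
  rcases lt_trichotomy p 0 with h | h | h
  · refine Or.inr (Or.inr ⟨⟨(-p).toNat, by omega⟩, ?_⟩)
    simp only [PNat.mk_coe]; omega
  · exact Or.inr (Or.inl h)
  · refine Or.inl ⟨⟨p.toNat, by omega⟩, ?_⟩
    simp only [PNat.mk_coe]; omega

lemma commute_J_of_ne {μ ν : Γ.ramT} (h : μ ≠ ν) (p p' : ℤ) : Commute (W.J μ p) (W.J ν p') := by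
  have hne : ∀ k l : ℕ+, ((ν, l) : Idx Γ) ≠ (μ, k) := fun k l h' => h (congrArg Prod.fst h').symm
  have hne' : ∀ k l : ℕ+, ((μ, k) : Idx Γ) ≠ (ν, l) := fun k l h' => h (congrArg Prod.fst h')
  refine LinearMap.ext fun f => ?_
  rw [End.mul_apply, End.mul_apply]
  rcases int_cases p with ⟨k, rfl⟩ | rfl | ⟨k, rfl⟩
  · rcases int_cases p' with ⟨l, rfl⟩ | rfl | ⟨l, rfl⟩
    · simp only [J_pos_apply, Derivation.map_smul]
      rw [pderiv_comm]
    · simp only [J_pos_apply, J_zero_apply, Derivation.map_smul]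
      rw [smul_comm]
    · simp only [J_pos_apply, J_neg_apply, Derivation.map_smul, leibniz, pderiv_X_of_ne (hne k l), smul_zero, add_zero, mul_zero, smul_eq_mul]
      rw [smul_comm, mul_smul_comm]
  · rw [J_zero_apply, J_zero_apply, map_smul]
  · rcases int_cases p' with ⟨l, rfl⟩ | rfl | ⟨l, rfl⟩
    · simp only [J_pos_apply, J_neg_apply, Derivation.map_smul, leibniz, pderiv_X_of_ne (hne' k l), smul_zero, add_zero, mul_zero, smul_eq_mul]
      rw [smul_comm, mul_smul_comm]
    · rw [J_zero_apply, J_zero_apply, map_smul]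
    · simp only [J_neg_apply]
      rw [mul_smul_comm, mul_smul_comm, smul_comm, mul_left_comm]

lemma commute_J_pos {μ ν : Γ.ramT} {p p' : ℤ} (hp : 0 < p) (hp' : 0 < p') : Commute (W.J μ p) (W.J ν p') := by
  refine LinearMap.ext fun f => ?_
  rw [End.mul_apply, End.mul_apply]
  obtain ⟨k, rfl⟩ := exists_pnat_eq (p := p) (by omega)
  obtain ⟨l, rfl⟩ := exists_pnat_eq (p := p') (by omega)
  simp only [J_pos_apply, Derivation.map_smul]
  rw [pderiv_comm]

/-- A polynomial which contains no variable `x_k^μ` with `k > P`. -/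
def IsBelow (μ : Γ.ramT) (P : ℕ) (f : Poly Γ) : Prop := ∀ p : ℤ, P < p → W.J μ p f = 0

lemma exists_isBelow (f : Poly Γ) : ∃ P : ℕ, ∀ μ, W.IsBelow μ P f := by
  classical
  refine ⟨f.vars.sup fun a => (a.2 : ℕ), fun μ p hp => ?_⟩
  obtain ⟨k, rfl⟩ := exists_pnat_eq (p := p) (by omega)
  rw [J_pos_apply, pderiv_eq_zero_of_notMem_vars, smul_zero]
  intro h
  have h2 : (k : ℕ) ≤ _ := le_sup (f := fun a : Idx Γ => (a.2 : ℕ)) h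
  omega

lemma orderedModes_apply_eq_zero {μ : Γ.ramT} {P : ℕ} {f : Poly Γ} (hf : W.IsBelow μ P f) {q : ℕ}
    {p : Fin q → ℤ} {l : Fin q} (hl : P < p l) : orderedModes (W.J μ) p f = 0 := by
  have key : ∀ L : List ℤ, (∀ a ∈ L, 0 < a) → p l ∈ L → (L.map (W.J μ)).prod f = 0 := by
    intro L hL hmem
    induction L with
    | nil => simp at hmem
    | cons a L ih =>
      rw [List.map_cons, List.prod_cons]
      have hL' : ∀ b ∈ L, 0 < b := fun b hb => hL b (List.mem_cons_of_mem a hb)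
      rcases List.mem_cons.1 hmem with h | h
      · have hc : Commute (W.J μ a) (L.map (W.J μ)).prod := by
          refine Commute.list_prod_right _ _ fun B hB => ?_
          obtain ⟨b, hb, rfl⟩ := List.mem_map.1 hB
          exact W.commute_J_pos (hL a List.mem_cons_self) (hL' b hb)
        rw [hc.eq, End.mul_apply, ← h, hf _ hl, map_zero]
      · rw [End.mul_apply, ih hL' h, map_zero]
  rw [orderedModes, End.mul_apply, key, map_zero]
  · intro a ha
    simpa using (List.mem_filter.1 ha).2
  · rw [List.mem_filter]
    exact ⟨List.mem_ofFn.2 ⟨l, rfl⟩, by simp; omega⟩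

lemma lower_bound_of_sum_eq {ι : Type*} [Fintype ι] {P s : ℤ} (hP : 0 ≤ P) {p : ι → ℤ}
    (hs : ∑ l, p l = s) (hp : ∀ l, p l ≤ P) (l : ι) : s - Fintype.card ι * P ≤ p l := by
  classical
  rw [← add_sum_erase _ _ (mem_univ l)] at hs
  have h1 : ∑ l' ∈ univ.erase l, p l' ≤ #(univ.erase l) • P := sum_le_card_nsmul _ _ _ fun l' _ => hp l'
  have h2 : #(univ.erase l) • P ≤ Fintype.card ι * P := by
    rw [nsmul_eq_mul]
    refine mul_le_mul_of_nonneg_right ?_ hP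
    exact_mod_cast card_le_univ _
  linarith

lemma finite_of_sum_eq {ι : Type*} [Fintype ι] (P : ℕ) (s : ℤ) : {p : {p : ι → ℤ // ∑ l, p l = s} | ∀ l, p.1 l ≤ P}.Finite := by
  classical
  refine Set.Finite.of_finite_image (f := Subtype.val) ?_ Subtype.val_injective.injOn
  refine ((Fintype.piFinset fun _ : ι => Finset.Icc (s - Fintype.card ι * P) (P : ℤ)).finite_toSet).subset ?_
  rintro _ ⟨p, hp, rfl⟩
  rw [mem_coe, Fintype.mem_piFinset]
  exact fun l => mem_Icc.2 ⟨lower_bound_of_sum_eq (by positivity) p.2 hp l, hp l⟩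

lemma locFinite_orderedModes (μ : Γ.ramT) (j q : ℕ) (s : ℤ) : LocFinite fun p : {p : Fin q → ℤ // ∑ l, p l = s} =>
      sc (psi (D.r μ) j p.1) • W.normalOrdered μ p.1 := by
  intro f
  obtain ⟨P, hP⟩ := W.exists_isBelow f
  refine (finite_of_sum_eq P s).subset fun p hp => ?_
  intro l
  by_contra hl
  push Not at hl
  refine hp ?_
  change sc _ • W.normalOrdered μ p.1 f = 0
  rw [normalOrdered_eq, W.orderedModes_apply_eq_zero (hP μ) hl, smul_zero]

lemma cycleMode_apply {μ : Γ.ramT} {P : ℕ} {f : Poly Γ} (hf : W.IsBelow μ P f) {i B : ℕ} {k : ℤ} (hPB : P ≤ B) (hB : -(B : ℤ) ≤ D.r μ * k - i * P) :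
    W.cycleMode μ i k f = cycleBox (W.J μ) (hb 2 • 1) B (D.r μ) i k f := by
  classical
  simp only [cycleMode, cycleBox, LinearMap.smul_apply, LinearMap.sum_apply, End.mul_apply, sc_smul, mul_smul]
  congr 1
  refine sum_congr rfl fun j _ => ?_
  rw [smul_pow, one_pow, LinearMap.smul_apply, End.one_apply, hb_pow, mul_comm (j : ℤ) 2]
  congr 2
  have h := locSum_subtype_apply (P := fun p : Fin (i - 2 * j) → ℤ => ∑ l, p l = D.r μ * k) (A := fun p => sc (psi (D.r μ) j p) • W.normalOrdered μ p)
    (W.locFinite_orderedModes μ j (i - 2 * j) (D.r μ * k)) (f := f) (Fintype.piFinset fun _ : Fin (i - 2 * j) => box B) ?_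
  · refine h.trans (sum_congr rfl fun p _ => ?_)
    rw [LinearMap.smul_apply, sc_smul, normalOrdered_eq]
  · intro p hp hpB
    by_cases hl : ∃ l, (P : ℤ) < p l
    · obtain ⟨l, hl⟩ := hl
      rw [LinearMap.smul_apply, normalOrdered_eq, W.orderedModes_apply_eq_zero hf hl, smul_zero]
    · push Not at hl
      refine absurd (Fintype.mem_piFinset.2 fun l => mem_Icc.2 ⟨?_, ?_⟩) hpB
      · have h1 := lower_bound_of_sum_eq (by positivity) hp hl l
        rw [Fintype.card_fin] at h1
        have h2 : ((i - 2 * j : ℕ) : ℤ) * P ≤ i * P := mul_le_mul_of_nonneg_right (mod_cast Nat.sub_le _ _) (by positivity)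
        linarith
      · have := hl l
        omega

lemma cycleMode_apply_eq_zero {μ : Γ.ramT} {P : ℕ} {f : Poly Γ} (hf : W.IsBelow μ P f) {i : ℕ}
    (hi : i ≤ D.r μ) {k : ℤ} (hk : P < k) : W.cycleMode μ i k f = 0 := by
  have hr : (1 : ℤ) ≤ D.r μ := mod_cast D.r_pos μ
  simp only [cycleMode, LinearMap.smul_apply, LinearMap.sum_apply]
  rw [sum_eq_zero, smul_zero]
  intro j _
  rw [locSum_apply_eq_sum (W.locFinite_orderedModes μ j (i - 2 * j) (D.r μ * k)) ∅, sum_empty, smul_zero]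
  intro p _
  by_cases hl : ∃ l, (P : ℤ) < p.1 l
  · obtain ⟨l, hl⟩ := hl
    rw [LinearMap.smul_apply, normalOrdered_eq, W.orderedModes_apply_eq_zero hf hl, smul_zero]
  · exfalso
    push Not at hl
    have h1 := sum_le_card_nsmul univ p.1 (P : ℤ) fun l _ => hl l
    rw [p.2, card_univ, Fintype.card_fin, nsmul_eq_mul] at h1
    have h2 : ((i - 2 * j : ℕ) : ℤ) * P ≤ D.r μ * P := mul_le_mul_of_nonneg_right (mod_cast (Nat.sub_le _ _).trans hi) (by positivity)
    nlinarith

lemma cycleBox_apply_eq_zero {μ : Γ.ramT} {P : ℕ} {f : Poly Γ} (hf : W.IsBelow μ P f) {i B : ℕ} (hi : i ≤ D.r μ) {k : ℤ} (hk : P < k) :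
    cycleBox (W.J μ) (hb 2 • 1) B (D.r μ) i k f = 0 := by
  have hr : (1 : ℤ) ≤ D.r μ := mod_cast D.r_pos μ
  simp only [cycleBox, LinearMap.smul_apply, LinearMap.sum_apply, End.mul_apply]
  rw [sum_eq_zero, smul_zero]
  intro j _
  rw [sum_eq_zero, map_zero, smul_zero]
  intro p hp
  by_cases hl : ∃ l, (P : ℤ) < p l
  · obtain ⟨l, hl⟩ := hl
    rw [W.orderedModes_apply_eq_zero hf hl, smul_zero]
  · exfalso
    push Not at hl
    have h1 := sum_le_card_nsmul univ p (P : ℤ) fun l _ => hl l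
    rw [(mem_filter.1 hp).2, card_univ, Fintype.card_fin, nsmul_eq_mul] at h1
    have h2 : ((i - 2 * j : ℕ) : ℤ) * P ≤ D.r μ * P := mul_le_mul_of_nonneg_right (mod_cast (Nat.sub_le _ _).trans hi) (by positivity)
    nlinarith

lemma commute_J_cycleBox {μ ν : Γ.ramT} (h : ν ≠ μ) (p : ℤ) (B r i : ℕ) (k : ℤ) : Commute (W.J ν p) (cycleBox (W.J μ) (hb 2 • 1) B r i k) := by
  refine Commute.smul_right (Commute.sum_right _ _ _ fun j _ => Commute.smul_right ?_ _) _
  refine Commute.mul_right (((Commute.one_right _).smul_right _).pow_right _) (Commute.sum_right _ _ _ fun p' _ => Commute.smul_right ?_ _)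
  refine Commute.mul_right ?_ ?_ <;> refine Commute.list_prod_right _ _ fun B hB => ?_ <;>
  · obtain ⟨b, _, rfl⟩ := List.mem_map.1 hB
    exact W.commute_J_of_ne h p b

lemma commute_J_cycleMode {μ ν : Γ.ramT} (h : ν ≠ μ) (p : ℤ) (i : ℕ) (k : ℤ) : Commute (W.J ν p) (W.cycleMode μ i k) := by
  refine Commute.smul_right (Commute.sum_right _ _ _ fun j _ => Commute.smul_right ?_ _) _
  refine commute_locSum fun p' => Commute.smul_right ?_ _
  refine Commute.mul_right ?_ ?_ <;> refine Commute.list_prod_right _ _ fun B hB => ?_ <;>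
  · obtain ⟨b, _, rfl⟩ := List.mem_map.1 hB
    exact W.commute_J_of_ne h p b

section Lists

variable {X : Type*} {A A' : X → End HRing (Poly Γ)} {pos : X → Γ.ramT}

lemma isBelow_list_prod (hA : ∀ x ν, ν ≠ pos x → ∀ p, Commute (W.J ν p) (A x)) {L : List X}
    {ν : Γ.ramT} (hν : ∀ x ∈ L, ν ≠ pos x) {P : ℕ} {f : Poly Γ} (hf : W.IsBelow ν P f) : W.IsBelow ν P ((L.map A).prod f) := by
  intro p hp
  have hc : Commute (W.J ν p) (L.map A).prod := by
    refine Commute.list_prod_right _ _ fun B hB => ?_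
    obtain ⟨x, hx, rfl⟩ := List.mem_map.1 hB
    exact hA x ν (hν x hx) p
  rw [← End.mul_apply, hc.eq, End.mul_apply, hf p hp, map_zero]

lemma list_prod_congr (hpos : Injective pos) (hA : ∀ x ν, ν ≠ pos x → ∀ p, Commute (W.J ν p) (A x)) {L : List X} (hL : L.Nodup) {P : ℕ}
    {f : Poly Γ} (hf : ∀ μ, W.IsBelow μ P f) (hAA : ∀ x ∈ L, ∀ g, W.IsBelow (pos x) P g → A x g = A' x g) : (L.map A).prod f = (L.map A').prod f := by
  induction L with
  | nil => rfl
  | cons x L ih =>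
    have hL' := List.nodup_cons.1 hL
    rw [List.map_cons, List.map_cons, List.prod_cons, List.prod_cons, End.mul_apply,
      End.mul_apply, ← ih hL'.2 fun y hy => hAA y (List.mem_cons_of_mem x hy)]
    refine hAA x List.mem_cons_self _ (W.isBelow_list_prod hA ?_ (hf (pos x)))
    intro y hy h
    exact hL'.1 (hpos h ▸ hy)

lemma list_prod_eq_zero (hpos : Injective pos) (hA : ∀ x ν, ν ≠ pos x → ∀ p, Commute (W.J ν p) (A x)) {L : List X} (hL : L.Nodup) {P : ℕ}
    {f : Poly Γ} (hf : ∀ μ, W.IsBelow μ P f) {x₀ : X} (hx₀ : x₀ ∈ L) (hAA : ∀ g, W.IsBelow (pos x₀) P g → A x₀ g = 0) : (L.map A).prod f = 0 := by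
  induction L with
  | nil => simp at hx₀
  | cons x L ih =>
    have hL' := List.nodup_cons.1 hL
    rw [List.map_cons, List.prod_cons, End.mul_apply]
    rcases List.mem_cons.1 hx₀ with rfl | h
    · refine hAA _ (W.isBelow_list_prod hA ?_ (hf (pos x₀)))
      intro y hy h
      exact hL'.1 (hpos h ▸ hy)
    · rw [ih hL'.2 h, map_zero]

end Lists

lemma twistedMode_apply {P : ℕ} {f : Poly Γ} (hf : ∀ μ, W.IsBelow μ P f) (α : Γ.ram) (i : ℕ) (k : ℤ) {B R : ℕ} (hR : ∀ μ, D.r μ ≤ R)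
    (hB : (R + 1) * (k.natAbs + (Fintype.card Γ.ramT + 1) * P) ≤ B) : W.twistedMode α i k f = twistedBox D W.J (hb 2 • 1) B α i k f := by
  classical
  simp only [twistedMode, twistedBox, LinearMap.sum_apply]
  refine sum_congr rfl fun M _ => sum_congr rfl fun im him => ?_
  have him' : ∀ μ, im μ ≤ D.r μ := fun μ => (mem_Icc.1 (Fintype.mem_piFinset.1 (mem_filter.1 him).1 μ)).2
  have hcomm : ∀ (km : {μ // μ ∈ M} → ℤ) (μ : {μ // μ ∈ M}) (ν : Γ.ramT), ν ≠ μ → ∀ p,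
      Commute (W.J ν p) (sc (1 / (D.r μ : ℂ) ^ (im μ - 1)) • W.cycleMode μ (im μ) (km μ)) :=
    fun km μ ν h p => Commute.smul_right (W.commute_J_cycleMode h p _ _) _
  have hzero : ∀ (Q : ℕ) (g : Poly Γ), (∀ μ, W.IsBelow μ Q g) → ∀ km : {μ // μ ∈ M} → ℤ, (∃ μ, (Q : ℤ) < km μ) →
      ((univ : Finset {μ // μ ∈ M}).toList.map fun (μ : {μ // μ ∈ M}) =>
          sc (1 / (D.r μ : ℂ) ^ (im μ - 1)) • W.cycleMode μ (im μ) (km μ)).prod g = 0 := by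
    rintro Q g hg km ⟨μ, hμ⟩
    refine W.list_prod_eq_zero (pos := fun μ : {μ // μ ∈ M} => (μ : Γ.ramT)) Subtype.val_injective
      (hcomm km) (nodup_toList _) hg (x₀ := μ) (by simp) fun h hh => ?_
    rw [LinearMap.smul_apply, W.cycleMode_apply_eq_zero hh (him' μ) hμ, smul_zero]
  have hfin : LocFinite fun km : {km : {μ // μ ∈ M} → ℤ // ∑ μ, km μ = k} => ((univ : Finset {μ // μ ∈ M}).toList.map fun (μ : {μ // μ ∈ M}) =>
          sc (1 / (D.r μ : ℂ) ^ (im μ - 1)) • W.cycleMode μ (im μ) (km.1 μ)).prod := by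
    intro g
    obtain ⟨Q, hQ⟩ := W.exists_isBelow g
    refine (finite_of_sum_eq Q k).subset fun km hkm μ => ?_
    by_contra hμ
    exact hkm (hzero Q g hQ km.1 ⟨μ, not_le.1 hμ⟩)
  have hlow : ∀ km : {μ // μ ∈ M} → ℤ, ∑ μ, km μ = k → (∀ μ, km μ ≤ P) → ∀ μ, -((k.natAbs : ℤ) + Fintype.card Γ.ramT * P) ≤ km μ := by
    intro km h1 h2 μ
    have h3 := lower_bound_of_sum_eq (by positivity) h1 h2 μ
    have h4 : (Fintype.card {μ // μ ∈ M} : ℤ) * P ≤ Fintype.card Γ.ramT * P := mul_le_mul_of_nonneg_right (by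
        exact_mod_cast Fintype.card_le_of_injective _ Subtype.val_injective) (by positivity)
    have h5 : -(k.natAbs : ℤ) ≤ k := by omega
    linarith
  have hB' : ((R : ℤ) + 1) * (k.natAbs + (Fintype.card Γ.ramT + 1) * P) ≤ B := mod_cast hB
  set c : ℤ := (Fintype.card Γ.ramT : ℤ)
  set a : ℤ := (k.natAbs : ℤ)
  have hc : 0 ≤ c := by positivity
  have ha : 0 ≤ a := by positivity
  have hP0 : (0 : ℤ) ≤ P := by positivity
  have hR0 : (0 : ℤ) ≤ R := by positivity
  have hcP : 0 ≤ c * P := by positivity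
  have hB2 : (R : ℤ) * (a + c * P) + R * P + (a + c * P) + P ≤ B := by linarith
  have hR1 : 0 ≤ (R : ℤ) * (a + c * P) := by positivity
  have hR2 : 0 ≤ (R : ℤ) * P := by positivity
  rw [locSum_subtype_apply (P := fun km : {μ // μ ∈ M} → ℤ => ∑ μ, km μ = k)
    (A := fun km => ((univ : Finset {μ // μ ∈ M}).toList.map fun (μ : {μ // μ ∈ M}) =>
          sc (1 / (D.r μ : ℂ) ^ (im μ - 1)) • W.cycleMode μ (im μ) (km μ)).prod) hfin
    (Fintype.piFinset fun _ : {μ // μ ∈ M} => box B)]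
  · refine sum_congr rfl fun km hkm => ?_
    by_cases hbig : ∃ μ, (P : ℤ) < km μ
    · rw [hzero P f hf km hbig]
      symm
      obtain ⟨μ, hμ⟩ := hbig
      refine W.list_prod_eq_zero (pos := fun μ : {μ // μ ∈ M} => (μ : Γ.ramT))
        Subtype.val_injective (fun μ ν h p => (W.commute_J_cycleBox h p _ _ _ _).smul_right _)
        (nodup_toList _) hf (x₀ := μ) (by simp) fun h hh => ?_
      rw [LinearMap.smul_apply, W.cycleBox_apply_eq_zero hh (him' μ) hμ, smul_zero]
    · push Not at hbig
      refine W.list_prod_congr (pos := fun μ : {μ // μ ∈ M} => (μ : Γ.ramT)) Subtype.val_injective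
        (hcomm km) (nodup_toList _) hf fun μ _ g hg => ?_
      rw [LinearMap.smul_apply, LinearMap.smul_apply, sc_smul, W.cycleMode_apply hg (B := B)]
      · exact_mod_cast (by linarith : (P : ℤ) ≤ B)
      · have h1 := hlow km (mem_filter.1 hkm).2 hbig μ
        have h2 : (im μ : ℤ) * P ≤ R * P := mul_le_mul_of_nonneg_right
          (mod_cast (him' μ).trans (hR μ)) hP0
        have h3 : (D.r μ : ℤ) * (a + c * P) ≤ R * (a + c * P) := mul_le_mul_of_nonneg_right
          (mod_cast hR μ) (by positivity)
        have h4 : (D.r μ : ℤ) * (-(a + c * P)) ≤ D.r μ * km μ := mul_le_mul_of_nonneg_left h1 (by positivity)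
        linarith
  · intro km hkm hkmB
    by_cases hbig : ∃ μ, (P : ℤ) < km μ
    · exact hzero P f hf km hbig
    · push Not at hbig
      refine absurd (Fintype.mem_piFinset.2 fun μ => mem_Icc.2 ⟨?_, ?_⟩) hkmB
      · have h1 := hlow km hkm hbig μ
        linarith
      · have := hbig μ
        linarith

end Correlators

end Box

section LocExp

variable {M : Type*} [AddCommGroup M] [Module HRing M]

/-- Every element is annihilated by some power of the endomorphism. -/
def LocNilpotent (A : End HRing M) : Prop := ∀ f, ∃ n : ℕ, (A ^ n) f = 0

lemma pow_apply_eq_zero_of_le {A : End HRing M} {f : M} {n N : ℕ} (h : (A ^ n) f = 0) (hN : n ≤ N) : (A ^ N) f = 0 := by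
  obtain ⟨m, rfl⟩ := Nat.exists_eq_add_of_le hN
  rw [add_comm, pow_add, End.mul_apply, h, map_zero]

lemma locExp_apply {A : End HRing M} (hA : LocNilpotent A) {f : M} {N : ℕ} (h : (A ^ N) f = 0) :
    locExp A f = ∑ n ∈ range N, sc (1 / (n.factorial : ℂ)) • (A ^ n) f := by
  have h1 : ∀ (g : M) (K : ℕ), (A ^ K) g = 0 → ∀ n, n ∉ range K → (sc (1 / (n.factorial : ℂ)) • A ^ n) g = 0 := by
    intro g K hK n hn
    rw [LinearMap.smul_apply, pow_apply_eq_zero_of_le hK (not_lt.1 fun h => hn (mem_range.2 h)), smul_zero]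
  rw [locExp, locSum_apply_eq_sum (A := fun n : ℕ => sc (1 / (n.factorial : ℂ)) • A ^ n) _ (range N) (h1 f N h)]
  · rfl
  · intro g
    obtain ⟨K, hK⟩ := hA g
    refine (range K).finite_toSet.subset fun n hn => ?_
    by_contra h
    exact hn (h1 g K hK n h)

lemma pow_mul_of_commutator {A X Y : End HRing M} (hX : A * X = X * A + Y)
    (hY : Commute A Y) (n : ℕ) : A ^ (n + 1) * X = X * A ^ (n + 1) + ((n : HRing) + 1) • (Y * A ^ n) := by
  induction n with
  | zero => simp [hX]
  | succ n ih =>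
    rw [pow_succ' A (n + 1), mul_assoc, ih, mul_add, mul_smul_comm, ← mul_assoc, hX, ← mul_assoc A Y,
      hY.eq, mul_assoc Y A, ← pow_succ', add_mul, mul_assoc, add_assoc]
    congr 1
    rw [add_smul (((n + 1 : ℕ) : HRing)), add_comm, one_smul]
    push_cast
    rfl

lemma locExp_mul_of_commutator {A X Y : End HRing M} (hA : LocNilpotent A)
    (hX : A * X = X * A + Y) (hY : Commute A Y) : locExp A * X = (X + Y) * locExp A := by
  refine LinearMap.ext fun f => ?_
  obtain ⟨N, hN⟩ := hA f
  have h1 : (A ^ (N + 1)) (X f) = 0 := by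
    rw [← End.mul_apply, pow_mul_of_commutator hX hY, LinearMap.add_apply, End.mul_apply,
      pow_apply_eq_zero_of_le hN (Nat.le_succ N), map_zero, LinearMap.smul_apply, End.mul_apply, hN, map_zero, smul_zero, add_zero]
  have e1 := locExp_apply hA (pow_apply_eq_zero_of_le hN (Nat.le_succ N))
  have e2 := locExp_apply hA hN
  have e3 : (X + Y) (locExp A f) = X (∑ n ∈ range (N + 1), sc (1 / (n.factorial : ℂ)) • (A ^ n) f) +
        Y (∑ n ∈ range N, sc (1 / (n.factorial : ℂ)) • (A ^ n) f) := by
    rw [LinearMap.add_apply, ← e1, ← e2]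
  rw [End.mul_apply, End.mul_apply, e3, locExp_apply hA h1, map_sum, map_sum, sum_range_succ', sum_range_succ' (fun n => X _)]
  have h2 : ∀ n, sc (1 / ((n + 1).factorial : ℂ)) • (A ^ (n + 1)) (X f) = X (sc (1 / ((n + 1).factorial : ℂ)) • (A ^ (n + 1)) f) +
        Y (sc (1 / (n.factorial : ℂ)) • (A ^ n) f) := by
    intro n
    rw [← End.mul_apply, pow_mul_of_commutator hX hY, LinearMap.add_apply, smul_add,
      LinearMap.smul_apply, map_smul, map_smul, smul_smul, End.mul_apply, End.mul_apply]
    congr 2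
    have : ((n : HRing) + 1) = sc ((n : ℂ) + 1) := by
      simp [sc]
    rw [this, sc, sc, sc, ← map_mul]
    congr 1
    rw [Nat.factorial_succ]
    push_cast
    have h1 : (n : ℂ) + 1 ≠ 0 := Nat.cast_add_one_ne_zero n
    have h2 : (n.factorial : ℂ) ≠ 0 := mod_cast n.factorial_ne_zero
    field_simp
  rw [sum_congr rfl fun n _ => h2 n, sum_add_distrib]
  simp only [Nat.factorial_zero, Nat.cast_one, div_one, pow_zero, End.one_apply, sc, map_one, one_smul]
  abel

lemma commute_locExp {A B : End HRing M} (h : Commute B A) : Commute B (locExp A) := commute_locSum fun n => (h.pow_right n).smul_right _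

lemma commute_locExp_neg (A : End HRing M) : Commute (locExp A) (locExp (-A)) := commute_locExp (commute_locExp (Commute.refl A).neg_left).symm

lemma LocNilpotent.neg {A : End HRing M} (hA : LocNilpotent A) : LocNilpotent (-A) :=
  fun f => (hA f).imp fun n hn => by rw [neg_pow, End.mul_apply, hn, map_zero]

lemma commute_locExp_mul_neg {A X Y : End HRing M} (hA : LocNilpotent A)
    (hX : A * X = X * A + Y) (hY : Commute A Y) : Commute X (locExp A * locExp (-A)) := by
  have hX' : -A * X = X * -A + -Y := by rw [neg_mul, hX, mul_neg, neg_add]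
  have e1 := locExp_mul_of_commutator hA hX hY
  have e2 := locExp_mul_of_commutator hA.neg hX' hY.neg_left.neg_right
  have e3 : locExp A * Y = Y * locExp A := (commute_locExp hY.symm).eq.symm
  change _ * _ = _ * _
  rw [mul_assoc (locExp A), e2, ← mul_assoc (locExp A), mul_add, e1, mul_neg, e3]
  simp only [add_mul, neg_mul, mul_assoc]
  abel

variable {σ : Type*} {A : End HRing (MvPolynomial σ HRing)}
  {Y : σ → End HRing (MvPolynomial σ HRing)}

lemma locNilpotent_of_commutator (h0 : ∀ c, A (C c) = 0) (hX : ∀ c, A * mulLeft HRing (X c) = mulLeft HRing (X c) * A + Y c)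
    (hY : ∀ c, Commute A (Y c)) : LocNilpotent A := by
  intro f
  induction f using MvPolynomial.induction_on with
  | C a => exact ⟨1, by rw [pow_one, h0]⟩
  | add p q hp hq =>
    obtain ⟨n, hn⟩ := hp
    obtain ⟨m, hm⟩ := hq
    exact ⟨max n m, by rw [map_add, pow_apply_eq_zero_of_le hn (le_max_left n m), pow_apply_eq_zero_of_le hm (le_max_right n m), add_zero]⟩
  | mul_X p c hp =>
    obtain ⟨N, hN⟩ := hp
    refine ⟨N + 1, ?_⟩
    rw [mul_comm, ← mulLeft_apply (R := HRing), ← End.mul_apply, pow_mul_of_commutator (hX c) (hY c), LinearMap.add_apply, End.mul_apply,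
      pow_apply_eq_zero_of_le hN (Nat.le_succ N), map_zero, LinearMap.smul_apply, End.mul_apply, hN, map_zero, smul_zero, add_zero]

lemma locExp_apply_C (h0 : ∀ c, A (C c) = 0) (hA : LocNilpotent A) (c : HRing) : locExp A (C c) = C c := by
  rw [locExp_apply hA (N := 1) (by rw [pow_one, h0])]
  simp [sc]

lemma locExp_mul_neg (h0 : ∀ c, A (C c) = 0) (hX : ∀ c, A * mulLeft HRing (X c) = mulLeft HRing (X c) * A + Y c)
    (hY : ∀ c, Commute A (Y c)) : locExp A * locExp (-A) = 1 := by
  have hA := locNilpotent_of_commutator h0 hX hY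
  have h1 := fun c => commute_locExp_mul_neg hA (hX c) (hY c)
  refine LinearMap.ext fun f => ?_
  induction f using MvPolynomial.induction_on with
  | C a =>
    rw [End.mul_apply, locExp_apply_C (A := -A) _ hA.neg, locExp_apply_C h0 hA]
    · rfl
    · intro c; rw [LinearMap.neg_apply, h0, neg_zero]
  | add p q hp hq => rw [map_add, hp, hq, map_add]
  | mul_X p c hp =>
    have := LinearMap.congr_fun (h1 c).eq p
    rw [End.mul_apply, hp, End.mul_apply, mulLeft_apply, mulLeft_apply, End.one_apply] at this
    rw [mul_comm, ← this, End.one_apply]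

lemma derivation_sum_apply {R B ι : Type*} [CommRing R] [CommRing B] [Algebra R B]
    (D : ι → Derivation R B B) (s : Finset ι) (f : B) : (∑ i ∈ s, D i) f = ∑ i ∈ s, D i f := by
  have := congrFun (map_sum (Derivation.coeFnAddMonoidHom : Derivation R B B →+ _) D s) f
  rw [Finset.sum_apply] at this
  exact this

lemma mkDerivation_eq_sum {R : Type*} [CommRing R] (v : σ → MvPolynomial σ R) (f : MvPolynomial σ R) (s : Finset σ) (hs : f.vars ⊆ s) :
    mkDerivation R v f = ∑ b ∈ s, v b * pderiv b f := by
  classical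
  have h : mkDerivation R v f = (∑ b ∈ s, v b • pderiv b : Derivation R (MvPolynomial σ R) (MvPolynomial σ R)) f := by
    refine MvPolynomial.derivation_eq_of_forall_mem_vars fun c hc => ?_
    rw [mkDerivation_X, derivation_sum_apply, sum_eq_single c]
    · simp
    · intro b _ hb
      rw [Derivation.smul_apply, pderiv_X_of_ne hb.symm, smul_zero]
    · intro h; exact absurd (hs hc) h
  rw [h, derivation_sum_apply]
  rfl

end LocExp

namespace Correlators

/-- The coefficients `F_{0,2}` are symmetric. -/
abbrev IsSymm : Prop := ∀ a b, W.F02 a b = W.F02 b a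

lemma locFinite_dilaton : LocFinite fun a : Idx Γ => ((hb (-2) * sc (D.F01 a.1 a.2) + hb (-1) * sc (W.F11 a)) * sc (1 / ((a.2 : ℕ) : ℂ))) •
      W.J a.1 a.2 := by
  intro f
  refine f.vars.finite_toSet.subset fun a ha => ?_
  by_contra h
  refine ha ?_
  change (_ : HRing) • W.J a.1 a.2 f = 0
  rw [J_pos_apply, pderiv_eq_zero_of_notMem_vars h, smul_zero, smul_zero]

lemma dilatonExponent_apply (f : Poly Γ) : W.dilatonExponent f = mkDerivation HRing (fun a : Idx Γ => C
      ((sc (D.F01 a.1 a.2) + hb 1 * sc (W.F11 a)) * sc (1 / ((a.2 : ℕ) : ℂ)))) f := by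
  rw [mkDerivation_eq_sum _ f f.vars subset_rfl, dilatonExponent, locSum_apply_eq_sum W.locFinite_dilaton f.vars]
  · refine sum_congr rfl fun a _ => ?_
    rw [LinearMap.smul_apply, J_pos_apply, smul_smul, C_mul']
    congr 1
    have h1 : hb (-2) * hb 2 = 1 := by rw [← hb_add]; exact hb_zero
    have h2 : hb (-1) * hb 2 = hb 1 := by rw [← hb_add]; rfl
    rw [add_mul, add_mul, add_mul, ← h2]
    linear_combination (sc (D.F01 a.1 a.2) * sc (1 / ((a.2 : ℕ) : ℂ))) * h1
  · intro a ha
    rw [LinearMap.smul_apply, J_pos_apply, pderiv_eq_zero_of_notMem_vars ha, smul_zero, smul_zero]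

lemma locFinite_polarisation : LocFinite fun a : Idx Γ × Idx Γ => sc (W.F02 a.1 a.2 / (((a.1.2 : ℕ) : ℂ) * ((a.2.2 : ℕ) : ℂ))) •
      (W.J a.1.1 a.1.2 * W.J a.2.1 a.2.2) := by
  intro f
  refine (f.vars ×ˢ f.vars).finite_toSet.subset fun a ha => ?_
  by_contra h
  refine ha ?_
  change (_ : HRing) • W.J a.1.1 a.1.2 (W.J a.2.1 a.2.2 f) = 0
  rw [mem_coe, mem_product, not_and_or] at h
  rw [J_pos_apply, J_pos_apply]
  rcases h with h | h
  · rw [Derivation.map_smul, pderiv_comm, pderiv_eq_zero_of_notMem_vars h]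
    simp
  · rw [pderiv_eq_zero_of_notMem_vars h]
    simp

lemma polarisationExponent_apply (f : Poly Γ) {s : Finset (Idx Γ)} (hs : f.vars ⊆ s) : W.polarisationExponent f = ∑ a ∈ s, ∑ b ∈ s,
      ((sc (1 / 2) * hb 2) * sc (W.F02 a b / (((a.2 : ℕ) : ℂ) * ((b.2 : ℕ) : ℂ)))) • pderiv a (pderiv b f) := by
  rw [polarisationExponent, LinearMap.smul_apply, locSum_apply_eq_sum W.locFinite_polarisation (s ×ˢ s), sum_product, smul_sum]
  · refine sum_congr rfl fun a _ => ?_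
    rw [smul_sum]
    refine sum_congr rfl fun b _ => ?_
    rw [LinearMap.smul_apply, End.mul_apply, J_pos_apply, J_pos_apply, Derivation.map_smul, smul_smul, smul_smul, smul_smul]
    congr 1
    have h1 : hb (-2) * hb 2 = 1 := by rw [← hb_add]; exact hb_zero
    linear_combination (sc (1 / 2) * hb 2 * sc (W.F02 a b / (((a.2 : ℕ) : ℂ) * ((b.2 : ℕ) : ℂ)))) * h1
  · intro a ha
    rw [mem_product, not_and_or] at ha
    rw [LinearMap.smul_apply, End.mul_apply, J_pos_apply, J_pos_apply]
    rcases ha with h | h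
    · rw [Derivation.map_smul, pderiv_comm, pderiv_eq_zero_of_notMem_vars fun h' => h (hs h')]
      simp
    · rw [pderiv_eq_zero_of_notMem_vars fun h' => h (hs h')]
      simp

/-- The derivation by which multiplication operators are shifted under the change of polarisation. -/
def polarisationShift (c : Idx Γ) : Derivation HRing (Poly Γ) (Poly Γ) := mkDerivation HRing fun b : Idx Γ => C
    (hb 2 * sc (W.F02 c b / (((c.2 : ℕ) : ℂ) * ((b.2 : ℕ) : ℂ))))

lemma polarisationExponent_X_mul (hsym : W.IsSymm) (c : Idx Γ) (f : Poly Γ) : W.polarisationExponent (X c * f) =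
      X c * W.polarisationExponent f + W.polarisationShift c f := by
  classical
  set s := insert c f.vars
  have h1 : (X c * f : Poly Γ).vars ⊆ s := by
    refine (MvPolynomial.vars_mul _ _).trans (union_subset ?_ (subset_insert _ _))
    rw [MvPolynomial.vars_X]
    exact singleton_subset_iff.2 (mem_insert_self _ _)
  have h2 : f.vars ⊆ s := subset_insert _ _
  have hc : c ∈ s := mem_insert_self _ _
  rw [W.polarisationExponent_apply _ h1, W.polarisationExponent_apply _ h2, polarisationShift, mkDerivation_eq_sum _ f s h2]
  set κ : Idx Γ → Idx Γ → HRing := fun a b => (sc (1 / 2) * hb 2) * sc (W.F02 a b / (((a.2 : ℕ) : ℂ) * ((b.2 : ℕ) : ℂ))) with hκ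
  have hκs : ∀ a b, κ a b = κ b a := fun a b => by
    simp only [hκ]
    rw [hsym a b, mul_comm ((a.2 : ℕ) : ℂ)]
  have h3 : ∀ a b, pderiv a (pderiv b (X c * f)) = X c * pderiv a (pderiv b f) +
        (if a = c then pderiv b f else 0) + (if b = c then pderiv a f else 0) := by
    intro a b
    have e : ∀ (d : Idx Γ) (g : Poly Γ), pderiv d (X c * g) = X c * pderiv d g + if d = c then g else 0 := by
      intro d g
      rw [leibniz, smul_eq_mul, smul_eq_mul, pderiv_X, Pi.single_apply]
      by_cases h : c = d
      · simp [h]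
      · rw [if_neg h, if_neg (fun h' => h h'.symm)]; simp
    rw [e, map_add, e]
    congr 1
    split_ifs <;> simp
  simp_rw [h3, smul_add, sum_add_distrib]
  rw [add_assoc]
  congr 1
  · rw [mul_sum]
    refine sum_congr rfl fun a _ => ?_
    rw [mul_sum]
    exact sum_congr rfl fun b _ => (mul_smul_comm _ _ _).symm
  · have e1 : ∑ a ∈ s, ∑ b ∈ s, κ a b • (if a = c then pderiv b f else 0) = ∑ b ∈ s, κ c b • pderiv b f := by
      rw [sum_comm]
      refine sum_congr rfl fun b _ => ?_
      simp_rw [smul_ite, smul_zero]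
      rw [sum_ite_eq' s c, if_pos hc]
    have e2 : ∑ a ∈ s, ∑ b ∈ s, κ a b • (if b = c then pderiv a f else 0) = ∑ b ∈ s, κ c b • pderiv b f := by
      refine sum_congr rfl fun b _ => ?_
      simp_rw [smul_ite, smul_zero]
      rw [sum_ite_eq' s c, if_pos hc, hκs]
    rw [e1, e2, ← sum_add_distrib]
    refine sum_congr rfl fun b _ => ?_
    rw [← add_smul, C_mul']
    congr 1
    have h4 : sc (1 / 2) + sc (1 / 2) = 1 := by
      rw [sc, ← map_add, ← map_one LaurentPolynomial.C]
      norm_num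
    simp only [hκ]
    linear_combination (hb 2 * sc (W.F02 c b / (((c.2 : ℕ) : ℂ) * ((b.2 : ℕ) : ℂ)))) * h4

lemma commute_polarisationShift (c : Idx Γ) : Commute W.polarisationExponent (W.polarisationShift c : Poly Γ →ₗ[HRing] Poly Γ) := by
  classical
  refine Commute.symm (Commute.smul_right (commute_locSum fun a => Commute.smul_right ?_ _) _)
  have h : ∀ a : Idx Γ, Commute (W.polarisationShift c : Poly Γ →ₗ[HRing] Poly Γ) (W.J a.1 a.2) := by
    intro a
    refine LinearMap.ext fun f => ?_
    rw [End.mul_apply, End.mul_apply, J_pos_apply, J_pos_apply, map_smul]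
    refine congrArg (hb 2 • ·) ?_
    change W.polarisationShift c (pderiv a f) = pderiv a (W.polarisationShift c f)
    refine derivation_comm _ _ (fun b => ?_) f
    rw [polarisationShift, mkDerivation_X, derivation_C, pderiv_X, Pi.single_apply]
    split_ifs <;> simp
  exact (h a.1).mul_right (h a.2)

/-- The coefficient by which multiplication operators are shifted under the dilaton shift. -/
def dilatonShift (c : Idx Γ) : HRing := (sc (D.F01 c.1 c.2) + hb 1 * sc (W.F11 c)) * sc (1 / ((c.2 : ℕ) : ℂ))

lemma dilaton_commutator (c : Idx Γ) : W.dilatonExponent * mulLeft HRing (X c) = mulLeft HRing (X c) * W.dilatonExponent + W.dilatonShift c • 1 := by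
  refine LinearMap.ext fun f => ?_
  rw [End.mul_apply, LinearMap.add_apply, End.mul_apply, mulLeft_apply, mulLeft_apply, dilatonExponent_apply, dilatonExponent_apply, leibniz,
    mkDerivation_X, smul_eq_mul, smul_eq_mul, mul_comm f, C_mul']
  rfl

lemma polarisation_commutator (hsym : W.IsSymm) (c : Idx Γ) : W.polarisationExponent * mulLeft HRing (X c) =
      mulLeft HRing (X c) * W.polarisationExponent + (W.polarisationShift c : Poly Γ →ₗ[HRing] Poly Γ) :=
  LinearMap.ext fun f => W.polarisationExponent_X_mul hsym c f

lemma dilatonExponent_C (a : HRing) : W.dilatonExponent (C a) = 0 := by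
  rw [dilatonExponent_apply, derivation_C]

lemma polarisationExponent_C (a : HRing) : W.polarisationExponent (C a) = 0 := by
  rw [W.polarisationExponent_apply (C a) (s := ∅) (by rw [MvPolynomial.vars_C]), sum_empty]

/-- The operator of the change of variables. -/
def change : End HRing (Poly Γ) := locExp W.polarisationExponent * locExp W.dilatonExponent

/-- The inverse of `change`. -/
def changeInv : End HRing (Poly Γ) := locExp (-W.dilatonExponent) * locExp (-W.polarisationExponent)

lemma locExp_neg_mul {σ : Type*} {A : End HRing (MvPolynomial σ HRing)} {Y : σ → End HRing (MvPolynomial σ HRing)} (h0 : ∀ c, A (C c) = 0)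
    (hX : ∀ c, A * mulLeft HRing (X c) = mulLeft HRing (X c) * A + Y c) (hY : ∀ c, Commute A (Y c)) : locExp (-A) * locExp A = 1 := by
  rw [← (commute_locExp_neg A).eq]
  exact locExp_mul_neg h0 hX hY

lemma change_mul_changeInv (hsym : W.IsSymm) : W.change * W.changeInv = 1 := by
  rw [change, changeInv, mul_assoc, ← mul_assoc (locExp W.dilatonExponent), locExp_mul_neg W.dilatonExponent_C W.dilaton_commutator
      (fun c => (Commute.one_right _).smul_right _), one_mul,
    locExp_mul_neg W.polarisationExponent_C (W.polarisation_commutator hsym)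
      W.commute_polarisationShift]

lemma changeInv_mul_change (hsym : W.IsSymm) : W.changeInv * W.change = 1 := by
  rw [change, changeInv, mul_assoc, ← mul_assoc (locExp (-W.polarisationExponent)),
    locExp_neg_mul W.polarisationExponent_C (W.polarisation_commutator hsym)
      W.commute_polarisationShift, one_mul,
    locExp_neg_mul W.dilatonExponent_C W.dilaton_commutator
      (fun c => (Commute.one_right _).smul_right _)]

/-- The Heisenberg generators, conjugated by the change of variables. -/
def Jhat (μ : Γ.ramT) (p : ℤ) : End HRing (Poly Γ) := if h : p < 0 then
    W.J μ p + (sc (D.F01 μ (-p)) + hb 1 * sc (W.F11 (μ, ⟨(-p).toNat, by omega⟩))) • 1 + (mkDerivation HRing fun b : Idx Γ => C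
        (hb 2 * sc (W.F02 (μ, ⟨(-p).toNat, by omega⟩) b / ((b.2 : ℕ) : ℂ)))).toLinearMap
  else W.J μ p

lemma Jhat_nonneg {μ : Γ.ramT} {p : ℤ} (hp : 0 ≤ p) : W.Jhat μ p = W.J μ p := dif_neg (by omega)

lemma Jhat_neg (μ : Γ.ramT) (k : ℕ+) : W.Jhat μ (-(k : ℤ)) = W.J μ (-(k : ℤ)) + (sc (D.F01 μ k) + hb 1 * sc (W.F11 (μ, k))) • 1 +
      (mkDerivation HRing fun b : Idx Γ => C
        (hb 2 * sc (W.F02 (μ, k) b / ((b.2 : ℕ) : ℂ)))).toLinearMap := by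
  have hk : (-(k : ℤ)) < 0 := by have := k.pos; omega
  have e : ∀ h, (⟨(-(-(k : ℤ))).toNat, h⟩ : ℕ+) = k := fun h => PNat.eq (by simp)
  rw [Jhat, dif_pos hk]
  simp only [e]
  rw [neg_neg]

lemma change_mul_J (hsym : W.IsSymm) (μ : Γ.ramT) (p : ℤ) : W.change * W.J μ p = W.Jhat μ p * W.change := by
  rcases int_cases p with ⟨k, rfl⟩ | rfl | ⟨k, rfl⟩
  · rw [W.Jhat_nonneg (by positivity)]
    have hk : (0 : ℤ) < k := mod_cast k.pos
    have hJ : ∀ a : Idx Γ, Commute (W.J μ k) (W.J a.1 a.2) := fun a => W.commute_J_pos hk (mod_cast a.2.pos)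
    have h1 : Commute (W.J μ k) W.dilatonExponent := by
      rw [dilatonExponent]
      exact commute_locSum fun a => (hJ a).smul_right _
    have h2 : Commute (W.J μ k) W.polarisationExponent := by
      rw [polarisationExponent]
      refine Commute.smul_right (commute_locSum fun a => ?_) _
      exact Commute.smul_right ((hJ a.1).mul_right (hJ a.2)) _
    exact ((commute_locExp h2).mul_right (commute_locExp h1)).eq.symm
  · rw [W.Jhat_nonneg le_rfl]
    refine LinearMap.ext fun f => ?_
    rw [End.mul_apply, End.mul_apply, J_zero_apply, J_zero_apply, map_smul]
  · have hJ : W.J μ (-(k : ℤ)) = ((k : ℕ) : HRing) • mulLeft HRing (X (μ, k)) := LinearMap.ext fun f => by rw [J_neg_apply]; rfl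
    have hd := locExp_mul_of_commutator
      (locNilpotent_of_commutator W.dilatonExponent_C W.dilaton_commutator
      (fun c => (Commute.one_right _).smul_right _)) (W.dilaton_commutator (μ, k))
      ((Commute.one_right _).smul_right _)
    have hp := locExp_mul_of_commutator
      (locNilpotent_of_commutator W.polarisationExponent_C (W.polarisation_commutator hsym)
      W.commute_polarisationShift) (W.polarisation_commutator hsym (μ, k))
      (W.commute_polarisationShift _)
    have hk : ((k : ℕ) : HRing) * sc (1 / ((k : ℕ) : ℂ)) = 1 := by
      have h1 : ((k : ℕ) : HRing) = sc ((k : ℕ) : ℂ) := by simp [sc]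
      have h2 : ((k : ℕ) : ℂ) ≠ 0 := mod_cast k.ne_zero
      rw [h1, sc, sc, ← map_mul, mul_one_div_cancel h2, map_one]
    have hder : ((k : ℕ) : HRing) • (W.polarisationShift (μ, k) : Poly Γ →ₗ[HRing] Poly Γ) = (mkDerivation HRing fun b : Idx Γ => C
        (hb 2 * sc (W.F02 (μ, k) b / ((b.2 : ℕ) : ℂ)))).toLinearMap := by
      have : ((k : ℕ) : HRing) • W.polarisationShift (μ, k) = (mkDerivation HRing fun b : Idx Γ => C
        (hb 2 * sc (W.F02 (μ, k) b / ((b.2 : ℕ) : ℂ)))) := by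
        refine derivation_ext fun b => ?_
        rw [Derivation.smul_apply, polarisationShift, mkDerivation_X, mkDerivation_X, smul_eq_C_mul, ← map_mul]
        congr 1
        have : sc (W.F02 (μ, k) b / (((k : ℕ) : ℂ) * ((b.2 : ℕ) : ℂ))) = sc (1 / ((k : ℕ) : ℂ)) * sc (W.F02 (μ, k) b / ((b.2 : ℕ) : ℂ)) := by
          rw [sc, sc, sc, ← map_mul]
          congr 1
          ring
        rw [this]
        linear_combination (hb 2 * sc (W.F02 (μ, k) b / ((b.2 : ℕ) : ℂ))) * hk
      rw [← this]; rfl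
    have hs : ((k : ℕ) : HRing) * W.dilatonShift (μ, k) = sc (D.F01 μ k) + hb 1 * sc (W.F11 (μ, k)) := by
      rw [dilatonShift]
      linear_combination (sc (D.F01 μ k) + hb 1 * sc (W.F11 (μ, k))) * hk
    rw [Jhat_neg, hJ, ← hder, ← hs, change, mul_smul_comm, mul_assoc, hd, ← mul_assoc, mul_add, hp]
    simp only [add_mul, smul_add, mul_smul, mul_smul_comm, smul_mul_assoc, mul_one, one_mul, mul_assoc]
    abel

/-- Conjugation by the change of variables. -/
def conj (hsym : W.IsSymm) : End HRing (Poly Γ) →ₐ[ℂ] End HRing (Poly Γ) where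
  toFun A := W.change * A * W.changeInv
  map_one' := by rw [mul_one, W.change_mul_changeInv hsym]
  map_mul' A B := by
    have h := W.changeInv_mul_change hsym
    calc W.change * (A * B) * W.changeInv = W.change * A * 1 * B * W.changeInv := by
          simp only [mul_assoc, one_mul]
      _ = _ := by rw [← h]; simp only [mul_assoc]
  map_zero' := by rw [mul_zero, zero_mul]
  map_add' A B := by rw [mul_add, add_mul]
  commutes' c := by
    rw [← Algebra.commutes, mul_assoc, W.change_mul_changeInv hsym, mul_one]

lemma conj_J (hsym : W.IsSymm) (μ : Γ.ramT) (p : ℤ) : W.conj hsym (W.J μ p) = W.Jhat μ p := by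
  change W.change * W.J μ p * W.changeInv = _
  rw [W.change_mul_J hsym, mul_assoc, W.change_mul_changeInv hsym, mul_one]

lemma H_apply (hsym : W.IsSymm) (f : Poly Γ) : ∃ P : ℕ, ∀ (α : Γ.ram) (i : ℕ) (k : ℤ) (B R : ℕ), (∀ μ, D.r μ ≤ R) →
    (R + 1) * (k.natAbs + (Fintype.card Γ.ramT + 1) * P) ≤ B → W.H α i k f = twistedBox D W.Jhat (hb 2 • 1) B α i k f := by
  obtain ⟨P, hP⟩ := W.exists_isBelow (W.changeInv f)
  refine ⟨P, fun α i k B R hR hB => ?_⟩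
  have h1 : W.H α i k f = W.change (W.twistedMode α i k (W.changeInv f)) := by
    rw [H, mul_assoc _ (locExp (-_))]; rfl
  rw [h1, W.twistedMode_apply hP α i k hR hB]
  have h2 := map_twistedBox (W.conj hsym) D W.J (hb 2 • 1) B α i k
  have h3 : W.conj hsym (hb 2 • 1) = hb 2 • 1 := by
    change W.change * (hb 2 • 1) * W.changeInv = _
    rw [mul_smul_comm, mul_one, smul_mul_assoc, W.change_mul_changeInv hsym]
  rw [h3, funext fun μ => funext fun a => W.conj_J hsym μ a] at h2
  rw [← h2]; rfl

end Correlators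

/-! ## Exponentials and derivations of power series -/

section PowerSeriesExp

open PowerSeries hiding C smul_eq_C_mul

variable {R : Type*} [CommRing R]

lemma coeff_pow_eq_zero {F : R⟦X⟧} (hF : constantCoeff F = 0) {d n : ℕ} (h : d < n) : coeff d (F ^ n) = 0 := by
  have h1 : (X : R⟦X⟧) ^ n ∣ F ^ n := pow_dvd_pow_of_dvd (X_dvd_iff.2 hF) n
  exact X_pow_dvd_iff.1 h1 d h

lemma coeff_exp_subst [Algebra ℚ R] {F : R⟦X⟧} (hF : constantCoeff F = 0) {d N : ℕ} (h : d < N) :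
    coeff d ((exp ℚ).subst F) = coeff d (∑ n ∈ range N, (1 / (n.factorial : ℚ)) • F ^ n) := by
  rw [coeff_subst' (HasSubst.of_constantCoeff_zero' hF), map_sum]
  rw [finsum_eq_sum_of_support_subset (s := range N)]
  · refine sum_congr rfl fun n _ => ?_
    rw [coeff_exp, coeff_smul]
    rfl
  · intro n hn
    by_contra h2
    refine hn ?_
    change _ • coeff d (F ^ n) = 0
    rw [coeff_pow_eq_zero hF (by simp at h2; omega), smul_zero]

lemma constantCoeff_exp_subst [Algebra ℚ R] {F : R⟦X⟧} (hF : constantCoeff F = 0) : constantCoeff ((exp ℚ).subst F : R⟦X⟧) = 1 := by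
  rw [← coeff_zero_eq_constantCoeff_apply, coeff_exp_subst hF (N := 1) zero_lt_one]
  simp

lemma isUnit_exp_subst [Algebra ℚ R] {F : R⟦X⟧} (hF : constantCoeff F = 0) : IsUnit ((exp ℚ).subst F : R⟦X⟧) := by
  rw [isUnit_iff_constantCoeff, constantCoeff_exp_subst hF]
  exact isUnit_one

lemma derivation_exp_subst [Algebra ℚ R] {k : Type*} [CommRing k] [Algebra k R]
    (δ : Derivation k R⟦X⟧ R⟦X⟧) (hδ : ∀ d f, PowerSeries.X ^ d ∣ f → PowerSeries.X ^ d ∣ δ f) {F : R⟦X⟧}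
    (hF : constantCoeff F = 0) : δ ((exp ℚ).subst F) = δ F * (exp ℚ).subst F := by
  ext d
  have h1 : ∀ N, PowerSeries.X ^ N ∣ ((exp ℚ).subst F - ∑ n ∈ range N, (1 / (n.factorial : ℚ)) • F ^ n : R⟦X⟧) := by
    intro N
    rw [X_pow_dvd_iff]
    intro m hm
    rw [map_sub, coeff_exp_subst hF hm, sub_self]
  have h2 : coeff d (δ ((exp ℚ).subst F)) = coeff d (δ (∑ n ∈ range (d + 2), (1 / (n.factorial : ℚ)) • F ^ n)) := by
    have := X_pow_dvd_iff.1 (hδ _ _ (h1 (d + 2))) d (by omega)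
    rw [map_sub, map_sub, sub_eq_zero] at this
    exact this
  have h3 : coeff d (δ F * (exp ℚ).subst F) = coeff d (δ F * ∑ n ∈ range (d + 1), (1 / (n.factorial : ℚ)) • F ^ n) := by
    have := X_pow_dvd_iff.1 ((h1 (d + 1)).mul_left (δ F)) d (by omega)
    rw [mul_sub, map_sub, sub_eq_zero] at this
    exact this
  rw [h2, h3, map_sum, sum_range_succ', mul_sum]
  congr 1
  have hQ : ∀ (q : ℚ) (f : R⟦X⟧), δ (q • f) = q • δ f := fun q f => map_rat_smul δ.toLinearMap.toAddMonoidHom q f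
  simp only [hQ, Derivation.leibniz_pow]
  rw [pow_zero]
  simp only [zero_smul, smul_zero, add_zero]
  refine sum_congr rfl fun n _ => ?_
  rw [Nat.add_sub_cancel, Nat.factorial_succ, smul_eq_mul, mul_smul_comm, mul_comm (δ F)]
  rw [← Nat.cast_smul_eq_nsmul ℚ, smul_smul]
  congr 1
  push_cast
  have h1 : (n : ℚ) + 1 ≠ 0 := Nat.cast_add_one_ne_zero n
  have h2 : (n.factorial : ℚ) ≠ 0 := mod_cast n.factorial_ne_zero
  field_simp

/-- A derivation acting on the coefficients of power series. -/
def coeffDer {k : Type*} [CommRing k] [Algebra k R] (v : Derivation k R R) : Derivation k R⟦X⟧ R⟦X⟧ := Derivation.mk'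
    { toFun := fun f => PowerSeries.mk fun n => v (coeff n f)
      map_add' := fun f g => by ext n; simp
      map_smul' := fun c f => by
        ext n
        rw [coeff_mk, RingHom.id_apply, coeff_smul, coeff_smul, coeff_mk, Derivation.map_smul] }
    fun f g => by
      ext n
      change coeff n (PowerSeries.mk fun n => v (coeff n (f * g))) = coeff n
        (f • (PowerSeries.mk fun n => v (coeff n g)) + g • PowerSeries.mk fun n => v (coeff n f))
      rw [coeff_mk, map_add, smul_eq_mul, smul_eq_mul, coeff_mul, map_sum, mul_comm g, coeff_mul, coeff_mul, ← sum_add_distrib]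
      refine sum_congr rfl fun p _ => ?_
      rw [leibniz, smul_eq_mul, smul_eq_mul, coeff_mk, coeff_mk]
      ring

variable {k : Type*} [CommRing k] [Algebra k R]

@[simp] lemma coeff_coeffDer (v : Derivation k R R) (n : ℕ) (f : R⟦X⟧) : coeff n (coeffDer v f) = v (coeff n f) := coeff_mk n fun n => v (coeff n f)

@[simp] lemma coeffDer_C (v : Derivation k R R) (a : R) : coeffDer v (PowerSeries.C a) = PowerSeries.C (v a) := by
  ext n
  rw [coeff_coeffDer, coeff_C, coeff_C]
  split_ifs <;> simp

@[simp] lemma coeffDer_X (v : Derivation k R R) : coeffDer v (X : R⟦X⟧) = 0 := by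
  ext n
  rw [coeff_coeffDer, coeff_X]
  split_ifs <;> simp

lemma coeffDer_dvd (v : Derivation k R R) {d : ℕ} {f : R⟦X⟧} (h : PowerSeries.X ^ d ∣ f) : PowerSeries.X ^ d ∣ coeffDer v f := by
  rw [X_pow_dvd_iff] at h ⊢
  intro m hm
  rw [coeff_coeffDer, h m hm, map_zero]

lemma coeffDer_X_mul (v : Derivation k R R) (f : R⟦X⟧) : coeffDer v (PowerSeries.X * f) = PowerSeries.X * coeffDer v f := by
  rw [leibniz, coeffDer_X, smul_zero, add_zero, smul_eq_mul]

lemma coeffDer_comm {v w : Derivation k R R} (h : ∀ a, v (w a) = w (v a)) (f : R⟦X⟧) : coeffDer v (coeffDer w f) = coeffDer w (coeffDer v f) := by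
  ext n
  simp only [coeff_coeffDer, h]

end PowerSeriesExp

/-! ## Grading -/

section Grading

open PowerSeries hiding C smul_eq_C_mul

/-- Polynomials in the variables `x_k^μ` with complex coefficients. -/
abbrev CPoly (Γ : SpectralCurve S Y) := MvPolynomial (Idx Γ) ℂ

/-- The homogenisation `x_k^μ ↦ ħ^{-1/2} x_k^μ`, with image in the polynomials of degree `0`. -/
def homog : CPoly Γ →ₐ[ℂ] Poly Γ := MvPolynomial.aeval fun a => C (hb (-1)) * X a

lemma coeff_homog (f : CPoly Γ) (m : Idx Γ →₀ ℕ) : (homog f).coeff m = hb (-(m.degree : ℤ)) * sc (f.coeff m) := by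
  classical
  induction f using MvPolynomial.induction_on' with
  | monomial u a =>
    have h : homog (MvPolynomial.monomial u a : CPoly Γ) = MvPolynomial.monomial u (sc a * hb (-(u.degree : ℤ))) := by
      rw [homog, MvPolynomial.aeval_monomial, MvPolynomial.monomial_eq, Finsupp.prod, Finsupp.prod]
      simp_rw [mul_pow]
      rw [prod_mul_distrib, ← mul_assoc]
      congr 1
      rw [map_mul]
      congr 1
      rw [prod_pow_eq_pow_sum, ← map_pow, hb_pow]
      congr 2
      rw [Finsupp.degree_apply]
      simp
    rw [h, MvPolynomial.coeff_monomial, MvPolynomial.coeff_monomial]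
    split_ifs with h1
    · rw [h1, mul_comm]
    · simp [sc]
  | add p q hp hq =>
    rw [map_add, coeff_add, coeff_add, hp, hq, sc, sc, sc, map_add, mul_add]

lemma hb_mul_hb_neg (n : ℤ) : hb n * hb (-n) = 1 := by rw [← hb_add, add_neg_cancel, hb_zero]

lemma sc_injective : Injective sc := by
  intro a b h
  have h1 : ∀ c : ℂ, (sc c).coeff 0 = c := fun c => by
    rw [sc, ← LaurentPolynomial.single_eq_C, AddMonoidAlgebra.coeff_single, Finsupp.single_eq_same]
  rw [← h1 a, h, h1]

lemma hb_smul_homog_eq_zero {d : ℤ} {f : CPoly Γ} (h : hb d • homog f = 0) : f = 0 := by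
  ext m
  have h1 := congrArg (MvPolynomial.coeff m) h
  rw [MvPolynomial.coeff_smul, coeff_homog, coeff_zero, smul_eq_mul] at h1
  have h2 : sc (f.coeff m) = 0 := by
    calc sc (f.coeff m) = (hb (m.degree) * hb (-(m.degree : ℤ))) * (hb d * hb (-d)) * sc (f.coeff m) := by
          rw [hb_mul_hb_neg, hb_mul_hb_neg, one_mul, one_mul]
      _ = hb (m.degree) * hb (-d) * (hb d * (hb (-(m.degree : ℤ)) * sc (f.coeff m))) := by ring
      _ = 0 := by rw [h1, mul_zero]
  rw [coeff_zero]
  exact sc_injective (h2.trans (map_zero LaurentPolynomial.C).symm)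

lemma coeff_degPart (d : ℤ) (f : Poly Γ) (m : Idx Γ →₀ ℕ) : (degPart d f).coeff m = sc ((f.coeff m).coeff (d - m.degree)) * hb (d - m.degree) := by
  classical
  rw [degPart, coeff_sum]
  simp_rw [MvPolynomial.coeff_monomial]
  rw [sum_ite_eq']
  split_ifs with h
  · rfl
  · rw [MvPolynomial.notMem_support_iff.1 h]
    simp [sc]

lemma degPart_add (d : ℤ) (f g : Poly Γ) : degPart d (f + g) = degPart d f + degPart d g := by
  ext1 m
  simp only [coeff_degPart, coeff_add, sc, AddMonoidAlgebra.coeff_add, Finsupp.add_apply, map_add, add_mul]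

lemma degPart_homog (d e : ℤ) (f : CPoly Γ) : degPart d (hb e • homog f) = if d = e then hb e • homog f else 0 := by
  ext1 m
  have h1 : hb e * (hb (-(m.degree : ℤ)) * sc (f.coeff m)) = AddMonoidAlgebra.single (e - m.degree) (f.coeff m) := by
    rw [LaurentPolynomial.single_eq_C_mul_T, ← mul_assoc, ← hb_add, mul_comm]; rfl
  rw [coeff_degPart, MvPolynomial.coeff_smul, coeff_homog, smul_eq_mul, h1, AddMonoidAlgebra.coeff_single, Finsupp.single_apply]
  by_cases h : d = e
  · rw [if_pos h, if_pos (by rw [h]), MvPolynomial.coeff_smul, coeff_homog, smul_eq_mul, h1, LaurentPolynomial.single_eq_C_mul_T, h]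
    rfl
  · rw [if_neg h, if_neg (by omega)]
    simp [sc]

/-- The polynomial `∑_d ħ^{d/2} p_d(ħ^{-1/2} x)` attached to `∑_d p_d t^d`. -/
def graded : Polynomial (CPoly Γ) →+* Poly Γ := Polynomial.eval₂RingHom (homog : CPoly Γ →ₐ[ℂ] Poly Γ).toRingHom (C (hb 1))

lemma graded_monomial (d : ℕ) (f : CPoly Γ) : graded (Polynomial.monomial d f) = hb d • homog f := by
  rw [graded, Polynomial.coe_eval₂RingHom, Polynomial.eval₂_monomial, ← map_pow, hb_pow, mul_one, mul_comm, C_mul']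
  rfl

lemma degPart_graded (d : ℕ) (p : Polynomial (CPoly Γ)) : degPart d (graded p) = hb d • homog (p.coeff d) := by
  induction p using Polynomial.induction_on' with
  | add p q hp hq => rw [map_add, degPart_add, hp, hq, Polynomial.coeff_add, map_add, smul_add]
  | monomial n a =>
    rw [graded_monomial, degPart_homog, Polynomial.coeff_monomial]
    by_cases h : d = n
    · rw [h, if_pos rfl, if_pos rfl]
    · rw [if_neg (mod_cast h), if_neg (Ne.symm h), map_zero, smul_zero]

lemma pderiv_homog (a : Idx Γ) (f : CPoly Γ) : pderiv a (homog f) = hb (-1) • homog (pderiv a f) := by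
  classical
  induction f using MvPolynomial.induction_on with
  | C c => 
    rw [homog, MvPolynomial.aeval_C, MvPolynomial.algebraMap_apply]
    simp
  | add p q hp hq => simp only [map_add, hp, hq, smul_add]
  | mul_X p b hp =>
    rw [map_mul, leibniz, leibniz, hp, map_add, smul_eq_mul, smul_eq_mul, smul_eq_mul, smul_eq_mul, map_mul, map_mul, smul_add, pderiv_X,
      show homog (X b : CPoly Γ) = C (hb (-1)) * X b from
        aeval_X _ _, MvPolynomial.pderiv_C_mul, pderiv_X, smul_eq_C_mul,
      smul_eq_C_mul, smul_eq_C_mul]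
    by_cases h : a = b
    · subst h
      rw [Pi.single_eq_same, Pi.single_eq_same, map_one]
      ring
    · rw [Pi.single_eq_of_ne (Ne.symm h), Pi.single_eq_of_ne (Ne.symm h), map_zero]
      ring

lemma mkDerivation_homog {v : Idx Γ → CPoly Γ} {v' : Idx Γ → Poly Γ} {c : HRing} (hv : ∀ b, hb (-1) • v' b = c • homog (v b)) (f : CPoly Γ) :
    mkDerivation HRing v' (homog f) = c • homog (mkDerivation ℂ v f) := by
  classical
  set s := f.vars ∪ (homog f).vars
  rw [mkDerivation_eq_sum v f s subset_union_left, mkDerivation_eq_sum v' _ s subset_union_right, map_sum, smul_sum]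
  refine sum_congr rfl fun b _ => ?_
  rw [pderiv_homog, map_mul, mul_smul_comm, ← smul_mul_assoc, hv, smul_mul_assoc]

end Grading

section Dehomogenisation

open PowerSeries hiding C smul_eq_C_mul

/-- Families of coefficients `F_{g,n}`. -/
abbrev Coefficients (Γ : SpectralCurve S Y) := ∀ _ n : ℕ, (Fin n → Idx Γ) →₀ ℂ

/-- Power series in `t` with coefficients in the polynomials in the variables `x_k^μ`. -/
abbrev CSeries (Γ : SpectralCurve S Y) := PowerSeries (CPoly Γ)

/-- The extension of `graded` to power series. -/
def gradedSeries : CSeries Γ →+* Formal Γ := (rescale (C (hb 1))).comp (PowerSeries.map (homog : CPoly Γ →ₐ[ℂ] Poly Γ).toRingHom)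

lemma coeff_gradedSeries (d : ℕ) (f : CSeries Γ) : coeff d (gradedSeries f) = hb d • homog (coeff d f) := by
  rw [gradedSeries, RingHom.comp_apply, coeff_rescale, coeff_map, ← map_pow, hb_pow, mul_one, C_mul']
  rfl

/-- The free energy, as a power series in `t`. -/
def freeSeries (F : Coefficients Γ) : CSeries Γ := PowerSeries.mk fun d => if d = 0 then 0 else
    ∑ hn ∈ Finset.HasAntidiagonal.antidiagonal (d + 2), if hn.2 = 0 then 0 else
      (F hn.1 hn.2).sum fun a c => C (c / (hn.2.factorial : ℂ)) * ∏ i, X (a i)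

lemma constantCoeff_freeSeries (F : Coefficients Γ) : constantCoeff (freeSeries F) = 0 := by
  rw [← coeff_zero_eq_constantCoeff_apply, freeSeries, coeff_mk, if_pos rfl]

lemma freeEnergy_eq (F : Coefficients Γ) : freeEnergy F = gradedSeries (freeSeries F) := by
  ext1 d
  rw [coeff_gradedSeries, freeEnergy, freeSeries, coeff_mk, coeff_mk]
  split_ifs with h0
  · rw [map_zero, smul_zero]
  rw [map_sum, smul_sum]
  refine sum_congr rfl fun hn hhn => ?_
  split_ifs with h1
  · rw [map_zero, smul_zero]
  rw [Finsupp.sum, Finsupp.sum, map_sum, smul_sum]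
  refine sum_congr rfl fun a _ => ?_
  have hX : ∀ b : Idx Γ, homog (X b : CPoly Γ) = hb (-1) • X b := fun b => by
    rw [homog, aeval_X, C_mul']
  rw [map_mul, map_prod]
  simp_rw [hX]
  rw [prod_smul, prod_const, card_univ, Fintype.card_fin, hb_pow, show homog (C _ : CPoly Γ) = C (sc _) from MvPolynomial.aeval_C _ _,
    C_mul', smul_smul, smul_smul]
  congr 1
  have h2 : (hn.1 : ℤ) - 2 = d + hn.2 * (-1) := by
    have := mem_antidiagonal.1 hhn
    omega
  rw [h2, hb_add]
  ring

/-- The exponential of the free energy, as a power series in `t`. -/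
def partSeries (F : Coefficients Γ) : CSeries Γ := (exp ℚ).subst (freeSeries F)

lemma constantCoeff_freeEnergy (F : Coefficients Γ) : constantCoeff (freeEnergy F) = 0 := by
  rw [← coeff_zero_eq_constantCoeff_apply, freeEnergy, coeff_mk, if_pos rfl]

lemma coeff_fexp_freeEnergy (F : Coefficients Γ) (d : ℕ) : coeff d (fexp (freeEnergy F)) = hb d • homog (coeff d (partSeries F)) := by
  rw [fexp, coeff_exp_subst (constantCoeff_freeEnergy F) (Nat.lt_succ_self d), partSeries,
    coeff_exp_subst (constantCoeff_freeSeries F) (Nat.lt_succ_self d), ← coeff_gradedSeries, freeEnergy_eq]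
  congr 1
  rw [map_sum]
  refine sum_congr rfl fun n _ => ?_
  rw [← map_pow]
  exact (map_rat_smul gradedSeries _ _).symm

namespace Correlators

/-- The derivation part of the dehomogenised creation operators. -/
def creator (μ : Γ.ramT) : ℤ → Derivation ℂ (CSeries Γ) (CSeries Γ)
  | .ofNat _ => 0
  | .negSucc k => (X : CSeries Γ) • coeffDer (mkDerivation ℂ fun b : Idx Γ =>
      C (W.F02 (μ, k.succPNat) b / ((b.2 : ℕ) : ℂ)))

/-- The multiplication part of the dehomogenised creation operators. -/
def multiplier (μ : Γ.ramT) : ℤ → CSeries Γ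
  | .ofNat 0 => PowerSeries.X * PowerSeries.C (C (W.Q μ))
  | .ofNat (_ + 1) => 0
  | .negSucc k => PowerSeries.C (C (D.F01 μ k.succPNat)) + PowerSeries.X * PowerSeries.C (C (W.F11 (μ, k.succPNat)) +
        ((k.succPNat : ℕ) : ℂ) • X (μ, k.succPNat))

/-- The dehomogenised annihilation operators. -/
def annihilator (_ : Correlators D) (μ : Γ.ramT) : ℤ → Derivation ℂ (CSeries Γ) (CSeries Γ)
  | .ofNat 0 => 0
  | .ofNat (k + 1) => (X : CSeries Γ) • coeffDer (pderiv (μ, k.succPNat))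
  | .negSucc _ => 0

/-- The dehomogenised Heisenberg generators. -/
def K (μ : Γ.ramT) (p : ℤ) : End ℂ (CSeries Γ) := (W.creator μ p : CSeries Γ →ₗ[ℂ] CSeries Γ) + mulLeft ℂ (W.multiplier μ p) +
    (W.annihilator μ p : CSeries Γ →ₗ[ℂ] CSeries Γ)

lemma exists_succPNat (k : ℕ+) : ∃ n : ℕ, n.succPNat = k := ⟨k.natPred, PNat.succPNat_natPred k⟩

section Values

variable (μ : Γ.ramT) (k : ℕ+)

lemma creator_pos : W.creator μ (k : ℤ) = 0 := rfl
lemma creator_zero : W.creator μ 0 = 0 := rfl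
lemma creator_neg : W.creator μ (-(k : ℤ)) = (X : CSeries Γ) • coeffDer (mkDerivation ℂ fun b : Idx Γ => C (W.F02 (μ, k) b / ((b.2 : ℕ) : ℂ))) := by
  obtain ⟨n, rfl⟩ := exists_succPNat k; rfl
lemma multiplier_pos : W.multiplier μ (k : ℤ) = 0 := by
  obtain ⟨n, rfl⟩ := exists_succPNat k; rfl
lemma multiplier_zero : W.multiplier μ 0 = PowerSeries.X * PowerSeries.C (C (W.Q μ)) := rfl
lemma multiplier_neg : W.multiplier μ (-(k : ℤ)) = PowerSeries.C (C (D.F01 μ k)) +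
      PowerSeries.X * PowerSeries.C (C (W.F11 (μ, k)) + ((k : ℕ) : ℂ) • X (μ, k)) := by
  obtain ⟨n, rfl⟩ := exists_succPNat k; rfl
lemma annihilator_pos : W.annihilator μ (k : ℤ) = (X : CSeries Γ) • coeffDer (pderiv (μ, k)) := by
  obtain ⟨n, rfl⟩ := exists_succPNat k; rfl
lemma annihilator_zero : W.annihilator μ 0 = 0 := rfl
lemma annihilator_neg : W.annihilator μ (-(k : ℤ)) = 0 := by
  obtain ⟨n, rfl⟩ := exists_succPNat k; rfl

lemma K_pos_apply (f : CSeries Γ) : W.K μ (k : ℤ) f = PowerSeries.X * coeffDer (pderiv (μ, k)) f := by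
  rw [K, creator_pos, multiplier_pos, annihilator_pos]
  simp

lemma K_zero_apply (f : CSeries Γ) : W.K μ 0 f = PowerSeries.X * (PowerSeries.C (C (W.Q μ)) * f) := by
  rw [K, creator_zero, multiplier_zero, annihilator_zero]
  simp [mul_assoc]

lemma K_neg_apply (f : CSeries Γ) : W.K μ (-(k : ℤ)) f = PowerSeries.X * coeffDer (mkDerivation ℂ fun b : Idx Γ =>
      C (W.F02 (μ, k) b / ((b.2 : ℕ) : ℂ))) f +
    (PowerSeries.C (C (D.F01 μ k)) + PowerSeries.X * PowerSeries.C (C (W.F11 (μ, k)) + ((k : ℕ) : ℂ) • X (μ, k))) * f := by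
  rw [K, creator_neg, multiplier_neg, annihilator_neg]
  simp only [LinearMap.add_apply, Derivation.coeFn_coe, Derivation.smul_apply, smul_eq_mul,
    mulLeft_apply, Derivation.coe_zero, Pi.zero_apply, add_zero]

end Values

lemma K_X_mul (μ : Γ.ramT) (p : ℤ) (f : CSeries Γ) : W.K μ p (PowerSeries.X * f) = PowerSeries.X * W.K μ p f := by
  rcases int_cases p with ⟨k, rfl⟩ | rfl | ⟨k, rfl⟩
  · rw [K_pos_apply, K_pos_apply, coeffDer_X_mul]
  · rw [K_zero_apply, K_zero_apply]; ring
  · rw [K_neg_apply, K_neg_apply, coeffDer_X_mul]; ring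

lemma X_mul_monomial (d : ℕ) (f : CPoly Γ) : (X : CSeries Γ) * PowerSeries.monomial d f = PowerSeries.monomial (d + 1) f := by
  rw [X_eq, monomial_mul_monomial, one_mul, add_comm]

lemma C_mul_monomial (a : CPoly Γ) (d : ℕ) (f : CPoly Γ) : PowerSeries.C a * PowerSeries.monomial d f = PowerSeries.monomial d (a * f) := by
  rw [← monomial_zero_eq_C_apply, monomial_mul_monomial, zero_add]

lemma coeffDer_monomial (v : Derivation ℂ (CPoly Γ) (CPoly Γ)) (d : ℕ) (f : CPoly Γ) :
    coeffDer v (PowerSeries.monomial d f) = PowerSeries.monomial d (v f) := by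
  ext1 n
  rw [coeff_coeffDer, coeff_monomial, coeff_monomial]
  split_ifs
  · rfl
  · exact map_zero v

lemma Jhat_graded (μ : Γ.ramT) (p : ℤ) (q : Polynomial (CPoly Γ)) :
    ∃ q' : Polynomial (CPoly Γ), W.Jhat μ p (graded q) = graded q' ∧ W.K μ p q = q' := by
  induction q using Polynomial.induction_on' with
  | add q₁ q₂ h₁ h₂ =>
    obtain ⟨q₁', h₁, h₁'⟩ := h₁
    obtain ⟨q₂', h₂, h₂'⟩ := h₂
    exact ⟨q₁' + q₂', by rw [map_add, map_add, map_add, h₁, h₂], by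
      rw [Polynomial.coe_add, Polynomial.coe_add, map_add, h₁', h₂']⟩
  | monomial d f =>
    rw [graded_monomial, Polynomial.coe_monomial]
    have e1 : hb ((d + 1 : ℕ) : ℤ) = hb 1 * hb d := by rw [← hb_add]; congr 1; push_cast; ring
    have e2 : hb 2 * hb (-1) = hb 1 := by rw [← hb_add]; rfl
    have e3 : hb 1 * hb (-1) = 1 := by rw [← hb_add]; exact hb_zero
    have hsc : ∀ (c : ℂ) (g : CPoly Γ), homog (c • g) = sc c • homog g := fun c g => by
      rw [map_smul, sc_smul]
    rcases int_cases p with ⟨k, rfl⟩ | rfl | ⟨k, rfl⟩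
    · refine ⟨Polynomial.monomial (d + 1) (pderiv (μ, k) f), ?_, ?_⟩
      · rw [graded_monomial, Jhat_nonneg _ (by positivity), J_pos_apply, Derivation.map_smul, pderiv_homog, smul_smul, smul_smul, e1, ← e2]
        congr 1; ring
      · rw [K_pos_apply, Polynomial.coe_monomial, coeffDer_monomial, X_mul_monomial]
    · refine ⟨Polynomial.monomial (d + 1) (W.Q μ • f), ?_, ?_⟩
      · rw [graded_monomial, Jhat_nonneg _ le_rfl, J_zero_apply, hsc, smul_smul, smul_smul, e1]
        congr 1; ring
      · rw [K_zero_apply, Polynomial.coe_monomial, C_mul_monomial, X_mul_monomial, smul_eq_C_mul]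
    · set v := mkDerivation ℂ fun b : Idx Γ => (C (W.F02 (μ, k) b / ((b.2 : ℕ) : ℂ)) : CPoly Γ)
      refine ⟨Polynomial.monomial (d + 1) (v f) + (Polynomial.monomial d (D.F01 μ k • f) +
        Polynomial.monomial (d + 1) (W.F11 (μ, k) • f + ((k : ℕ) : ℂ) • (X (μ, k) * f))), ?_, ?_⟩
      · have h := mkDerivation_homog (Γ := Γ) (v := fun b : Idx Γ => C (W.F02 (μ, k) b / ((b.2 : ℕ) : ℂ))) (v' := fun b : Idx Γ => C
          (hb 2 * sc (W.F02 (μ, k) b / ((b.2 : ℕ) : ℂ)))) (c := hb 1) (fun b => by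
            rw [show homog (C _ : CPoly Γ) = C (sc _) from
              MvPolynomial.aeval_C _ _, smul_eq_C_mul, smul_eq_C_mul,
              ← map_mul, ← map_mul, ← e2]
            congr 1; ring) f
        have hX : homog (X (μ, k) : CPoly Γ) = hb (-1) • X (μ, k) := by
          rw [homog, aeval_X, C_mul']
        have hk : ((k : ℕ) : HRing) = sc ((k : ℕ) : ℂ) := by simp [sc]
        rw [map_add, map_add, graded_monomial, graded_monomial, graded_monomial, Jhat_neg,
          LinearMap.add_apply, LinearMap.add_apply, J_neg_apply, LinearMap.smul_apply,
          End.one_apply, Derivation.coeFn_coe, Derivation.map_smul, h, map_add, hsc, hsc, hsc, map_mul, hX, e1, hk, add_smul]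
        simp only [smul_smul, smul_add, smul_mul_assoc, mul_smul_comm]
        rw [show hb 1 * hb d * (sc ((k : ℕ) : ℂ) * hb (-1)) = sc ((k : ℕ) : ℂ) * hb d by
          linear_combination (hb d * sc ((k : ℕ) : ℂ)) * e3,
          mul_comm (hb d) (hb 1), mul_comm (sc (D.F01 μ k)),
          show hb 1 * sc (W.F11 (μ, k)) * hb d = hb 1 * hb d * sc (W.F11 (μ, k)) by ring]
        abel
      · rw [K_neg_apply, Polynomial.coe_add, Polynomial.coe_add, Polynomial.coe_monomial,
          Polynomial.coe_monomial, Polynomial.coe_monomial, coeffDer_monomial, X_mul_monomial, add_mul,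
          mul_assoc, C_mul_monomial, C_mul_monomial, X_mul_monomial, smul_eq_C_mul, add_mul, smul_eq_C_mul, smul_eq_C_mul, smul_eq_C_mul, mul_assoc]

/-- Pairs of operators which correspond to each other under dehomogenisation. -/
def dehomog : Subalgebra ℂ (End HRing (Poly Γ) × End ℂ (CSeries Γ)) where
  carrier := {A | (∀ q : Polynomial (CPoly Γ), ∃ q' : Polynomial (CPoly Γ),
    A.1 (graded q) = graded q' ∧ A.2 q = q') ∧ ∀ f, A.2 (PowerSeries.X * f) = PowerSeries.X * A.2 f}
  mul_mem' := by
    rintro A B ⟨hA, hA'⟩ ⟨hB, hB'⟩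
    refine ⟨fun q => ?_, fun f => ?_⟩
    · obtain ⟨q₁, h₁, h₁'⟩ := hB q
      obtain ⟨q₂, h₂, h₂'⟩ := hA q₁
      exact ⟨q₂, by rw [Prod.fst_mul, End.mul_apply, h₁, h₂], by
        rw [Prod.snd_mul, End.mul_apply, h₁', h₂']⟩
    · rw [Prod.snd_mul, End.mul_apply, End.mul_apply, hB', hA']
  add_mem' := by
    rintro A B ⟨hA, hA'⟩ ⟨hB, hB'⟩
    refine ⟨fun q => ?_, fun f => ?_⟩
    · obtain ⟨q₁, h₁, h₁'⟩ := hA q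
      obtain ⟨q₂, h₂, h₂'⟩ := hB q
      exact ⟨q₁ + q₂, by rw [Prod.fst_add, LinearMap.add_apply, h₁, h₂, map_add], by
        rw [Prod.snd_add, LinearMap.add_apply, h₁', h₂', Polynomial.coe_add]⟩
    · rw [Prod.snd_add, LinearMap.add_apply, LinearMap.add_apply, hB', hA', mul_add]
  algebraMap_mem' := by
    intro c
    refine ⟨fun q => ⟨Polynomial.C (C c) * q, ?_, ?_⟩, fun f => ?_⟩
    · rw [map_mul, ← Polynomial.monomial_zero_left, graded_monomial, show homog (C c : CPoly Γ) = C (sc c) from MvPolynomial.aeval_C _ _]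
      change c • graded q = _
      rw [Nat.cast_zero, hb_zero, one_smul, C_mul', sc_smul]
    · change c • (q : CSeries Γ) = _
      rw [Polynomial.coe_mul, Polynomial.coe_C, ← PowerSeries.smul_eq_C_mul]
      ext1 n
      rw [coeff_smul, coeff_smul, smul_eq_mul, smul_eq_C_mul]
    · change c • _ = PowerSeries.X * c • f
      rw [mul_smul_comm]
      rfl

lemma twistedBox_mem (B : ℕ) (α : Γ.ram) (i : ℕ) (k : ℤ) : (twistedBox D W.Jhat (hb 2 • 1) B α i k,
      twistedBox D W.K (mulLeft ℂ (PowerSeries.X ^ 2)) B α i k) ∈ dehomog (Γ := Γ) := by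
  let O : Γ.ramT → ℤ → dehomog (Γ := Γ) := fun μ p => ⟨(W.Jhat μ p, W.K μ p), W.Jhat_graded μ p, W.K_X_mul μ p⟩
  have hħ : ((hb 2 • 1 : End HRing (Poly Γ)), (mulLeft ℂ (PowerSeries.X ^ 2) : End ℂ (CSeries Γ))) ∈ dehomog (Γ := Γ) := by
    refine ⟨fun q => ⟨Polynomial.X ^ 2 * q, ?_, ?_⟩, fun f => ?_⟩
    · rw [map_mul, Polynomial.X_pow_eq_monomial, graded_monomial, map_one, LinearMap.smul_apply, smul_one_mul]
      rfl
    · rw [mulLeft_apply, Polynomial.coe_mul, Polynomial.coe_pow, Polynomial.coe_X]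
    · rw [mulLeft_apply, mulLeft_apply]; ring
  let ħ : dehomog (Γ := Γ) := ⟨_, hħ⟩
  have h1 := map_twistedBox ((AlgHom.fst ℂ _ _).comp (dehomog (Γ := Γ)).val) D O ħ B α i k
  have h2 := map_twistedBox ((AlgHom.snd ℂ _ _).comp (dehomog (Γ := Γ)).val) D O ħ B α i k
  have h3 : (twistedBox D W.Jhat (hb 2 • 1) B α i k, twistedBox D W.K (mulLeft ℂ (PowerSeries.X ^ 2)) B α i k) =
        ((twistedBox D O ħ B α i k : dehomog (Γ := Γ)) : _ × _) := Prod.ext h1.symm h2.symm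
  rw [h3]
  exact Subtype.property _

lemma coeff_eq_zero_of_X_mul {A : End ℂ (CSeries Γ)} (hA : ∀ f, A (PowerSeries.X * f) = PowerSeries.X * A f) {d : ℕ}
    {f : CSeries Γ} (h : ∀ n ≤ d, coeff n f = 0) : coeff d (A f) = 0 := by
  obtain ⟨g, rfl⟩ := X_pow_dvd_iff.2 (fun m (hm : m < d + 1) => h m (by omega))
  have h1 : ∀ n : ℕ, A (PowerSeries.X ^ n * g) = PowerSeries.X ^ n * A g := by
    intro n
    induction n with
    | zero => simp
    | succ n ih => rw [pow_succ', mul_assoc, hA, ih, mul_assoc]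
  rw [h1, coeff_X_pow_mul', if_neg (by omega)]

lemma coeff_act_H (hsym : W.IsSymm) (F : Coefficients Γ) (α : Γ.ram) (i : ℕ) (k : ℤ) (d : ℕ) : ∃ B₀ : ℕ, ∀ B, B₀ ≤ B →
      coeff d (act (W.H α i k) (fexp (freeEnergy F))) = hb d • homog (coeff d
        (twistedBox D W.K (mulLeft ℂ (PowerSeries.X ^ 2)) B α i k (partSeries F))) := by
  obtain ⟨R, hR⟩ : ∃ R, ∀ μ, D.r μ ≤ R := ⟨∑ μ, D.r μ, fun μ => single_le_sum_of_canonicallyOrdered (mem_univ μ)⟩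
  choose P hP using fun d' : ℕ => W.H_apply hsym (coeff d' (fexp (freeEnergy F)))
  refine ⟨∑ d' ∈ range (d + 1), (R + 1) * (k.natAbs + (Fintype.card Γ.ramT + 1) * P d'), fun B hB => ?_⟩
  obtain ⟨h1, h2⟩ := W.twistedBox_mem B α i k
  simp only at h1 h2
  set A := twistedBox D W.K (mulLeft ℂ (PowerSeries.X ^ 2)) B α i k
  set z := partSeries F
  choose q hq hq' using fun d' : ℕ => h1 (Polynomial.monomial d' (coeff d' z))
  rw [act, coeff_mk]
  have h3 : ∀ d' ∈ range (d + 1), degPart d (W.H α i k (coeff d' (fexp (freeEnergy F)))) =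
      hb d • homog (coeff d (A (PowerSeries.monomial d' (coeff d' z)))) := by
    intro d' hd'
    rw [hP d' α i k B R hR (le_trans (single_le_sum_of_canonicallyOrdered
      (f := fun d' => (R + 1) * (k.natAbs + (Fintype.card Γ.ramT + 1) * P d')) hd') hB), coeff_fexp_freeEnergy,
      ← graded_monomial, hq, degPart_graded, ← Polynomial.coe_monomial, hq', Polynomial.coeff_coe]
  rw [sum_congr rfl h3, ← smul_sum, ← map_sum, ← map_sum, ← map_sum]
  congr 2
  rw [← sub_eq_zero, ← map_sub, ← map_sub]
  refine coeff_eq_zero_of_X_mul h2 fun n hn => ?_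
  rw [map_sub, map_sum, sum_eq_single n]
  · rw [coeff_monomial, if_pos rfl, sub_self]
  · intro m _ hm
    rw [coeff_monomial, if_neg hm.symm]
  · intro h; simp at h; omega

lemma constraint_iff (hsym : W.IsSymm) (F : Coefficients Γ) (α : Γ.ram) (i : ℕ) (k : ℤ) :
    fexp (-freeEnergy F) * act (W.H α i k) (fexp (freeEnergy F)) = 0 ↔ ∀ d, ∃ B₀ : ℕ, ∀ B, B₀ ≤ B →
      coeff d (twistedBox D W.K (mulLeft ℂ (PowerSeries.X ^ 2)) B α i k (partSeries F)) = 0 := by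
  have hu : IsUnit (fexp (-freeEnergy F)) := isUnit_exp_subst (by
    rw [map_neg, constantCoeff_freeEnergy, neg_zero])
  rw [hu.mul_right_eq_zero, PowerSeries.ext_iff]
  refine forall_congr' fun d => ?_
  obtain ⟨B₀, hB₀⟩ := W.coeff_act_H hsym F α i k d
  constructor
  · intro h
    refine ⟨B₀, fun B hB => hb_smul_homog_eq_zero (d := d) ?_⟩
    rw [← hB₀ B hB, h, map_zero]
  · rintro ⟨B₁, hB₁⟩
    rw [hB₀ (max B₀ B₁) (le_max_left _ _), hB₁ _ (le_max_right _ _), map_zero, smul_zero, map_zero]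

lemma constraint_iff' (hsym : W.IsSymm) (F : Coefficients Γ) (α : Γ.ram) (i : ℕ) (k : ℤ) (d : ℕ) : ∃ B₀ : ℕ, ∀ B, B₀ ≤ B →
      coeff d (twistedBox D W.K (mulLeft ℂ (PowerSeries.X ^ 2)) B α i k (partSeries F)) =
      coeff d (twistedBox D W.K (mulLeft ℂ (PowerSeries.X ^ 2)) B₀ α i k (partSeries F)) := by
  obtain ⟨B₀, hB₀⟩ := W.coeff_act_H hsym F α i k d
  refine ⟨B₀, fun B hB => sub_eq_zero.1 (hb_smul_homog_eq_zero (d := d) ?_)⟩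
  rw [map_sub, smul_sub, ← hB₀ B hB, ← hB₀ B₀ le_rfl, sub_self]

end Correlators

end Dehomogenisation

section PartitionLemmas

variable {ι R : Type*} [DecidableEq ι] [CommRing R]

lemma partSum_pow_mul (a : R) (f : Finset ι → R) (Z : Finset ι) : partSum (fun L => a ^ #L * f L) Z = a ^ #Z * partSum f Z := by
  rw [partSum, partSum, mul_sum]
  refine sum_congr rfl fun P _ => ?_
  rw [prod_mul_distrib, prod_pow_eq_pow_sum, P.sum_card_parts]

lemma partSum_eq_zero {f : Finset ι → R} {Z : Finset ι} {a : ι} (ha : a ∈ Z) (hf : ∀ L, a ∈ L → f L = 0) : partSum f Z = 0 := by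
  obtain ⟨Y, haY, rfl⟩ : ∃ Y, a ∉ Y ∧ insert a Y = Z := ⟨Z.erase a, notMem_erase a Z, insert_erase ha⟩
  rw [partSum_insert _ haY]
  exact sum_eq_zero fun V _ => by rw [hf _ (mem_insert_self _ _), zero_mul]

/-- Multiplicativity for weights which vanish on the blocks that meet two separated sets. -/
lemma partSum_union {f : Finset ι → R} {Z Z' : Finset ι} (hZ : Disjoint Z Z') (hf : ∀ L ⊆ Z ∪ Z', ¬ L ⊆ Z → ¬ L ⊆ Z' → f L = 0) :
    partSum f (Z ∪ Z') = partSum f Z * partSum f Z' := by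
  have h1 : partSum f (Z ∪ Z') = partSum (fun L => (if L ⊆ Z then f L else 0) + (if L ⊆ Z then 0 else if L ⊆ Z' then f L else 0)) (Z ∪ Z') := by
    refine partSum_congr fun L hL _ => ?_
    by_cases h : L ⊆ Z
    · simp [h]
    · by_cases h' : L ⊆ Z'
      · simp [h, h']
      · simp [h, h', hf L hL h h']
  rw [h1, partSum_add, sum_eq_single Z]
  · rw [union_sdiff_cancel_left hZ]
    congr 1
    · exact partSum_congr fun L hL _ => if_pos hL
    · refine partSum_congr fun L hL hLn => ?_
      rw [if_pos hL]
      split_ifs with h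
      · obtain ⟨x, hx⟩ := hLn
        exact absurd (hL hx) (disjoint_left.1 hZ (h hx))
      · rfl
  · intro Y hY hYZ
    by_cases h : Y ⊆ Z
    · obtain ⟨x, hxZ, hxY⟩ : ∃ x ∈ Z, x ∉ Y := by
        by_contra h2
        push Not at h2
        exact hYZ (Subset.antisymm h h2)
      rw [partSum_eq_zero (a := x) (Z := (Z ∪ Z') \ Y) (Finset.mem_sdiff.2 ⟨mem_union_left _ hxZ, hxY⟩), mul_zero]
      intro L hxL
      split_ifs with h3 h4
      · rfl
      · exact absurd (h4 hxL) (disjoint_left.1 hZ hxZ)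
      · rfl
    · obtain ⟨x, hxY, hxZ⟩ := not_subset.1 h
      rw [partSum_eq_zero hxY, zero_mul]
      intro L hxL
      rw [if_neg fun h => hxZ (h hxL)]
  · intro h
    exact absurd (mem_powerset.2 subset_union_left) h

end PartitionLemmas

section ListProducts

lemma sum_piFinset_list_prod {X κ Ω : Type*} [Fintype X] [DecidableEq X] [Ring Ω] [Algebra ℂ Ω] (s : X → Finset κ) (f : X → κ → Ω) :
    ∑ k ∈ Fintype.piFinset s, ((univ : Finset X).toList.map fun x => f x (k x)).prod =
      ((univ : Finset X).toList.map fun x => ∑ k ∈ s x, f x k).prod := by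
  have e := List.Nodup.getEquivOfForallMemList (univ : Finset X).toList (nodup_toList _) (by simp)
  set l := (univ : Finset X).toList with hl
  let e := List.Nodup.getEquivOfForallMemList l (nodup_toList _) (by simp [hl])
  let Φ : MultilinearMap ℂ (fun _ : X => Ω) Ω := (MultilinearMap.mkPiAlgebraFin ℂ l.length Ω).domDomCongr e
  have hΦ : ∀ v : X → Ω, Φ v = (l.map v).prod := by
    intro v
    rw [MultilinearMap.domDomCongr_apply, MultilinearMap.mkPiAlgebraFin_apply]
    congr 1
    refine List.ext_getElem (by simp) fun n h1 h2 => ?_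
    simp [e]
  have h := Φ.map_sum_finset f s
  rw [hΦ] at h
  rw [h]
  exact sum_congr rfl fun k _ => (hΦ _).symm

end ListProducts

section Rotation

lemma prod_zpow_eq {ι : Type*} (s : Finset ι) {x : ℂ} (hx : x ≠ 0) (n : ι → ℤ) : ∏ l ∈ s, x ^ n l = x ^ ∑ l ∈ s, n l := by
  classical
  induction s using Finset.induction_on with
  | empty => simp
  | insert a s ha ih => rw [prod_insert ha, sum_insert ha, ih, zpow_add₀ hx]

lemma psi_eq_zero {r : ℕ} (hr : 1 ≤ r) (j : ℕ) {q : ℕ} {a : Fin q → ℤ} (h : ¬ (r : ℤ) ∣ ∑ l, a l) : psi r j a = 0 := by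
  obtain ⟨n, rfl⟩ : ∃ n, r = n + 1 := ⟨r - 1, by omega⟩
  set θ := Complex.exp (2 * Real.pi * I / (n + 1 : ℕ)) with hθ
  have hprim : IsPrimitiveRoot θ (n + 1) := Complex.isPrimitiveRoot_exp _ (Nat.succ_ne_zero n)
  have hθ0 : θ ≠ 0 := Complex.exp_ne_zero _
  have hrot : ∀ m : Fin (n + 1), θ ^ ((finRotate (n + 1) m : Fin (n + 1)) : ℕ) = θ * θ ^ (m : ℕ) := by
    intro m
    rw [finRotate_apply, Fin.val_add_one]
    split_ifs with h1
    · rw [h1, Fin.val_last, pow_zero, ← pow_succ', hprim.pow_eq_one]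
    · rw [pow_succ']
  set c : ((Fin j ⊕ Fin j) ⊕ Fin q ↪ Fin (n + 1)) → ℂ := fun m => (∏ l : Fin j, θ ^ ((m (.inl (.inl l)) : ℕ) + (m (.inl (.inr l)) : ℕ)) /
          (θ ^ (m (.inl (.inr l)) : ℕ) - θ ^ (m (.inl (.inl l)) : ℕ)) ^ 2) *
      ∏ l : Fin q, θ ^ (-((m (.inr l) : ℕ) : ℤ) * a l) with hc
  have hpsi : psi (n + 1) j a = (1 / ((2 * j + q).factorial : ℂ)) * ∑ m, c m := rfl
  let σ : ((Fin j ⊕ Fin j) ⊕ Fin q ↪ Fin (n + 1)) ≃ ((Fin j ⊕ Fin j) ⊕ Fin q ↪ Fin (n + 1)) := Equiv.embeddingCongr (Equiv.refl _) (finRotate (n + 1))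
  have hσ : ∀ m x, σ m x = finRotate (n + 1) (m x) := fun m x => rfl
  have h1 : ∑ m, c m = θ ^ (-∑ l, a l) * ∑ m, c m := by
    conv_lhs => rw [← Equiv.sum_comp σ]
    rw [mul_sum]
    refine sum_congr rfl fun m _ => ?_
    simp only [hc, hσ]
    rw [mul_left_comm]
    congr 1
    · refine prod_congr rfl fun l _ => ?_
      rw [pow_add, hrot, hrot, ← mul_sub, mul_pow, pow_add, show θ * θ ^ (m (.inl (.inl l)) : ℕ) * (θ * θ ^ (m (.inl (.inr l)) : ℕ)) =
          θ ^ 2 * (θ ^ (m (.inl (.inl l)) : ℕ) * θ ^ (m (.inl (.inr l)) : ℕ)) by ring]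
      rw [mul_div_mul_left _ _ (pow_ne_zero 2 hθ0)]
    · rw [← sum_neg_distrib, ← prod_zpow_eq _ hθ0, ← prod_mul_distrib]
      refine prod_congr rfl fun l _ => ?_
      rw [zpow_mul, zpow_neg, zpow_natCast, hrot, mul_inv, mul_zpow, inv_zpow, zpow_neg, zpow_mul θ, zpow_neg, zpow_natCast]
  have h2 : θ ^ (-∑ l, a l) ≠ 1 := fun h3 => h (by
    have := (hprim.zpow_eq_one_iff_dvd _).1 h3
    rwa [dvd_neg] at this)
  have h3 : (θ ^ (-∑ l, a l) - 1) * ∑ m, c m = 0 := by rw [sub_mul, one_mul, ← h1, sub_self]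
  rw [hpsi, (mul_eq_zero.1 h3).resolve_left (sub_ne_zero.2 h2), mul_zero]

end Rotation

/-! ## Expansion of normally ordered products -/

section Expansion

variable {A : Type*} [CommRing A] [Algebra ℂ A] {κ : Type*} [DecidableEq κ]

lemma orderedModes_cons {Ω : Type*} [Semiring Ω] [Algebra ℂ Ω] (O : ℤ → Ω)
    (hO : ∀ a b, 0 < a → 0 < b → Commute (O a) (O b)) {q : ℕ} (a : ℤ) (p : Fin q → ℤ) : orderedModes O (Fin.cons a p : Fin (q + 1) → ℤ) =
      if a ≤ 0 then O a * orderedModes O p else orderedModes O p * O a := by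
  rw [orderedModes, List.ofFn_cons]
  by_cases ha : a ≤ 0
  · rw [if_pos ha, List.filter_cons_of_pos (by simpa using ha), List.filter_cons_of_neg (by simpa using ha), List.map_cons, List.prod_cons, mul_assoc]
    rfl
  · have hc : Commute (O a) (((List.ofFn p).filter fun a => 0 < a).map O).prod := by
      refine Commute.list_prod_right _ _ fun B hB => ?_
      obtain ⟨b, hb, rfl⟩ := List.mem_map.1 hB
      exact hO a b (by omega) (by simpa using (List.mem_filter.1 hb).2)
    rw [if_neg ha, List.filter_cons_of_neg (by simpa using ha),
      List.filter_cons_of_pos (by simpa using ha), List.map_cons, List.prod_cons, hc.eq, ← mul_assoc]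
    rfl

lemma sum_orderedModes (K : OpFamily κ A) (O : ℤ → End ℂ A) (hO : ∀ a b, 0 < a → 0 < b → Commute (O a) (O b)) (b : Finset ℤ) (w : κ → ℤ → ℂ) {q : ℕ}
    (s : Fin q → κ) (hl : ∀ l, K.left (s l) = ∑ p ∈ b with p ≤ 0, w (s l) p • O p) (hr : ∀ l, K.right (s l) = ∑ p ∈ b with ¬ p ≤ 0, w (s l) p • O p) :
    ∑ p ∈ Fintype.piFinset (fun _ : Fin q => b), (∏ l, w (s l) (p l)) • orderedModes O p = K.ordered (List.ofFn s) := by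
  induction q with
  | zero =>
    have h : Fintype.piFinset (fun _ : Fin 0 => b) = {fun l => Fin.elim0 l} := by
      ext p
      rw [mem_singleton, Fintype.mem_piFinset]
      exact ⟨fun _ => funext fun l => Fin.elim0 l, fun _ l => Fin.elim0 l⟩
    rw [h, sum_singleton]
    simp [orderedModes, OpFamily.ordered]
  | succ q ih =>
    have ih := ih (fun l => s l.succ) (fun l => hl l.succ) fun l => hr l.succ
    have h1 : ∑ p ∈ Fintype.piFinset (fun _ : Fin (q + 1) => b), (∏ l, w (s l) (p l)) • orderedModes O p =
        ∑ a ∈ b, ∑ p ∈ Fintype.piFinset (fun _ : Fin q => b),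
          (w (s 0) a * ∏ l : Fin q, w (s l.succ) (p l)) • orderedModes O (Fin.cons a p : Fin (q + 1) → ℤ) := by
      rw [← sum_product']
      symm
      refine sum_bij' (i := fun y _ => (Fin.cons y.1 y.2 : Fin (q + 1) → ℤ)) (j := fun p _ => (p 0, Fin.tail p)) ?_ ?_ ?_ ?_ ?_
      · intro y hy
        rw [mem_product] at hy
        refine Fintype.mem_piFinset.2 fun l => ?_
        refine Fin.cases ?_ (fun l => ?_) l
        · exact hy.1
        · exact Fintype.mem_piFinset.1 hy.2 l
      · intro p hp
        rw [mem_product]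
        exact ⟨Fintype.mem_piFinset.1 hp 0, Fintype.mem_piFinset.2 fun l => Fintype.mem_piFinset.1 hp l.succ⟩
      · intro y _
        rfl
      · intro p _
        exact Fin.cons_self_tail p
      · intro y _
        congr 1
        exact (Fin.prod_univ_succ fun l => w (s l) ((Fin.cons y.1 y.2 : Fin (q + 1) → ℤ) l)).symm
    rw [h1, List.ofFn_succ, OpFamily.ordered, hl 0, hr 0, ← ih, sum_mul, mul_sum, ← sum_filter_add_sum_filter_not b fun p => p ≤ 0]
    congr 1
    · refine sum_congr rfl fun a ha => ?_
      rw [mul_sum]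
      refine sum_congr rfl fun p _ => ?_
      rw [orderedModes_cons O hO, if_pos (mem_filter.1 ha).2, smul_mul_smul_comm]
    · refine sum_congr rfl fun a ha => ?_
      rw [sum_mul]
      refine sum_congr rfl fun p _ => ?_
      rw [orderedModes_cons O hO, if_neg (mem_filter.1 ha).2, smul_mul_smul_comm, mul_comm (w (s 0) a)]

end Expansion

section Sheets

open PowerSeries hiding C smul_eq_C_mul

/-! ### Derivations with constant coefficients -/

/-- The derivation `t ∑ u_a ∂_a`. -/
def constDer : (Idx Γ → ℂ) →ₗ[ℂ] Derivation ℂ (CSeries Γ) (CSeries Γ) where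
  toFun u := (X : CSeries Γ) • coeffDer (mkDerivation ℂ fun b : Idx Γ => C (u b))
  map_add' u v := by
    refine Derivation.ext fun f => ?_
    simp only [Derivation.smul_apply, Derivation.add_apply, smul_eq_mul, ← mul_add]
    congr 1
    ext1 n
    rw [map_add, coeff_coeffDer, coeff_coeffDer, coeff_coeffDer]
    have : (mkDerivation ℂ fun b : Idx Γ => (C ((u + v) b) : CPoly Γ)) = (mkDerivation ℂ fun b => C (u b)) + mkDerivation ℂ fun b => C (v b) := by
      refine derivation_ext fun b => ?_
      simp [mkDerivation_X]
    rw [this]; rfl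
  map_smul' c u := by
    refine Derivation.ext fun f => ?_
    rw [RingHom.id_apply, Derivation.smul_apply, Derivation.smul_apply, Derivation.smul_apply, smul_eq_mul, smul_eq_mul, ← mul_smul_comm]
    congr 1
    ext1 n
    rw [coeff_smul, coeff_coeffDer, coeff_coeffDer]
    have : (mkDerivation ℂ fun b : Idx Γ => (C ((c • u) b) : CPoly Γ)) = c • mkDerivation ℂ fun b => C (u b) := by
      refine derivation_ext fun b => ?_
      rw [Derivation.smul_apply, mkDerivation_X, mkDerivation_X, smul_eq_C_mul, ← map_mul]
      rfl
    rw [this]; rfl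

lemma constDer_apply (u : Idx Γ → ℂ) (f : CSeries Γ) : constDer u f = PowerSeries.X * coeffDer (mkDerivation ℂ fun b : Idx Γ => C (u b)) f := rfl

lemma constDer_C_C (u : Idx Γ → ℂ) (a : ℂ) : constDer u (PowerSeries.C (C a) : CSeries Γ) = 0 := by
  rw [constDer_apply, coeffDer_C, derivation_C, map_zero, mul_zero]

lemma constDer_X (u : Idx Γ → ℂ) : constDer u (X : CSeries Γ) = 0 := by
  rw [constDer_apply, coeffDer_X, mul_zero]

lemma constDer_X_mul (u : Idx Γ → ℂ) (f : CSeries Γ) : constDer u (PowerSeries.X * f) = PowerSeries.X * constDer u f := by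
  rw [leibniz, constDer_X, smul_zero, add_zero, smul_eq_mul]

lemma constDer_var (u : Idx Γ → ℂ) (a : Idx Γ) : constDer u (PowerSeries.C (X a) : CSeries Γ) = PowerSeries.X * PowerSeries.C (C (u a)) := by
  rw [constDer_apply, coeffDer_C, mkDerivation_X]

lemma constDer_comm (u v : Idx Γ → ℂ) : Commute (constDer u : CSeries Γ →ₗ[ℂ] CSeries Γ) (constDer v : CSeries Γ →ₗ[ℂ] CSeries Γ) := by
  refine LinearMap.ext fun f => ?_
  change constDer u (constDer v f) = constDer v (constDer u f)
  rw [constDer_apply v, constDer_apply u f, constDer_X_mul, constDer_X_mul, constDer_apply, constDer_apply, coeffDer_comm]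
  refine fun a => derivation_comm _ _ (fun b => ?_) a
  rw [mkDerivation_X, mkDerivation_X, derivation_C, derivation_C]

lemma constDer_dvd (u : Idx Γ → ℂ) (d : ℕ) (f : CSeries Γ) (h : PowerSeries.X ^ d ∣ f) : PowerSeries.X ^ d ∣ constDer u f := by
  rw [constDer_apply]
  exact (coeffDer_dvd _ h).mul_left _

lemma constDer_partSeries (u : Idx Γ → ℂ) (F : Coefficients Γ) : constDer u (partSeries F) = constDer u (freeSeries F) * partSeries F :=
  derivation_exp_subst _ (constDer_dvd u) (constantCoeff_freeSeries F)

/-! ### The sheets -/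

/-- The sheets of `x̃` at the points of `𝔞̃`. -/
abbrev Sheet (D : LocalCoords Γ) := Σ μ : Γ.ramT, Fin (D.r μ)

instance sheetDecidableEq (D : LocalCoords Γ) : DecidableEq (Sheet D) := Classical.decEq _

/-- The root of unity attached to a sheet. -/
def sheetRoot (D : LocalCoords Γ) (s : Sheet D) : ℂ := Complex.exp (2 * Real.pi * I / D.r s.1) ^ (s.2 : ℕ)

/-- The product of all the `r_μ`. -/
def rProd (D : LocalCoords Γ) : ℕ := ∏ μ, D.r μ

lemma rProd_pos (D : LocalCoords Γ) : 1 ≤ rProd D := Nat.succ_le_of_lt (prod_pos fun μ _ => D.r_pos μ)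

/-- `N / r_μ`, where `N` is the product of all the `r_μ`. -/
def rQuot (D : LocalCoords Γ) (μ : Γ.ramT) : ℕ := rProd D / D.r μ

lemma r_mul_rQuot (D : LocalCoords Γ) (μ : Γ.ramT) : D.r μ * rQuot D μ = rProd D := Nat.mul_div_cancel' (dvd_prod_of_mem _ (mem_univ μ))

/-- The value of the coordinate `ζ_μ` on a sheet, at the point `x₀ = x(α) + q ^ N`. -/
def sheetCoord (D : LocalCoords Γ) (q : ℂ) (s : Sheet D) : ℂ := sheetRoot D s * q ^ rQuot D s.1

lemma sheetRoot_ne_zero (D : LocalCoords Γ) (s : Sheet D) : sheetRoot D s ≠ 0 := pow_ne_zero _ (Complex.exp_ne_zero _)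

lemma sheetCoord_ne_zero (D : LocalCoords Γ) {q : ℂ} (hq : q ≠ 0) (s : Sheet D) : sheetCoord D q s ≠ 0 :=
  mul_ne_zero (sheetRoot_ne_zero D s) (pow_ne_zero _ hq)

/-- The contractions between sheets coming from `ω_{0,2}^{std}`. -/
def sheetPair (D : LocalCoords Γ) (s s' : Sheet D) : ℂ := open Classical in
  if s.1 = s'.1 then sheetRoot D s * sheetRoot D s' / (sheetRoot D s' - sheetRoot D s) ^ 2 / (D.r s.1) ^ 2
  else 0

lemma sheetPair_symm (D : LocalCoords Γ) (s s' : Sheet D) : sheetPair D s s' = sheetPair D s' s := by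
  rw [sheetPair, sheetPair]
  by_cases h : s.1 = s'.1
  · rw [if_pos h, if_pos h.symm, h, mul_comm, ← neg_sq, neg_sub]
  · rw [if_neg h, if_neg (Ne.symm h)]

/-- The sheets above a point. -/
def sheets (D : LocalCoords Γ) (α : Γ.ram) : Finset (Sheet D) := (Γ.above α).sigma fun _ => univ

namespace Correlators

/-- The coefficients of the derivation parts of the creation operators. -/
def creatorVec (μ : Γ.ramT) (p : ℤ) (b : Idx Γ) : ℂ := if h : p < 0 then W.F02 (μ, ⟨(-p).toNat, by omega⟩) b / ((b.2 : ℕ) : ℂ) else 0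

/-- The coefficients of the annihilation operators. -/
def annihVec (_ : Correlators D) (μ : Γ.ramT) (p : ℤ) (b : Idx Γ) : ℂ := open Classical in if b.1 = μ ∧ ((b.2 : ℕ) : ℤ) = p then 1 else 0

lemma creatorVec_neg (μ : Γ.ramT) (k : ℕ+) (b : Idx Γ) : W.creatorVec μ (-(k : ℤ)) b = W.F02 (μ, k) b / ((b.2 : ℕ) : ℂ) := by
  have hk : (-(k : ℤ)) < 0 := by have := k.pos; omega
  have e : ∀ h, (⟨(-(-(k : ℤ))).toNat, h⟩ : ℕ+) = k := fun h => PNat.eq (by simp)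
  rw [creatorVec, dif_pos hk]
  simp only [e]

lemma creator_eq (μ : Γ.ramT) (p : ℤ) : W.creator μ p = constDer (W.creatorVec μ p) := by
  rcases int_cases p with ⟨k, rfl⟩ | rfl | ⟨k, rfl⟩
  · have : W.creatorVec μ (k : ℤ) = 0 := funext fun b => dif_neg (by omega)
    rw [creator_pos, this, map_zero]
  · have : W.creatorVec μ 0 = 0 := funext fun b => dif_neg (by omega)
    rw [creator_zero, this, map_zero]
  · rw [creator_neg, funext (W.creatorVec_neg μ k)]; rfl

lemma annihilator_eq (μ : Γ.ramT) (p : ℤ) : W.annihilator μ p = constDer (W.annihVec μ p) := by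
  classical
  rcases int_cases p with ⟨k, rfl⟩ | rfl | ⟨k, rfl⟩
  · have h : (pderiv (μ, k) : Derivation ℂ (CPoly Γ) (CPoly Γ)) = mkDerivation ℂ fun b => C (W.annihVec μ k b) := by
      refine derivation_ext fun b => ?_
      rw [pderiv_X, mkDerivation_X, annihVec, Pi.single_apply]
      have : (μ, k) = b ↔ b.1 = μ ∧ ((b.2 : ℕ) : ℤ) = (k : ℤ) := by
        rw [Prod.ext_iff, eq_comm, eq_comm (a := k)]
        refine and_congr Iff.rfl ?_
        rw [← PNat.coe_inj]
        norm_cast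
      by_cases h : b = (μ, k)
      · rw [if_pos h, if_pos (this.1 h.symm), map_one]
      · rw [if_neg h, if_neg (fun h' => h (this.2 h').symm), map_zero]
    rw [annihilator_pos, h]; rfl
  · have : W.annihVec μ 0 = 0 := funext fun b => if_neg (by have := b.2.pos; omega)
    rw [annihilator_zero, this, map_zero]
  · have : W.annihVec μ (-(k : ℤ)) = 0 := funext fun b => if_neg (by have := b.2.pos; have := k.pos; omega)
    rw [annihilator_neg, this, map_zero]

lemma constDer_multiplier (u : Idx Γ → ℂ) (μ : Γ.ramT) (k : ℕ+) : constDer u (W.multiplier μ (-(k : ℤ))) =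
      PowerSeries.X ^ 2 * PowerSeries.C (C (((k : ℕ) : ℂ) * u (μ, k))) := by
  rw [multiplier_neg, map_add, constDer_C_C, zero_add, constDer_X_mul, map_add, map_add, constDer_C_C, zero_add,
    smul_eq_C_mul, map_mul, leibniz, constDer_C_C, constDer_var, smul_zero, add_zero, smul_eq_mul, map_mul, map_mul]
  ring

lemma constDer_multiplier_nonneg (u : Idx Γ → ℂ) (μ : Γ.ramT) {p : ℤ} (hp : 0 ≤ p) : constDer u (W.multiplier μ p) = 0 := by
  rcases int_cases p with ⟨k, rfl⟩ | rfl | ⟨k, rfl⟩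
  · rw [multiplier_pos, map_zero]
  · rw [multiplier_zero, constDer_X_mul, constDer_C_C, mul_zero]
  · have := k.pos; omega

/-- The weight of the mode `p` on a sheet. -/
def sheetWeight (D : LocalCoords Γ) (q : ℂ) (s : Sheet D) (p : ℤ) : ℂ := (1 / (D.r s.1 : ℂ)) * sheetCoord D q s ^ (-p)

lemma contraction_symm_aux (hsym : W.IsSymm) (μ ν : Γ.ramT) (p p' : ℤ) :
    constDer (W.creatorVec μ p) (W.multiplier ν p') = constDer (W.creatorVec ν p') (W.multiplier μ p) := by
  have h0 : ∀ (μ : Γ.ramT) (p : ℤ), 0 ≤ p → constDer (W.creatorVec μ p) = 0 := fun μ p hp => by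
    rw [funext fun b => show W.creatorVec μ p b = (0 : Idx Γ → ℂ) b from dif_neg (by omega)]
    exact map_zero _
  by_cases hp : 0 ≤ p
  · rw [h0 μ p hp, W.constDer_multiplier_nonneg _ _ hp]; rfl
  by_cases hp' : 0 ≤ p'
  · rw [h0 ν p' hp', W.constDer_multiplier_nonneg _ _ hp']; rfl
  obtain ⟨k, rfl⟩ := exists_pnat_eq_neg (p := p) (by omega)
  obtain ⟨l, rfl⟩ := exists_pnat_eq_neg (p := p') (by omega)
  rw [constDer_multiplier, constDer_multiplier, creatorVec_neg, creatorVec_neg, hsym (μ, k)]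
  have h1 : ((k : ℕ) : ℂ) ≠ 0 := mod_cast k.ne_zero
  have h2 : ((l : ℕ) : ℂ) ≠ 0 := mod_cast l.ne_zero
  rw [mul_div_cancel₀ _ h1, mul_div_cancel₀ _ h2]

lemma constDer_constDer_multiplier (u v : Idx Γ → ℂ) (μ : Γ.ramT) (p : ℤ) : constDer u (constDer v (W.multiplier μ p)) = 0 := by
  by_cases hp : 0 ≤ p
  · rw [W.constDer_multiplier_nonneg _ _ hp, map_zero]
  obtain ⟨k, rfl⟩ := exists_pnat_eq_neg (p := p) (by omega)
  rw [constDer_multiplier, pow_two, mul_assoc, constDer_X_mul, constDer_X_mul, constDer_C_C, mul_zero, mul_zero]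

/-- The generating functions of the Heisenberg generators, on the sheets above `x(α) + q ^ N`. -/
def sheetFamily (hsym : W.IsSymm) (B : ℕ) (q : ℂ) : OpFamily (Sheet D) (CSeries Γ) where
  der s := constDer (∑ p ∈ box B, sheetWeight D q s p • W.creatorVec s.1 p)
  mult s := ∑ p ∈ box B, sheetWeight D q s p • W.multiplier s.1 p
  annih s := constDer (∑ p ∈ box B, sheetWeight D q s p • W.annihVec s.1 p)
  der_der _ _ := constDer_comm _ _
  annih_annih _ _ := constDer_comm _ _
  der_annih _ _ := constDer_comm _ _
  contraction_symm s s' := by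
    simp only [map_sum, map_smul, derivation_sum_apply, Derivation.smul_apply, smul_sum]
    rw [sum_comm]
    refine sum_congr rfl fun p _ => sum_congr rfl fun p' _ => ?_
    rw [Derivation.map_smul, Derivation.map_smul, W.contraction_symm_aux hsym, smul_comm]
  der_contraction u s s' := by
    have h : ∀ u v : Idx Γ → ℂ, constDer u (constDer v
        (∑ p ∈ box B, sheetWeight D q s' p • W.multiplier s'.1 p)) = 0 := fun u v => by
      simp only [map_sum, Derivation.map_smul, W.constDer_constDer_multiplier, smul_zero, sum_const_zero]
    exact h _ _

variable (hsym : W.IsSymm) (B : ℕ) (q : ℂ)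

lemma commute_K_pos (μ : Γ.ramT) {a b : ℤ} (ha : 0 < a) (hb : 0 < b) : Commute (W.K μ a) (W.K μ b) := by
  have h : ∀ a, 0 < a → W.K μ a = (constDer (W.annihVec μ a) : CSeries Γ →ₗ[ℂ] CSeries Γ) := by
    intro a ha
    obtain ⟨k, rfl⟩ := exists_pnat_eq (p := a) (by omega)
    rw [K, creator_pos, multiplier_pos, annihilator_eq]
    refine LinearMap.ext fun f => ?_
    simp
  rw [h a ha, h b hb]
  exact constDer_comm _ _

lemma sheetFamily_left (s : Sheet D) : (W.sheetFamily hsym B q).left s = ∑ p ∈ box B with p ≤ 0, sheetWeight D q s p • W.K s.1 p := by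
  refine LinearMap.ext fun f => ?_
  simp only [OpFamily.left, sheetFamily, LinearMap.add_apply, Derivation.coeFn_coe,
    mulLeft_apply, map_sum, map_smul, derivation_sum_apply, Derivation.smul_apply, sum_mul, smul_mul_assoc, LinearMap.sum_apply, LinearMap.smul_apply]
  rw [← sum_add_distrib, sum_filter]
  refine sum_congr rfl fun p _ => ?_
  rw [← W.creator_eq]
  split_ifs with h
  · rw [K, LinearMap.add_apply, LinearMap.add_apply, annihilator_eq, funext fun b => show W.annihVec s.1 p b = (0 : Idx Γ → ℂ) b from
        if_neg (by have := b.2.pos; omega)]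
    rw [map_zero, smul_add, smul_add]
    simp
  · obtain ⟨k, rfl⟩ := exists_pnat_eq (p := p) (by omega)
    rw [creator_pos, multiplier_pos]
    simp

lemma sheetFamily_right (s : Sheet D) : (W.sheetFamily hsym B q).right s = ∑ p ∈ box B with ¬ p ≤ 0, sheetWeight D q s p • W.K s.1 p := by
  refine LinearMap.ext fun f => ?_
  simp only [OpFamily.right, sheetFamily, Derivation.coeFn_coe,
    map_sum, map_smul, derivation_sum_apply, Derivation.smul_apply, LinearMap.sum_apply, LinearMap.smul_apply]
  rw [sum_filter]
  refine sum_congr rfl fun p _ => ?_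
  rw [← W.annihilator_eq]
  split_ifs with h
  · rcases int_cases p with ⟨k, rfl⟩ | rfl | ⟨k, rfl⟩
    · have := k.pos; omega
    · rw [annihilator_zero]; simp
    · rw [annihilator_neg]; simp
  · obtain ⟨k, rfl⟩ := exists_pnat_eq (p := p) (by omega)
    rw [K, creator_pos, multiplier_pos]
    simp

end Correlators

end Sheets

section CycleIdentity

open PowerSeries hiding C smul_eq_C_mul

/-- The sheets at a point of `𝔞̃`. -/
def sheetsAt (D : LocalCoords Γ) (μ : Γ.ramT) : Finset (Sheet D) := (univ : Finset (Fin (D.r μ))).map (Embedding.sigmaMk μ)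

lemma mem_sheetsAt {D : LocalCoords Γ} {μ : Γ.ramT} {s : Sheet D} : s ∈ sheetsAt D μ ↔ s.1 = μ := by
  rw [sheetsAt, Finset.mem_map]
  constructor
  · rintro ⟨m, _, rfl⟩; rfl
  · rintro rfl; exact ⟨s.2, mem_univ _, rfl⟩

lemma pairWeight_map {κ ι A : Type*} [DecidableEq κ] [DecidableEq ι] [CommRing A] [Algebra ℂ A]
    (e : κ ↪ ι) {c : ι → ι → ℂ} (hc : ∀ a b, c a b = c b a) (x : A) (L : Finset κ) : pairWeight (fun a b => c a b • x ^ 2) (L.map e) =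
      x ^ #L * algebraMap ℂ A (pairWeight (fun a b => c (e a) (e b)) L) := by
  by_cases h : #L = 2
  · obtain ⟨a, b, hab, rfl⟩ := card_eq_two.1 h
    rw [map_insert, map_singleton, pairWeight_pair (fun a b => by rw [hc]) (by simpa using hab),
      pairWeight_pair (fun a b => hc _ _) hab, h, Algebra.smul_def, mul_comm]
  · rw [pairWeight_of_card_ne _ (by rwa [card_map]), pairWeight_of_card_ne _ h, map_zero, mul_zero]

namespace Correlators

variable (hsym : W.IsSymm)

/-- The pairings between sheets, with the power of `t` which they carry. -/
def pairing (_ : Correlators D) (s s' : Sheet D) : CSeries Γ := sheetPair D s s' • (X : CSeries Γ) ^ 2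

lemma contracted_map (B : ℕ) (q : ℂ) (μ : Γ.ramT) {i : ℕ} {Z : Finset (Fin (D.r μ))} (hZ : #Z = i) :
    (W.sheetFamily hsym B q).contracted W.pairing (Z.map (Embedding.sigmaMk μ)) =
      ∑ Y ∈ Z.powerset, partSum (pairWeight fun m m' => sheetPair D ⟨μ, m⟩ ⟨μ, m'⟩) (Z \ Y) • (mulLeft ℂ ((X : CSeries Γ) ^ (i - #Y)) *
          (W.sheetFamily hsym B q).orderedSet (Y.map (Embedding.sigmaMk μ))) := by
  rw [OpFamily.contracted]
  symm
  refine sum_bij (fun Y _ => Y.map (Embedding.sigmaMk μ)) ?_ ?_ ?_ ?_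
  · intro Y hY
    rw [mem_powerset] at hY ⊢
    exact map_subset_map.2 hY
  · intro Y _ Y' _ h
    exact map_injective _ h
  · intro Y hY
    rw [mem_powerset, subset_map_iff] at hY
    obtain ⟨u, hu, rfl⟩ := hY
    exact ⟨u, mem_powerset.2 hu, rfl⟩
  · intro Y hY
    rw [← Finset.map_sdiff, partSum_map]
    have h1 : (fun L : Finset (Fin (D.r μ)) => pairWeight W.pairing (L.map (Embedding.sigmaMk μ))) =
        fun L => (X : CSeries Γ) ^ #L * algebraMap ℂ (CSeries Γ) (pairWeight (fun m m' => sheetPair D ⟨μ, m⟩ ⟨μ, m'⟩) L) :=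
      funext fun L => pairWeight_map (Embedding.sigmaMk μ) (sheetPair_symm D) PowerSeries.X L
    rw [h1, partSum_pow_mul, ← map_partSum, card_sdiff_of_subset (mem_powerset.1 hY), hZ]
    refine LinearMap.ext fun f => ?_
    rw [LinearMap.smul_apply, End.mul_apply, End.mul_apply, mulLeft_apply, mulLeft_apply, Algebra.smul_def]
    ring

lemma pow_rQuot_sum {q : ℂ} (hq : q ≠ 0) (μ : Γ.ramT) {j n : ℕ} (m : ((Fin j ⊕ Fin j) ⊕ Fin n) ↪ Fin (D.r μ))
    (p : Fin n → ℤ) : (∏ l, Complex.exp (2 * Real.pi * I / D.r μ) ^ (-((m (.inr l) : ℕ) : ℤ) * p l)) * (q ^ rQuot D μ) ^ (-∑ l, p l) =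
      (D.r μ : ℂ) ^ n * ∏ l, sheetWeight D q ⟨μ, m (.inr l)⟩ (p l) := by
  have hr : (D.r μ : ℂ) ≠ 0 := mod_cast Nat.ne_of_gt (D.r_pos μ)
  have hq' : q ^ rQuot D μ ≠ 0 := pow_ne_zero _ hq
  simp only [sheetWeight]
  rw [prod_mul_distrib, prod_const, card_univ, Fintype.card_fin, ← mul_assoc, ← mul_pow,
    mul_one_div_cancel hr, one_pow, one_mul, ← sum_neg_distrib, ← prod_zpow_eq _ hq', ← prod_mul_distrib]
  refine prod_congr rfl fun l _ => ?_
  rw [sheetCoord, mul_zpow, sheetRoot, ← zpow_natCast, ← zpow_mul, neg_mul, mul_neg]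
  congr 1
  rw [← zpow_natCast, ← zpow_mul, mul_neg]

lemma sum_cycleBox (B : ℕ) {q : ℂ} (hq : q ≠ 0) (μ : Γ.ramT) {i : ℕ} (hi : 1 ≤ i) (hir : i ≤ D.r μ) :
    ∑ k ∈ box B, (q ^ rProd D) ^ (-k) • ((1 / (D.r μ : ℂ) ^ (i - 1)) • cycleBox (W.K μ) (mulLeft ℂ ((X : CSeries Γ) ^ 2)) B (D.r μ) i k) =
      ∑ Z ∈ powersetCard i (sheetsAt D μ), (W.sheetFamily hsym B q).contracted W.pairing Z := by
  have hr : (D.r μ : ℂ) ≠ 0 := mod_cast Nat.ne_of_gt (D.r_pos μ)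
  set r := D.r μ with hrdef
  set θ := Complex.exp (2 * Real.pi * I / r) with hθ
  rw [sheetsAt, powersetCard_map, sum_map]
  have hR : ∑ Z ∈ powersetCard i (univ : Finset (Fin r)), (W.sheetFamily hsym B q).contracted W.pairing
        ((mapEmbedding (Embedding.sigmaMk (β := fun μ : Γ.ramT => Fin (D.r μ)) μ)).toEmbedding Z) =
      ∑ Z ∈ powersetCard i univ, ∑ Y ∈ Z.powerset, partSum (pairWeight fun m m' => sheetPair D ⟨μ, m⟩ ⟨μ, m'⟩) (Z \ Y) •
        (mulLeft ℂ ((X : CSeries Γ) ^ (i - #Y)) * (W.sheetFamily hsym B q).orderedSet (Y.map (Embedding.sigmaMk μ))) :=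
    sum_congr rfl fun Z hZ => W.contracted_map hsym B q μ (mem_powersetCard.1 hZ).2
  rw [hR]
  refine Eq.trans ?_ (sum_embedding_pairs_singles
    (c := fun m m' : Fin r => sheetPair D ⟨μ, m⟩ ⟨μ, m'⟩) (fun a b => sheetPair_symm D _ _)
    (fun Y => mulLeft ℂ ((X : CSeries Γ) ^ (i - #Y)) * (W.sheetFamily hsym B q).orderedSet (Y.map (Embedding.sigmaMk μ))) i)
  simp only [cycleBox, smul_sum]
  rw [sum_comm]
  refine sum_congr rfl fun j hj => ?_
  have hj2 : 2 * j + (i - 2 * j) = i := by rw [mem_range] at hj; omega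
  set n := i - 2 * j with hn
  -- the sum over the modes
  have e1 : ∑ k ∈ box B, ∑ p ∈ (Fintype.piFinset fun _ : Fin n => box B) with ∑ l, p l = r * k,
      ((q ^ rProd D) ^ (-k) * psi r j p) • orderedModes (W.K μ) p = ∑ p ∈ Fintype.piFinset fun _ : Fin n => box B,
        ((q ^ rQuot D μ) ^ (-∑ l, p l) * psi r j p) • orderedModes (W.K μ) p := by
    simp_rw [sum_filter]
    rw [sum_comm]
    refine sum_congr rfl fun p hp => ?_
    by_cases hd : (r : ℤ) ∣ ∑ l, p l
    · obtain ⟨k, hk⟩ := hd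
      have hr0 : (r : ℤ) ≠ 0 := mod_cast Nat.ne_of_gt (D.r_pos μ)
      rw [sum_eq_single k, if_pos hk, hk, ← r_mul_rQuot D μ, mul_comm (D.r μ), pow_mul, ← hrdef]
      · congr 2
        rw [← zpow_natCast (q ^ rQuot D μ) r, ← zpow_mul, mul_neg]
      · intro k' _ hk'
        rw [if_neg]
        intro h
        exact hk' (mul_left_cancel₀ hr0 (h.symm.trans hk))
      · intro hkB
        exfalso
        refine hkB (mem_Icc.2 ?_)
        have hB : ∀ l, p l ∈ box B := fun l => Fintype.mem_piFinset.1 hp l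
        have h1 : ∑ l, p l ≤ n * (B : ℤ) := by
          have := sum_le_card_nsmul univ p (B : ℤ) fun l _ => (mem_Icc.1 (hB l)).2
          rwa [card_univ, Fintype.card_fin, nsmul_eq_mul] at this
        have h2 : n * (-(B : ℤ)) ≤ ∑ l, p l := by
          have := card_nsmul_le_sum univ p (-(B : ℤ)) fun l _ => (mem_Icc.1 (hB l)).1
          rwa [card_univ, Fintype.card_fin, nsmul_eq_mul] at this
        have h3 : (n : ℤ) * B ≤ r * B := mul_le_mul_of_nonneg_right (mod_cast (by omega : n ≤ r)) (by positivity)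
        have hrp : (0 : ℤ) < r := mod_cast D.r_pos μ
        rw [hk] at h1 h2
        constructor
        · refine le_of_mul_le_mul_left (a := (r : ℤ)) ?_ hrp
          linarith
        · refine le_of_mul_le_mul_left (a := (r : ℤ)) ?_ hrp
          linarith
    · rw [psi_eq_zero (D.r_pos μ) j hd, mul_zero, zero_smul]
      exact sum_eq_zero fun k _ => by rw [mul_zero, zero_smul, ite_self]
  have e2 : ∑ p ∈ Fintype.piFinset fun _ : Fin n => box B, ((q ^ rQuot D μ) ^ (-∑ l, p l) * psi r j p) • orderedModes (W.K μ) p =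
      ∑ m : ((Fin j ⊕ Fin j) ⊕ Fin n) ↪ Fin r, ((1 / (i.factorial : ℂ)) * (r : ℂ) ^ n *
        ∏ l, (sheetPair D ⟨μ, m (.inl (.inl l))⟩ ⟨μ, m (.inl (.inr l))⟩ * (r : ℂ) ^ 2)) • (W.sheetFamily hsym B q).orderedSet
          ((univ.map (Embedding.inr.trans m)).map (Embedding.sigmaMk μ)) := by
    have h1 : ∀ p : Fin n → ℤ, (q ^ rQuot D μ) ^ (-∑ l, p l) * psi r j p =
        ∑ m : ((Fin j ⊕ Fin j) ⊕ Fin n) ↪ Fin r, ((1 / (i.factorial : ℂ)) * (r : ℂ) ^ n *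
          ∏ l, (sheetPair D ⟨μ, m (.inl (.inl l))⟩ ⟨μ, m (.inl (.inr l))⟩ * (r : ℂ) ^ 2)) * ∏ l, sheetWeight D q ⟨μ, m (.inr l)⟩ (p l) := by
      intro p
      rw [psi, hj2, mul_sum, mul_sum]
      refine sum_congr rfl fun m _ => ?_
      have h2 := pow_rQuot_sum hq μ m p
      have h3 : ∀ l, sheetPair D ⟨μ, m (.inl (.inl l))⟩ ⟨μ, m (.inl (.inr l))⟩ * (r : ℂ) ^ 2 =
          θ ^ ((m (.inl (.inl l)) : ℕ) + (m (.inl (.inr l)) : ℕ)) /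
          (θ ^ (m (.inl (.inr l)) : ℕ) - θ ^ (m (.inl (.inl l)) : ℕ)) ^ 2 := by
        intro l
        rw [sheetPair, if_pos rfl, div_mul_cancel₀ _ (pow_ne_zero 2 hr), pow_add]
        rfl
      simp_rw [h3]
      rw [show ∀ a b c d : ℂ, a * (b * (c * d)) = b * c * (d * a) from fun a b c d => by ring, h2]
      ring
    simp_rw [h1, sum_smul]
    rw [sum_comm]
    refine sum_congr rfl fun m _ => ?_
    simp_rw [mul_smul]
    rw [← smul_sum, ← smul_sum, ← smul_sum]
    congr 3
    have h4 := sum_orderedModes (W.sheetFamily hsym B q) (W.K μ) (fun a b ha hb => W.commute_K_pos μ ha hb) (box B)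
      (sheetWeight D q) (fun l : Fin n => (⟨μ, m (.inr l)⟩ : Sheet D))
      (fun l => W.sheetFamily_left hsym B q _) (fun l => W.sheetFamily_right hsym B q _)
    rw [h4, OpFamily.orderedSet_eq]
    · congr 1
      ext s
      simp only [List.mem_toFinset, List.mem_ofFn, Finset.mem_map, mem_univ, true_and]
      constructor
      · rintro ⟨l, rfl⟩
        exact ⟨m (.inr l), ⟨l, rfl⟩, rfl⟩
      · rintro ⟨_, ⟨l, rfl⟩, rfl⟩
        exact ⟨l, rfl⟩
    · rw [List.nodup_ofFn]
      intro l l' h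
      have h5 : m (.inr l) = m (.inr l') := by simpa using h
      exact Sum.inr_injective (m.injective h5)
  have e3 : ∀ k : ℤ, (q ^ rProd D) ^ (-k) • (1 / (r : ℂ) ^ (i - 1)) • (1 / (r : ℂ)) •
      ((i.factorial : ℂ) / (2 ^ j * j.factorial * (i - 2 * j).factorial)) • (mulLeft ℂ ((X : CSeries Γ) ^ 2) ^ j *
        ∑ p ∈ (Fintype.piFinset fun _ : Fin n => box B) with ∑ l, p l = (r : ℤ) * k, psi r j p • orderedModes (W.K μ) p) =
      ((1 / (r : ℂ) ^ i) * ((i.factorial : ℂ) / (2 ^ j * j.factorial * (i - 2 * j).factorial))) •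
      (mulLeft ℂ ((X : CSeries Γ) ^ (2 * j)) * ∑ p ∈ (Fintype.piFinset fun _ : Fin n => box B) with ∑ l, p l = (r : ℤ) * k,
          ((q ^ rProd D) ^ (-k) * psi r j p) • orderedModes (W.K μ) p) := by
    intro k
    have h : ∑ p ∈ (Fintype.piFinset fun _ : Fin n => box B) with ∑ l, p l = (r : ℤ) * k,
          ((q ^ rProd D) ^ (-k) * psi r j p) • orderedModes (W.K μ) p = (q ^ rProd D) ^ (-k) •
        ∑ p ∈ (Fintype.piFinset fun _ : Fin n => box B) with ∑ l, p l = (r : ℤ) * k, psi r j p • orderedModes (W.K μ) p := by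
      rw [smul_sum]
      exact sum_congr rfl fun p _ => mul_smul _ _ _
    rw [h, mul_smul_comm, pow_mul, LinearMap.pow_mulLeft]
    simp only [smul_smul]
    congr 1
    obtain ⟨i', rfl⟩ : ∃ i', i = i' + 1 := ⟨i - 1, by omega⟩
    rw [Nat.add_sub_cancel, pow_succ (r : ℂ) i', one_div_mul_eq_div, ← one_div_mul_one_div]
    ring
  rw [sum_congr rfl fun k _ => e3 k, ← smul_sum, ← mul_sum, e1, e2, mul_sum, smul_sum]
  refine sum_congr rfl fun m _ => ?_
  have hcard : #(univ.map (Embedding.inr.trans m)) = n := by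
    rw [card_map, card_univ, Fintype.card_fin]
  rw [hcard, show i - n = 2 * j by omega, mul_smul_comm, smul_smul, smul_smul]
  congr 1
  rw [prod_mul_distrib, prod_const, card_univ, Fintype.card_fin]
  have hf : (i.factorial : ℂ) ≠ 0 := mod_cast i.factorial_ne_zero
  have hri : (r : ℂ) ^ i = (r : ℂ) ^ n * ((r : ℂ) ^ 2) ^ j := by
    rw [← pow_mul, ← pow_add]; congr 1; omega
  have hri0 : (r : ℂ) ^ i ≠ 0 := pow_ne_zero _ hr
  calc _ = (1 / (r : ℂ) ^ i) * ((r : ℂ) ^ n * ((r : ℂ) ^ 2) ^ j) *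
        ((i.factorial : ℂ) * (1 / (i.factorial : ℂ))) * (1 / (2 ^ j * j.factorial * (i - 2 * j).factorial)) *
        ∏ l, sheetPair D ⟨μ, m (.inl (.inl l))⟩ ⟨μ, m (.inl (.inr l))⟩ := by ring
    _ = _ := by rw [← hri, mul_one_div_cancel hf, one_div_mul_cancel hri0, one_mul, one_mul]

end Correlators

end CycleIdentity

section TwistedIdentity

open PowerSeries hiding C smul_eq_C_mul

lemma list_prod_smul {X Ω : Type*} [Ring Ω] [Algebra ℂ Ω] (l : List X) (a : X → ℂ) (f : X → Ω) :
    (l.map fun x => a x • f x).prod = (l.map a).prod • (l.map f).prod := by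
  induction l with
  | nil => simp
  | cons x l ih => simp only [List.map_cons, List.prod_cons, ih, smul_mul_smul_comm]

lemma constDer_pow_X_mul_algebraMap (u : Idx Γ → ℂ) (n : ℕ) (c : ℂ) : constDer u ((X : CSeries Γ) ^ n * algebraMap ℂ (CSeries Γ) c) = 0 := by
  rw [leibniz, Derivation.leibniz_pow, constDer_X, Derivation.map_algebraMap]
  simp

namespace Correlators

variable (hsym : W.IsSymm) (B : ℕ) (q : ℂ)

lemma constDer_partSum_pairing (u : Idx Γ → ℂ) (Z : Finset (Sheet D)) : constDer u (partSum (pairWeight W.pairing) Z) = 0 := by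
  have h : pairWeight W.pairing = fun L => (X : CSeries Γ) ^ #L * algebraMap ℂ (CSeries Γ) (pairWeight (sheetPair D) L) := by
    refine funext fun L => ?_
    have := pairWeight_map (Embedding.refl _) (sheetPair_symm D) (X : CSeries Γ) L
    rwa [map_refl] at this
  rw [h, partSum_pow_mul, ← map_partSum, constDer_pow_X_mul_algebraMap]

lemma commute_orderedSet_mulLeft {b : CSeries Γ} (hb : ∀ u : Idx Γ → ℂ, constDer u b = 0) (Y : Finset (Sheet D)) :
    Commute (mulLeft ℂ b) ((W.sheetFamily hsym B q).orderedSet Y) := by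
  have hd : ∀ u : Idx Γ → ℂ, Commute (mulLeft ℂ b) (constDer u : CSeries Γ →ₗ[ℂ] CSeries Γ) := by
    intro u
    refine LinearMap.ext fun f => ?_
    rw [End.mul_apply, End.mul_apply, mulLeft_apply, mulLeft_apply, Derivation.coeFn_coe, leibniz, hb, smul_zero, add_zero, smul_eq_mul]
  refine OpFamily.commute_ordered _ (fun s _ => ?_) fun s _ => hd _
  exact (hd _).add_right (LinearMap.ext fun f => by simp [mul_left_comm])

lemma commute_right_left {s s' : Sheet D} (h : s.1 ≠ s'.1) : Commute ((W.sheetFamily hsym B q).right s) ((W.sheetFamily hsym B q).left s') := by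
  have h0 : constDer (∑ p ∈ box B, sheetWeight D q s p • W.annihVec s.1 p) (∑ p ∈ box B, sheetWeight D q s' p • W.multiplier s'.1 p) = 0 := by
    rw [map_sum]
    refine sum_eq_zero fun p _ => ?_
    rw [Derivation.map_smul]
    by_cases hp : 0 ≤ p
    · rw [W.constDer_multiplier_nonneg _ _ hp, smul_zero]
    obtain ⟨k, rfl⟩ := exists_pnat_eq_neg (p := p) (by omega)
    rw [constDer_multiplier, Finset.sum_apply, sum_eq_zero (fun p _ => by
      rw [Pi.smul_apply, annihVec, if_neg (fun h' => h h'.1.symm), smul_zero])]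
    simp
  refine Commute.add_right (constDer_comm _ _) (LinearMap.ext fun f => ?_)
  rw [End.mul_apply, End.mul_apply, mulLeft_apply, mulLeft_apply]
  change constDer _ (_ * f) = _ * constDer _ f
  rw [leibniz, sheetFamily, h0, smul_zero, add_zero, smul_eq_mul]

lemma contracted_mul {Z Z' : Finset (Sheet D)} (h : ∀ s ∈ Z, ∀ s' ∈ Z', s.1 ≠ s'.1) :
    (W.sheetFamily hsym B q).contracted W.pairing Z * (W.sheetFamily hsym B q).contracted W.pairing Z' =
      (W.sheetFamily hsym B q).contracted W.pairing (Z ∪ Z') := by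
  have hZ : Disjoint Z Z' := disjoint_left.2 fun s hs hs' => h s hs s hs' rfl
  simp only [OpFamily.contracted]
  rw [sum_mul_sum, ← sum_product']
  refine sum_bij' (i := fun x _ => x.1 ∪ x.2) (j := fun U _ => (U ∩ Z, U ∩ Z')) ?_ ?_ ?_ ?_ ?_
  · rintro ⟨Y, Y'⟩ hY
    rw [mem_product, mem_powerset, mem_powerset] at hY
    exact mem_powerset.2 (union_subset_union hY.1 hY.2)
  · intro U _
    exact mem_product.2 ⟨mem_powerset.2 inter_subset_right, mem_powerset.2 inter_subset_right⟩
  · rintro ⟨Y, Y'⟩ hY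
    rw [mem_product, mem_powerset, mem_powerset] at hY
    have h1 : Disjoint Y' Z := (hZ.mono_right hY.2).symm
    have h2 : Disjoint Y Z' := hZ.mono_left hY.1
    simp only [union_inter_distrib_right, inter_eq_left.2 hY.1, inter_eq_left.2 hY.2,
      disjoint_iff_inter_eq_empty.1 h1, disjoint_iff_inter_eq_empty.1 h2, union_empty, empty_union]
  · intro U hU
    rw [← inter_union_distrib_left, inter_eq_left.2 (mem_powerset.1 hU)]
  · rintro ⟨Y, Y'⟩ hY
    rw [mem_product, mem_powerset, mem_powerset] at hY
    obtain ⟨hY, hY'⟩ := hY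
    have hsd : (Z ∪ Z') \ (Y ∪ Y') = Z \ Y ∪ Z' \ Y' := by
      ext s
      have h1 : s ∈ Z → s ∉ Z' := fun hs => disjoint_left.1 hZ hs
      have h2 := fun h2 : s ∈ Y => hY h2
      have h3 := fun h3 : s ∈ Y' => hY' h3
      simp only [Finset.mem_sdiff, mem_union]
      tauto
    have e1 : partSum (pairWeight W.pairing) (Z \ Y ∪ Z' \ Y') =
        partSum (pairWeight W.pairing) (Z \ Y) * partSum (pairWeight W.pairing) (Z' \ Y') := by
      refine partSum_union (hZ.mono sdiff_subset sdiff_subset) fun L hL h1 h2 => ?_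
      by_cases hc : #L = 2
      swap
      · exact pairWeight_of_card_ne _ hc
      obtain ⟨s, hs, hs1⟩ := not_subset.1 h1
      obtain ⟨s', hs', hs1'⟩ := not_subset.1 h2
      have hs2 := (mem_union.1 (hL hs)).resolve_left hs1
      have hs2' := (mem_union.1 (hL hs')).resolve_right hs1'
      have hne := h s' (Finset.mem_sdiff.1 hs2').1 s (Finset.mem_sdiff.1 hs2).1
      have hne' : s' ≠ s := fun h => hne (congrArg _ h)
      have hL' : L = {s', s} := (eq_of_subset_of_card_le (insert_subset hs' (singleton_subset_iff.2 hs)) (by rw [hc, card_pair hne'])).symm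
      rw [hL', pairWeight_pair (fun a b => by rw [pairing, pairing, sheetPair_symm]) hne', pairing, sheetPair, if_neg hne, zero_smul]
    have e2 : (W.sheetFamily hsym B q).orderedSet (Y ∪ Y') = (W.sheetFamily hsym B q).orderedSet Y * (W.sheetFamily hsym B q).orderedSet Y' := by
      have hnd : (Y.toList ++ Y'.toList).Nodup := List.Nodup.append Y.nodup_toList Y'.nodup_toList
        (fun s hs hs' => disjoint_left.1 hZ (hY (mem_toList.1 hs)) (hY' (mem_toList.1 hs')))
      have e3 : Y ∪ Y' = (Y.toList ++ Y'.toList).toFinset := by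
        rw [List.toFinset_append, toList_toFinset, toList_toFinset]
      rw [e3, ← OpFamily.orderedSet_eq _ hnd, OpFamily.ordered_append]
      · rfl
      · intro s hs s' hs'
        exact W.commute_right_left hsym B q (h s (hY (mem_toList.1 hs)) s' (hY' (mem_toList.1 hs')))
    have e4 := W.commute_orderedSet_mulLeft hsym B q
      (fun u => W.constDer_partSum_pairing u (Z' \ Y')) Y
    simp only [hsd, e1, e2, LinearMap.mulLeft_mul]
    rw [mul_assoc, ← mul_assoc _ _ (OpFamily.orderedSet _ Y'), ← e4.eq, mul_assoc, ← mul_assoc]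
    rfl

lemma contracted_empty : (W.sheetFamily hsym B q).contracted W.pairing ∅ = 1 := by
  rw [OpFamily.contracted, powerset_empty, sum_singleton, OpFamily.orderedSet, toList_empty,
    OpFamily.ordered, sdiff_empty, partSum_empty, LinearMap.mulLeft_one]
  rfl

lemma list_prod_contracted {X : Type*} [DecidableEq X] {l : List X} (hl : l.Nodup) (p : X → Γ.ramT)
    (hp : Injective p) (z : X → Finset (Sheet D)) (hz : ∀ x, z x ⊆ sheetsAt D (p x)) :
    (l.map fun x => (W.sheetFamily hsym B q).contracted W.pairing (z x)).prod =
      (W.sheetFamily hsym B q).contracted W.pairing (l.toFinset.biUnion z) := by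
  induction l with
  | nil => simp [contracted_empty]
  | cons x l ih =>
    rw [List.nodup_cons] at hl
    rw [List.map_cons, List.prod_cons, ih hl.2, W.contracted_mul, List.toFinset_cons, biUnion_insert]
    intro s hs s' hs' he
    obtain ⟨y, hy, hs'⟩ := mem_biUnion.1 hs'
    rw [mem_sheetsAt.1 (hz x hs), mem_sheetsAt.1 (hz y hs')] at he
    exact hl.1 (hp he ▸ List.mem_toFinset.1 hy)

lemma sum_twistedBox {q : ℂ} (hq : q ≠ 0) (α : Γ.ram) (i : ℕ) : ∑ k ∈ box (Fintype.card Γ.ramT * B), (q ^ rProd D) ^ (-k) •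
      twistedBox D W.K (mulLeft ℂ ((X : CSeries Γ) ^ 2)) B α i k =
      ∑ Z ∈ powersetCard i (sheets D α), (W.sheetFamily hsym B q).contracted W.pairing Z := by
  classical
  have hQ : q ^ rProd D ≠ 0 := pow_ne_zero _ hq
  simp only [twistedBox, smul_sum]
  rw [sum_comm]
  rw [← sum_fiberwise_of_maps_to (s := powersetCard i (sheets D α)) (t := (Γ.above α).powerset)
    (g := fun Z => Z.image Sigma.fst) (fun Z hZ => mem_powerset.2 fun μ hμ => by
      obtain ⟨s, hs, rfl⟩ := mem_image.1 hμ
      exact (mem_sigma.1 ((mem_powersetCard.1 hZ).1 hs)).1)]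
  refine sum_congr rfl fun M hM => ?_
  rw [sum_comm]
  have e1 : ∀ im ∈ filter (fun im : {μ // μ ∈ M} → ℕ => ∑ μ, im μ = i) (Fintype.piFinset fun μ : {μ // μ ∈ M} => Finset.Icc 1 (D.r μ)),
      ∑ k ∈ box (Fintype.card Γ.ramT * B), ∑ km ∈ (Fintype.piFinset fun _ : {μ // μ ∈ M} => box B) with ∑ μ, km μ = k,
          (q ^ rProd D) ^ (-k) • ((univ : Finset {μ // μ ∈ M}).toList.map fun (μ : {μ // μ ∈ M}) => (1 / (D.r μ : ℂ) ^ (im μ - 1)) •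
            cycleBox (W.K μ) (mulLeft ℂ ((X : CSeries Γ) ^ 2)) B (D.r μ) (im μ) (km μ)).prod =
      ∑ z ∈ Fintype.piFinset fun μ : {μ // μ ∈ M} => powersetCard (im μ) (sheetsAt D (μ : Γ.ramT)),
        (W.sheetFamily hsym B q).contracted W.pairing (univ.biUnion z) := by
    intro im him
    have him' : ∀ μ : {μ // μ ∈ M}, im μ ∈ Finset.Icc 1 (D.r μ) := Fintype.mem_piFinset.1 (mem_filter.1 him).1
    have e2 : ∀ z ∈ Fintype.piFinset fun μ : {μ // μ ∈ M} => powersetCard (im μ) (sheetsAt D (μ : Γ.ramT)),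
        (W.sheetFamily hsym B q).contracted W.pairing (univ.biUnion z) = ((univ : Finset {μ // μ ∈ M}).toList.map fun μ =>
          (W.sheetFamily hsym B q).contracted W.pairing (z μ)).prod := by
      intro z hz
      rw [W.list_prod_contracted hsym B q (nodup_toList _) Subtype.val Subtype.val_injective z fun μ =>
        (mem_powersetCard.1 (Fintype.mem_piFinset.1 hz μ)).1, toList_toFinset]
    rw [sum_congr rfl e2, sum_piFinset_list_prod (fun μ : {μ // μ ∈ M} => powersetCard (im μ) (sheetsAt D (μ : Γ.ramT)))
      fun _ Z => (W.sheetFamily hsym B q).contracted W.pairing Z]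
    simp_rw [← fun μ : {μ // μ ∈ M} => W.sum_cycleBox hsym B hq μ.1 (mem_Icc.1 (him' μ)).1
      (mem_Icc.1 (him' μ)).2]
    rw [← sum_piFinset_list_prod (fun _ : {μ // μ ∈ M} => box B) fun μ k => (q ^ rProd D) ^ (-k) • ((1 / (D.r μ : ℂ) ^ (im μ - 1)) •
        cycleBox (W.K μ) (mulLeft ℂ ((X : CSeries Γ) ^ 2)) B (D.r μ) (im μ) k)]
    simp_rw [sum_filter]
    rw [sum_comm]
    refine sum_congr rfl fun km hkm => ?_
    rw [sum_ite_eq, if_pos]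
    · refine Eq.trans ?_ (list_prod_smul univ.toList (fun μ : {μ // μ ∈ M} => (q ^ rProd D) ^ (-km μ)) fun μ =>
        (1 / (D.r μ : ℂ) ^ (im μ - 1)) • cycleBox (W.K μ) (mulLeft ℂ ((X : CSeries Γ) ^ 2)) B (D.r μ) (im μ) (km μ)).symm
      congr 1
      rw [prod_map_toList]
      rw [prod_zpow_eq _ hQ, sum_neg_distrib]
    · have hb := fun μ => mem_Icc.1 (Fintype.mem_piFinset.1 hkm μ)
      have hc : (Fintype.card {μ // μ ∈ M} : ℤ) * B ≤ (Fintype.card Γ.ramT * B : ℕ) := by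
        push_cast
        exact mul_le_mul_of_nonneg_right (mod_cast Fintype.card_subtype_le _) (by positivity)
      have h1 := sum_le_card_nsmul univ km (B : ℤ) fun l _ => (hb l).2
      have h2 := card_nsmul_le_sum univ km (-(B : ℤ)) fun l _ => (hb l).1
      rw [card_univ, nsmul_eq_mul] at h1 h2
      exact mem_Icc.2 ⟨by linarith, by linarith⟩
  rw [sum_congr rfl e1, sum_sigma']
  refine sum_bij' (i := fun x _ => univ.biUnion x.2)
    (j := fun Z _ => ⟨fun μ => #(Z.filter (·.1 = μ.1)), fun μ => Z.filter (·.1 = μ.1)⟩) ?_ ?_ ?_ ?_ ?_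
  · rintro ⟨im, z⟩ h
    obtain ⟨him, hz⟩ := mem_sigma.1 h
    obtain ⟨him, hi⟩ := mem_filter.1 him
    have hz1 := fun μ => mem_powersetCard.1 (Fintype.mem_piFinset.1 hz μ)
    have hz2 : ∀ μ, ∀ s ∈ z μ, s.1 = μ.1 := fun μ s hs => mem_sheetsAt.1 ((hz1 μ).1 hs)
    refine mem_filter.2 ⟨mem_powersetCard.2 ⟨fun s hs => ?_, ?_⟩, ?_⟩
    · obtain ⟨μ, _, hs⟩ := mem_biUnion.1 hs
      exact mem_sigma.2 ⟨hz2 μ s hs ▸ mem_powerset.1 hM μ.2, mem_univ _⟩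
    · rw [card_biUnion, ← hi]
      · exact sum_congr rfl fun μ _ => (hz1 μ).2
      · exact fun μ _ ν _ hne => disjoint_left.2 fun s hs hs' => hne (Subtype.ext ((hz2 μ s hs).symm.trans (hz2 ν s hs')))
    · ext μ
      rw [mem_image]
      constructor
      · rintro ⟨s, hs, rfl⟩
        obtain ⟨μ, _, hs⟩ := mem_biUnion.1 hs
        exact hz2 μ s hs ▸ μ.2
      · intro hμ
        have h1 := (mem_Icc.1 (Fintype.mem_piFinset.1 him ⟨μ, hμ⟩)).1
        rw [← (hz1 ⟨μ, hμ⟩).2] at h1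
        obtain ⟨s, hs⟩ := card_pos.1 h1
        exact ⟨s, mem_biUnion.2 ⟨_, mem_univ _, hs⟩, hz2 ⟨μ, hμ⟩ s hs⟩
  · intro Z hZ
    obtain ⟨hZ, hZM⟩ := mem_filter.1 hZ
    obtain ⟨hZs, hZi⟩ := mem_powersetCard.1 hZ
    have hsub : ∀ μ : {μ // μ ∈ M}, Z.filter (·.1 = μ.1) ⊆ sheetsAt D μ.1 := fun μ s hs => mem_sheetsAt.2 (mem_filter.1 hs).2
    refine mem_sigma.2 ⟨mem_filter.2 ⟨Fintype.mem_piFinset.2 fun μ => mem_Icc.2 ⟨?_, ?_⟩, ?_⟩,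
      Fintype.mem_piFinset.2 fun μ => mem_powersetCard.2 ⟨hsub μ, rfl⟩⟩
    · obtain ⟨s, hs, hsμ⟩ := mem_image.1 (hZM.symm ▸ μ.2 : μ.1 ∈ Z.image Sigma.fst)
      exact card_pos.2 ⟨s, mem_filter.2 ⟨hs, hsμ⟩⟩
    · refine (card_le_card (hsub μ)).trans ?_
      rw [sheetsAt, card_map, card_univ, Fintype.card_fin]
    · rw [sum_coe_sort M fun μ => #(Z.filter (·.1 = μ)), ← hZi]
      exact (card_eq_sum_card_fiberwise fun s hs => mem_coe.2 (hZM ▸ mem_image_of_mem _ hs)).symm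
  · rintro ⟨im, z⟩ h
    obtain ⟨him, hz⟩ := mem_sigma.1 h
    have hz1 := fun μ => mem_powersetCard.1 (Fintype.mem_piFinset.1 hz μ)
    have hz2 : ∀ μ, ∀ s ∈ z μ, s.1 = μ.1 := fun μ s hs => mem_sheetsAt.1 ((hz1 μ).1 hs)
    have hf : (fun μ : {μ // μ ∈ M} => (univ.biUnion z).filter (·.1 = μ.1)) = z := by
      refine funext fun μ => ?_
      ext s
      rw [mem_filter, mem_biUnion]
      constructor
      · rintro ⟨⟨ν, _, hs⟩, h⟩
        rwa [← Subtype.ext ((hz2 ν s hs).symm.trans h)]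
      · exact fun hs => ⟨⟨μ, mem_univ _, hs⟩, hz2 μ s hs⟩
    have hf' := fun μ => congrFun hf μ
    refine Sigma.ext (funext fun μ => ?_) (heq_of_eq hf)
    exact (congrArg _ (hf' μ)).trans (hz1 μ).2
  · intro Z hZ
    ext s
    rw [mem_biUnion]
    refine ⟨fun ⟨μ, _, hs⟩ => (mem_filter.1 hs).1, fun hs => ⟨⟨s.1, ?_⟩, mem_univ _, mem_filter.2 ⟨hs, rfl⟩⟩⟩
    rw [← (mem_filter.1 hZ).2]
    exact mem_image_of_mem _ hs
  · exact fun _ _ => rfl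

/-- The generating function of the constraints, divided by the partition function. -/
def blockSum (hsym : W.IsSymm) (F : Coefficients Γ) (B : ℕ) (q : ℂ) (α : Γ.ram) (i : ℕ) : CSeries Γ :=
  ∑ Z ∈ powersetCard i (sheets D α), partSum (fun L => (W.sheetFamily hsym B q).blockWeight (freeSeries F) L + pairWeight W.pairing L) Z

lemma sum_twistedBox_partSeries (F : Coefficients Γ) {q : ℂ} (hq : q ≠ 0) (α : Γ.ram) (i : ℕ) :
    ∑ k ∈ box (Fintype.card Γ.ramT * B), (q ^ rProd D) ^ (-k) • twistedBox D W.K (mulLeft ℂ ((X : CSeries Γ) ^ 2)) B α i k (partSeries F) =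
      W.blockSum hsym F B q α i * partSeries F := by
  have h := LinearMap.congr_fun (W.sum_twistedBox hsym B hq α i) (partSeries F)
  simp only [LinearMap.sum_apply, LinearMap.smul_apply] at h
  rw [h, blockSum, sum_mul]
  exact sum_congr rfl fun Z _ => OpFamily.contracted_apply _ (fun s => constDer_partSeries _ F) (fun s => constDer_partSeries _ F) _ _

end Correlators

end TwistedIdentity

section Disconnected

/-- The value of a multidifferential on a finite set of labelled tangent vectors. -/
def evSet (η : ∀ n, MultiForm S n) {Y : Type*} (t : Y → TB S) (U : Finset Y) : ℂ := ev (η #U) fun j => t (U.equivFin.symm j)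

lemma exists_perm_of_image_eq {Y : Type*} [DecidableEq Y] {k : ℕ} {v v' : Fin k → Y} (hv' : Injective v') (h : univ.image v = univ.image v') : ∃ τ : Equiv.Perm (Fin k), v' = v ∘ τ := by
  have h1 : ∀ j, ∃ i, v i = v' j := fun j => by
    have := mem_image_of_mem v' (mem_univ j)
    rw [← h] at this
    simpa using this
  choose τ hτ using h1
  have hinj : Injective τ := fun j j' hj => hv' (by rw [← hτ, hj, hτ])
  exact ⟨Equiv.ofBijective τ (Finite.injective_iff_bijective.1 hinj), funext fun j => (hτ j).symm⟩

/-- Symmetry of a family of multidifferentials at a finite set of labelled tangent vectors. -/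
def IsSymmAt (η : ∀ n, MultiForm S n) {Y : Type*} (t : Y → TB S) (U : Finset Y) : Prop :=
  ∀ (v : Fin #U → Y), Injective v → (∀ j, v j ∈ U) → ∀ τ : Equiv.Perm (Fin #U), ev (η #U) (fun j => t (v (τ j))) = ev (η #U) fun j => t (v j)

lemma IsSymmAt.ev_eq {η : ∀ n, MultiForm S n} {Y : Type*} {t : Y → TB S} {U : Finset Y} (h : IsSymmAt η t U)
    {k : ℕ} (hk : k = #U) {v : Fin k → Y} (hv : Injective v) (hU : ∀ j, v j ∈ U) : ev (η k) (fun j => t (v j)) = evSet η t U := by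
  classical
  subst hk
  have himg : ∀ v : Fin #U → Y, Injective v → (∀ j, v j ∈ U) → univ.image v = U := fun v hv hU =>
    eq_of_subset_of_card_le (image_subset_iff.2 fun j _ => hU j) (by
      rw [card_image_of_injective _ hv, card_univ, Fintype.card_fin])
  have h2 : Injective fun j => ((U.equivFin.symm j : U) : Y) := Subtype.val_injective.comp U.equivFin.symm.injective
  obtain ⟨τ, hτ⟩ := exists_perm_of_image_eq hv ((himg _ h2 fun j => (U.equivFin.symm j).2).trans (himg v hv hU).symm)
  rw [hτ]
  exact h _ h2 (fun j => (U.equivFin.symm j).2) τ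

lemma IsSymmAt.evFam_eq {η : ∀ n, MultiForm S n} {Y : Type*} {t : Y → TB S} {U : Finset Y} (h : IsSymmAt η t U)
    {ι : Type*} [Fintype ι] {e : ι → Y} (he : Injective e) (hU : ∀ i, e i ∈ U) (hc : Fintype.card ι = #U) :
    evFam η (fun i => t (e i)) = evSet η t U :=
  h.ev_eq hc (v := fun j => e ((Fintype.equivFin ι).symm j)) (he.comp (Fintype.equivFin ι).symm.injective)
    fun _ => hU _

variable {κ : Type*} [DecidableEq κ] {n : ℕ}

/-- The weights of the blocks in the disconnected correlators, as power series: the index of the block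
is recorded by the power of `t`, and the labels of the connected variables by the monomials. -/
def formSeries (η : ∀ _ n : ℕ, MultiForm S n) (t : κ ⊕ Fin n → TB S) (m : κ → ℂ) (L : Finset κ) : PowerSeries (MvPolynomial (Fin n) ℂ) :=
  PowerSeries.mk fun l => ∑ N : Finset (Fin n), MvPolynomial.monomial (sqf N)
    (if 2 * #L + #N ≤ l + 2 then (∏ s ∈ L, m s) * evSet (η (l + 2 - 2 * #L - #N)) t (L.disjSum N) else 0)

lemma coeff_formSeries (η : ∀ _ n : ℕ, MultiForm S n) (t : κ ⊕ Fin n → TB S) (m : κ → ℂ) (L : Finset κ)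
    (N : Finset (Fin n)) (l : ℕ) : (coeff l (formSeries η t m L)).coeff (sqf N) =
    if 2 * #L + #N ≤ l + 2 then (∏ s ∈ L, m s) * evSet (η (l + 2 - 2 * #L - #N)) t (L.disjSum N) else 0 := by
  rw [formSeries, PowerSeries.coeff_mk, coeff_sum]
  simp_rw [MvPolynomial.coeff_monomial, sqf_injective.eq_iff]
  rw [sum_ite_eq' univ N, if_pos (mem_univ _)]

open Classical in
lemma coeff_partSum_formSeries_univ {A : Type*} [Fintype A] (z : A ↪ κ) (η : ∀ _ n : ℕ, MultiForm S n) (t : κ ⊕ Fin n → TB S) (m : κ → ℂ)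
    (hsym : ∀ g, ∀ L : Finset A, L.Nonempty → ∀ N, IsSymmAt (η g) t ((L.map z).disjSum N)) (h : ℕ) :
    (coeff (h + n) (partSum (fun L : Finset A => formSeries η t m (L.map z)) univ)).coeff (sqf univ) =
      (∏ a, m (z a)) * disconnected η h (fun a : A => t (.inl (z a))) (fun b => t (.inr b)) := by
  rw [partSum, map_sum, coeff_sum, disconnected, mul_sum]
  refine sum_congr rfl fun P _ => ?_
  rw [← prod_coe_sort, PowerSeries.coeff_prod, coeff_sum]
  simp_rw [coeff_sqf_prod, mul_sum]
  rw [sum_comm]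
  refine sum_congr (by ext; simp) fun N _ => ?_
  have hc : ∀ L : {L // L ∈ P.parts}, 1 ≤ #L.1 := fun L => card_pos.2 (P.nonempty_of_mem_parts L.2)
  have hA : ∑ L : {L // L ∈ P.parts}, #L.1 = Fintype.card A := by
    rw [sum_coe_sort P.parts fun L => #L, P.sum_card_parts]; rfl
  have hN : ∑ L : {L // L ∈ P.parts}, #({b | N b = L} : Finset (Fin n)) = n := by
    rw [← card_eq_sum_card_fiberwise (fun b _ => mem_coe.2 (mem_univ _)), card_univ, Fintype.card_fin]
  have hcP : ∑ L : {L // L ∈ P.parts}, 1 = P.parts.card := by simp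
  have hm : ∏ a, m (z a) = ∏ L : {L // L ∈ P.parts}, ∏ s ∈ L.1.map z, m s := by
    simp_rw [prod_map]
    rw [prod_coe_sort P.parts fun L => ∏ x ∈ L, m (z x)]
    have h1 := prod_biUnion (s := P.parts) (t := id) (f := fun x => m (z x)) P.disjoint
    rw [P.biUnion_parts] at h1
    exact h1
  have hval : ∀ (g : ℕ) (L : {L // L ∈ P.parts}),
      evFam (η g) (Sum.elim (fun a : {a // a ∈ L.1} => t (.inl (z a))) (fun b : {b // N b = L} => t (.inr b))) =
      evSet (η g) t ((L.1.map z).disjSum ({b | N b = L} : Finset (Fin n))) := by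
    intro g L
    have hs := hsym g L.1 (P.nonempty_of_mem_parts L.2) ({b | N b = L})
    rw [← hs.evFam_eq (ι := {a // a ∈ L.1} ⊕ {b // N b = L}) (e := Sum.map (fun a => z a.1) (fun b => b.1))]
    · congr 1
      ext1 (a | b) <;> rfl
    · exact Sum.map_injective.2 ⟨z.injective.comp Subtype.val_injective, Subtype.val_injective⟩
    · rintro (a | b)
      · exact inl_mem_disjSum.2 (Finset.mem_map.2 ⟨a.1, a.2, rfl⟩)
      · exact inr_mem_disjSum.2 (mem_filter.2 ⟨mem_univ _, b.2⟩)
    · rw [card_disjSum, card_map, Fintype.card_sum, Fintype.card_coe, Fintype.card_subtype]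
  simp_rw [hval, coeff_formSeries, card_map]
  set c : {L // L ∈ P.parts} → ℕ := fun L => 2 * #L.1 + #({b | N b = L} : Finset (Fin n)) with hcdef
  have hcsum : ∑ L, c L = 2 * Fintype.card A + n := by
    rw [hcdef, sum_add_distrib, ← mul_sum, hA, hN]
  have hc2 : ∀ L, 2 ≤ c L := fun L => by have := hc L; simp only [hcdef]; omega
  have hsum : ∀ (l : {L // L ∈ P.parts} → ℕ) (g : {L // L ∈ P.parts} → ℕ), (∀ L, l L + 2 = g L + c L) →
      (∑ L, l L) + 2 * #P.parts = ∑ L, g L + (2 * Fintype.card A + n) := by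
    intro l g hlg
    have := sum_congr rfl fun L (_ : L ∈ univ) => hlg L
    rwa [sum_add_distrib, sum_add_distrib, hcsum, sum_const, card_univ, Fintype.card_coe, smul_eq_mul, mul_comm] at this
  have hcard : #P.parts ≤ Fintype.card A := by
    have := P.card_parts_le_card; rwa [card_univ] at this
  have key : ∀ (l : {L // L ∈ P.parts} →₀ ℕ) (g : {L // L ∈ P.parts} → Fin (h + 1)),
      (∀ L, l L + 2 = g L + c L) → 2 * Fintype.card A + ∑ L, (g L : ℕ) = h + 2 * #P.parts →
      (∏ L : {L // L ∈ P.parts}, if 2 * #L.1 + #({b | N b = L} : Finset (Fin n)) ≤ l L + 2 then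
        (∏ s ∈ L.1.map z, m s) * evSet (η (l L + 2 - 2 * #L.1 - #({b | N b = L} : Finset (Fin n)))) t
            ((L.1.map z).disjSum ({b | N b = L} : Finset (Fin n))) else 0) =
      (∏ a, m (z a)) * if 2 * Fintype.card A + ∑ L, (g L : ℕ) = h + 2 * #P.parts then
        ∏ L : {L // L ∈ P.parts}, evSet (η (g L)) t
          ((L.1.map z).disjSum ({b | N b = L} : Finset (Fin n))) else 0 := by
    intro l g hlg hg
    rw [if_pos hg, hm, ← prod_mul_distrib]
    refine prod_congr rfl fun L _ => ?_
    have h1 := hlg L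
    simp only [hcdef] at h1
    rw [if_pos (by omega), show l L + 2 - 2 * #L.1 - #({b | N b = L} : Finset (Fin n)) = g L by omega]
  have hex : ∀ l ∈ finsuppAntidiag (univ : Finset {L // L ∈ P.parts}) (h + n),
      (∏ L : {L // L ∈ P.parts}, if 2 * #L.1 + #({b | N b = L} : Finset (Fin n)) ≤ l L + 2 then
        (∏ s ∈ L.1.map z, m s) * evSet (η (l L + 2 - 2 * #L.1 - #({b | N b = L} : Finset (Fin n)))) t
            ((L.1.map z).disjSum ({b | N b = L} : Finset (Fin n))) else 0) ≠ 0 →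
      ∃ g : {L // L ∈ P.parts} → Fin (h + 1), (∀ L, l L + 2 = g L + c L) ∧ 2 * Fintype.card A + ∑ L, (g L : ℕ) = h + 2 * #P.parts := by
    intro l hl hl0
    have h1 : ∀ L, c L ≤ l L + 2 := fun L => by
      by_contra hcon
      exact prod_ne_zero_iff.1 hl0 L (mem_univ _) (if_neg hcon)
    have h2 : ∀ L, l L + 2 = (l L + 2 - c L) + c L := fun L => by have := h1 L; omega
    have h3 := hsum l (fun L => l L + 2 - c L) h2
    rw [(mem_finsuppAntidiag.1 hl).1] at h3
    have h4 : ∀ L, l L + 2 - c L < h + 1 := fun L => by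
      have := single_le_sum_of_canonicallyOrdered (f := fun L => l L + 2 - c L) (mem_univ L)
      omega
    exact ⟨fun L => ⟨_, h4 L⟩, h2, by simp only; omega⟩
  choose! G hG1 hG2 using hex
  refine sum_bij_ne_zero (i := fun l _ _ => G l) (fun _ _ _ => mem_univ _) ?_ ?_ ?_
  · intro l hl hl0 l' hl' hl0' heq
    ext L
    have h1 := hG1 l hl hl0 L
    have h2 := hG1 l' hl' hl0' L
    rw [heq] at h1
    omega
  · intro g _ hg0
    have hg : 2 * Fintype.card A + ∑ L, (g L : ℕ) = h + 2 * #P.parts := by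
      by_contra hcon
      rw [if_neg hcon, mul_zero] at hg0
      exact hg0 rfl
    set l : {L // L ∈ P.parts} →₀ ℕ := Finsupp.equivFunOnFinite.symm fun L => g L + c L - 2 with hldef
    have h1 : ∀ L, l L + 2 = g L + c L := fun L => by
      have := hc2 L
      have h2 : l L = g L + c L - 2 := rfl
      omega
    have h2 := hsum l (fun L => g L) h1
    have hl : l ∈ finsuppAntidiag (univ : Finset {L // L ∈ P.parts}) (h + n) :=
      mem_finsuppAntidiag.2 ⟨show ∑ L, l L = h + n by omega, fun _ _ => mem_univ _⟩
    have hl0 := (key l g h1 hg).trans_ne hg0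
    refine ⟨l, hl, hl0, funext fun L => Fin.ext ?_⟩
    have h3 := hG1 l hl hl0 L
    have h4 := h1 L
    omega
  · exact fun l hl hl0 => key l _ (hG1 l hl hl0) (hG2 l hl hl0)

lemma coeff_partSum_formSeries (η : ∀ _ n : ℕ, MultiForm S n) (t : κ ⊕ Fin n → TB S) (m : κ → ℂ)
    (Z : Finset κ) (hsym : ∀ g, ∀ L ⊆ Z, L.Nonempty → ∀ N, IsSymmAt (η g) t (L.disjSum N)) (h : ℕ) :
    (coeff (h + n) (partSum (formSeries η t m) Z)).coeff (sqf univ) =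
      (∏ s ∈ Z, m s) * disconnected η h (fun a : {a // a ∈ Z} => t (.inl a)) (fun b => t (.inr b)) := by
  have e1 : ∀ inst : DecidableEq {a // a ∈ Z}, partSum (formSeries η t m) Z = @partSum _ _ inst _
      (fun L : Finset {a // a ∈ Z} => formSeries η t m (L.map (Embedding.subtype _))) univ := by
    intro inst
    rw [← partSum_map]
    congr 1
    ext a
    simp
  rw [e1 fun a b => Classical.propDecidable (a = b)]
  refine (coeff_partSum_formSeries_univ (Embedding.subtype _) η t m (fun g L hL N => ?_) h).trans ?_
  · exact hsym g _ (fun a ha => by obtain ⟨x, _, rfl⟩ := Finset.mem_map.1 ha; exact x.2) (hL.map) N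
  · congr 1
    exact prod_coe_sort Z m

end Disconnected

section Asymptotics

lemma zpow_isBigO {a b : ℤ} (h : b ≤ a) : (fun q : ℂ => q ^ a) =O[𝓝[≠] 0] fun q => q ^ b := by
  refine IsBigO.of_bound 1 ?_
  have h1 : ∀ᶠ q : ℂ in 𝓝[≠] 0, ‖q‖ < 1 := nhdsWithin_le_nhds (by
    simpa using Metric.ball_mem_nhds (0 : ℂ) one_pos |> fun h => (by simpa [Metric.ball] using h : {q : ℂ | ‖q‖ < 1} ∈ 𝓝 0))
  filter_upwards [h1, self_mem_nhdsWithin] with q hq hq0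
  obtain ⟨n, rfl⟩ : ∃ n : ℕ, a = b + n := ⟨(a - b).toNat, by omega⟩
  rw [zpow_add₀ hq0, norm_mul, one_mul, zpow_natCast, norm_pow]
  exact mul_le_of_le_one_right (norm_nonneg _) (pow_le_one₀ (norm_nonneg _) hq.le)

lemma isBigO_zpow_mul {f g : ℂ → ℂ} {a b c : ℤ} (hf : f =O[𝓝[≠] 0] fun q => q ^ a)
    (hg : g =O[𝓝[≠] 0] fun q => q ^ b) (h : c ≤ a + b) : (fun q => f q * g q) =O[𝓝[≠] 0] fun q => q ^ c := by
  refine ((hf.mul hg).congr' (EventuallyEq.rfl) ?_).trans (zpow_isBigO h)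
  filter_upwards [self_mem_nhdsWithin] with q hq
  rw [zpow_add₀ hq]

/-- `φ B` is an approximation of `f` up to the order `B`, uniformly in a weak sense. -/
def AsympTo (f : ℂ → ℂ) (φ : ℕ → ℂ → ℂ) : Prop := ∃ C : ℕ, (f =O[𝓝[≠] 0] fun q => q ^ (-(C : ℤ))) ∧
    ∀ᶠ B : ℕ in atTop, (fun q => f q - φ B q) =O[𝓝[≠] 0] fun q => q ^ ((B : ℤ) - C)

namespace AsympTo

variable {f g : ℂ → ℂ} {φ ψ : ℕ → ℂ → ℂ}

lemma congr (h : AsympTo f φ) (hf : ∀ᶠ q in 𝓝[≠] 0, f q = g q) (hφ : ∀ B, ∀ᶠ q in 𝓝[≠] 0, φ B q = ψ B q) : AsympTo g ψ := by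
  obtain ⟨C, h1, h2⟩ := h
  refine ⟨C, h1.congr' hf EventuallyEq.rfl, h2.mono fun B hB => hB.congr' ?_ EventuallyEq.rfl⟩
  filter_upwards [hf, hφ B] with q h1 h2
  rw [h1, h2]

lemma const (c : ℂ) : AsympTo (fun _ => c) fun _ _ => c :=
  ⟨0, by simpa using Asymptotics.isBigO_const_const c (one_ne_zero (α := ℂ)) (𝓝[≠] (0 : ℂ)), .of_forall fun B => by simp [isBigO_zero]⟩

lemma zpow (k : ℤ) : AsympTo (fun q => q ^ k) fun _ q => q ^ k := ⟨k.natAbs, zpow_isBigO (by omega), .of_forall fun B => by simp [isBigO_zero]⟩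

lemma add (hf : AsympTo f φ) (hg : AsympTo g ψ) : AsympTo (fun q => f q + g q) fun B q => φ B q + ψ B q := by
  obtain ⟨C, h1, h2⟩ := hf
  obtain ⟨C', h1', h2'⟩ := hg
  refine ⟨max C C', (h1.trans (zpow_isBigO (by omega))).add (h1'.trans (zpow_isBigO (by omega))), ?_⟩
  filter_upwards [h2, h2'] with B hB hB'
  refine ((hB.trans (zpow_isBigO (b := (B : ℤ) - max C C') (by omega))).add (hB'.trans (zpow_isBigO (by omega)))).congr_left
    fun q => by ring

lemma mul (hf : AsympTo f φ) (hg : AsympTo g ψ) : AsympTo (fun q => f q * g q) fun B q => φ B q * ψ B q := by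
  obtain ⟨C, h1, h2⟩ := hf
  obtain ⟨C', h1', h2'⟩ := hg
  refine ⟨C + C', isBigO_zpow_mul h1 h1' (by push_cast; omega), ?_⟩
  filter_upwards [h2, h2'] with B hB hB'
  have hψ : ψ B =O[𝓝[≠] 0] fun q => q ^ (-(C' : ℤ)) := (h1'.sub (hB'.trans (zpow_isBigO (by omega)))).congr_left fun q => by ring
  exact ((isBigO_zpow_mul h1 hB' (by push_cast; omega)).add (isBigO_zpow_mul hB hψ (c := (B : ℤ) - (C + C' : ℕ))
    (by push_cast; omega))).congr_left fun q => by ring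

lemma sum {ι : Type*} (s : Finset ι) {f : ι → ℂ → ℂ} {φ : ι → ℕ → ℂ → ℂ} (h : ∀ i ∈ s, AsympTo (f i) (φ i)) :
    AsympTo (fun q => ∑ i ∈ s, f i q) fun B q => ∑ i ∈ s, φ i B q := by
  classical
  induction s using Finset.induction_on with
  | empty => simpa using const 0
  | insert a s ha ih =>
    simp_rw [sum_insert ha]
    exact (h a (mem_insert_self _ _)).add (ih fun i hi => h i (mem_insert_of_mem hi))

lemma prod {ι : Type*} (s : Finset ι) {f : ι → ℂ → ℂ} {φ : ι → ℕ → ℂ → ℂ} (h : ∀ i ∈ s, AsympTo (f i) (φ i)) :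
    AsympTo (fun q => ∏ i ∈ s, f i q) fun B q => ∏ i ∈ s, φ i B q := by
  classical
  induction s using Finset.induction_on with
  | empty => simpa using const 1
  | insert a s ha ih =>
    simp_rw [prod_insert ha]
    exact (h a (mem_insert_self _ _)).mul (ih fun i hi => h i (mem_insert_of_mem hi))

end AsympTo

/-- Coefficientwise approximation, for the square-free coefficients of series of polynomials. -/
def AsympSeries {V : Type*} [Fintype V] [DecidableEq V] (f : ℂ → PowerSeries (MvPolynomial V ℂ))
    (φ : ℕ → ℂ → PowerSeries (MvPolynomial V ℂ)) : Prop :=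
  ∀ m ≤ (sqf univ : V →₀ ℕ), ∀ l, AsympTo (fun q => (coeff l (f q)).coeff m)
    fun B q => (coeff l (φ B q)).coeff m

namespace AsympSeries

variable {V : Type*} [Fintype V] [DecidableEq V]

lemma of_sqf {f : ℂ → PowerSeries (MvPolynomial V ℂ)} {φ : ℕ → ℂ → PowerSeries (MvPolynomial V ℂ)}
    (h : ∀ N : Finset V, ∀ l, AsympTo (fun q => (coeff l (f q)).coeff (sqf N))
      fun B q => (coeff l (φ B q)).coeff (sqf N)) : AsympSeries f φ := by
  intro m hm l
  have : m = sqf m.support := by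
    ext v
    have h1 := hm v
    rw [sqf_apply, if_pos (mem_univ v)] at h1
    rw [sqf_apply]
    split_ifs with h2
    · exact le_antisymm h1 (Nat.one_le_iff_ne_zero.2 (Finsupp.mem_support_iff.1 h2))
    · exact Finsupp.notMem_support_iff.1 h2
  rw [this]
  exact h _ l

lemma sum {ι : Type*} (s : Finset ι) {f : ι → ℂ → PowerSeries (MvPolynomial V ℂ)}
    {φ : ι → ℕ → ℂ → PowerSeries (MvPolynomial V ℂ)} (h : ∀ i ∈ s, AsympSeries (f i) (φ i)) :
    AsympSeries (fun q => ∑ i ∈ s, f i q) fun B q => ∑ i ∈ s, φ i B q := by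
  intro m hm l
  simp_rw [map_sum, coeff_sum]
  exact AsympTo.sum s fun i hi => h i hi m hm l

lemma prod {ι : Type*} (s : Finset ι) {f : ι → ℂ → PowerSeries (MvPolynomial V ℂ)}
    {φ : ι → ℕ → ℂ → PowerSeries (MvPolynomial V ℂ)} (h : ∀ i ∈ s, AsympSeries (f i) (φ i)) :
    AsympSeries (fun q => ∏ i ∈ s, f i q) fun B q => ∏ i ∈ s, φ i B q := by
  classical
  induction s using Finset.induction_on with
  | empty =>
    intro m hm l
    simp only [prod_empty]
    exact AsympTo.const _
  | insert a s ha ih =>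
    simp_rw [prod_insert ha]
    intro m hm l
    simp_rw [PowerSeries.coeff_mul, coeff_sum, MvPolynomial.coeff_mul]
    refine AsympTo.sum _ fun l _ => AsympTo.sum _ fun x hx => ?_
    have hx' := Finset.HasAntidiagonal.mem_antidiagonal.1 hx
    exact (h a (mem_insert_self _ _) _ ((le_self_add.trans hx'.le).trans hm) _).mul
      (ih (fun i hi => h i (mem_insert_of_mem hi)) _ ((le_add_self.trans hx'.le).trans hm) _)

lemma partSum {κ : Type*} [DecidableEq κ] (Z : Finset κ) {f : Finset κ → ℂ → PowerSeries (MvPolynomial V ℂ)}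
    {φ : Finset κ → ℕ → ℂ → PowerSeries (MvPolynomial V ℂ)} (h : ∀ L ⊆ Z, L.Nonempty → AsympSeries (f L) (φ L)) :
    AsympSeries (fun q => WLoop.partSum (fun L => f L q) Z)
      fun B q => WLoop.partSum (fun L => φ L B q) Z :=
  sum _ fun P _ => prod _ fun L hL => h L (P.le hL) (P.nonempty_of_mem_parts hL)

end AsympSeries

end Asymptotics

section LinearSubstitution

/-- The substitution of generic linear combinations of a finite family of vectors. -/
def linSubst {V : Type*} [Fintype V] (c : V → Idx Γ → ℂ) : CPoly Γ →ₐ[ℂ] MvPolynomial V ℂ := MvPolynomial.aeval fun a => ∑ v, C (c v a) * X v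

variable {V : Type*} [Fintype V] [DecidableEq V] (c : V → Idx Γ → ℂ)

lemma pderiv_linSubst (v : V) (f : CPoly Γ) : pderiv v (linSubst c f) = linSubst c (mkDerivation ℂ (fun b => C (c v b)) f) := by
  induction f using MvPolynomial.induction_on with
  | C a =>
    rw [derivation_C, map_zero, ← algebraMap_eq, AlgHom.commutes, Derivation.map_algebraMap]
  | add p q hp hq => simp only [map_add, hp, hq]
  | mul_X p a hp =>
    have h1 : pderiv v (linSubst c (X a)) = C (c v a) := by
      rw [linSubst, aeval_X, map_sum, sum_eq_single v]
      · simp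
      · intro u _ hu
        rw [MvPolynomial.pderiv_C_mul, pderiv_X_of_ne hu, mul_zero]
      · simp
    have h2 : linSubst c (C (c v a)) = C (c v a) := by
      rw [← algebraMap_eq, AlgHom.commutes]; rfl
    simp only [map_mul, leibniz, smul_eq_mul, hp, h1, map_add, mkDerivation_X, h2]

lemma coeff_linSubst_insert {U : Finset V} {v : V} (hv : v ∉ U) (f : CPoly Γ) : (linSubst c f).coeff (sqf (insert v U)) =
      (linSubst c (mkDerivation ℂ (fun b => C (c v b)) f)).coeff (sqf U) := by
  rw [coeff_sqf_insert hv, pderiv_linSubst]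

lemma coeff_linSubst_zero (f : CPoly Γ) : (linSubst c f).coeff 0 = MvPolynomial.constantCoeff f := by
  have h : (MvPolynomial.constantCoeff (σ := V)).comp (linSubst c).toRingHom = MvPolynomial.constantCoeff := by
    refine MvPolynomial.ringHom_ext (fun a => ?_) fun a => ?_
    · change MvPolynomial.constantCoeff (linSubst c (algebraMap ℂ (CPoly Γ) a)) = _
      rw [AlgHom.commutes, algebraMap_eq, MvPolynomial.constantCoeff_C, MvPolynomial.constantCoeff_C]
    · change MvPolynomial.constantCoeff (linSubst c (X a)) = _
      simp [linSubst, aeval_X, map_sum]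
  exact RingHom.congr_fun h f

lemma coeff_linSubst_inr {κ : Type*} [Fintype κ] [DecidableEq κ] (c : κ ⊕ V → Idx Γ → ℂ) (N : Finset V)
    (f : CPoly Γ) : (linSubst c f).coeff (sqf ((∅ : Finset κ).disjSum N)) = (linSubst (fun v => c (.inr v)) f).coeff (sqf N) := by
  induction N using Finset.induction_on generalizing f with
  | empty => 
    rw [show (∅ : Finset κ).disjSum (∅ : Finset V) = ∅ from rfl, sqf_empty, sqf_empty, coeff_linSubst_zero, coeff_linSubst_zero]
  | insert b N hb ih =>
    rw [show (∅ : Finset κ).disjSum (insert b N) = insert (Sum.inr b) ((∅ : Finset κ).disjSum N) by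
      ext (a | a) <;> simp, coeff_linSubst_insert c (by simpa using hb), coeff_linSubst_insert _ hb, ih]

lemma coeff_linSubst_iterD {κ : Type*} [Fintype κ] [DecidableEq κ] (c : κ ⊕ V → Idx Γ → ℂ) {D : κ → Derivation ℂ (CSeries Γ) (CSeries Γ)}
    (hD : ∀ s s', Commute (D s : CSeries Γ →ₗ[ℂ] CSeries Γ) (D s' : CSeries Γ →ₗ[ℂ] CSeries Γ))
    (hc : ∀ s, D s = constDer (c (.inl s))) (L : Finset κ) (N : Finset V) (l : ℕ) (f : CSeries Γ) :
    (linSubst (fun v => c (.inr v)) (coeff l (iterD D hD L f))).coeff (sqf N) =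
      if #L ≤ l then (linSubst c (coeff (l - #L) f)).coeff (sqf (L.disjSum N)) else 0 := by
  induction L using Finset.induction_on generalizing f with
  | empty => rw [iterD_empty, card_empty, if_pos (Nat.zero_le _), Nat.sub_zero, coeff_linSubst_inr]
  | insert s L hs ih =>
    rw [iterD_insert hD hs, ih, card_insert_of_notMem hs, hc, constDer_apply]
    by_cases h : #L + 1 ≤ l
    · rw [if_pos h, if_pos (by omega), show l - #L = (l - (#L + 1)) + 1 by omega, PowerSeries.coeff_succ_X_mul,
        coeff_coeffDer, ← coeff_linSubst_insert c (by simpa using hs)]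
      congr 2
      ext (a | a) <;> simp
    · rw [if_neg h]
      split_ifs with h'
      · rw [show l - #L = 0 by omega, PowerSeries.coeff_zero_X_mul, map_zero, coeff_zero]
      · rfl

lemma coeff_linSubst_prod_X {n : ℕ} (a : Fin n → Idx Γ) (U : Finset V) : (linSubst c (∏ i, X (a i))).coeff (sqf U) =
      ∑ e : Fin n ↪ V with univ.map e = U, ∏ j, c (e j) (a j) := by
  rw [← coeff_sqf_sum_embedding fun v : Fin n → V => ∏ j, c (v j) (a j), map_prod]
  simp_rw [linSubst, aeval_X]
  rw [Fintype.prod_sum]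
  simp_rw [prod_mul_distrib, map_prod]

lemma coeff_linSubst_freeSeries (F : Coefficients Γ) {U : Finset V} (hU : U.Nonempty) {d : ℕ} (hd : 1 ≤ d) :
    (linSubst c (coeff d (freeSeries F))).coeff (sqf U) = if #U ≤ d + 2 then
      (1 / ((#U).factorial : ℂ)) * ∑ e : Fin #U ↪ V with univ.map e = U, (F (d + 2 - #U) #U).sum fun a x => x * ∏ j, c (e j) (a j) else 0 := by
  have hU0 : #U ≠ 0 := card_ne_zero.2 hU
  have hterm : ∀ h n : ℕ, (linSubst c ((F h n).sum fun a x => C (x / (n.factorial : ℂ)) * ∏ i, X (a i))).coeff (sqf U) =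
      (1 / (n.factorial : ℂ)) * ∑ e : Fin n ↪ V with univ.map e = U, (F h n).sum fun a x => x * ∏ j, c (e j) (a j) := by
    intro h n
    simp only [Finsupp.sum]
    rw [map_sum, coeff_sum, sum_comm, mul_sum]
    refine sum_congr rfl fun a _ => ?_
    rw [map_mul, ← algebraMap_eq, AlgHom.commutes, algebraMap_eq, coeff_C_mul, coeff_linSubst_prod_X, ← mul_sum]
    ring
  have hzero : ∀ h n : ℕ, n ≠ #U → (linSubst c ((F h n).sum fun a x => C (x / (n.factorial : ℂ)) * ∏ i, X (a i))).coeff (sqf U) = 0 := by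
    intro h n hn
    rw [hterm, filter_false_of_mem, sum_empty, mul_zero]
    rintro e - rfl
    rw [card_map, card_univ, Fintype.card_fin] at hn
    exact hn rfl
  rw [freeSeries, PowerSeries.coeff_mk, if_neg (by omega), map_sum, coeff_sum]
  split_ifs with h
  · rw [sum_eq_single (d + 2 - #U, #U)]
    · rw [if_neg hU0, hterm]
    · rintro ⟨h', n⟩ hn hne
      dsimp only
      split_ifs with h0
      · rw [map_zero, coeff_zero]
      · refine hzero _ _ fun h1 => hne ?_
        rw [Finset.HasAntidiagonal.mem_antidiagonal] at hn
        simp only [Prod.mk.injEq]; omega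
    · intro h1
      rw [Finset.HasAntidiagonal.mem_antidiagonal] at h1
      omega
  · refine sum_eq_zero fun x hx => ?_
    rw [Finset.HasAntidiagonal.mem_antidiagonal] at hx
    split_ifs with h0
    · rw [map_zero, coeff_zero]
    · exact hzero _ _ (by omega)

end LinearSubstitution

lemma sum_box {M : Type*} [AddCommMonoid M] (B : ℕ) (g : ℤ → M) :
    ∑ p ∈ box B, g p = ∑ k ∈ range B, g ((k.succPNat : ℕ+) : ℤ) + (g 0 + ∑ k ∈ range B, g (-((k.succPNat : ℕ+) : ℤ))) := by
  induction B with
  | zero => simp [box]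
  | succ B ih =>
    have h : box (B + 1) = insert ((B : ℤ) + 1) (insert (-((B : ℤ) + 1)) (box B)) := by
      ext p
      simp only [box, mem_Icc, mem_insert]
      push_cast
      omega
    rw [h, sum_insert, sum_insert, ih, sum_range_succ, sum_range_succ]
    · simp only [Nat.succPNat_coe, Nat.succ_eq_add_one, Nat.cast_add, Nat.cast_one]
      abel
    · simp [box]
    · simp only [box, mem_Icc, mem_insert]
      omega

lemma coeff_linSubst_X {V : Type*} [Fintype V] [DecidableEq V] (c : V → Idx Γ → ℂ) (a : Idx Γ) (N : Finset V) :
    (linSubst c (X a)).coeff (sqf N) = if #N = 1 then ∑ b ∈ N, c b a else 0 := by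
  by_cases hN : #N = 1
  · obtain ⟨b, rfl⟩ := card_eq_one.1 hN
    rw [if_pos hN, sum_singleton, ← insert_empty_eq, coeff_linSubst_insert c (notMem_empty b), mkDerivation_X,
      sqf_empty, coeff_linSubst_zero, MvPolynomial.constantCoeff_C]
  · rw [if_neg hN, linSubst, aeval_X, coeff_sum]
    refine sum_eq_zero fun b _ => ?_
    rw [coeff_C_mul, MvPolynomial.coeff_X, if_neg, mul_zero]
    intro h
    have : sqf {b} = sqf N := by rw [← h]; simp [sqf]
    exact hN (by rw [← sqf_injective this, card_singleton])

lemma coeff_linSubst_C {V : Type*} [Fintype V] [DecidableEq V] (c : V → Idx Γ → ℂ) (a : ℂ) (N : Finset V) :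
    (linSubst c (C a)).coeff (sqf N) = if N = ∅ then a else 0 := by
  rw [← algebraMap_eq, AlgHom.commutes, algebraMap_eq, MvPolynomial.coeff_C, ← sqf_empty]
  simp_rw [sqf_injective.eq_iff, eq_comm]

namespace Correlators

/-- The point of a sheet, as a tangent vector. -/
def sheetPoint (_ : Correlators D) (q : ℂ) (s : Sheet D) : TB S := coordVec (D.ζ s.1) (sheetCoord D q s)

/-- The ratio between the tangent vectors `(x₀ - x(α)) ∂/∂x₀` and `∂/∂ζ`. -/
def sheetScale (_ : Correlators D) (q : ℂ) (s : Sheet D) : ℂ := 1 / (D.r s.1 : ℂ) * sheetCoord D q s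

/-- Truncation of the expansion of `ω_{0,1}`. -/
def approx01 (_ : Correlators D) (B : ℕ) (q : ℂ) (s : Sheet D) : ℂ :=
  ∑ k ∈ range B, 1 / (D.r s.1 : ℂ) * sheetCoord D q s ^ (k + 1) * D.F01 s.1 (k.succPNat : ℕ+)

/-- Truncation of the expansion of `ω_{1/2,1}`. -/
def approx11 (B : ℕ) (q : ℂ) (s : Sheet D) : ℂ :=
  1 / (D.r s.1 : ℂ) * W.Q s.1 + ∑ k ∈ range B, 1 / (D.r s.1 : ℂ) * sheetCoord D q s ^ (k + 1) * W.F11 (s.1, k.succPNat)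

/-- Truncation of the expansion of `ω_{0,2}` in its first variable. -/
def approx02Left (B : ℕ) (q : ℂ) (s : Sheet D) (t : TB S) : ℂ :=
  ∑ k ∈ range B, 1 / (D.r s.1 : ℂ) * sheetCoord D q s ^ (k + 1) * ((k + 1 : ℕ) * W.dxi (s.1, k.succPNat) t)

/-- Truncation of the expansion of `ω_{0,2}` in both variables. -/
def approx02 (B : ℕ) (q : ℂ) (s s' : Sheet D) : ℂ := ∑ k ∈ range B, 1 / (D.r s'.1 : ℂ) * sheetCoord D q s' ^ (k + 1) *
    ∑ l ∈ range B, 1 / (D.r s.1 : ℂ) * sheetCoord D q s ^ (l + 1) * W.F02 (s.1, l.succPNat) (s'.1, k.succPNat)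

/-- Truncation of the expansion of the differentials `dξ`. -/
def sheetVec (B : ℕ) (q : ℂ) (s : Sheet D) : Idx Γ → ℂ :=
  ∑ p ∈ box B, sheetWeight D q s p • W.creatorVec s.1 p + ∑ p ∈ box B, sheetWeight D q s p • W.annihVec s.1 p

lemma sheetWeight_neg (q : ℂ) (s : Sheet D) (k : ℕ) :
    sheetWeight D q s (-((k.succPNat : ℕ+) : ℤ)) = 1 / (D.r s.1 : ℂ) * sheetCoord D q s ^ (k + 1) := by
  rw [sheetWeight, neg_neg, zpow_natCast]; rfl

variable (hsym : W.IsSymm) (B : ℕ) (q : ℂ)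

lemma sheetFamily_mult (s : Sheet D) : (W.sheetFamily hsym B q).mult s =
    PowerSeries.C (C (W.approx01 B q s)) + PowerSeries.X * (PowerSeries.C (C (W.approx11 B q s) +
      ∑ k ∈ range B, (1 / (D.r s.1 : ℂ) * sheetCoord D q s ^ (k + 1) * (k + 1 : ℕ)) • X (s.1, k.succPNat))) := by
  have h3 : ∀ (c : ℂ) (f : CSeries Γ), c • f = PowerSeries.C (C c) * f := fun c f => by
    rw [Algebra.smul_def, PowerSeries.algebraMap_apply, algebraMap_eq]
  have hw : sheetWeight D q s 0 = 1 / (D.r s.1 : ℂ) := by rw [sheetWeight, neg_zero, zpow_zero, mul_one]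
  have e : ∀ (w a b k : ℂ) (x : CPoly Γ), w • (PowerSeries.C (C a) +
      PowerSeries.X * PowerSeries.C (C b + k • x) : CSeries Γ) = PowerSeries.C (C (w * a)) +
      (PowerSeries.X * PowerSeries.C (C (w * b)) + PowerSeries.X * PowerSeries.C ((w * k) • x)) := by
    intro w a b k x
    rw [h3]
    simp only [smul_eq_C_mul, map_mul, map_add]
    ring
  change ∑ p ∈ box B, _ = _
  rw [sum_box]
  simp only [multiplier_pos, smul_zero, sum_const_zero, zero_add, multiplier_zero, multiplier_neg, sheetWeight_neg, e, sum_add_distrib, hw]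
  simp only [h3, approx01, approx11, map_add, map_sum, map_mul, mul_add, mul_sum, Nat.succPNat_coe, Nat.succ_eq_add_one]
  ring

lemma sheetFamily_der_mult (s s' : Sheet D) : (W.sheetFamily hsym B q).der s ((W.sheetFamily hsym B q).mult s') =
    PowerSeries.X ^ 2 * PowerSeries.C (C (W.approx02 B q s s')) := by
  have h0 : ∀ b, (∑ p ∈ box B, sheetWeight D q s p • W.creatorVec s.1 p) b =
      ∑ l ∈ range B, 1 / (D.r s.1 : ℂ) * sheetCoord D q s ^ (l + 1) * (W.F02 (s.1, l.succPNat) b / ((b.2 : ℕ) : ℂ)) := by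
    intro b
    rw [Finset.sum_apply, sum_box]
    have h1 : ∀ p : ℤ, 0 ≤ p → W.creatorVec s.1 p b = 0 := fun p hp => dif_neg (by omega)
    simp only [Pi.smul_apply, h1 _ le_rfl, h1 _ (Int.natCast_nonneg _), smul_zero, mul_zero, sum_const_zero, zero_add, sheetWeight_neg,
      creatorVec_neg, smul_eq_mul]
  change constDer (∑ p ∈ box B, sheetWeight D q s p • W.creatorVec s.1 p) _ = _
  generalize (∑ p ∈ box B, sheetWeight D q s p • W.creatorVec s.1 p) = u at h0 ⊢
  rw [sheetFamily_mult, map_add, constDer_C_C, zero_add, constDer_X_mul, map_add, map_add, constDer_C_C, zero_add,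
    map_sum, map_sum, pow_two, mul_assoc]
  congr 1
  have h2 : ∀ k : ℕ, constDer u (PowerSeries.C ((1 / (D.r s'.1 : ℂ) * sheetCoord D q s' ^ (k + 1) * (k + 1 : ℕ)) • X (s'.1, k.succPNat)) : CSeries Γ) =
      PowerSeries.X * PowerSeries.C (C (1 / (D.r s'.1 : ℂ) * sheetCoord D q s' ^ (k + 1) *
    ∑ l ∈ range B, 1 / (D.r s.1 : ℂ) * sheetCoord D q s ^ (l + 1) * W.F02 (s.1, l.succPNat) (s'.1, k.succPNat))) := by
    intro k
    have hk : ((k + 1 : ℕ) : ℂ) ≠ 0 := mod_cast k.succ_ne_zero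
    rw [smul_eq_C_mul, map_mul, leibniz, constDer_C_C, constDer_var, smul_zero, add_zero, smul_eq_mul,
      mul_left_comm, ← map_mul, ← map_mul, h0, mul_assoc _ ((k + 1 : ℕ) : ℂ), mul_sum]
    congr 4
    refine sum_congr rfl fun l _ => ?_
    simp only [Nat.succPNat_coe, Nat.succ_eq_add_one]
    field_simp
  rw [sum_congr rfl fun k _ => h2 k, ← mul_sum, ← map_sum, ← map_sum]
  rfl

end Correlators

lemma evSet_singleton {Y : Type*} (η : ∀ n, MultiForm S n) (t : Y → TB S) (a : Y) : evSet η t {a} = ev (η 1) ![t a] := by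
  have h := (show IsSymmAt η t {a} from fun v _ _ τ => by
    have : Subsingleton (Fin #{a}) := by rw [card_singleton]; infer_instance
    rw [Subsingleton.elim τ 1]; rfl).ev_eq (k := 1) rfl (v := fun _ => a) (fun i j _ => Subsingleton.elim i j)
      fun _ => mem_singleton_self _
  rw [← h]
  congr 1
  ext1 i; fin_cases i; rfl

lemma evSet_pair {Y : Type*} [DecidableEq Y] (η : ∀ n, MultiForm S n) (t : Y → TB S) {a b : Y} (hab : a ≠ b)
    (hs : IsSymmAt η t {a, b}) : evSet η t {a, b} = ev (η 2) ![t a, t b] := by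
  rw [← hs.ev_eq (k := 2) (card_pair hab).symm (v := ![a, b])]
  · congr 1
    ext1 i; fin_cases i <;> rfl
  · intro i j h
    fin_cases i <;> fin_cases j <;> simp_all
  · intro i; fin_cases i <;> simp

namespace Correlators

/-- The expansions of the unstable correlators and of the differentials `dξ` on the sheets above the points close
to `x(α)`. -/
structure HasSheetExpansions : Prop where
  notMem : ∀ s, ∀ᶠ q in 𝓝[≠] 0, (W.sheetPoint q s).proj ∉ Γ.ramT
  ne : ∀ s s', s ≠ s' → ∀ᶠ q in 𝓝[≠] 0, (W.sheetPoint q s).proj ≠ (W.sheetPoint q s').proj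
  ne_of_notMem : ∀ s (t : TB S), t.proj ∉ Γ.ramT → ∀ᶠ q in 𝓝[≠] 0, (W.sheetPoint q s).proj ≠ t.proj
  form01 : ∀ s, AsympTo (fun q => W.sheetScale q s * ev (W.form 0 1) ![W.sheetPoint q s]) fun B q => W.approx01 B q s
  form11 : ∀ s, AsympTo (fun q => W.sheetScale q s * ev (W.form 1 1) ![W.sheetPoint q s]) fun B q => W.approx11 B q s
  form02_left : ∀ s (t : TB S), t.proj ∉ Γ.ramT →
    AsympTo (fun q => W.sheetScale q s * ev (W.form 0 2) ![W.sheetPoint q s, t]) fun B q => W.approx02Left B q s t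
  form02 : ∀ s s', s ≠ s' → AsympTo (fun q => W.sheetScale q s * W.sheetScale q s' * ev (W.form 0 2) ![W.sheetPoint q s, W.sheetPoint q s'])
      fun B q => W.approx02 B q s s' + sheetPair D s s'
  dxi : ∀ s a, AsympTo (fun q => W.sheetScale q s * W.dxi a (W.sheetPoint q s)) fun B q => W.sheetVec B q s a
  symm : W.IsSymm

variable {W}

lemma HasSheetExpansions.isSymmAt (H : W.HasSheetExpansions) {n : ℕ} {w : Fin n → TB S} (hw : ∀ j, (w j).proj ∉ Γ.ramT) :
    ∀ᶠ q in 𝓝[≠] 0, ∀ g, ∀ L : Finset (Sheet D), L.Nonempty → ∀ N, IsSymmAt (W.form g) (Sum.elim (W.sheetPoint q) w) (L.disjSum N) := by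
  have h1 : ∀ᶠ q in 𝓝[≠] 0, ∀ s, (W.sheetPoint q s).proj ∉ Γ.ramT := eventually_all.2 H.notMem
  have h2 : ∀ᶠ q in 𝓝[≠] 0, ∀ s s', s ≠ s' → (W.sheetPoint q s).proj ≠ (W.sheetPoint q s').proj := by
    refine eventually_all.2 fun s => eventually_all.2 fun s' => ?_
    by_cases h : s = s'
    · exact .of_forall fun q h' => absurd h h'
    · exact (H.ne s s' h).mono fun q hq _ => hq
  have h3 : ∀ᶠ q in 𝓝[≠] 0, ∀ s j, (W.sheetPoint q s).proj ≠ (w j).proj :=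
    eventually_all.2 fun s => eventually_all.2 fun j => H.ne_of_notMem s (w j) (hw j)
  filter_upwards [h1, h2, h3] with q h1 h2 h3 g L hL N v hv hvU τ
  have hc : #(L.disjSum N) ≠ 0 := card_ne_zero.2 (hL.elim fun s hs => ⟨_, inl_mem_disjSum.2 hs⟩)
  have hoff : ∀ y, (Sum.elim (W.sheetPoint q) w y).proj ∉ Γ.ramT := by
    rintro (s | j)
    · exact h1 s
    · exact hw j
  by_cases hst : 2 < g + #(L.disjSum N)
  · exact W.form_symm g _ (by omega) hst _ (fun i => hoff _) τ
  have himg : univ.image v = L.disjSum N := eq_of_subset_of_card_le (image_subset_iff.2 fun j _ => hvU j) (by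
      rw [card_image_of_injective _ hv, card_univ, Fintype.card_fin])
  obtain ⟨s₀, hs₀⟩ := hL
  obtain ⟨j₀, -, hj₀⟩ := mem_image.1 (himg.symm ▸ inl_mem_disjSum.2 hs₀ : Sum.inl s₀ ∈ univ.image v)
  generalize hm : #(L.disjSum N) = m at *
  obtain rfl | rfl : m = 1 ∨ m = 2 := by omega
  · rw [Subsingleton.elim τ 1]; rfl
  · obtain rfl : g = 0 := by omega
    have hne : ∀ j, j ≠ j₀ → (Sum.elim (W.sheetPoint q) w (v j₀)).proj ≠ (Sum.elim (W.sheetPoint q) w (v j)).proj := by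
      intro j hj
      have hvj : v j ≠ v j₀ := fun h => hj (hv h)
      rw [hj₀] at hvj ⊢
      rcases hvj' : v j with s | b
      · exact h2 _ _ fun h => hvj (by rw [hvj', h])
      · exact h3 _ _
    have hne01 : (Sum.elim (W.sheetPoint q) w (v 0)).proj ≠ (Sum.elim (W.sheetPoint q) w (v 1)).proj := by
      fin_cases j₀
      · exact hne 1 (by simp)
      · exact (hne 0 (by simp)).symm
    have e : ∀ u : Fin 2 → TB S, u = ![u 0, u 1] := fun u => by ext1 i; fin_cases i <;> rfl
    rw [e fun j => _, e fun j => Sum.elim (W.sheetPoint q) w (v j)]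
    have hτ : τ 0 = 0 ∧ τ 1 = 1 ∨ τ 0 = 1 ∧ τ 1 = 0 := by
      have h : ∀ a b : Fin 2, a ≠ b → a = 0 ∧ b = 1 ∨ a = 1 ∧ b = 0 := by decide
      exact h _ _ (τ.injective.ne (by simp))
    rcases hτ with ⟨h, h'⟩ | ⟨h, h'⟩
    · rw [h, h']
    · rw [h, h']
      exact (W.form02.symm _ _ hne01).symm

lemma coeff_block (hsym : W.IsSymm) (F : Coefficients Γ) (B : ℕ) (q : ℂ) {n : ℕ}
    (c : Fin n → Idx Γ → ℂ) {L : Finset (Sheet D)} (hL : L.Nonempty) (N : Finset (Fin n)) (l : ℕ) :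
    (coeff l (PowerSeries.map (linSubst c).toRingHom ((W.sheetFamily hsym B q).blockWeight (freeSeries F) L +
      pairWeight W.pairing L))).coeff (sqf N) = (if #L ≤ l then (linSubst (Sum.elim (W.sheetVec B q) c) (coeff (l - #L) (freeSeries F))).coeff
        (sqf (L.disjSum N)) else 0) +
      (linSubst c (coeff l (singleWeight (W.sheetFamily hsym B q).mult L))).coeff (sqf N) +
      (linSubst c (coeff l (pairWeight (fun s s' => PowerSeries.X ^ 2 * PowerSeries.C (C
        (W.approx02 B q s s'))) L + pairWeight W.pairing L))).coeff (sqf N) := by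
  have h := coeff_linSubst_iterD (Sum.elim (W.sheetVec B q) c) (W.sheetFamily hsym B q).tot_tot (fun s => by
    rw [OpFamily.tot]
    exact (map_add constDer _ _).symm) L N l (freeSeries F)
  rw [← h, OpFamily.blockWeight, if_neg hL.ne_empty]
  simp_rw [sheetFamily_der_mult]
  rw [PowerSeries.coeff_map]
  change (linSubst c _).coeff _ = _
  simp only [map_add, coeff_add, Sum.elim_inr]
  ring

lemma approx02_symm (hsym : W.IsSymm) (B : ℕ) (q : ℂ) (s s' : Sheet D) : W.approx02 B q s s' = W.approx02 B q s' s := by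
  simp only [approx02, mul_sum]
  rw [sum_comm]
  refine sum_congr rfl fun k _ => sum_congr rfl fun l _ => ?_
  rw [hsym]
  ring

variable (W)

lemma prod_elim_embedding {κ ι : Type*} {m : ℕ} (e : Fin m ↪ κ ⊕ ι) {L : Finset κ} {N : Finset ι}
    (he : univ.map e = L.disjSum N) (f : κ → ℂ) : ∏ j, Sum.elim f (fun _ => 1) (e j) = ∏ s ∈ L, f s := by
  have h1 := prod_map univ e (Sum.elim f fun _ => 1)
  rw [← h1, he, prod_disjSum]
  simp

lemma asympTo_stable (H : W.HasSheetExpansions) {F : Coefficients Γ} (hF : W.IsDecomposition F)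
    {n : ℕ} {w : Fin n → TB S} (hw : ∀ j, (w j).proj ∉ Γ.ramT) {L : Finset (Sheet D)} (hL : L.Nonempty) (N : Finset (Fin n)) {l : ℕ} (hl : #L < l) :
    AsympTo (fun q => if 2 * #L + #N ≤ l + 2 then (∏ s ∈ L, W.sheetScale q s) *
        evSet (W.form (l + 2 - 2 * #L - #N)) (Sum.elim (W.sheetPoint q) w) (L.disjSum N) else 0)
      fun B q => (linSubst (Sum.elim (W.sheetVec B q) fun b a => W.dxi a (w b)) (coeff (l - #L) (freeSeries F))).coeff (sqf (L.disjSum N)) := by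
  have hU : (L.disjSum N).Nonempty := hL.elim fun s hs => ⟨_, inl_mem_disjSum.2 hs⟩
  have hc : #(L.disjSum N) = #L + #N := card_disjSum _ _
  simp_rw [fun B q => coeff_linSubst_freeSeries (Sum.elim (W.sheetVec B q) fun b a => W.dxi a (w b)) F hU
    (d := l - #L) (by omega)]
  by_cases h : 2 * #L + #N ≤ l + 2
  swap
  · simp_rw [if_neg h, if_neg (show ¬ #(L.disjSum N) ≤ l - #L + 2 by omega)]
    exact AsympTo.const 0
  simp_rw [if_pos h, if_pos (show #(L.disjSum N) ≤ l - #L + 2 by omega)]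
  have hh : l - #L + 2 - #(L.disjSum N) = l + 2 - 2 * #L - #N := by omega
  rw [hh]
  set g := l + 2 - 2 * #L - #N with hg
  set k := #(L.disjSum N) with hk
  have hstab : 2 < g + k := by have := hL.card_pos; omega
  have hfac : ((k.factorial : ℕ) : ℂ) ≠ 0 := mod_cast k.factorial_ne_zero
  -- the approximation of the sum
  have h1 : AsympTo (fun q => (1 / (k.factorial : ℂ)) * ∑ e : Fin k ↪ (Sheet D ⊕ Fin n) with univ.map e = L.disjSum N,
        (F g k).sum fun a x => x * ∏ j, Sum.elim (fun s a => W.sheetScale q s * W.dxi a (W.sheetPoint q s)) (fun b a => W.dxi a (w b)) (e j) (a j))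
      fun B q => (1 / (k.factorial : ℂ)) * ∑ e : Fin k ↪ (Sheet D ⊕ Fin n) with univ.map e = L.disjSum N,
        (F g k).sum fun a x => x * ∏ j, Sum.elim (W.sheetVec B q) (fun b a => W.dxi a (w b)) (e j) (a j) := by
    refine (AsympTo.const _).mul (AsympTo.sum _ fun e _ => AsympTo.sum _ fun a _ => (AsympTo.const _).mul
      (AsympTo.prod _ fun j _ => ?_))
    rcases e j with s | b
    · exact H.dxi s (a j)
    · exact AsympTo.const _
  refine h1.congr ?_ fun B => .of_forall fun q => rfl
  filter_upwards [H.isSymmAt hw, eventually_all.2 H.notMem] with q hq hq'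
  have hoff : ∀ y, (Sum.elim (W.sheetPoint q) w y).proj ∉ Γ.ramT := by
    rintro (s | j)
    · exact hq' s
    · exact hw j
  have h2 : ∀ e ∈ ({e | univ.map e = L.disjSum N} : Finset (Fin k ↪ (Sheet D ⊕ Fin n))),
      ((F g k).sum fun a x => x * ∏ j, Sum.elim (fun s a => W.sheetScale q s * W.dxi a (W.sheetPoint q s)) (fun b a => W.dxi a (w b)) (e j) (a j)) =
      (∏ s ∈ L, W.sheetScale q s) * evSet (W.form g) (Sum.elim (W.sheetPoint q) w) (L.disjSum N) := by
    intro e he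
    have he' := (mem_filter.1 he).2
    rw [← (hq g L hL N).ev_eq (v := e) rfl e.injective (fun j => he' ▸ mem_map_of_mem e (mem_univ j)),
      hF g k (by have := hL.card_pos; omega) hstab _ fun i => hoff _, Finsupp.mul_sum]
    refine sum_congr rfl fun a _ => ?_
    dsimp only
    rw [← prod_elim_embedding e he', mul_left_comm, ← prod_mul_distrib]
    congr 1
    refine prod_congr rfl fun j _ => ?_
    rcases e j with s | b
    · rfl
    · exact (one_mul _).symm
  have h3 : (#({e | univ.map e = L.disjSum N} : Finset (Fin k ↪ (Sheet D ⊕ Fin n))) : ℂ) = k.factorial := by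
    rw [card_embedding_map_eq, if_pos rfl]
  rw [sum_congr rfl h2, sum_const, nsmul_eq_mul, h3, ← mul_assoc, one_div_mul_cancel hfac, one_mul]

lemma coeff_mult (hsym : W.IsSymm) (B : ℕ) (q : ℂ) {n : ℕ} (w : Fin n → TB S) (s : Sheet D) (N : Finset (Fin n)) (l : ℕ) :
    (linSubst (fun b a => W.dxi a (w b)) (coeff l ((W.sheetFamily hsym B q).mult s))).coeff (sqf N) =
      if l = 0 then (if N = ∅ then W.approx01 B q s else 0) else if l = 1 then
        (if N = ∅ then W.approx11 B q s else if #N = 1 then ∑ b ∈ N, W.approx02Left B q s (w b) else 0) else 0 := by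
  rw [sheetFamily_mult, map_add]
  rcases l with _ | _ | l
  · rw [if_pos rfl, PowerSeries.coeff_zero_X_mul, PowerSeries.coeff_zero_C, add_zero, coeff_linSubst_C]
  · rw [if_neg (by omega), if_pos rfl, PowerSeries.coeff_succ_X_mul, PowerSeries.coeff_zero_C, PowerSeries.coeff_C,
      if_neg (by omega), zero_add, map_add, coeff_add, coeff_linSubst_C, map_sum, coeff_sum]
    simp_rw [map_smul, MvPolynomial.coeff_smul, coeff_linSubst_X]
    by_cases h0 : N = ∅
    · subst h0; simp
    · rw [if_neg h0, if_neg h0, zero_add]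
      by_cases h1 : #N = 1
      · obtain ⟨b, rfl⟩ := card_eq_one.1 h1
        simp only [card_singleton, if_true, sum_singleton, approx02Left, smul_eq_mul, mul_assoc]
      · simp [h1]
  · rw [if_neg (by omega), if_neg (by omega), PowerSeries.coeff_succ_X_mul, PowerSeries.coeff_C, PowerSeries.coeff_C,
      if_neg (by omega), if_neg (by omega), add_zero, map_zero, coeff_zero]

lemma coeff_pairs (B : ℕ) (q : ℂ) {n : ℕ} (c : Fin n → Idx Γ → ℂ) (s s' : Sheet D) (N : Finset (Fin n)) (l : ℕ) :
    (linSubst c (coeff l (PowerSeries.X ^ 2 * PowerSeries.C (C (W.approx02 B q s s')) + W.pairing s s'))).coeff (sqf N) =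
      if l = 2 ∧ N = ∅ then W.approx02 B q s s' + sheetPair D s s' else 0 := by
  have h : PowerSeries.X ^ 2 * PowerSeries.C (C (W.approx02 B q s s')) + W.pairing s s' =
      PowerSeries.X ^ 2 * PowerSeries.C (C (W.approx02 B q s s' + sheetPair D s s')) := by
    rw [pairing, Algebra.smul_def, PowerSeries.algebraMap_apply, algebraMap_eq, map_add, map_add]
    ring
  rw [h, PowerSeries.coeff_X_pow_mul']
  by_cases hl : l = 2
  · subst hl
    rw [if_pos le_rfl, Nat.sub_self, PowerSeries.coeff_zero_C, coeff_linSubst_C]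
    simp
  · rw [if_neg (show ¬ (l = 2 ∧ N = ∅) from fun h' => hl h'.1)]
    split_ifs with h2
    · rw [PowerSeries.coeff_C, if_neg (by omega), map_zero, coeff_zero]
    · rw [map_zero, coeff_zero]

lemma asympSeries_formSeries (H : W.HasSheetExpansions) {F : Coefficients Γ}
    (hF : W.IsDecomposition F) {n : ℕ} {w : Fin n → TB S} (hw : ∀ j, (w j).proj ∉ Γ.ramT) {L : Finset (Sheet D)}
    (hL : L.Nonempty) : AsympSeries (fun q => formSeries W.form (Sum.elim (W.sheetPoint q) w) (W.sheetScale q) L)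
      fun B q => PowerSeries.map (linSubst fun b a => W.dxi a (w b)).toRingHom
        ((W.sheetFamily H.symm B q).blockWeight (freeSeries F) L + pairWeight W.pairing L) := by
  refine AsympSeries.of_sqf fun N l => ?_
  simp_rw [coeff_formSeries, coeff_block H.symm F _ _ _ hL]
  have hcard := hL.card_pos
  have hone : ∀ {s}, L = {s} → ∀ B q, singleWeight (W.sheetFamily H.symm B q).mult L = (W.sheetFamily H.symm B q).mult s := by
    rintro s rfl B q; exact singleWeight_singleton _ _
  have hnone : #L ≠ 1 → ∀ B q, singleWeight (W.sheetFamily H.symm B q).mult L = 0 := fun h B q => if_neg h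
  have hnpair : #L ≠ 2 → ∀ B q, pairWeight (fun s s' => PowerSeries.X ^ 2 * PowerSeries.C (C
        (W.approx02 B q s s'))) L + pairWeight W.pairing L = 0 := fun h B q => by
    rw [pairWeight_of_card_ne _ h, pairWeight_of_card_ne _ h, add_zero]
  have hpair : ∀ {s s'}, s ≠ s' → L = {s, s'} → ∀ B q, pairWeight (fun s s' => PowerSeries.X ^ 2 * PowerSeries.C (C
        (W.approx02 B q s s'))) L + pairWeight W.pairing L =
      PowerSeries.X ^ 2 * PowerSeries.C (C (W.approx02 B q s s')) + W.pairing s s' := by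
    rintro s s' hss rfl B q
    rw [pairWeight_pair (fun a b => by rw [approx02_symm H.symm]) hss, pairWeight_pair (fun a b => by rw [pairing, pairing, sheetPair_symm]) hss]
  by_cases hl : #L < l
  · -- stable correlators
    refine (W.asympTo_stable H hF hw hL N hl).congr (.of_forall fun q => rfl) fun B => .of_forall fun q => ?_
    have e1 : (linSubst (fun b a => W.dxi a (w b)) (coeff l (singleWeight (W.sheetFamily H.symm B q).mult L))).coeff
        (sqf N) = 0 := by
      by_cases h1 : #L = 1
      · obtain ⟨s, hs⟩ := card_eq_one.1 h1
        rw [hone hs, coeff_mult, if_neg (by omega), if_neg (by omega)]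
      · rw [hnone h1, map_zero, map_zero, coeff_zero]
    have e2 : (linSubst (fun b a => W.dxi a (w b)) (coeff l (pairWeight (fun s s' => PowerSeries.X ^ 2 *
        PowerSeries.C (C (W.approx02 B q s s'))) L + pairWeight W.pairing L))).coeff (sqf N) = 0 := by
      by_cases h1 : #L = 2
      · obtain ⟨s, s', hss, hs⟩ := card_eq_two.1 h1
        rw [hpair hss hs, coeff_pairs, if_neg (by omega)]
      · rw [hnpair h1, map_zero, map_zero, coeff_zero]
    rw [e1, e2, if_pos (by omega), add_zero, add_zero]
  have e0 : ∀ B q, (if #L ≤ l then (linSubst (Sum.elim (W.sheetVec B q) fun b a => W.dxi a (w b))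
      (coeff (l - #L) (freeSeries F))).coeff (sqf (L.disjSum N)) else 0) = 0 := by
    intro B q
    split_ifs with h
    · rw [show l - #L = 0 by omega, PowerSeries.coeff_zero_eq_constantCoeff_apply, constantCoeff_freeSeries, map_zero, coeff_zero]
    · rfl
  simp_rw [e0, zero_add]
  have hsy := H.isSymmAt hw
  rcases Nat.lt_trichotomy #L 2 with h | h | h
  · obtain ⟨s, rfl⟩ := card_eq_one.1 (show #L = 1 by omega)
    simp_rw [hnpair (by omega), map_zero, coeff_zero, add_zero, singleWeight_singleton, coeff_mult, card_singleton, prod_singleton]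
    obtain rfl | rfl : l = 0 ∨ l = 1 := by rw [card_singleton] at hl; omega
    · by_cases hN : N = ∅
      · subst hN
        refine (H.form01 s).congr (.of_forall fun q => ?_) fun B => .of_forall fun q => ?_
        · have e : ({s} : Finset (Sheet D)).disjSum (∅ : Finset (Fin n)) = {Sum.inl s} := rfl
          simp [e, evSet_singleton]
        · simp
      · have := card_pos.2 (nonempty_iff_ne_empty.2 hN)
        simp_rw [if_neg (show ¬ 2 * 1 + #N ≤ 0 + 2 by omega), if_pos trivial, if_neg hN]
        exact AsympTo.const 0
    · simp_rw [if_neg one_ne_zero, if_pos trivial]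
      by_cases hN : N = ∅
      · subst hN
        refine (H.form11 s).congr (.of_forall fun q => ?_) fun B => .of_forall fun q => ?_
        · have e : ({s} : Finset (Sheet D)).disjSum (∅ : Finset (Fin n)) = {Sum.inl s} := rfl
          simp [e, evSet_singleton]
        · simp
      · by_cases hN1 : #N = 1
        · obtain ⟨b, rfl⟩ := card_eq_one.1 hN1
          refine (H.form02_left s (w b) (hw b)).congr ?_ fun B => .of_forall fun q => ?_
          · filter_upwards [hsy] with q hq
            have e : ({s} : Finset (Sheet D)).disjSum ({b} : Finset (Fin n)) = {Sum.inl s, Sum.inr b} := by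
              ext (a | a) <;> simp
            have hq' := hq 0 {s} (singleton_nonempty s) {b}
            rw [e] at hq'
            simp [e, evSet_pair _ _ (by simp : (Sum.inl s : Sheet D ⊕ Fin n) ≠ Sum.inr b) hq']
          · simp
        · have := card_pos.2 (nonempty_iff_ne_empty.2 hN)
          simp_rw [if_neg (show ¬ 2 * 1 + #N ≤ 1 + 2 by omega), if_neg hN, if_neg hN1]
          exact AsympTo.const 0
  · obtain ⟨s, s', hss, rfl⟩ := card_eq_two.1 h
    simp_rw [hnone (by omega), hpair hss rfl, map_zero, coeff_zero, zero_add, coeff_pairs, h]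
    by_cases hlN : l = 2 ∧ N = ∅
    · obtain ⟨rfl, rfl⟩ := hlN
      refine (H.form02 s s' hss).congr ?_ fun B => .of_forall fun q => ?_
      · filter_upwards [hsy] with q hq
        have e : ({s, s'} : Finset (Sheet D)).disjSum (∅ : Finset (Fin n)) = {Sum.inl s, Sum.inl s'} := by
          ext (a | a) <;> simp
        have hq' := hq 0 {s, s'} hL ∅
        rw [e] at hq'
        simp [e, evSet_pair _ _ (by simpa using hss : (Sum.inl s : Sheet D ⊕ Fin n) ≠ Sum.inl s') hq', prod_pair hss]
      · simp
    · simp_rw [if_neg hlN]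
      have : ¬ 2 * 2 + #N ≤ l + 2 := by
        intro hcon
        exact hlN ⟨by omega, card_eq_zero.1 (by omega)⟩
      simp_rw [if_neg this]
      exact AsympTo.const 0
  · simp_rw [hnone (by omega), hnpair (by omega), map_zero, coeff_zero, add_zero, if_neg (show ¬ 2 * #L + #N ≤ l + 2 by omega)]
    exact AsympTo.const 0

end Correlators

/-- The integral of `f` along small circles around `0` is `2 π i r`. -/
def HasRes (f : ℂ → ℂ) (r : ℂ) : Prop := ∀ᶠ ρ in 𝓝[>] (0 : ℝ), CircleIntegrable f 0 ρ ∧ (2 * (Real.pi : ℂ) * I)⁻¹ * ∮ w in C(0, ρ), f w = r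

lemma eventually_circle {p : ℂ → Prop} (h : ∀ᶠ w in 𝓝[≠] 0, p w) : ∀ᶠ ρ in 𝓝[>] (0 : ℝ), ∀ w ∈ Metric.sphere (0 : ℂ) ρ, p w := by
  obtain ⟨ε, hε, h⟩ := Metric.mem_nhdsWithin_iff.1 h
  filter_upwards [Ioo_mem_nhdsGT hε] with ρ hρ w hw
  refine h ⟨?_, ?_⟩
  · rw [Metric.mem_ball, Metric.mem_sphere.1 hw]; exact hρ.2
  · rintro rfl
    rw [Metric.mem_sphere, dist_self] at hw
    exact hρ.1.ne hw

namespace HasRes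

variable {f g : ℂ → ℂ} {a b : ℂ}

lemma residue_eq (h : HasRes f a) : residue f = a := Tendsto.limUnder_eq (tendsto_const_nhds.congr' (h.mono fun _ hρ => hρ.2.symm))

lemma congr (h : HasRes f a) (hfg : f =ᶠ[𝓝[≠] 0] g) : HasRes g a := by
  filter_upwards [h, eventually_circle hfg, self_mem_nhdsWithin] with ρ h1 h2 hρ
  have e : f =ᶠ[codiscreteWithin (Metric.sphere 0 |ρ|)] g := by
    filter_upwards [self_mem_codiscreteWithin _] with w hw
    exact h2 w (by rwa [abs_of_pos hρ] at hw)
  exact ⟨(circleIntegrable_congr_codiscreteWithin e).1 h1.1, by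
    rw [← h1.2, circleIntegral.integral_congr (le_of_lt hρ) fun w hw => h2 w hw]⟩

lemma add (hf : HasRes f a) (hg : HasRes g b) : HasRes (fun w => f w + g w) (a + b) := by
  filter_upwards [hf, hg] with ρ h1 h2
  exact ⟨h1.1.add h2.1, by rw [circleIntegral.integral_add h1.1 h2.1, mul_add, h1.2, h2.2]⟩

lemma const_mul (hf : HasRes f a) (c : ℂ) : HasRes (fun w => c * f w) (c * a) := by
  filter_upwards [hf] with ρ h1
  exact ⟨h1.1.const_fun_smul, by rw [circleIntegral.integral_const_mul, mul_left_comm, h1.2]⟩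

lemma sum {ι : Type*} {s : Finset ι} {f : ι → ℂ → ℂ} {a : ι → ℂ} (h : ∀ i ∈ s, HasRes (f i) (a i)) :
    HasRes (fun w => ∑ i ∈ s, f i w) (∑ i ∈ s, a i) := by
  induction s using cons_induction with
  | empty => exact .of_forall fun ρ => ⟨by simp, by simp [circleIntegral]⟩
  | cons i s hi ih =>
    simp_rw [sum_cons]
    exact (h i (mem_cons_self i s)).add (ih fun j hj => h j (mem_cons_of_mem hj))

lemma of_analyticAt (h : AnalyticAt ℂ f 0) : HasRes f 0 := by
  obtain ⟨ε, hε, h⟩ := Metric.eventually_nhds_iff_ball.1 h.eventually_analyticAt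
  filter_upwards [Ioo_mem_nhdsGT hε] with ρ hρ
  have hd : ∀ w ∈ Metric.closedBall (0 : ℂ) ρ, DifferentiableAt ℂ f w := fun w hw => (h w (Metric.closedBall_subset_ball hρ.2 hw)).differentiableAt
  refine ⟨ContinuousOn.circleIntegrable hρ.1.le fun w hw => (hd w (Metric.sphere_subset_closedBall hw)).continuousAt.continuousWithinAt, ?_⟩
  rw [Complex.circleIntegral_eq_zero_of_differentiable_on_off_countable hρ.1.le Set.countable_empty
    (fun w hw => (hd w hw).continuousAt.continuousWithinAt)
    fun w hw => hd w (Metric.ball_subset_closedBall hw.1), mul_zero]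

lemma zpow (n : ℤ) : HasRes (fun w => w ^ n) (if n = -1 then 1 else 0) := by
  filter_upwards [self_mem_nhdsWithin] with ρ hρ
  have hρ' : ρ ≠ 0 := ne_of_gt hρ
  refine ⟨by simpa using (circleIntegrable_sub_zpow_iff (c := 0) (w := 0) (R := ρ) (n := n)).2 (by
    simp [hρ', Ne.symm hρ', (abs_pos.2 hρ').ne]), ?_⟩
  by_cases hn : n = -1
  · subst hn
    have := circleIntegral.integral_sub_center_inv (0 : ℂ) hρ'
    simp only [sub_zero] at this
    simp only [zpow_neg_one, this, if_true]
    exact inv_mul_cancel₀ Complex.two_pi_I_ne_zero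
  · have := circleIntegral.integral_sub_zpow_of_ne hn 0 0 ρ
    simp only [sub_zero] at this
    rw [this, mul_zero, if_neg hn]

end HasRes

lemma residue_congr {f g : ℂ → ℂ} (h : f =ᶠ[𝓝[≠] 0] g) : residue f = residue g := by
  refine congrArg lim (Filter.map_congr ?_)
  filter_upwards [eventually_circle h, self_mem_nhdsWithin] with ρ h hρ
  rw [circleIntegral.integral_congr (le_of_lt hρ) fun w hw => h w hw]

lemma laurentCoeff_congr {f g : ℂ → ℂ} (h : f =ᶠ[𝓝[≠] 0] g) (k : ℤ) : laurentCoeff f k = laurentCoeff g k :=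
  residue_congr (h.mono fun w hw => by simp only [hw])

lemma laurentCoeff_mul_zpow {f g : ℂ → ℂ} (m : ℤ) (h : g =ᶠ[𝓝[≠] 0] fun w => w ^ m * f w) (k : ℤ) : laurentCoeff g k = laurentCoeff f (k - m) := by
  refine residue_congr ?_
  filter_upwards [h, self_mem_nhdsWithin] with w hw hw0
  rw [hw, mul_comm (w ^ m), mul_assoc, ← zpow_add₀ hw0]
  ring_nf

lemma AnalyticAt.exists_taylor {f : ℂ → ℂ} (hf : AnalyticAt ℂ f 0) :
    ∃ c : ℕ → ℂ, ∀ M, ∃ g : ℂ → ℂ, AnalyticAt ℂ g 0 ∧ ∀ w, f w = ∑ k ∈ range M, c k * w ^ k + w ^ M * g w := by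
  obtain ⟨p, hp⟩ := hf
  refine ⟨fun k => ((fun g => dslope g 0)^[k] f) 0, fun M => ⟨(fun g => dslope g 0)^[M] f,
    ⟨_, hp.has_fpower_series_iterate_dslope_fslope M⟩, fun w => ?_⟩⟩
  induction M with
  | zero => simp
  | succ M ih =>
    have h := sub_smul_dslope ((fun g => dslope g 0)^[M] f) 0 w
    rw [sub_zero, smul_eq_mul] at h
    rw [ih, sum_range_succ, iterate_succ_apply', pow_succ, mul_assoc, h]
    ring

lemma MeromorphicAt.exists_laurent {f : ℂ → ℂ} (hf : MeromorphicAt f 0) :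
    ∃ n : ℕ, (∀ k < -(n : ℤ), laurentCoeff f k = 0) ∧ (∀ k, HasRes (fun w => f w * w ^ (-k - 1)) (laurentCoeff f k)) ∧
      ∀ M : ℕ, ∃ g : ℂ → ℂ, AnalyticAt ℂ g 0 ∧
        ∀ᶠ w in 𝓝[≠] 0, f w = ∑ k ∈ range M, laurentCoeff f (k - n) * w ^ ((k : ℤ) - n) + w ^ ((M : ℤ) - n) * g w := by
  obtain ⟨n, hn⟩ := hf
  simp only [sub_zero, smul_eq_mul] at hn
  obtain ⟨c, hc⟩ := AnalyticAt.exists_taylor hn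
  have hf : ∀ M : ℕ, ∃ g : ℂ → ℂ, AnalyticAt ℂ g 0 ∧ ∀ w ≠ 0, f w = ∑ k ∈ range M, c k * w ^ ((k : ℤ) - n) + w ^ ((M : ℤ) - n) * g w := by
    intro M
    obtain ⟨g, hg, h⟩ := hc M
    refine ⟨g, hg, fun w hw => mul_left_cancel₀ (pow_ne_zero n hw) ?_⟩
    rw [h, mul_add, mul_sum]
    congr 1
    · refine sum_congr rfl fun k _ => ?_
      rw [mul_left_comm, ← zpow_natCast w n, ← zpow_add₀ hw, add_sub_cancel, zpow_natCast]
    · rw [← mul_assoc, ← zpow_natCast w n, ← zpow_add₀ hw, add_sub_cancel, zpow_natCast]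
  have hres : ∀ k : ℤ, HasRes (fun w => f w * w ^ (-k - 1)) (if 0 ≤ k + n then c (k + n).toNat else 0) := by
    intro k
    obtain ⟨g, hg, h⟩ := hf ((k + n).toNat + 1)
    have h1 : HasRes (fun w => ∑ j ∈ range ((k + n).toNat + 1), c j * w ^ ((j : ℤ) - n - k - 1) + w ^ ((k + n).toNat - (k + n)).toNat * g w) _ :=
      (HasRes.sum fun (j : ℕ) _ => (HasRes.zpow ((j : ℤ) - n - k - 1)).const_mul (c j)).add
        (HasRes.of_analyticAt ((analyticAt_id.pow _).mul hg))
    have h2 := h1.congr (g := fun w => f w * w ^ (-k - 1)) (by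
      filter_upwards [self_mem_nhdsWithin] with w hw
      rw [h w hw, add_mul, sum_mul]
      congr 1
      · refine sum_congr rfl fun j _ => ?_
        rw [mul_assoc, ← zpow_add₀ hw]
        ring_nf
      · rw [mul_right_comm, ← zpow_add₀ hw, ← zpow_natCast w]
        congr 2
        push_cast
        omega)
    convert h2 using 1
    rw [add_zero]
    by_cases hk : 0 ≤ k + n
    · rw [if_pos hk, sum_eq_single_of_mem (k + n).toNat (self_mem_range_succ _), if_pos (by omega), mul_one]
      intro j _ hj
      rw [if_neg (by omega), mul_zero]
    · rw [if_neg hk]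
      refine (sum_eq_zero fun j _ => ?_).symm
      rw [if_neg (by omega), mul_zero]
  have hL : ∀ k : ℤ, laurentCoeff f k = if 0 ≤ k + n then c (k + n).toNat else 0 := fun k => (hres k).residue_eq
  refine ⟨n, fun k hk => by rw [hL, if_neg (by omega)], fun k => by rw [hL]; exact hres k, fun M => ?_⟩
  obtain ⟨g, hg, h⟩ := hf M
  refine ⟨g, hg, eventually_nhdsWithin_of_forall fun w hw => ?_⟩
  rw [h w hw]
  congr 1
  refine sum_congr rfl fun k _ => ?_
  rw [hL, if_pos (by omega), sub_add_cancel, Int.toNat_natCast]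

lemma MeromorphicAt.hasRes {f : ℂ → ℂ} (hf : MeromorphicAt f 0) : HasRes f (residue f) := by
  obtain ⟨n, -, h, -⟩ := MeromorphicAt.exists_laurent hf
  have := h (-1)
  simpa [laurentCoeff] using this

lemma MeromorphicAt.laurent_eq {f : ℂ → ℂ} (hf : MeromorphicAt f 0) {m : ℤ} (hm : ∀ k < m, laurentCoeff f k = 0) (B : ℕ) :
    ∃ g : ℂ → ℂ, AnalyticAt ℂ g 0 ∧ ∀ᶠ w in 𝓝[≠] 0, f w = ∑ k ∈ range B, laurentCoeff f (m + k) * w ^ (m + k) + w ^ (m + B) * g w := by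
  obtain ⟨n, hn, -, h⟩ := MeromorphicAt.exists_laurent hf
  -- both expansions are truncations of the expansion from `-d`
  obtain ⟨g, hg, h⟩ := h (m + n + B).toNat
  refine ⟨fun w => w ^ ((m + n + B).toNat - (m + n + B)).toNat * g w, (analyticAt_id.pow _).mul hg, ?_⟩
  filter_upwards [h, self_mem_nhdsWithin] with w hw hw0
  rw [hw]
  congr 1
  · have e1 : ∑ k ∈ range (m + n + B).toNat, laurentCoeff f (k - n) * w ^ ((k : ℤ) - n) =
        ∑ j ∈ Finset.Ico (-(n : ℤ)) (m + B), laurentCoeff f j * w ^ j := by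
      refine sum_bij_ne_zero (fun k _ _ => (k : ℤ) - n) ?_ ?_ ?_ ?_
      · intro k hk _
        have := mem_range.1 hk
        exact mem_Ico.2 ⟨by omega, by omega⟩
      · intros; omega
      · intro j hj _
        have := mem_Ico.1 hj
        exact ⟨(j + n).toNat, mem_range.2 (by omega), by
          rwa [show (((j + n).toNat : ℕ) : ℤ) - n = j by omega], by omega⟩
      · intros; rfl
    have e2 : ∑ k ∈ range B, laurentCoeff f (m + k) * w ^ (m + (k : ℤ)) = ∑ j ∈ Finset.Ico (-(n : ℤ)) (m + B), laurentCoeff f j * w ^ j := by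
      refine sum_bij_ne_zero (fun k _ _ => m + (k : ℤ)) ?_ ?_ ?_ ?_
      · intro k hk hne
        have := mem_range.1 hk
        refine mem_Ico.2 ⟨?_, by omega⟩
        by_contra hlt
        exact hne (by rw [hn _ (by omega), zero_mul])
      · intros; omega
      · intro j hj hne
        have := mem_Ico.1 hj
        have hmj : m ≤ j := by
          by_contra hlt
          exact hne (by rw [hm _ (by omega), zero_mul])
        exact ⟨(j - m).toNat, mem_range.2 (by omega), by
          rwa [show m + (((j - m).toNat : ℕ) : ℤ) = j by omega], by omega⟩
      · intros; rfl
    rw [e1, e2]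
  · rw [← mul_assoc, ← zpow_natCast w, ← zpow_add₀ hw0]
    congr 2
    omega

lemma AnalyticAt.laurentCoeff_of_neg {f : ℂ → ℂ} (hf : AnalyticAt ℂ f 0) {k : ℤ} (hk : k < 0) : laurentCoeff f k = 0 := by
  refine ((HasRes.of_analyticAt (hf.mul (analyticAt_id.pow (-k - 1).toNat))).congr ?_).residue_eq
  refine .of_forall fun w => ?_
  simp only [Pi.mul_apply, Pi.pow_apply, id]
  rw [← zpow_natCast w, Int.toNat_of_nonneg (by omega)]

lemma AnalyticAt.taylor_eq {f : ℂ → ℂ} (hf : AnalyticAt ℂ f 0) (B : ℕ) : ∃ g : ℂ → ℂ, AnalyticAt ℂ g 0 ∧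
      ∀ᶠ w in 𝓝 0, f w = ∑ k ∈ range B, laurentCoeff f k * w ^ k + w ^ B * g w := by
  obtain ⟨g, hg, h⟩ := MeromorphicAt.laurent_eq hf.meromorphicAt (m := 0) (fun k hk => AnalyticAt.laurentCoeff_of_neg hf hk) B
  refine ⟨g, hg, ?_⟩
  simp only [zero_add, zpow_natCast] at h
  have := (AnalyticAt.frequently_eq_iff_eventually_eq hf (g := fun w => ∑ k ∈ range B, laurentCoeff f k * w ^ k + w ^ B * g w)
    (by fun_prop)).1 h.frequently
  exact this

section Division

variable {E : Type*} [NormedAddCommGroup E] [NormedSpace ℂ E]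

/-- The power series of the quotient of `F - F ∘ π` by `ℓ`, where `v = ℓ v • e + π v`. -/
def divSeries (p : FormalMultilinearSeries ℂ E ℂ) (e : E) (π : E →L[ℂ] E) : FormalMultilinearSeries ℂ E ℂ := fun n =>
  ∑ k : Fin (n + 1), ((p (n + 1)).curryMid k e).compContinuousLinearMap fun j => if j.castSucc < k then ContinuousLinearMap.id ℂ E else π

lemma mul_divSeries (p : FormalMultilinearSeries ℂ E ℂ) {e : E} {π : E →L[ℂ] E} {ℓ : E →L[ℂ] ℂ}
    (h : ∀ v, v = ℓ v • e + π v) (n : ℕ) (v : E) : ℓ v * divSeries p e π n (fun _ => v) = p (n + 1) (fun _ => v) - p (n + 1) (fun _ => π v) := by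
  have hk : ∀ k : Fin (n + 1), ℓ v * ((p (n + 1)).curryMid k e).compContinuousLinearMap (fun j =>
      if j.castSucc < k then ContinuousLinearMap.id ℂ E else π) (fun _ => v) =
      p (n + 1) (fun j => if (j : ℕ) < k + 1 then v else π v) - p (n + 1) (fun j => if (j : ℕ) < k then v else π v) := by
    intro k
    have e1 : ∀ x : E, Fin.insertNth k x (fun j : Fin n => if j.castSucc < k then v else π v) =
        update (fun j : Fin (n + 1) => if (j : ℕ) < k then v else π v) k x := by
      intro x
      refine Fin.insertNth_eq_iff.2 ⟨by rw [update_self], ?_⟩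
      ext1 j
      rw [Fin.removeNth, update_of_ne (Fin.succAbove_ne k j)]
      exact if_congr (by rw [← Fin.lt_def, Fin.succAbove_lt_iff_castSucc_lt]) rfl rfl
    have e2 : (fun j : Fin (n + 1) => if (j : ℕ) < k + 1 then v else π v) = update (fun j : Fin (n + 1) => if (j : ℕ) < k then v else π v) k v := by
      ext1 j
      by_cases hj : j = k
      · subst hj; simp
      · have : (j : ℕ) ≠ k := fun h => hj (Fin.ext h)
        rw [update_of_ne hj]
        exact if_congr (by omega) rfl rfl
    have e3 : (fun j : Fin (n + 1) => if (j : ℕ) < k then v else π v) = update (fun j : Fin (n + 1) => if (j : ℕ) < k then v else π v) k (π v) := by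
      rw [eq_comm, update_eq_iff]
      simp
    have e4 : (fun j : Fin n => (if j.castSucc < k then ContinuousLinearMap.id ℂ E else π) v) = fun j => if j.castSucc < k then v else π v := by
      ext1 j; split_ifs <;> rfl
    rw [ContinuousMultilinearMap.compContinuousLinearMap_apply, ContinuousMultilinearMap.curryMid_apply, e4, e1, e2]
    conv_rhs => rw [e3]
    simp only [update_idem]
    rw [← ContinuousMultilinearMap.map_update_sub, ← smul_eq_mul, ← ContinuousMultilinearMap.map_update_smul]
    congr 2
    rw [eq_sub_iff_add_eq, ← h]
  rw [divSeries, _root_.sum_apply, mul_sum, sum_congr rfl fun k _ => hk k,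
    Fin.sum_univ_eq_sum_range (fun k => p (n + 1) (fun j => if (j : ℕ) < k + 1 then v else π v) -
      p (n + 1) (fun j => if (j : ℕ) < k then v else π v)) (n + 1), sum_range_sub
      fun k => p (n + 1) fun j => if (j : ℕ) < k then v else π v]
  simp [fun j : Fin (n + 1) => Nat.lt_succ_iff.1 j.2]

lemma norm_divSeries_le (p : FormalMultilinearSeries ℂ E ℂ) (e : E) {π : E →L[ℂ] E} (hπ : ‖π‖ ≤ 1) (n : ℕ) :
    ‖divSeries p e π n‖ ≤ (n + 1) * (‖p (n + 1)‖ * ‖e‖) := by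
  refine (norm_sum_le _ _).trans ((sum_le_sum fun k _ => ?_).trans_eq (b := ∑ _k : Fin (n + 1), ‖p (n + 1)‖ * ‖e‖) (by simp))
  refine (ContinuousMultilinearMap.norm_compContinuousLinearMap_le _ _).trans ?_
  refine (mul_le_mul_of_nonneg_left (prod_le_one (fun _ _ => norm_nonneg _) fun j _ => ?_) (norm_nonneg _)).trans ?_
  · split_ifs
    · exact ContinuousLinearMap.norm_id_le
    · exact hπ
  · rw [mul_one]
    exact (((p (n + 1)).curryMid k).le_opNorm e).trans (mul_le_mul_of_nonneg_right
      (by rw [ContinuousMultilinearMap.norm_curryMid]) (norm_nonneg _))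

lemma AnalyticAt.exists_div {F : E → ℂ} (hF : AnalyticAt ℂ F 0) {e : E} {π : E →L[ℂ] E} {ℓ : E →L[ℂ] ℂ} (h : ∀ v, v = ℓ v • e + π v) (hπ : ‖π‖ ≤ 1) :
    ∃ g : E → ℂ, AnalyticAt ℂ g 0 ∧ ∀ᶠ v in 𝓝 0, F v = F (π v) + ℓ v * g v := by
  obtain ⟨p, r, hp⟩ := hF
  obtain ⟨C, a, ha, hC⟩ : ∃ C a : ℝ, 0 < a ∧ ∀ n, ‖p n‖ ≤ C * a ^ n := by
    obtain ⟨C, a, -, ha, hC⟩ := p.le_mul_pow_of_radius_pos (hp.r_pos.trans_le hp.r_le)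
    exact ⟨C, a, ha, hC⟩
  have hrad : 0 < (divSeries p e π).radius := by
    refine lt_of_lt_of_le ?_ ((divSeries p e π).le_radius_of_bound (C * a * ‖e‖) (r := ⟨(2 * a)⁻¹, by positivity⟩) fun n => ?_)
    · exact ENNReal.coe_pos.2 (show (0 : ℝ) < (2 * a)⁻¹ by positivity)
    · have h2 : ((n : ℝ) + 1) ≤ 2 ^ n := mod_cast Nat.lt_two_pow_self
      have hC0 : 0 ≤ C * a ^ (n + 1) := (norm_nonneg _).trans (hC (n + 1))
      calc ‖divSeries p e π n‖ * ((2 * a)⁻¹) ^ n ≤ (2 ^ n * (C * a ^ (n + 1) * ‖e‖)) * ((2 * a)⁻¹) ^ n := by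
            refine mul_le_mul_of_nonneg_right ((norm_divSeries_le p e hπ n).trans (mul_le_mul h2
              (mul_le_mul_of_nonneg_right (hC _) (norm_nonneg _)) (by positivity) (by positivity))) (by positivity)
        _ = C * a * ‖e‖ := by
            rw [inv_pow, mul_pow]
            field_simp
            ring
  have hq := (divSeries p e π).hasFPowerSeriesOnBall hrad
  refine ⟨_, hq.analyticAt, ?_⟩
  have hball : ∀ᶠ v in 𝓝 (0 : E), v ∈ Metric.eball (0 : E) r := Metric.eball_mem_nhds 0 hp.r_pos
  have hball' : ∀ᶠ v in 𝓝 (0 : E), π v ∈ Metric.eball (0 : E) r := (π.continuous.tendsto' 0 0 (map_zero π)).eventually hball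
  filter_upwards [hball, hball', Metric.eball_mem_nhds 0 hq.r_pos] with v h1 h2 h3
  have s1 := (hasSum_nat_add_iff' 1).2 (hp.hasSum h1)
  have s2 := (hasSum_nat_add_iff' 1).2 (hp.hasSum h2)
  have s3 := (hq.hasSum h3).mul_left (ℓ v)
  simp_rw [mul_divSeries p h] at s3
  have := s3.unique (s1.sub s2)
  simp only [zero_add, range_one, sum_singleton] at this
  rw [this, Subsingleton.elim (fun _ : Fin 0 => v) fun _ => π v]
  ring

variable {F : ℂ × ℂ → ℂ}

lemma AnalyticAt.exists_div_fst (hF : AnalyticAt ℂ F 0) : ∃ g : ℂ × ℂ → ℂ, AnalyticAt ℂ g 0 ∧ ∀ᶠ v in 𝓝 0, F v = F (0, v.2) + v.1 * g v :=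
  AnalyticAt.exists_div hF (e := (1, 0)) (π := (0 : ℂ × ℂ →L[ℂ] ℂ).prod (ContinuousLinearMap.snd ℂ ℂ ℂ))
    (ℓ := ContinuousLinearMap.fst ℂ ℂ ℂ) (fun v => by ext <;> simp)
    (ContinuousLinearMap.opNorm_le_bound _ zero_le_one fun v => by simp [Prod.norm_def])

lemma AnalyticAt.exists_div_sub (hF : AnalyticAt ℂ F 0) :
    ∃ g : ℂ × ℂ → ℂ, AnalyticAt ℂ g 0 ∧ ∀ᶠ v in 𝓝 0, F v = F (v.2, v.2) + (v.1 - v.2) * g v := by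
  have hF' : AnalyticAt ℂ (fun v : ℂ × ℂ => F (v.1 + v.2, v.2)) 0 := hF.comp_of_eq ((analyticAt_fst.add analyticAt_snd).prod analyticAt_snd) (by simp)
  obtain ⟨g, hg, h⟩ := AnalyticAt.exists_div_fst hF'
  refine ⟨fun v => g (v.1 - v.2, v.2), hg.comp_of_eq ((analyticAt_fst.sub analyticAt_snd).prod analyticAt_snd) (by simp), ?_⟩
  have hc : Tendsto (fun v : ℂ × ℂ => (v.1 - v.2, v.2)) (𝓝 0) (𝓝 0) := Continuous.tendsto' (by fun_prop) _ _ (by simp)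
  filter_upwards [hc.eventually h] with v hv
  simpa using hv

lemma AnalyticAt.exists_taylor_snd (hF : AnalyticAt ℂ F 0) (M : ℕ) :
    ∃ (a : ℕ → ℂ → ℂ) (g : ℂ × ℂ → ℂ), (∀ j, AnalyticAt ℂ (a j) 0) ∧ AnalyticAt ℂ g 0 ∧
      ∀ᶠ v in 𝓝 0, F v = ∑ j ∈ range M, a j v.1 * v.2 ^ j + v.2 ^ M * g v := by
  induction M with
  | zero => exact ⟨fun _ _ => 0, F, fun _ => analyticAt_const, hF, by simp⟩
  | succ M ih =>
    obtain ⟨a, g, ha, hg, h⟩ := ih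
    have hs : AnalyticAt ℂ (fun v : ℂ × ℂ => g v.swap) 0 := hg.comp_of_eq (analyticAt_snd.prod analyticAt_fst) rfl
    obtain ⟨g', hg', h'⟩ := AnalyticAt.exists_div_fst hs
    refine ⟨update a M fun u => g (u, 0), fun v => g' v.swap, fun j => ?_, hg'.comp_of_eq (analyticAt_snd.prod analyticAt_fst) rfl, ?_⟩
    · by_cases hj : j = M
      · subst hj
        rw [update_self]
        exact hg.comp_of_eq (analyticAt_id.prod analyticAt_const) rfl
      · rw [update_of_ne hj]; exact ha j
    · have hc : Tendsto (Prod.swap : ℂ × ℂ → ℂ × ℂ) (𝓝 0) (𝓝 0) := continuous_swap.tendsto' _ _ rfl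
      filter_upwards [h, hc.eventually h'] with v hv hv'
      simp only [Prod.swap_swap, Prod.fst_swap, Prod.snd_swap, Prod.swap_prod_mk] at hv'
      rw [hv, hv', sum_range_succ, update_self, sum_congr rfl fun j hj => by
        rw [← update_of_ne (mem_range.1 hj).ne (fun u => g (u, 0)) a]]
      ring

end Division

section TwoVariables

lemma laurentCoeff_eq_of_taylor {f g : ℂ → ℂ} {M : ℕ} {c : ℕ → ℂ} (hg : AnalyticAt ℂ g 0)
    (h : ∀ᶠ w in 𝓝[≠] 0, f w = ∑ k ∈ range M, c k * w ^ k + w ^ M * g w) {k : ℕ} (hk : k < M) : laurentCoeff f k = c k := by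
  have h1 : HasRes (fun w => ∑ j ∈ range M, c j * w ^ ((j : ℤ) - k - 1) + w ^ (M - k - 1) * g w) _ :=
    (HasRes.sum fun (j : ℕ) _ => (HasRes.zpow ((j : ℤ) - k - 1)).const_mul (c j)).add
      (HasRes.of_analyticAt ((analyticAt_id.pow _).mul hg))
  have h2 := h1.congr (g := fun w => f w * w ^ (-(k : ℤ) - 1)) (by
    filter_upwards [h, self_mem_nhdsWithin] with w hw hw0
    rw [hw, add_mul, sum_mul]
    congr 1
    · refine sum_congr rfl fun j _ => ?_
      rw [mul_assoc, ← zpow_natCast w j, ← zpow_add₀ hw0]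
      ring_nf
    · rw [mul_right_comm, ← zpow_natCast w M, ← zpow_add₀ hw0, ← zpow_natCast w]
      congr 2
      omega)
  rw [laurentCoeff, h2.residue_eq, add_zero, sum_eq_single_of_mem k (mem_range.2 hk), if_pos (by omega), mul_one]
  intro j _ hj
  rw [if_neg (by omega), mul_zero]

lemma eventually_curry_zero {p : ℂ × ℂ → Prop} (h : ∀ᶠ u in 𝓝 (0 : ℂ × ℂ), p u) : ∀ᶠ x in 𝓝 (0 : ℂ), ∀ᶠ y in 𝓝 (0 : ℂ), p (x, y) := by
  rw [show (0 : ℂ × ℂ) = (0, 0) from rfl, nhds_prod_eq] at h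
  exact h.curry

lemma eventually_swap_zero {p : ℂ × ℂ → Prop} (h : ∀ᶠ u in 𝓝 (0 : ℂ × ℂ), p u) : ∀ᶠ u in 𝓝 (0 : ℂ × ℂ), p u.swap :=
  (continuous_swap.tendsto' (0 : ℂ × ℂ) 0 rfl).eventually h

lemma eventually_analytic_snd {g : ℂ × ℂ → ℂ} (hg : AnalyticAt ℂ g 0) : ∀ᶠ x in 𝓝 (0 : ℂ), AnalyticAt ℂ (fun y => g (x, y)) 0 := by
  filter_upwards [eventually_curry_zero hg.eventually_analyticAt] with x hx
  exact hx.self_of_nhds.comp_of_eq (analyticAt_const.prod analyticAt_id) rfl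

variable {G : ℂ × ℂ → ℂ}

lemma AnalyticAt.exists_taylor_snd' (hG : AnalyticAt ℂ G 0) (M : ℕ) :
    ∃ (a : ℕ → ℂ → ℂ) (g : ℂ × ℂ → ℂ), (∀ j, AnalyticAt ℂ (a j) 0) ∧ AnalyticAt ℂ g 0 ∧
      (∀ᶠ v in 𝓝 0, G v = ∑ j ∈ range M, a j v.1 * v.2 ^ j + v.2 ^ M * g v) ∧ ∀ᶠ x in 𝓝 0, ∀ j < M, laurentCoeff (fun y => G (x, y)) j = a j x := by
  obtain ⟨a, g, ha, hg, h⟩ := AnalyticAt.exists_taylor_snd hG M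
  refine ⟨a, g, ha, hg, h, ?_⟩
  filter_upwards [eventually_curry_zero h, eventually_analytic_snd hg] with x hx hgx j hj
  exact laurentCoeff_eq_of_taylor (c := fun j => a j x) hgx (hx.filter_mono nhdsWithin_le_nhds) hj

/-- The Taylor coefficients of a function of two variables. -/
def taylorTwo (G : ℂ × ℂ → ℂ) (i j : ℕ) : ℂ := laurentCoeff (fun x => laurentCoeff (fun y => G (x, y)) j) i

lemma AnalyticAt.exists_taylor_two (hG : AnalyticAt ℂ G 0) (M : ℕ) : (∃ h₁ h₂ : ℂ × ℂ → ℂ, AnalyticAt ℂ h₁ 0 ∧ AnalyticAt ℂ h₂ 0 ∧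
      ∀ᶠ v in 𝓝 0, G v = ∑ i ∈ range M, ∑ j ∈ range M, taylorTwo G i j * v.1 ^ i * v.2 ^ j + v.1 ^ M * h₁ v + v.2 ^ M * h₂ v) ∧
    ∀ i < M, ∃ b : ℂ → ℂ, AnalyticAt ℂ b 0 ∧
      ∀ᶠ y in 𝓝 0, laurentCoeff (fun x => G (x, y)) i = ∑ j ∈ range M, taylorTwo G i j * y ^ j + y ^ M * b y := by
  obtain ⟨a, g, ha, hg, h, hc⟩ := AnalyticAt.exists_taylor_snd' hG M
  have hcoeff : ∀ j < M, ∀ i : ℕ, taylorTwo G i j = laurentCoeff (a j) i := fun j hj i =>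
    laurentCoeff_congr ((hc.mono fun x hx => hx j hj).filter_mono nhdsWithin_le_nhds) i
  choose b hb hab using fun j => AnalyticAt.taylor_eq (ha j) M
  have hb' : AnalyticAt ℂ (fun v : ℂ × ℂ => ∑ j ∈ range M, b j v.1 * v.2 ^ j) 0 :=
    analyticAt_fun_sum _ fun j _ => ((hb j).comp_of_eq analyticAt_fst rfl).mul (analyticAt_snd.pow j)
  have hfst : Tendsto (Prod.fst : ℂ × ℂ → ℂ) (𝓝 0) (𝓝 0) := continuous_fst.tendsto' _ _ rfl
  have hexp : ∀ᶠ v in 𝓝 0, G v = ∑ i ∈ range M, ∑ j ∈ range M, taylorTwo G i j * v.1 ^ i * v.2 ^ j +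
        v.1 ^ M * (∑ j ∈ range M, b j v.1 * v.2 ^ j) + v.2 ^ M * g v := by
    filter_upwards [h, hfst.eventually (eventually_all.2 fun j : Fin M => hab j)] with v hv hv'
    rw [hv, sum_comm, mul_sum, ← sum_add_distrib]
    congr 1
    refine sum_congr rfl fun j hj => ?_
    rw [hv' ⟨j, mem_range.1 hj⟩, add_mul, sum_mul, mul_assoc]
    congr 1
    exact sum_congr rfl fun i _ => by rw [hcoeff j (mem_range.1 hj)]
  refine ⟨⟨_, g, hb', hg, hexp⟩, fun i hi => ?_⟩
  obtain ⟨a', g', ha', hg', h', -⟩ := AnalyticAt.exists_taylor_snd' (G := fun v => g v.swap)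
    (hg.comp_of_eq (analyticAt_snd.prod analyticAt_fst) rfl) M
  refine ⟨a' i, ha' i, ?_⟩
  have hR : AnalyticAt ℂ (fun v : ℂ × ℂ => (∑ j ∈ range M, b j v.2 * v.1 ^ j) + v.1 ^ M * g' v) 0 :=
    (hb'.comp_of_eq (analyticAt_snd.prod analyticAt_fst) rfl).add ((analyticAt_fst.pow M).mul hg')
  filter_upwards [eventually_curry_zero (eventually_swap_zero hexp), eventually_curry_zero h', eventually_analytic_snd hR] with y h1 h2 h3
  refine laurentCoeff_eq_of_taylor (M := M) (c := fun i => ∑ j ∈ range M, taylorTwo G i j * y ^ j + y ^ M * a' i y)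
    h3 (Eventually.filter_mono nhdsWithin_le_nhds ?_) hi
  filter_upwards [h1, h2] with x h1 h2
  simp only [Prod.swap_prod_mk] at h1 h2
  have e1 : ∀ i, (∑ j ∈ range M, taylorTwo G i j * y ^ j + y ^ M * a' i y) * x ^ i =
      ∑ j ∈ range M, taylorTwo G i j * x ^ i * y ^ j + y ^ M * (a' i y * x ^ i) := fun i => by
    rw [add_mul, sum_mul, mul_assoc]
    congr 1
    exact sum_congr rfl fun j _ => by ring
  rw [sum_congr rfl fun i _ => e1 i, sum_add_distrib, ← mul_sum, h1, h2]
  ring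

end TwoVariables

section Expansions

lemma AsympTo.of_remainder {f : ℂ → ℂ} {φ : ℕ → ℂ → ℂ} (m : ℤ)
    (h : ∀ B : ℕ, ∃ g : ℂ → ℂ, AnalyticAt ℂ g 0 ∧ ∀ᶠ q in 𝓝[≠] 0, f q = φ B q + q ^ (m + B) * g q) (hφ : φ 0 = 0) : AsympTo f φ := by
  have hO : ∀ g : ℂ → ℂ, AnalyticAt ℂ g 0 → ∀ k : ℤ, (fun q => q ^ k * g q) =O[𝓝[≠] 0] fun q => q ^ k := fun g hg k => by
    have := (Asymptotics.isBigO_refl (fun q : ℂ => q ^ k) (𝓝[≠] 0)).mul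
      ((hg.continuousAt.tendsto.mono_left nhdsWithin_le_nhds).isBigO_one ℂ)
    simpa using this
  refine ⟨m.natAbs, ?_, .of_forall fun B => ?_⟩
  · obtain ⟨g, hg, h⟩ := h 0
    refine ((hO g hg (m + (0 : ℕ))).trans (zpow_isBigO (by omega))).congr' ?_ EventuallyEq.rfl
    filter_upwards [h] with q hq
    rw [hq, hφ]; simp
  · obtain ⟨g, hg, h⟩ := h B
    refine ((hO g hg (m + B)).trans (zpow_isBigO (by omega))).congr' ?_ EventuallyEq.rfl
    filter_upwards [h] with q hq
    rw [hq]; ring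

lemma rQuot_pos (D : LocalCoords Γ) (μ : Γ.ramT) : 1 ≤ rQuot D μ := by
  have h := rProd_pos D
  rw [← r_mul_rQuot D μ] at h
  exact Nat.pos_of_mul_pos_left h

lemma tendsto_sheetCoord
    (D : LocalCoords Γ) (s : Sheet D) : Tendsto (fun q => sheetCoord D q s) (𝓝[≠] 0) (𝓝[≠] 0) := by
  refine tendsto_nhdsWithin_iff.2 ⟨?_, eventually_nhdsWithin_of_forall fun q hq => sheetCoord_ne_zero D hq s⟩
  have h : Continuous fun q => sheetCoord D q s := by unfold sheetCoord; fun_prop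
  refine (h.tendsto' 0 0 ?_).mono_left nhdsWithin_le_nhds
  rw [sheetCoord, zero_pow (Nat.ne_of_gt (rQuot_pos D s.1)), mul_zero]

lemma AsympTo.comp_sheetCoord
    (s : Sheet D) {f : ℂ → ℂ} {φ : ℕ → ℂ → ℂ} (m : ℤ)
    (h : ∀ B : ℕ, ∃ g : ℂ → ℂ, AnalyticAt ℂ g 0 ∧ ∀ᶠ w in 𝓝[≠] 0, f w = φ B w + w ^ (m + B) * g w)
    (hφ : φ 0 = 0) : AsympTo (fun q => f (sheetCoord D q s)) fun B q => φ B (sheetCoord D q s) := by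
  refine AsympTo.of_remainder (rQuot D s.1 * m) (fun B => ?_) (by ext q; simp [hφ])
  obtain ⟨g, hg, h⟩ := h B
  have hr := rQuot_pos D s.1
  refine ⟨fun q => sheetRoot D s ^ (m + B) * q ^ ((rQuot D s.1 - 1) * B) * g (sheetRoot D s * q ^ rQuot D s.1), ?_, ?_⟩
  · refine (analyticAt_const.mul (analyticAt_id.pow _)).mul (hg.comp_of_eq (analyticAt_const.mul (analyticAt_id.pow _)) ?_)
    simp [Nat.ne_of_gt hr]
  · filter_upwards [(tendsto_sheetCoord D s).eventually h, self_mem_nhdsWithin] with q hq hq0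
    rw [hq, sheetCoord, mul_zpow, ← zpow_natCast q (rQuot D s.1), ← zpow_mul, ← zpow_natCast q ((rQuot D s.1 - 1) * B)]
    have e : q ^ ((rQuot D s.1 : ℤ) * (m + B)) = q ^ ((rQuot D s.1 : ℤ) * m + B) * q ^ (((rQuot D s.1 - 1) * B : ℕ) : ℤ) := by
      rw [← zpow_add₀ hq0]
      congr 1
      push_cast [Nat.cast_sub hr]
      ring
    rw [e]
    ring

end Expansions

variable [T2Space S] [IsManifold 𝓘(ℂ) ω S]

section Coordinates

variable {e : OpenPartialHomeomorph S ℂ}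

lemma ev_smul {n : ℕ} (η : MultiForm S n) {t t' : Fin n → TB S} (c : Fin n → ℂ)
    (h : ∀ i, t' i = ⟨(t i).proj, c i • (t i).2⟩) : ev η t' = (∏ i, c i) * ev η t := by
  obtain rfl : t' = fun i => ⟨(t i).proj, c i • (t i).2⟩ := funext h
  exact (η fun i => (t i).proj).map_smul_univ c fun i => (t i).2

lemma coordinates_mem_one (he : e ∈ coordinates S) : e ∈ IsManifold.maximalAtlas 𝓘(ℂ) 1 S := IsManifold.maximalAtlas_subset_of_le le_top he

lemma coordVec_chain (he : e ∈ coordinates S) {w : ℂ} (hw : w ∈ e.target) {g : S → ℂ} {f : ℂ → ℂ} {f' : ℂ}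
    (hf : HasDerivAt f f' w) (hg : ∀ p ∈ e.source, g p = f (e p)) : (show ℂ from mfderiv 𝓘(ℂ) 𝓘(ℂ) g (coordVec e w).proj (coordVec e w).2) = f' := by
  have h1 : MDifferentiableAt 𝓘(ℂ) 𝓘(ℂ) e.symm w := mdifferentiableAt_symm_of_mem_maximalAtlas (coordinates_mem_one he) hw
  have h2 : MDifferentiableAt 𝓘(ℂ) 𝓘(ℂ) g (e.symm w) := by
    have h3 : MDifferentiableAt 𝓘(ℂ) 𝓘(ℂ) (f ∘ e) (e.symm w) :=
      MDifferentiableAt.comp _ (by rw [e.right_inv hw]; exact hf.differentiableAt.mdifferentiableAt)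
        (mdifferentiableAt_of_mem_maximalAtlas (coordinates_mem_one he) (e.map_target hw))
    refine h3.congr_of_eventuallyEq ?_
    filter_upwards [e.open_source.mem_nhds (e.map_target hw)] with p hp using hg p hp
  have h4 : mfderiv 𝓘(ℂ) 𝓘(ℂ) (g ∘ e.symm) w = fderiv ℂ f w := by
    rw [← mfderiv_eq_fderiv]
    refine Filter.EventuallyEq.mfderiv_eq ?_
    filter_upwards [e.open_target.mem_nhds hw] with u hu
    rw [comp_apply, hg _ (e.map_target hu), e.right_inv hu]
  have h5 := congrArg (fun L : ℂ →L[ℂ] ℂ => L 1) ((mfderiv_comp w h2 h1).symm.trans h4)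
  exact h5.trans (by rw [fderiv_apply_one_eq_deriv, hf.deriv])

lemma coordVec_ne_zero (he : e ∈ coordinates S) {w : ℂ} (hw : w ∈ e.target) : (show ℂ from (coordVec e w).2) ≠ 0 := by
  intro h
  have h1 := coordVec_chain he hw (hasDerivAt_id w) (g := e) fun p _ => rfl
  refine zero_ne_one (α := ℂ) (Eq.trans ?_ h1)
  have h2 : (coordVec e w).2 = 0 := h
  rw [h2]
  exact (map_zero (mfderiv 𝓘(ℂ) 𝓘(ℂ) e (coordVec e w).proj)).symm

lemma exists_smul_coordVec (he : e ∈ coordinates S) (t : TB S) (ht : t.proj ∈ e.source) :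
    ∃ c : ℂ, t = ⟨(coordVec e (e t.proj)).proj, c • (coordVec e (e t.proj)).2⟩ := by
  have h := coordVec_ne_zero he (e.map_source ht)
  have hp : (coordVec e (e t.proj)).proj = t.proj := e.left_inv ht
  generalize coordVec e (e t.proj) = u at h hp ⊢
  obtain ⟨p, v⟩ := t
  obtain ⟨p', v'⟩ := u
  obtain rfl : p' = p := hp
  exact ⟨(show ℂ from v) / (show ℂ from v'), congrArg _ (div_mul_cancel₀ _ h).symm⟩

namespace LocalCoords

variable (D) (μ : Γ.ramT)

lemma zero_mem_target : (0 : ℂ) ∈ (D.ζ μ).target := by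
  have := (D.ζ μ).map_source (D.mem_source μ)
  rwa [D.ζ_center] at this

lemma symm_zero : (D.ζ μ).symm 0 = μ := by
  rw [← D.ζ_center μ, (D.ζ μ).left_inv (D.mem_source μ)]

lemma eventually_mem_target : ∀ᶠ w in 𝓝 (0 : ℂ), w ∈ (D.ζ μ).target := (D.ζ μ).open_target.mem_nhds (D.zero_mem_target μ)

lemma tendsto_symm : Tendsto (D.ζ μ).symm (𝓝 0) (𝓝 (μ : S)) := by
  have := (D.ζ μ).continuousAt_symm (D.zero_mem_target μ)
  rwa [ContinuousAt, D.symm_zero] at this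

lemma symm_ne {w : ℂ} (hw : w ∈ (D.ζ μ).target) (h0 : w ≠ 0) : (D.ζ μ).symm w ≠ μ := by
  rw [← D.symm_zero]
  exact fun h => h0 ((D.ζ μ).symm.injOn hw (D.zero_mem_target μ) h)

lemma tendsto_symm_punctured : Tendsto (D.ζ μ).symm (𝓝[≠] 0) (𝓝[≠] (μ : S)) := by
  refine tendsto_nhdsWithin_iff.2 ⟨(D.tendsto_symm μ).mono_left nhdsWithin_le_nhds, ?_⟩
  filter_upwards [(D.eventually_mem_target μ).filter_mono nhdsWithin_le_nhds, self_mem_nhdsWithin] with w hw h0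
  exact D.symm_ne μ hw h0

lemma eventually_notMem : ∀ᶠ w in 𝓝[≠] (0 : ℂ), (coordVec (D.ζ μ) w).proj ∉ Γ.ramT := by
  have h := (Γ.ramT_finite.subset (Set.sdiff_subset (t := {(μ : S)}))).isClosed.isOpen_compl.mem_nhds
    (show (μ : S) ∈ (Γ.ramT \ {(μ : S)})ᶜ from fun h => h.2 rfl)
  have h' := (D.tendsto_symm_punctured μ).eventually ((show ∀ᶠ p in 𝓝 (μ : S), _ from h).filter_mono nhdsWithin_le_nhds)
  filter_upwards [h', (D.tendsto_symm_punctured μ).eventually self_mem_nhdsWithin] with w hw hw' hw''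
  exact hw ⟨hw'', hw'⟩

lemma xt_symm {w : ℂ} (hw : w ∈ (D.ζ μ).target) : Γ.xt ((D.ζ μ).symm w) = ((Γ.xf μ + w ^ D.r μ : ℂ) : OnePoint ℂ) := by
  rw [D.xt_eq μ _ ((D.ζ μ).map_target hw), (D.ζ μ).right_inv hw]

lemma mfderiv_xf {w : ℂ} (hw : w ∈ (D.ζ μ).target) :
    (show ℂ from mfderiv 𝓘(ℂ) 𝓘(ℂ) Γ.xf (coordVec (D.ζ μ) w).proj (coordVec (D.ζ μ) w).2) = D.r μ * w ^ (D.r μ - 1) := by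
  refine coordVec_chain (D.ζ_mem μ) hw (f := fun w => Γ.xf μ + w ^ D.r μ) ?_ fun p hp => ?_
  · exact (hasDerivAt_pow (D.r μ) w).const_add _
  · rw [SpectralCurve.xf, D.xt_eq μ p hp]; rfl

end LocalCoords

lemma liftVec_eq {D : LocalCoords Γ} (W : Correlators D) (μ : Γ.ramT) {w : ℂ} (hw : w ∈ (D.ζ μ).target) (h0 : w ≠ 0) :
    W.liftVec ((D.ζ μ).symm w) = ⟨(coordVec (D.ζ μ) w).proj, (D.r μ * w ^ (D.r μ - 1) : ℂ)⁻¹ • (coordVec (D.ζ μ) w).2⟩ := by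
  have h := D.mfderiv_xf μ hw
  have hr : (D.r μ * w ^ (D.r μ - 1) : ℂ) ≠ 0 := mul_ne_zero (mod_cast Nat.ne_of_gt (D.r_pos μ)) (pow_ne_zero _ h0)
  refine congrArg (Bundle.TotalSpace.mk _) ?_
  change ContinuousLinearMap.inverse (mfderiv 𝓘(ℂ) 𝓘(ℂ) Γ.xf (coordVec (D.ζ μ) w).proj) (1 : ℂ) = _
  generalize (coordVec (D.ζ μ) w).2 = v at h ⊢
  generalize mfderiv 𝓘(ℂ) 𝓘(ℂ) Γ.xf (coordVec (D.ζ μ) w).proj = L at h ⊢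
  generalize (D.r μ * w ^ (D.r μ - 1) : ℂ) = c at h hr ⊢
  change ℂ →L[ℂ] ℂ at L
  change ℂ at v
  change L v = c at h
  change L.inverse 1 = c⁻¹ * v
  have hL : ∀ u : ℂ, L u = u * L 1 := fun u => by rw [← smul_eq_mul, ← map_smul, smul_eq_mul, mul_one]
  have hv : v * L 1 = c := by rw [← hL, h]
  have hinv : L.inverse = ContinuousLinearMap.mul ℂ ℂ (c⁻¹ * v) := by
    refine ContinuousLinearMap.inverse_eq ?_ ?_
    · ext
      rw [ContinuousLinearMap.comp_apply, hL, ContinuousLinearMap.mul_apply', mul_one, mul_assoc, hv, inv_mul_cancel₀ hr]; rfl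
    · ext
      rw [ContinuousLinearMap.comp_apply, ContinuousLinearMap.mul_apply', mul_assoc, hv, inv_mul_cancel₀ hr]; rfl
  rw [hinv, ContinuousLinearMap.mul_apply', mul_one]

end Coordinates

lemma HasRes.of_hasDerivAt {F f : ℂ → ℂ} (h : ∀ᶠ w in 𝓝[≠] 0, HasDerivAt F (f w) w) {r : ℂ} (hf : HasRes f r) : r = 0 := by
  obtain ⟨ρ, ⟨h1, h2⟩, hρ⟩ := ((hf.and (eventually_circle h)).and self_mem_nhdsWithin).exists
  rw [← h1.2, circleIntegral.integral_eq_zero_of_hasDerivWithinAt (le_of_lt hρ) fun w hw => (h2 w hw).hasDerivWithinAt, mul_zero]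

lemma laurentCoeff_deriv {F f : ℂ → ℂ} (hF : AnalyticAt ℂ F 0) (hf : AnalyticAt ℂ f 0)
    (h : ∀ᶠ w in 𝓝 0, HasDerivAt F (f w) w) (k : ℤ) : laurentCoeff f (k - 1) = k * laurentCoeff F k := by
  have hm : ∀ {g : ℂ → ℂ}, AnalyticAt ℂ g 0 → ∀ n : ℤ, HasRes (fun w => g w * w ^ n) (residue fun w => g w * w ^ n) :=
    fun {g} hg n => MeromorphicAt.hasRes (hg.meromorphicAt.mul ((MeromorphicAt.id 0).zpow n))
  have h1 := (hm hf (-(k - 1) - 1)).add ((hm hF (-k - 1)).const_mul (-k))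
  have h2 := HasRes.of_hasDerivAt (F := fun w => F w * w ^ (-k)) (by
    filter_upwards [h.filter_mono nhdsWithin_le_nhds, self_mem_nhdsWithin] with w hw hw0
    convert! hw.mul (hasDerivAt_zpow (-k) w (Or.inl hw0)) using 1
    push_cast
    ring_nf) h1
  rw [laurentCoeff, laurentCoeff]
  linear_combination h2

lemma laurentCoeff_inv_sub_sq {w : ℂ} (hw : w ≠ 0) (k : ℕ) : laurentCoeff (fun u => 1 / (u - w) ^ 2) ((k : ℤ) - 1) = k * w ^ (-(k : ℤ) - 1) := by
  have ha : AnalyticAt ℂ (fun u => (w - u)⁻¹) 0 := (analyticAt_const.sub analyticAt_id).inv (by simpa using hw)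
  have hne : ∀ᶠ u in 𝓝 (0 : ℂ), u ≠ w := eventually_ne_nhds (Ne.symm hw)
  have h1 : laurentCoeff (fun u => (w - u)⁻¹) k = w ^ (-(k : ℤ) - 1) := by
    refine laurentCoeff_eq_of_taylor (M := k + 1) (c := fun j => w ^ (-(j : ℤ) - 1)) (g := fun u => w ^ (-(k : ℤ) - 1) * (w - u)⁻¹)
      (analyticAt_const.mul ha) (Eventually.filter_mono nhdsWithin_le_nhds ?_) (Nat.lt_succ_self k)
    filter_upwards [hne] with u hu
    have hu' : w - u ≠ 0 := sub_ne_zero.2 (Ne.symm hu)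
    have hs : ∀ M : ℕ, (∑ j ∈ range M, w ^ (-(j : ℤ) - 1) * u ^ j) * (w - u) = 1 - w ^ (-(M : ℤ)) * u ^ M := by
      intro M
      induction M with
      | zero => simp
      | succ M ih =>
        rw [sum_range_succ, add_mul, ih]
        have e1 : w ^ (-(M : ℤ)) = w ^ (-(M : ℤ) - 1) * w := by rw [← zpow_add_one₀ hw]; ring_nf
        rw [e1, show -((M + 1 : ℕ) : ℤ) = -(M : ℤ) - 1 by push_cast; ring, pow_succ]
        ring
    have := hs (k + 1)
    rw [show -((k + 1 : ℕ) : ℤ) = -(k : ℤ) - 1 by push_cast; ring] at this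
    field_simp
    linear_combination -this
  rw [← h1]
  have h2 := laurentCoeff_deriv (f := fun u => 1 / (u - w) ^ 2) ha (by
    refine (analyticAt_const.div ((analyticAt_id.sub analyticAt_const).pow 2) ?_)
    simpa using hw) (by
      filter_upwards [hne] with u hu
      have hu' : w - u ≠ 0 := sub_ne_zero.2 (Ne.symm hu)
      convert! ((hasDerivAt_id u).const_sub w).inv hu' using 1
      simp only [id]
      rw [neg_neg, sq, sq, ← neg_sub w u, neg_mul_neg]) k
  exact_mod_cast h2

namespace LocalCoords

variable (D) (μ ν : Γ.ramT)

lemma eventually_symm_ne {p : S} (hp : p ≠ μ) : ∀ᶠ w in 𝓝 (0 : ℂ), (D.ζ μ).symm w ≠ p :=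
  (D.tendsto_symm μ).eventually (eventually_ne_nhds (Ne.symm hp))

lemma eventually_symm_ne_symm : ∀ᶠ u in 𝓝 (0 : ℂ × ℂ), (μ = ν → u.1 ≠ u.2) → (D.ζ μ).symm u.1 ≠ (D.ζ ν).symm u.2 := by
  have h1 : Tendsto (Prod.fst : ℂ × ℂ → ℂ) (𝓝 0) (𝓝 0) := continuous_fst.tendsto' _ _ rfl
  have h2 : Tendsto (Prod.snd : ℂ × ℂ → ℂ) (𝓝 0) (𝓝 0) := continuous_snd.tendsto' _ _ rfl
  by_cases h : μ = ν
  · subst h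
    filter_upwards [h1.eventually (D.eventually_mem_target μ), h2.eventually (D.eventually_mem_target μ)] with u hu hu' hne heq
    exact hne rfl ((D.ζ μ).symm.injOn hu hu' heq)
  · obtain ⟨U, V, hU, hV, hμ, hν, hd⟩ := t2_separation (Subtype.coe_injective.ne h : (μ : S) ≠ ν)
    filter_upwards [h1.eventually ((D.tendsto_symm μ).eventually (hU.mem_nhds hμ)),
      h2.eventually ((D.tendsto_symm ν).eventually (hV.mem_nhds hν))] with u hu hu' _ heq
    exact Set.disjoint_left.1 hd hu (heq ▸ hu')

/-- The function `ỹ` in the local coordinate. -/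
def yLocal (w : ℂ) : ℂ := finPart (Γ.y ((D.ζ μ).symm w))

lemma meromorphicAt_yLocal : MeromorphicAt (D.yLocal μ) 0 := by
  have := Γ.meromorphic_y.meromorphicAt μ (D.ζ μ) (D.ζ_mem μ) (D.mem_source μ)
  rwa [D.ζ_center] at this

lemma F01_nonempty_bdd : BddBelow {k : ℤ | D.F01 μ k ≠ 0} := by
  obtain ⟨n, hn, -⟩ := MeromorphicAt.exists_laurent (D.meromorphicAt_yLocal μ)
  refine ⟨-(n : ℤ) + D.r μ, fun k hk => ?_⟩
  by_contra h
  exact hk (mul_eq_zero_of_right _ (hn _ (by omega)))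

lemma s_le {k : ℤ} (h : D.F01 μ k ≠ 0) : D.s μ ≤ k := by
  rw [s, if_neg fun h' => h (h' k)]
  exact_mod_cast csInf_le (D.F01_nonempty_bdd μ) h

lemma F01_eq_zero {k : ℤ} (h : (k : WithTop ℤ) < D.s μ) : D.F01 μ k = 0 := by_contra fun h' => (D.s_le μ h').not_gt h

end LocalCoords

namespace Correlators

variable (μ ν : Γ.ramT)

lemma form01_local : ∀ᶠ w in 𝓝[≠] 0, ev (W.form 0 1) ![coordVec (D.ζ μ) w] = D.yLocal μ w * (D.r μ * w ^ (D.r μ - 1)) := by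
  filter_upwards [(D.tendsto_symm_punctured μ).eventually (Γ.meromorphic_y.isolated_poles μ),
    (D.eventually_mem_target μ).filter_mono nhdsWithin_le_nhds] with w hw hw'
  rw [W.form01 (coordVec (D.ζ μ) w) (by
    rw [show (coordVec (D.ζ μ) w).proj = (D.ζ μ).symm w from rfl, D.xt_symm μ hw']; exact OnePoint.coe_ne_infty _) hw,
    D.mfderiv_xf μ hw']
  rfl

lemma analyticAt_form02 (t : TB S) {w : ℂ} (hw : w ∈ (D.ζ μ).target) (h : (D.ζ μ).symm w ≠ t.proj) :
    AnalyticAt ℂ (fun u => ev (W.form 0 2) ![coordVec (D.ζ μ) u, t]) w := by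
  have he : chartAt ℂ t.proj ∈ coordinates S := IsManifold.chart_mem_maximalAtlas t.proj
  obtain ⟨c, hc⟩ := exists_smul_coordVec he t (mem_chart_source ℂ _)
  have h1 := W.form02.holomorphic _ _ h (D.ζ μ) (D.ζ_mem μ) _ he ((D.ζ μ).map_target hw) (mem_chart_source ℂ t.proj)
  rw [(D.ζ μ).right_inv hw] at h1
  have h2 := analyticAt_const (v := c) |>.mul (h1.comp_of_eq (analyticAt_id.prod analyticAt_const) rfl)
  refine h2.congr (.of_forall fun u => ?_)
  refine ((ev_smul (W.form 0 2) (t' := ![coordVec (D.ζ μ) u, t]) ![1, c] fun i => ?_).trans (by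
    simp only [Fin.prod_univ_two, Matrix.cons_val_zero, Matrix.cons_val_one, one_mul]; rfl)).symm
  fin_cases i
  · exact congrArg (Bundle.TotalSpace.mk _) (one_smul ℂ (coordVec (D.ζ μ) u).2).symm
  · exact hc

lemma analyticAt_kernel {t : TB S} (ht : t.proj ≠ μ) : AnalyticAt ℂ (W.kernel μ t) 0 ∧
    AnalyticAt ℂ (fun u => ev (W.form 0 2) ![coordVec (D.ζ μ) u, t]) 0 ∧
    ∀ᶠ w in 𝓝 0, HasDerivAt (W.kernel μ t) (ev (W.form 0 2) ![coordVec (D.ζ μ) w, t]) w := by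
  obtain ⟨ε, hε, h⟩ := Metric.eventually_nhds_iff_ball.1 ((D.eventually_mem_target μ).and (D.eventually_symm_ne μ ht))
  have han : ∀ w ∈ Metric.ball (0 : ℂ) ε, AnalyticAt ℂ (fun u => ev (W.form 0 2) ![coordVec (D.ζ μ) u, t]) w :=
    fun w hw => W.analyticAt_form02 μ t (h w hw).1 (h w hw).2
  generalize hφ : (fun u => ev (W.form 0 2) ![coordVec (D.ζ μ) u, t]) = φ at han
  simp_rw [fun w => (congrFun hφ w : ev (W.form 0 2) ![coordVec (D.ζ μ) w, t] = φ w)]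
  obtain ⟨Φ, hΦ⟩ := DifferentiableOn.isExactOn_ball (f := φ) fun w hw => (han w hw).differentiableAt.differentiableWithinAt
  have h0 : (0 : ℂ) ∈ Metric.ball (0 : ℂ) ε := Metric.mem_ball_self hε
  have hker : ∀ w ∈ Metric.ball (0 : ℂ) ε, W.kernel μ t w = Φ w - Φ 0 := by
    intro w hw
    have hmem : ∀ τ ∈ Set.uIcc (0 : ℝ) 1, (τ : ℂ) * w ∈ Metric.ball (0 : ℂ) ε := fun τ hτ => by
      rw [Set.uIcc_of_le zero_le_one] at hτ
      rw [mem_ball_zero_iff] at hw ⊢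
      rw [norm_mul, Complex.norm_real, Real.norm_of_nonneg hτ.1]
      exact (mul_le_of_le_one_left (norm_nonneg w) hτ.2).trans_lt hw
    have hd : ∀ τ ∈ Set.uIcc (0 : ℝ) 1, HasDerivAt (fun τ : ℝ => Φ (τ * w)) (w * φ (τ * w)) τ := fun τ hτ => by
      have h1 := (hΦ _ (hmem τ hτ)).comp τ ((Complex.ofRealCLM.hasDerivAt (x := τ)).mul_const w)
      rw [mul_comm w]
      simpa [comp_def] using h1
    have hi := intervalIntegral.integral_eq_sub_of_hasDerivAt hd (ContinuousOn.intervalIntegrable fun τ hτ => by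
      have := (han _ (hmem τ hτ)).continuousAt
      exact (ContinuousAt.mul continuousAt_const (ContinuousAt.comp (f := fun τ : ℝ => (τ : ℂ) * w) this (by fun_prop))).continuousWithinAt)
    simp only [Complex.ofReal_one, Complex.ofReal_zero, one_mul, zero_mul] at hi
    rw [← hi, kernel, ← hφ]
  have hball : ∀ᶠ w in 𝓝 (0 : ℂ), w ∈ Metric.ball (0 : ℂ) ε := Metric.isOpen_ball.mem_nhds h0
  have hΦa : AnalyticAt ℂ (fun w => Φ w - Φ 0) 0 := by
    refine (DifferentiableOn.analyticAt (s := Metric.ball 0 ε) (fun w hw => ?_) hball).sub analyticAt_const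
    exact (hΦ w hw).differentiableAt.differentiableWithinAt
  have hev : ∀ᶠ w in 𝓝 (0 : ℂ), W.kernel μ t w = Φ w - Φ 0 := hball.mono hker
  refine ⟨hΦa.congr (hev.mono fun w hw => hw.symm), han 0 h0, ?_⟩
  filter_upwards [hball, hev.eventually_nhds] with w hw hw'
  exact ((hΦ w hw).sub_const _).congr_of_eventuallyEq hw'

lemma dxi_eq {t : TB S} (ht : t.proj ≠ μ) (k : ℕ+) :
    (k : ℂ) * W.dxi (μ, k) t = laurentCoeff (fun u => ev (W.form 0 2) ![coordVec (D.ζ μ) u, t]) ((k : ℤ) - 1) := by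
  obtain ⟨h1, h2, h3⟩ := W.analyticAt_kernel μ ht
  exact (laurentCoeff_deriv h1 h2 h3 k).symm

lemma exists_regular : ∃ G : ℂ × ℂ → ℂ, AnalyticAt ℂ G 0 ∧ ∀ᶠ u in 𝓝 (0 : ℂ × ℂ), (μ = ν → u.1 ≠ u.2) →
    ev (W.form 0 2) ![coordVec (D.ζ μ) u.1, coordVec (D.ζ ν) u.2] = G u + open Classical in if μ = ν then 1 / (u.1 - u.2) ^ 2 else 0 := by
  have h0 : ((D.ζ μ μ, D.ζ ν ν) : ℂ × ℂ) = 0 := by rw [D.ζ_center, D.ζ_center]; rfl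
  by_cases h : μ = ν
  swap
  · have h1 := W.form02.holomorphic μ ν (Subtype.coe_injective.ne h) _ (D.ζ_mem μ) _ (D.ζ_mem ν) (D.mem_source μ) (D.mem_source ν)
    rw [h0] at h1
    exact ⟨_, h1, .of_forall fun u _ => by rw [if_neg h, add_zero]⟩
  subst h
  obtain ⟨f, hf, hf1, hfB⟩ := W.form02.diagonal μ _ (D.ζ_mem μ) (D.mem_source μ)
  rw [h0] at hf hfB
  rw [D.ζ_center] at hf1
  have hsnd : Tendsto (Prod.snd : ℂ × ℂ → ℂ) (𝓝 0) (𝓝 0) := continuous_snd.tendsto' _ _ rfl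
  obtain ⟨g, hg, hfg⟩ := AnalyticAt.exists_div_sub hf
  have hfg' : ∀ᶠ v in 𝓝 (0 : ℂ × ℂ), f v = 1 + (v.1 - v.2) * g v := by
    filter_upwards [hfg, hsnd.eventually hf1] with v h1 h2
    rw [h1, h2]
  have hanti : ∀ᶠ v in 𝓝 (0 : ℂ × ℂ), v.1 ≠ v.2 → g v + g v.swap = 0 := by
    filter_upwards [hfg', eventually_swap_zero hfg', hfB, eventually_swap_zero hfB, D.eventually_symm_ne_symm μ μ]
      with v h1 h2 h3 h4 h5 hv
    have hv' : v.1 - v.2 ≠ 0 := sub_ne_zero.2 hv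
    have h6 := (h3 hv).symm.trans ((W.form02.symm _ _ (h5 fun _ => hv)).trans (h4 (Ne.symm hv)))
    simp only [Prod.fst_swap, Prod.snd_swap] at h2 h6
    rw [show (v.2 - v.1) ^ 2 = (v.1 - v.2) ^ 2 by ring, div_left_inj' (pow_ne_zero 2 hv'), h1, h2] at h6
    exact mul_left_cancel₀ hv' (by linear_combination h6)
  have hdiag : ∀ᶠ y in 𝓝 (0 : ℂ), g (y, y) = 0 := by
    have hd : Tendsto (fun y : ℂ => (y, y)) (𝓝 0) (𝓝 0) := Continuous.tendsto' (by fun_prop) _ _ rfl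
    filter_upwards [hd.eventually hanti.eventually_nhds, hd.eventually hg.eventually_analyticAt] with y h1 h2
    have hc : Tendsto (fun x => g (x, y) + g (y, x)) (𝓝[≠] y) (𝓝 (g (y, y) + g (y, y))) := by
      refine Tendsto.mono_left ?_ nhdsWithin_le_nhds
      exact ContinuousAt.add (h2.continuousAt.comp (f := fun x : ℂ => (x, y)) (by fun_prop))
        (h2.continuousAt.comp (f := fun x : ℂ => (y, x)) (by fun_prop))
    have hz : Tendsto (fun x => g (x, y) + g (y, x)) (𝓝[≠] y) (𝓝 0) := by
      refine tendsto_const_nhds.congr' ?_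
      have hxy : Tendsto (fun x : ℂ => (x, y)) (𝓝 y) (𝓝 (y, y)) := Continuous.tendsto' (by fun_prop) _ _ rfl
      filter_upwards [(hxy.eventually h1).filter_mono nhdsWithin_le_nhds, self_mem_nhdsWithin] with x hx hxy
      exact (hx hxy).symm
    have := tendsto_nhds_unique hc hz
    rwa [← two_mul, mul_eq_zero, or_iff_right two_ne_zero] at this
  obtain ⟨h, hh, hgh⟩ := AnalyticAt.exists_div_sub hg
  refine ⟨h, hh, ?_⟩
  filter_upwards [hfB, hfg', hgh, hsnd.eventually hdiag] with u h1 h2 h3 h4 hu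
  have hu' : u.1 - u.2 ≠ 0 := sub_ne_zero.2 (hu rfl)
  rw [if_pos rfl, h1 (hu rfl), h2, h3, h4]
  field_simp
  ring

end Correlators

lemma eventually_ne_zero_right : ∀ᶠ y in 𝓝[≠] (0 : ℂ), ∀ᶠ x in 𝓝 (0 : ℂ), x ≠ y := by
  filter_upwards [self_mem_nhdsWithin] with y hy
  exact eventually_ne_nhds (Ne.symm hy)

namespace Correlators

lemma sheetCoord_injective (D : LocalCoords Γ) {q : ℂ} (hq : q ≠ 0) {s s' : Sheet D} (h : s.1 = s'.1)
    (he : sheetCoord D q s = sheetCoord D q s') : s = s' := by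
  obtain ⟨μ, m⟩ := s
  obtain ⟨μ', m'⟩ := s'
  obtain rfl : μ = μ' := h
  have h1 := mul_right_cancel₀ (pow_ne_zero _ hq) he
  have hr : D.r μ ≠ 0 := Nat.ne_of_gt (D.r_pos μ)
  exact congrArg _ (Fin.ext ((Complex.isPrimitiveRoot_exp _ hr).pow_inj m.2 m'.2 h1))

/-- The regular part of `ω_{0,2}` near `(μ, ν)`. -/
def regular (μ ν : Γ.ramT) : ℂ × ℂ → ℂ := (W.exists_regular μ ν).choose

variable (μ ν : Γ.ramT)

lemma analyticAt_regular : AnalyticAt ℂ (W.regular μ ν) 0 := (W.exists_regular μ ν).choose_spec.1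

lemma form02_eq_regular : ∀ᶠ u in 𝓝 (0 : ℂ × ℂ), (μ = ν → u.1 ≠ u.2) → ev (W.form 0 2) ![coordVec (D.ζ μ) u.1, coordVec (D.ζ ν) u.2] =
      W.regular μ ν u + open Classical in if μ = ν then 1 / (u.1 - u.2) ^ 2 else 0 :=
  (W.exists_regular μ ν).choose_spec.2

lemma F02_eq (k l : ℕ+) : W.F02 (μ, k) (ν, l) = taylorTwo (W.regular μ ν) (k - 1) (l - 1) := by
  have hk := k.pos
  have hl := l.pos
  rw [taylorTwo, F02, Nat.cast_sub hk, Nat.cast_sub hl]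
  refine laurentCoeff_congr ?_ _
  filter_upwards [(eventually_curry_zero (W.form02_eq_regular μ ν)).filter_mono nhdsWithin_le_nhds, eventually_ne_zero_right] with x hx hx'
  refine laurentCoeff_congr (Eventually.filter_mono nhdsWithin_le_nhds ?_) _
  filter_upwards [hx, hx'] with y hy hxy
  rw [hy fun _ => hxy.symm]
  exact add_sub_cancel_right _ _

lemma F02_symm (a b : Idx Γ) : W.F02 a b = W.F02 b a := by
  obtain ⟨μ, k⟩ := a
  obtain ⟨ν, l⟩ := b
  rw [F02_eq, F02]
  have hk := k.pos
  have hl := l.pos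
  obtain ⟨b, hb, h⟩ := (AnalyticAt.exists_taylor_two (W.analyticAt_regular μ ν) (k + l)).2 (k - 1) (by omega)
  rw [← laurentCoeff_eq_of_taylor hb (h.filter_mono nhdsWithin_le_nhds) (show (l : ℕ) - 1 < k + l by omega), Nat.cast_sub hk, Nat.cast_sub hl]
  refine laurentCoeff_congr ?_ _
  filter_upwards [(eventually_curry_zero (eventually_swap_zero ((W.form02_eq_regular μ ν).and
    (D.eventually_symm_ne_symm μ ν)))).filter_mono nhdsWithin_le_nhds, eventually_ne_zero_right] with y hy hy'
  refine laurentCoeff_congr (Eventually.filter_mono nhdsWithin_le_nhds ?_) _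
  filter_upwards [hy, hy'] with x hx hxy
  have h1 := hx.1 fun _ => hxy
  simp only [Prod.swap_prod_mk] at h1
  rw [W.form02.symm _ _ (Ne.symm (hx.2 fun _ => hxy)), h1]
  by_cases hμ : μ = ν
  · rw [if_pos hμ, if_pos hμ.symm, ← neg_sub y x, neg_sq, add_sub_cancel_right]
  · rw [if_neg hμ, if_neg (Ne.symm hμ), add_zero, sub_zero]

lemma dxi_local (k : ℕ+) : ∀ᶠ w in 𝓝[≠] 0, (k : ℂ) * W.dxi (μ, k) (coordVec (D.ζ ν) w) =
    laurentCoeff (fun u => W.regular μ ν (u, w)) ((k - 1 : ℕ) : ℤ) + open Classical in if μ = ν then k * w ^ (-(k : ℤ) - 1) else 0 := by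
  have hk := k.pos
  filter_upwards [(eventually_curry_zero (eventually_swap_zero ((W.form02_eq_regular μ ν).and
    (D.eventually_symm_ne_symm μ ν)))).filter_mono nhdsWithin_le_nhds, eventually_ne_zero_right, self_mem_nhdsWithin,
    (eventually_curry_zero (eventually_swap_zero (W.analyticAt_regular μ ν).eventually_analyticAt)).filter_mono
      nhdsWithin_le_nhds] with w h1 h2 h0 h3
  have hp : (coordVec (D.ζ ν) w).proj ≠ μ := by
    have := h1.self_of_nhds.2 fun _ => h2.self_of_nhds
    simp only [Prod.swap_prod_mk] at this
    rw [D.symm_zero] at this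
    exact Ne.symm this
  rw [W.dxi_eq μ hp k, Nat.cast_sub hk]
  have ha : AnalyticAt ℂ (fun u => W.regular μ ν (u, w)) 0 := h3.self_of_nhds.comp_of_eq (analyticAt_id.prod analyticAt_const) rfl
  by_cases hμ : μ = ν
  · have hs : AnalyticAt ℂ (fun u => 1 / (u - w) ^ 2) 0 := analyticAt_const.div ((analyticAt_id.sub analyticAt_const).pow 2) (by simpa using h0)
    rw [if_pos hμ, ← laurentCoeff_inv_sub_sq h0]
    have hr : ∀ {g : ℂ → ℂ}, AnalyticAt ℂ g 0 → HasRes (fun u => g u * u ^ (-((k : ℤ) - 1) - 1)) (laurentCoeff g ((k : ℤ) - 1)) :=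
      fun {g} hg => MeromorphicAt.hasRes (hg.meromorphicAt.mul ((MeromorphicAt.id 0).zpow _))
    refine HasRes.residue_eq (((hr ha).add (hr hs)).congr (Eventually.filter_mono nhdsWithin_le_nhds ?_))
    filter_upwards [h1, h2] with u hu hu'
    have := hu.1 fun _ => hu'
    simp only [Prod.swap_prod_mk, if_pos hμ] at this
    rw [this, add_mul]
  · rw [if_neg hμ, add_zero]
    refine laurentCoeff_congr (Eventually.filter_mono nhdsWithin_le_nhds ?_) _
    filter_upwards [h1, h2] with u hu hu'
    have := hu.1 fun _ => hu'
    simpa only [Prod.swap_prod_mk, if_neg hμ, add_zero] using this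

lemma dxi_expansion (k : ℕ+) (B : ℕ) : ∃ g : ℂ → ℂ, AnalyticAt ℂ g 0 ∧ ∀ᶠ w in 𝓝[≠] 0,
    W.dxi (μ, k) (coordVec (D.ζ ν) w) = ∑ l ∈ range B, W.F02 (ν, l.succPNat) (μ, k) / k * w ^ l +
      (open Classical in if μ = ν then w ^ (-(k : ℤ) - 1) else 0) + w ^ B * g w := by
  have hk := k.pos
  have hk0 : (k : ℂ) ≠ 0 := mod_cast hk.ne'
  obtain ⟨b, hb, h⟩ := (AnalyticAt.exists_taylor_two (W.analyticAt_regular μ ν) (B + k)).2 (k - 1) (by omega)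
  refine ⟨fun w => (∑ j ∈ range k, taylorTwo (W.regular μ ν) (k - 1) (B + j) * w ^ j + w ^ (k : ℕ) * b w) / k,
    ((analyticAt_fun_sum _ fun j _ => analyticAt_const.mul (analyticAt_id.pow j)).add
      ((analyticAt_id.pow _).mul hb)).div analyticAt_const hk0, ?_⟩
  filter_upwards [W.dxi_local μ ν k, h.filter_mono nhdsWithin_le_nhds] with w h1 h2
  rw [h2, sum_range_add] at h1
  refine mul_left_cancel₀ hk0 (h1.trans ?_)
  have e1 : ∀ l : ℕ, W.F02 (ν, l.succPNat) (μ, k) / k * w ^ l = taylorTwo (W.regular μ ν) (k - 1) l * w ^ l / k := fun l => by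
    rw [W.F02_symm, F02_eq, Nat.succPNat_coe, Nat.succ_sub_one]; ring
  have e2 : ∀ l : ℕ, taylorTwo (W.regular μ ν) (k - 1) (B + l) * w ^ (B + l) =
      w ^ B * (taylorTwo (W.regular μ ν) (k - 1) (B + l) * w ^ l) := fun l => by ring
  rw [sum_congr rfl fun l _ => e1 l, ← sum_div, sum_congr rfl fun l _ => e2 l, ← mul_sum]
  by_cases hμ : μ = ν
  · rw [if_pos hμ, if_pos hμ]; field_simp; ring
  · rw [if_neg hμ, if_neg hμ]; field_simp; ring

variable {W}

lemma sheetVec_apply (B : ℕ) (q : ℂ) (s : Sheet D) (a : Idx Γ) (hB : a.2 ≤ B) : W.sheetVec B q s a =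
    ∑ l ∈ range B, 1 / (D.r s.1 : ℂ) * sheetCoord D q s ^ (l + 1) * (W.F02 (s.1, l.succPNat) a / a.2) +
      open Classical in if a.1 = s.1 then 1 / (D.r s.1 : ℂ) * sheetCoord D q s ^ (-(a.2 : ℤ)) else 0 := by
  rw [sheetVec, Pi.add_apply, Finset.sum_apply, Finset.sum_apply, sum_box]
  have h1 : ∀ p : ℤ, 0 ≤ p → W.creatorVec s.1 p a = 0 := fun p hp => dif_neg (by omega)
  simp only [Pi.smul_apply, h1 _ le_rfl, h1 _ (Int.natCast_nonneg _), smul_zero, mul_zero, sum_const_zero, zero_add,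
    sheetWeight_neg, creatorVec_neg, smul_eq_mul]
  congr 1
  have ha := a.2.pos
  rw [sum_eq_single_of_mem ((a.2 : ℕ) : ℤ) (by rw [box, mem_Icc]; omega)]
  · rw [annihVec, sheetWeight]
    by_cases h : a.1 = s.1
    · rw [if_pos ⟨h, rfl⟩, if_pos h, mul_one]
    · rw [if_neg fun h' => h h'.1, if_neg h, mul_zero]
  · intro p _ hp
    rw [annihVec, if_neg fun h' => hp h'.2.symm, mul_zero]

lemma _root_.WLoop.AsympTo.scaled_comp_sheetCoord (s : Sheet D) (a : ℂ) {f : ℂ → ℂ} {c : ℕ → ℂ} (h : ∀ B : ℕ, ∃ g : ℂ → ℂ,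
    AnalyticAt ℂ g 0 ∧ ∀ᶠ w in 𝓝[≠] 0, f w = ∑ k ∈ range B, c k * w ^ k + w ^ B * g w) :
    AsympTo (fun q => a * sheetCoord D q s * f (sheetCoord D q s))
      fun B q => ∑ k ∈ range B, a * sheetCoord D q s ^ (k + 1) * c k := by
  refine AsympTo.comp_sheetCoord s (f := fun w => a * w * f w) (φ := fun B w => ∑ k ∈ range B, a * w ^ (k + 1) * c k) 1
    (fun B => ?_) (by ext; simp)
  obtain ⟨g, hg, h⟩ := h B
  refine ⟨fun w => a * g w, analyticAt_const.mul hg, h.mono fun w hw => ?_⟩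
  rw [hw, mul_add, mul_sum, show (1 : ℤ) + B = (B + 1 : ℕ) by push_cast; ring, zpow_natCast]
  congr 1
  · exact sum_congr rfl fun k _ => by ring
  · ring

lemma hasSheetExpansions (hs : ∀ μ, 1 ≤ D.s μ) : W.HasSheetExpansions := by
  have hr : ∀ s : Sheet D, (D.r s.1 : ℂ) ≠ 0 := fun s => mod_cast Nat.ne_of_gt (D.r_pos s.1)
  have hpair : ∀ s s' : Sheet D, s ≠ s' → ∀ᶠ q in 𝓝[≠] (0 : ℂ), s.1 = s'.1 → sheetCoord D q s ≠ sheetCoord D q s' := by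
    intro s s' hss
    filter_upwards [self_mem_nhdsWithin] with q hq h heq
    exact hss (sheetCoord_injective D hq h heq)
  have htend : ∀ s s' : Sheet D, Tendsto (fun q => (sheetCoord D q s, sheetCoord D q s')) (𝓝[≠] 0) (𝓝 0) := fun s s' =>
    Tendsto.prodMk_nhds ((tendsto_sheetCoord D s).mono_right nhdsWithin_le_nhds) ((tendsto_sheetCoord D s').mono_right nhdsWithin_le_nhds)
  refine ⟨fun s => ?_, fun s s' hss => ?_, fun s t ht => ?_, fun s => ?_, fun s => ?_, fun s t ht => ?_, fun s s' hss => ?_,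
    fun s a => ?_, W.F02_symm⟩
  · exact (tendsto_sheetCoord D s).eventually (D.eventually_notMem s.1)
  · filter_upwards [(htend s s').eventually (D.eventually_symm_ne_symm s.1 s'.1), hpair s s' hss] with q h1 h2
    exact h1 h2
  · exact (tendsto_sheetCoord D s).eventually ((D.eventually_symm_ne s.1 (p := t.proj) fun h => ht (h ▸ s.1.2)).filter_mono nhdsWithin_le_nhds)
  · refine AsympTo.comp_sheetCoord s (f := fun w => 1 / (D.r s.1 : ℂ) * w * ev (W.form 0 1) ![coordVec (D.ζ s.1) w])
      (φ := fun B w => ∑ k ∈ range B, 1 / (D.r s.1 : ℂ) * w ^ (k + 1) * D.F01 s.1 (k.succPNat : ℕ+)) 1 (fun B => ?_) (by ext; simp)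
    have hl : ∀ k, laurentCoeff (fun w => w ^ (D.r s.1 : ℤ) * D.yLocal s.1 w) k = D.F01 s.1 k / D.r s.1 := fun k => by
      rw [laurentCoeff_mul_zpow _ (.of_forall fun w => rfl), LocalCoords.F01, mul_div_cancel_left₀ _ (hr s)]; rfl
    obtain ⟨g, hg, h⟩ := MeromorphicAt.laurent_eq (f := fun w => w ^ (D.r s.1 : ℤ) * D.yLocal s.1 w)
      (((MeromorphicAt.id 0).zpow _).mul (D.meromorphicAt_yLocal s.1)) (m := 1) (fun k hk => by
        rw [hl, D.F01_eq_zero s.1 (lt_of_lt_of_le (mod_cast hk) (hs s.1)), zero_div]) B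
    refine ⟨g, hg, ?_⟩
    filter_upwards [h, W.form01_local s.1] with w h1 h2
    simp_rw [hl] at h1
    rw [h2]
    refine Eq.trans ?_ (h1.trans ?_)
    · rw [zpow_natCast, ← pow_sub_one_mul (Nat.ne_of_gt (D.r_pos s.1)) w]
      field_simp [hr s]
    · congr 1
      refine sum_congr rfl fun k _ => ?_
      rw [show (1 : ℤ) + k = (k + 1 : ℕ) by push_cast; ring, zpow_natCast]
      simp only [Nat.succPNat_coe, Nat.succ_eq_add_one]
      ring
  · have hm := W.form11_meromorphic s.1 _ (D.ζ_mem s.1) (D.mem_source s.1)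
    rw [D.ζ_center] at hm
    have hpole := W.form11_pole s.1
    set f := fun w => ev (W.form 1 1) ![coordVec (D.ζ s.1) w] with hf
    obtain ⟨g, hg, hg'⟩ := (MeromorphicAt.meromorphicOrderAt_nonneg_iff ((MeromorphicAt.id 0).mul hm)).1 (by
      have h1 : meromorphicOrderAt (id : ℂ → ℂ) 0 = 1 := by
        have := meromorphicOrderAt_id_sub_const (𝕜 := ℂ) (x := 0)
        simp only [sub_zero] at this
        exact this
      rw [meromorphicOrderAt_mul (MeromorphicAt.id 0) hm, h1]
      generalize meromorphicOrderAt f 0 = o at hpole ⊢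
      cases o with
      | top => exact le_top
      | coe o =>
        have : (-1 : ℤ) ≤ o := mod_cast hpole
        exact_mod_cast (by omega : 0 ≤ 1 + o))
    have hz : ∀ k < -1, laurentCoeff f k = 0 := fun k hk => by
      have := laurentCoeff_mul_zpow (f := f) 1 (hg'.symm.trans (.of_forall fun w => by simp)) (k + 1)
      rw [add_sub_cancel_right] at this
      rw [← this, AnalyticAt.laurentCoeff_of_neg hg (by omega)]
    refine ((AsympTo.const (1 / (D.r s.1 : ℂ) * W.Q s.1)).add (AsympTo.scaled_comp_sheetCoord s (1 / (D.r s.1 : ℂ))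
      (f := fun w => f w - W.Q s.1 * w⁻¹) (c := fun k => W.F11 (s.1, k.succPNat)) fun B => ?_)).congr ?_ fun B => .of_forall fun q => rfl
    · obtain ⟨g, hg, h⟩ := MeromorphicAt.laurent_eq hm hz (B + 1)
      refine ⟨g, hg, h.mono fun w hw => ?_⟩
      rw [hw, sum_range_succ', sum_congr rfl fun k _ => show laurentCoeff f (-1 + (k + 1 : ℕ)) * w ^ (-1 + ((k + 1 : ℕ) : ℤ)) =
        W.F11 (s.1, k.succPNat) * w ^ k by rw [F11, ← zpow_natCast w k]; congr 2; simp]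
      simp [hf, laurentCoeff, Q]
      ring
    · filter_upwards [self_mem_nhdsWithin] with q hq
      have := sheetCoord_ne_zero D hq s
      simp only [sheetScale, sheetPoint, hf]
      field_simp
      ring
  · have ht' : t.proj ≠ s.1 := fun h => ht (h ▸ s.1.2)
    refine AsympTo.scaled_comp_sheetCoord s _ (f := fun w => ev (W.form 0 2) ![coordVec (D.ζ s.1) w, t])
      (c := fun k => (k + 1 : ℕ) * W.dxi (s.1, k.succPNat) t) fun B => ?_
    obtain ⟨g, hg, h⟩ := AnalyticAt.taylor_eq (W.analyticAt_form02 s.1 t (D.zero_mem_target s.1) (by rw [D.symm_zero]; exact Ne.symm ht')) B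
    refine ⟨g, hg, (h.filter_mono nhdsWithin_le_nhds).mono fun w hw => ?_⟩
    rw [hw]
    congr 1
    refine sum_congr rfl fun k _ => ?_
    have := W.dxi_eq s.1 ht' k.succPNat
    simp only [Nat.succPNat_coe, Nat.succ_eq_add_one, Nat.cast_add, Nat.cast_one, add_sub_cancel_right] at this
    rw [← this]
    push_cast
    ring
  · have hG := W.analyticAt_regular s.1 s'.1
    have hcoord : ∀ s : Sheet D, AnalyticAt ℂ (fun q => sheetCoord D q s) 0 := fun s => analyticAt_const.mul (analyticAt_id.pow _)
    have hcoord0 : ∀ s : Sheet D, sheetCoord D 0 s = 0 := fun s => by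
      rw [sheetCoord, zero_pow (Nat.ne_of_gt (rQuot_pos D s.1)), mul_zero]
    have h1 : AsympTo (fun q => W.sheetScale q s * W.sheetScale q s' * W.regular s.1 s'.1 (sheetCoord D q s, sheetCoord D q s'))
        fun B q => W.approx02 B q s s' := by
      refine AsympTo.of_remainder 0 (fun B => ?_) (by ext; simp [approx02])
      obtain ⟨h₁, h₂, hh₁, hh₂, h⟩ := (AnalyticAt.exists_taylor_two hG B).1
      have hc : ∀ {h : ℂ × ℂ → ℂ}, AnalyticAt ℂ h 0 → AnalyticAt ℂ (fun q => h (sheetCoord D q s, sheetCoord D q s')) 0 :=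
        fun hh => hh.comp_of_eq ((hcoord s).prod (hcoord s')) (by rw [hcoord0, hcoord0]; rfl)
      have hq : ∀ (s : Sheet D) (q : ℂ), sheetCoord D q s ^ B = q ^ B * (sheetRoot D s ^ B * q ^ ((rQuot D s.1 - 1) * B)) := by
        intro s q
        rw [sheetCoord, mul_pow, mul_left_comm, ← pow_add, ← pow_mul]
        congr 2
        have := rQuot_pos D s.1
        rw [Nat.sub_mul, one_mul]
        have := Nat.le_mul_of_pos_left B this
        omega
      refine ⟨fun q => W.sheetScale q s * W.sheetScale q s' * (sheetRoot D s ^ B * q ^ ((rQuot D s.1 - 1) * B) *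
        h₁ (sheetCoord D q s, sheetCoord D q s') + sheetRoot D s' ^ B * q ^ ((rQuot D s'.1 - 1) * B) *
        h₂ (sheetCoord D q s, sheetCoord D q s')), ?_, ?_⟩
      · exact ((analyticAt_const.mul (hcoord s)).mul (analyticAt_const.mul (hcoord s'))).mul
          (((analyticAt_const.mul (analyticAt_id.pow _)).mul (hc hh₁)).add
            ((analyticAt_const.mul (analyticAt_id.pow _)).mul (hc hh₂)))
      · filter_upwards [(htend s s').eventually h] with q hv
        rw [hv]
        simp only [hq]
        rw [approx02, zero_add, zpow_natCast, sum_comm, mul_add, mul_add, mul_sum, add_assoc]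
        congr 1
        · refine sum_congr rfl fun k _ => ?_
          rw [mul_sum, mul_sum]
          refine sum_congr rfl fun l _ => ?_
          rw [F02_eq]
          simp only [Nat.succPNat_coe, Nat.succ_eq_add_one, Nat.add_sub_cancel, sheetScale]
          ring
        · ring
    refine (h1.add (AsympTo.const (sheetPair D s s'))).congr ?_ fun B => .of_forall fun q => rfl
    filter_upwards [(htend s s').eventually (W.form02_eq_regular s.1 s'.1), hpair s s' hss, self_mem_nhdsWithin] with q h2 h3 hq
    rw [sheetPoint, sheetPoint, h2 h3, mul_add]
    congr 1
    by_cases h : s.1 = s'.1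
    · have h3 := h3 h
      rw [sheetPair, if_pos h, if_pos h, sheetScale, sheetScale]
      simp only [sheetCoord, ← h] at h3 ⊢
      generalize q ^ rQuot D s.1 = Q at h3 ⊢
      have hQ : Q ≠ 0 := fun h0 => h3 (by rw [h0, mul_zero, mul_zero])
      have hne : sheetRoot D s' - sheetRoot D s ≠ 0 := sub_ne_zero.2 fun h0 => h3 (by rw [h0])
      rw [show (sheetRoot D s * Q - sheetRoot D s' * Q) ^ 2 = (sheetRoot D s' - sheetRoot D s) ^ 2 * Q ^ 2 by ring]
      have := hr s
      field_simp
    · rw [sheetPair, if_neg h, if_neg h, mul_zero]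
  · obtain ⟨μ, k⟩ := a
    have h1 := AsympTo.scaled_comp_sheetCoord s (1 / (D.r s.1 : ℂ)) (f := fun w => W.dxi (μ, k) (coordVec (D.ζ s.1) w) -
        open Classical in if μ = s.1 then w ^ (-(k : ℤ) - 1) else 0) (c := fun l => W.F02 (s.1, l.succPNat) (μ, k) / k) fun B => by
      obtain ⟨g, hg, h⟩ := W.dxi_expansion μ s.1 k B
      exact ⟨g, hg, h.mono fun w hw => by rw [hw, add_right_comm, add_sub_cancel_right]⟩
    have h2 : AsympTo (fun q => open Classical in if μ = s.1 then 1 / (D.r s.1 : ℂ) * sheetCoord D q s ^ (-(k : ℤ)) else 0)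
        fun B q => open Classical in if μ = s.1 then 1 / (D.r s.1 : ℂ) * sheetCoord D q s ^ (-(k : ℤ)) else 0 := by
      by_cases h : μ = s.1
      · simp_rw [if_pos h, sheetCoord, mul_zpow, ← zpow_natCast _ (rQuot D s.1), ← zpow_mul]
        exact (AsympTo.const _).mul ((AsympTo.const _).mul (AsympTo.zpow _))
      · simp_rw [if_neg h]
        exact AsympTo.const 0
    obtain ⟨c, h3, h4⟩ := h1.add h2
    have e : ∀ᶠ q in 𝓝[≠] (0 : ℂ), W.sheetScale q s * W.dxi (μ, k) (W.sheetPoint q s) =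
        1 / (D.r s.1 : ℂ) * sheetCoord D q s * (W.dxi (μ, k) (coordVec (D.ζ s.1) (sheetCoord D q s)) -
        open Classical in if μ = s.1 then sheetCoord D q s ^ (-(k : ℤ) - 1) else 0) +
        open Classical in if μ = s.1 then 1 / (D.r s.1 : ℂ) * sheetCoord D q s ^ (-(k : ℤ)) else 0 := by
      filter_upwards [self_mem_nhdsWithin] with q hq
      have h0 := sheetCoord_ne_zero D hq s
      by_cases h : μ = s.1
      · simp_rw [if_pos h]
        rw [mul_sub, mul_assoc _ _ (_ ^ _), ← zpow_one_add₀ h0, show 1 + (-(k : ℤ) - 1) = -k by ring, sub_add_cancel]; rfl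
      · simp_rw [if_neg h]
        rw [sub_zero, add_zero]; rfl
    refine ⟨c, h3.congr' (e.mono fun q hq => hq.symm) EventuallyEq.rfl, ?_⟩
    filter_upwards [h4, eventually_ge_atTop (k : ℕ)] with B hB hBk
    refine hB.congr' ?_ EventuallyEq.rfl
    filter_upwards [e] with q hq
    rw [hq, sheetVec_apply B q s (μ, k) hBk]

end Correlators

section LaurentPolynomials

lemma HasRes.eq_zero_of_isBigO {f : ℂ → ℂ} {r : ℂ} (h : HasRes f r) (hO : f =O[𝓝[≠] 0] fun _ => (1 : ℂ)) : r = 0 := by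
  obtain ⟨C, hC⟩ := hO.bound
  have h1 : ∀ᶠ ρ in 𝓝[>] (0 : ℝ), ‖r‖ ≤ ρ * C := by
    filter_upwards [h, eventually_circle hC, self_mem_nhdsWithin] with ρ h1 h2 hρ
    rw [← h1.2, ← smul_eq_mul]
    exact circleIntegral.norm_two_pi_i_inv_smul_integral_le_of_norm_le_const (le_of_lt hρ) fun w hw => by simpa using h2 w hw
  have h2 : Tendsto (fun ρ : ℝ => ρ * C) (𝓝[>] 0) (𝓝 0) :=
    ((show Continuous fun ρ : ℝ => ρ * C by fun_prop).tendsto' 0 0 (zero_mul C)).mono_left nhdsWithin_le_nhds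
  exact norm_le_zero_iff.1 (ge_of_tendsto h2 h1)

lemma coeff_eq_zero_of_isBigO {K : Finset ℤ} {c : ℤ → ℂ} {N : ℕ} (hN : 1 ≤ N) {M : ℤ}
    (h : (fun q : ℂ => ∑ k ∈ K, (q ^ N) ^ (-k) * c k) =O[𝓝[≠] 0] fun q => q ^ M) {k : ℤ} (hk : k ∈ K) (hM : -(N * k) < M) : c k = 0 := by
  have h1 : HasRes (fun q => ∑ j ∈ K, c j * q ^ (-(N * j) + N * k - 1)) _ :=
    HasRes.sum fun j _ => (HasRes.zpow (-(N * j) + N * k - 1)).const_mul (c j)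
  have h2 := h1.eq_zero_of_isBigO (((isBigO_zpow_mul h (Asymptotics.isBigO_refl (fun q : ℂ => q ^ (N * k - 1)) _) (c := 0) (by omega)).congr' ?_ ?_))
  · rwa [sum_eq_single_of_mem k hk, if_pos (by ring), mul_one] at h2
    intro j _ hj
    rw [if_neg, mul_zero]
    intro h
    have : (N : ℤ) * (k - j) = 0 := by linarith
    rcases mul_eq_zero.1 this with h | h
    · omega
    · exact hj (sub_eq_zero.1 h).symm
  · filter_upwards [self_mem_nhdsWithin] with q hq
    rw [sum_mul]
    refine sum_congr rfl fun j _ => ?_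
    rw [mul_right_comm, ← zpow_natCast q, ← zpow_mul, ← zpow_add₀ hq, mul_comm]
    congr 2
    ring
  · exact .of_forall fun q => zpow_zero q

/-- A function approximated by Laurent polynomials in `q ^ N` is `O(q ^ (- N (κ - 1)))` if and only if the
coefficients of the `q ^ (- N k)` vanish for `k ≥ κ`. -/
lemma AsympTo.isBigO_iff {f : ℂ → ℂ} {φ : ℕ → ℂ → ℂ} (h : AsympTo f φ) {N : ℕ} (hN : 1 ≤ N) {m : ℕ → ℕ}
    {c : ℕ → ℤ → ℂ} (hφ : ∀ B, ∀ q ≠ 0, φ B q = ∑ k ∈ box (m B), (q ^ N) ^ (-k) * c B k) (hm : ∀ B, ∀ k ∉ box (m B), c B k = 0)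
    {c' : ℤ → ℂ} (hc : ∀ k, ∀ᶠ B in atTop, c B k = c' k) (κ : ℤ) : ((∀ k, κ ≤ k → c' k = 0) → f =O[𝓝[≠] 0] fun q => q ^ (-(N * (κ - 1)))) ∧
    (∀ M : ℤ, -(N * κ) < M → (f =O[𝓝[≠] 0] fun q => q ^ M) → ∀ k, κ ≤ k → c' k = 0) := by
  obtain ⟨C, h1, h2⟩ := h
  have hφ' : ∀ B, φ B =ᶠ[𝓝[≠] 0] fun q => ∑ k ∈ box (m B), (q ^ N) ^ (-k) * c B k := fun B => by
    filter_upwards [self_mem_nhdsWithin] with q hq using hφ B q hq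
  have h3 : ∀ᶠ B : ℕ in atTop, ∀ M : ℤ, M ≤ B - C → (f =O[𝓝[≠] 0] fun q => q ^ M) → ∀ k : ℤ, -(N * k) < M → c B k = 0 := by
    filter_upwards [h2] with B hB M hM hf k hk
    by_cases hkB : k ∈ box (m B)
    · refine coeff_eq_zero_of_isBigO hN (M := M) (((hf.sub (hB.trans (zpow_isBigO hM))).congr_left fun q => ?_).congr' (hφ' B)
        EventuallyEq.rfl) hkB hk
      ring
    · exact hm B k hkB
  constructor
  · intro hz
    have h4 : ∀ᶠ B : ℕ in atTop, ∀ k ∈ Finset.Icc κ C, c B k = c' k := (Filter.eventually_all_finset _).2 fun k _ => hc k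
    obtain ⟨B, h2, h3, h4, hB1, hB2⟩ := (h2.and (h3.and (h4.and ((eventually_ge_atTop C).and
      (eventually_ge_atTop ((-(N * (κ - 1)) : ℤ) + C).toNat))))).exists
    have hc0 : ∀ k, κ ≤ k → c B k = 0 := by
      intro k hk
      by_cases hkC : k ≤ C
      · rw [h4 k (mem_Icc.2 ⟨hk, hkC⟩), hz k hk]
      · refine h3 (-(C : ℤ)) (by omega) h1 k ?_
        have : (k : ℤ) ≤ N * k := le_mul_of_one_le_left (by omega) (mod_cast hN)
        omega
    have h5 : φ B =O[𝓝[≠] 0] fun q => q ^ (-(N * (κ - 1))) := by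
      suffices h : (fun q : ℂ => ∑ k ∈ box (m B), (q ^ N) ^ (-k) * c B k) =O[𝓝[≠] 0] fun q => q ^ (-(N * (κ - 1))) from
        h.congr' (hφ' B).symm EventuallyEq.rfl
      refine Asymptotics.IsBigO.fun_sum fun k _ => ?_
      by_cases hk : κ ≤ k
      · simp only [hc0 k hk, mul_zero]
        exact Asymptotics.isBigO_zero _ _
      · have hle : -(N * (κ - 1)) ≤ -((N : ℤ) * k) := neg_le_neg (mul_le_mul_of_nonneg_left (by omega) (by positivity))
        refine ((zpow_isBigO hle).const_mul_left (c B k)).congr_left fun q => ?_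
        · rw [← zpow_natCast q, ← zpow_mul, mul_comm (c B k)]
          congr 2
          ring
    refine ((h2.trans (zpow_isBigO (by omega))).add h5).congr_left fun q => ?_
    ring
  · intro M hM hf k hk
    obtain ⟨B, hB, h3, hB2⟩ := ((hc k).and (h3.and (eventually_ge_atTop (M + C).toNat))).exists
    rw [← hB]
    refine h3 M (by omega) hf k ?_
    have : (N : ℤ) * κ ≤ N * k := mul_le_mul_of_nonneg_left hk (by positivity)
    omega

end LaurentPolynomials

section Detection

lemma coeff_linSubst_map {V V' : Type*} [Fintype V] [DecidableEq V] [Fintype V'] [DecidableEq V'] (e : V ↪ V')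
    (c : V' → Idx Γ → ℂ) (U : Finset V) (f : CPoly Γ) : (linSubst c f).coeff (sqf (U.map e)) = (linSubst (fun v => c (e v)) f).coeff (sqf U) := by
  induction U using Finset.induction_on generalizing f with
  | empty => rw [map_empty, sqf_empty, coeff_linSubst_zero, sqf_empty, coeff_linSubst_zero]
  | insert v U hv ih =>
    rw [map_insert, coeff_linSubst_insert c (by simpa using hv), ih, coeff_linSubst_insert _ hv]

namespace Correlators

lemma dxi_independent {A : Finset (Idx Γ)} {c : Idx Γ → ℂ}
    (h : ∀ t : TB S, t.proj ∉ Γ.ramT → ∑ a ∈ A, c a * W.dxi a t = 0) {a : Idx Γ} (ha : a ∈ A) : c a = 0 := by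
  classical
  obtain ⟨ν, k⟩ := a
  choose g hg hd using fun a : Idx Γ => W.dxi_expansion a.1 ν a.2 0
  have h1 : HasRes (fun w => ∑ a ∈ A, c a * ((if a.1 = ν then w ^ (-(a.2 : ℤ) - 1 + k) else 0) + w ^ (k : ℕ) * g a w))
      (∑ a ∈ A, c a * ((if a.1 = ν then if -(a.2 : ℤ) - 1 + k = -1 then 1 else 0 else 0) + 0)) := by
    refine HasRes.sum fun a _ => (HasRes.add ?_ (HasRes.of_analyticAt ((analyticAt_id.pow _).mul (hg a)))).const_mul _
    split_ifs with h1 h2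
    · simpa [h2] using HasRes.zpow (-(a.2 : ℤ) - 1 + k)
    · simpa [h2] using HasRes.zpow (-(a.2 : ℤ) - 1 + k)
    · exact HasRes.of_analyticAt analyticAt_const
  have h2 := h1.eq_zero_of_isBigO ((Asymptotics.isBigO_zero _ _).congr' (f₁ := fun _ => 0) (by
    filter_upwards [D.eventually_notMem ν, (Filter.eventually_all_finset A).2 fun a _ => hd a, self_mem_nhdsWithin] with w h1 h2 hw
    have h3 := congrArg (fun x => w ^ (k : ℕ) * x) (h _ h1)
    simp only [mul_zero, mul_sum] at h3
    refine h3.symm.trans ?_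
    refine sum_congr rfl fun a ha => ?_
    rw [h2 a ha, range_zero, sum_empty, zero_add, pow_zero, one_mul, mul_left_comm, mul_add]
    by_cases h : a.1 = ν
    · rw [if_pos h, if_pos h, zpow_add₀ hw, zpow_natCast]; ring
    · rw [if_neg h, if_neg h]; ring) EventuallyEq.rfl)
  rw [sum_eq_single_of_mem _ ha] at h2
  · rwa [if_pos rfl, if_pos (by ring), add_zero, mul_one] at h2
  · rintro ⟨ν', l⟩ _ hne
    rw [add_zero, mul_eq_zero]
    right
    split_ifs with h h'
    · refine absurd ?_ hne
      simp only at h h'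
      rw [h, show l = k from PNat.eq (by omega)]
    · rfl
    · rfl

lemma eq_zero_of_linSubst {f : CPoly Γ} (h : ∀ (n : ℕ) (w : Fin n → TB S), (∀ j, (w j).proj ∉ Γ.ramT) →
    (linSubst (fun b a => W.dxi a (w b)) f).coeff (sqf univ) = 0) : f = 0 := by
  have hpd : ∀ f : CPoly Γ, (∀ (n : ℕ) (w : Fin n → TB S), (∀ j, (w j).proj ∉ Γ.ramT) →
      (linSubst (fun b a => W.dxi a (w b)) f).coeff (sqf univ) = 0) → ∀ (a : Idx Γ) (n : ℕ) (w : Fin n → TB S), (∀ j, (w j).proj ∉ Γ.ramT) →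
      (linSubst (fun b a => W.dxi a (w b)) (pderiv a f)).coeff (sqf univ) = 0 := by
    classical
    intro f hf a n w hw
    refine W.dxi_independent (A := insert a f.vars) (c := fun a => (linSubst (fun b a => W.dxi a (w b)) (pderiv a f)).coeff (sqf univ)) ?_
      (mem_insert_self _ _)
    intro t ht
    have h1 := hf (n + 1) (Fin.cons t w) (Fin.cases ht hw)
    have e1 : (univ : Finset (Fin (n + 1))) = insert 0 (univ.map (Fin.succEmb n)) := by
      rw [Fin.univ_succ]; rw [cons_eq_insert]; rfl
    rw [e1, coeff_linSubst_insert _ (by simp [Fin.succ_ne_zero]), coeff_linSubst_map] at h1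
    have hsum : ∀ (A : Finset (Idx Γ)) (d : Idx Γ → Derivation ℂ (CPoly Γ) (CPoly Γ)) (g : CPoly Γ),
        (∑ a ∈ A, d a) g = ∑ a ∈ A, d a g := fun A d g => by
      induction A using Finset.induction_on with
      | empty => simp
      | insert a A ha ih => rw [sum_insert ha, sum_insert ha, Derivation.add_apply, ih]
    have e2 : mkDerivation ℂ (fun b : Idx Γ => C (W.dxi b (Fin.cons (α := fun _ => TB S) t w 0))) f =
        ∑ a ∈ insert a f.vars, W.dxi a t • pderiv a f := by
      have := MvPolynomial.derivation_eq_of_forall_mem_vars (f := f) (D₁ := mkDerivation ℂ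
        (fun b : Idx Γ => (C (W.dxi b t) : CPoly Γ)))
        (D₂ := ∑ a ∈ insert a f.vars, W.dxi a t • pderiv a) (fun b hb => by
          rw [mkDerivation_X, hsum, sum_eq_single_of_mem b (mem_insert_of_mem hb)]
          · simp [smul_eq_C_mul]
          · intro b' _ hb'
            simp [pderiv_X_of_ne hb'.symm])
      rw [Fin.cons_zero, this, hsum]
      rfl
    rw [e2, map_sum, coeff_sum] at h1
    rw [← h1]
    refine sum_congr rfl fun a _ => ?_
    rw [map_smul, MvPolynomial.coeff_smul, smul_eq_mul, mul_comm]
    rfl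
  have hco : ∀ (l : ℕ) (m : Idx Γ →₀ ℕ), m.degree = l → ∀ f : CPoly Γ, (∀ (n : ℕ) (w : Fin n → TB S), (∀ j, (w j).proj ∉ Γ.ramT) →
      (linSubst (fun b a => W.dxi a (w b)) f).coeff (sqf univ) = 0) → f.coeff m = 0 := by
    classical
    intro l
    induction l with
    | zero =>
      intro m hm f hf
      have h0 := hf 0 Fin.elim0 fun j => j.elim0
      rw [univ_eq_empty, sqf_empty, coeff_linSubst_zero] at h0
      rw [(Finsupp.degree_eq_zero_iff m).1 hm]
      exact h0
    | succ l ih =>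
      intro m hm f hf
      obtain ⟨a, ha⟩ : ∃ a, m a ≠ 0 := by
        by_contra hcon
        push Not at hcon
        rw [show m = 0 from Finsupp.ext hcon, map_zero] at hm
        omega
      have hle : Finsupp.single a 1 ≤ m := Finsupp.single_le_iff.2 (Nat.one_le_iff_ne_zero.2 ha)
      have h1 := ih (m - Finsupp.single a 1) (by
        have := congrArg Finsupp.degree (tsub_add_cancel_of_le hle)
        rw [map_add, Finsupp.degree_single, hm] at this
        omega) _ (hpd f hf a)
      rw [MvPolynomial.coeff_pderiv, tsub_add_cancel_of_le hle, mul_eq_zero] at h1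
      refine h1.resolve_right ?_
      exact Nat.cast_add_one_ne_zero _
  exact MvPolynomial.ext _ _ fun m => by rw [hco _ m rfl f h, coeff_zero]

end Correlators

end Detection

lemma mem_above
    {α : Γ.ram} {μ : Γ.ramT} : μ ∈ Γ.above α ↔ Γ.π μ = α := by
  classical
  simp [SpectralCurve.above]

section Fibres

lemma isSymmAt_iff {η : ∀ n, MultiForm S n} {Y : Type*} {t : Y → TB S} {U : Finset Y} : IsSymmAt η t U ↔
    ∀ k, k = U.card → ∀ v : Fin k → Y, Injective v → (∀ j, v j ∈ U) → ∀ τ : Equiv.Perm (Fin k),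
      ev (η k) (fun j => t (v (τ j))) = ev (η k) fun j => t (v j) := by
  constructor
  · rintro h k rfl
    exact h
  · exact fun h => h _ rfl

section Rescaling

variable {η : ∀ n, MultiForm S n} {Y Y' : Type*} {t : Y → TB S} {t' : Y' → TB S} {c : Y → ℂ} (ε : Y ↪ Y')
  {U : Finset Y}

lemma ev_rescale (h : ∀ y ∈ U, t' (ε y) = ⟨(t y).proj, c y • (t y).2⟩) {k : ℕ} (v : Fin k → Y) (hv : ∀ j, v j ∈ U) :
    ev (η k) (fun j => t' (ε (v j))) = (∏ j, c (v j)) * ev (η k) fun j => t (v j) :=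
  ev_smul (η k) (fun j => c (v j)) fun j => h (v j) (hv j)

lemma IsSymmAt.rescale (h : ∀ y ∈ U, t' (ε y) = ⟨(t y).proj, c y • (t y).2⟩) (hs : IsSymmAt η t U) : IsSymmAt η t' (U.map ε) := by
  rw [isSymmAt_iff] at hs ⊢
  intro k hk v hv hU τ
  choose u hu hu' using fun j => Finset.mem_map.1 (hU j)
  obtain rfl : v = fun j => ε (u j) := funext fun j => (hu' j).symm
  have hinj : Injective u := fun i j hij => hv (congrArg ε hij)
  rw [ev_rescale ε h (fun j => u (τ j)) fun j => hu _, ev_rescale ε h u hu, hs k (by rw [hk, card_map]) u hinj hu τ,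
    Equiv.prod_comp τ fun j => c (u j)]

lemma evSet_rescale (h : ∀ y ∈ U, t' (ε y) = ⟨(t y).proj, c y • (t y).2⟩)
    (hs : IsSymmAt η t U) : evSet η t' (U.map ε) = (∏ y ∈ U, c y) * evSet η t U := by
  have h1 := (IsSymmAt.rescale ε h hs).ev_eq (v := fun j => ε (U.equivFin.symm j)) (card_map ε).symm
    (ε.injective.comp (Subtype.val_injective.comp U.equivFin.symm.injective)) fun j => mem_map_of_mem ε (U.equivFin.symm j).2
  rw [← h1, ev_rescale ε h (fun j => (U.equivFin.symm j : Y)) fun j => (U.equivFin.symm j).2, evSet,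
    Equiv.prod_comp U.equivFin.symm fun y => c y, prod_coe_sort]

end Rescaling

lemma sheetCoord_pow (q : ℂ) (s : Sheet D) : sheetCoord D q s ^ D.r s.1 = q ^ rProd D := by
  have hr : D.r s.1 ≠ 0 := Nat.ne_of_gt (D.r_pos s.1)
  rw [sheetCoord, mul_pow, ← pow_mul, mul_comm (rQuot D s.1), r_mul_rQuot, sheetRoot, ← pow_mul, mul_comm (s.2 : ℕ), pow_mul,
    (Complex.isPrimitiveRoot_exp _ hr).pow_eq_one, one_pow, one_mul]

namespace Correlators

lemma fibre_eq (α : Γ.ram) {q : ℂ} (hq : q ≠ 0) (htarget : ∀ s : Sheet D, sheetCoord D q s ∈ (D.ζ s.1).target)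
    {e : Sheet D ↪ S} (he : ∀ s, e s = (D.ζ s.1).symm (sheetCoord D q s)) : D.fibre α (finPart (Γ.x α) + q ^ rProd D) = (sheets D α).map e := by
  have hx : ∀ μ ∈ Γ.above α, Γ.xf μ = finPart (Γ.x α) := fun μ hμ => by
    rw [SpectralCurve.xf, SpectralCurve.xt, mem_above.1 hμ]
  ext p
  simp only [LocalCoords.fibre, Set.Finite.mem_toFinset, Set.mem_ofPred_eq, Finset.mem_map]
  constructor
  · rintro ⟨hp, μ, hμ, hs⟩
    rw [D.xt_eq μ p hs, hx μ hμ, OnePoint.coe_eq_coe, add_right_inj, ← r_mul_rQuot D μ, mul_comm (D.r μ), pow_mul] at hp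
    have hr : D.r μ ≠ 0 := Nat.ne_of_gt (D.r_pos μ)
    have hQ := pow_ne_zero (rQuot D μ) hq
    have h1 : (D.ζ μ p / q ^ rQuot D μ) ^ D.r μ = 1 := by rw [div_pow, hp, div_self (pow_ne_zero _ hQ)]
    have : NeZero (D.r μ) := ⟨hr⟩
    obtain ⟨m, hm, hm'⟩ := (Complex.isPrimitiveRoot_exp _ hr).eq_pow_of_pow_eq_one h1
    refine ⟨⟨μ, ⟨m, hm⟩⟩, by simp [sheets, hμ], ?_⟩
    rw [he, sheetCoord, sheetRoot]
    change (D.ζ μ).symm (_ ^ m * q ^ rQuot D μ) = p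
    rw [hm', div_mul_cancel₀ _ hQ, (D.ζ μ).left_inv hs]
  · rintro ⟨s, hs, rfl⟩
    have hμ : s.1 ∈ Γ.above α := by simpa [sheets] using hs
    rw [he]
    refine ⟨?_, s.1, hμ, (D.ζ s.1).map_target (htarget s)⟩
    rw [D.xt_symm s.1 (htarget s), hx _ hμ, sheetCoord_pow]

lemma loopDifferential_eq (hs : ∀ μ, 1 ≤ D.s μ) (α : Γ.ram) (i h : ℕ) {n : ℕ} {w : Fin n → TB S} (hw : ∀ j, (w j).proj ∉ Γ.ramT) :
    ∀ᶠ q in 𝓝[≠] 0, (q ^ rProd D) ^ i * W.loopDifferential α i h (finPart (Γ.x α) + q ^ rProd D) w =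
      (coeff (h + n) (∑ Z ∈ powersetCard i (sheets D α),
        partSum (formSeries W.form (Sum.elim (W.sheetPoint q) w) (W.sheetScale q)) Z)).coeff (sqf univ) := by
  classical
  have H := hasSheetExpansions (W := W) hs
  filter_upwards [H.isSymmAt hw, self_mem_nhdsWithin, eventually_all.2 fun s : Sheet D =>
    (tendsto_sheetCoord D s).eventually ((D.eventually_mem_target s.1).filter_mono nhdsWithin_le_nhds),
    eventually_all.2 fun s : Sheet D => eventually_all.2 fun s' : Sheet D =>
      (show ∀ᶠ q in 𝓝[≠] (0 : ℂ), s ≠ s' → (W.sheetPoint q s).proj ≠ (W.sheetPoint q s').proj by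
        by_cases hss : s = s'
        · exact .of_forall fun q h' => absurd hss h'
        · exact (H.ne s s' hss).mono fun q hq _ => hq)] with q hsym hq htarget hne
  let e : Sheet D ↪ S := ⟨fun s => (W.sheetPoint q s).proj, fun s s' hss => by_contra fun h' => hne s s' h' hss⟩
  let ε : Sheet D ⊕ Fin n ↪ S ⊕ Fin n := e.sumMap (Embedding.refl _)
  let c : Sheet D ⊕ Fin n → ℂ := Sum.elim (fun s => (D.r s.1 * sheetCoord D q s ^ (D.r s.1 - 1) : ℂ)⁻¹) 1
  have hε : ∀ y, Sum.elim W.liftVec w (ε y) = ⟨(Sum.elim (W.sheetPoint q) w y).proj, c y • (Sum.elim (W.sheetPoint q) w y).2⟩ := by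
    rintro (s | j)
    · exact liftVec_eq W s.1 (htarget s) (sheetCoord_ne_zero D hq s)
    · exact congrArg (Bundle.TotalSpace.mk _) (one_smul ℂ (w j).2).symm
  have hmap : ∀ (L : Finset (Sheet D)) (N : Finset (Fin n)), (L.disjSum N).map ε = (L.map e).disjSum N := by
    intro L N
    ext (y | y) <;> simp [ε]
  have hscale : ∀ s, q ^ rProd D * (D.r s.1 * sheetCoord D q s ^ (D.r s.1 - 1) : ℂ)⁻¹ = W.sheetScale q s := by
    intro s
    have h0 := sheetCoord_ne_zero D hq s
    have hr : (D.r s.1 : ℂ) ≠ 0 := mod_cast Nat.ne_of_gt (D.r_pos s.1)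
    rw [← sheetCoord_pow q s, ← pow_sub_one_mul (Nat.ne_of_gt (D.r_pos s.1)), sheetScale]
    field_simp
  have hform : ∀ L : Finset (Sheet D), L.Nonempty → formSeries W.form (Sum.elim W.liftVec w) (fun _ => q ^ rProd D) (L.map e) =
      formSeries W.form (Sum.elim (W.sheetPoint q) w) (W.sheetScale q) L := by
    intro L hL
    ext l : 1
    simp only [formSeries, PowerSeries.coeff_mk, card_map]
    refine sum_congr rfl fun N _ => ?_
    congr 1
    refine if_congr Iff.rfl ?_ rfl
    rw [← hmap, evSet_rescale ε (fun y _ => hε y) (hsym _ L hL N), prod_disjSum, prod_map]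
    simp only [c, Sum.elim_inl, Sum.elim_inr, Pi.one_apply, prod_const_one, mul_one]
    rw [← mul_assoc, ← prod_mul_distrib]
    congr 1
    exact prod_congr rfl fun s _ => hscale s
  rw [loopDifferential, fibre_eq α hq htarget (e := e) fun s => rfl, powersetCard_map, sum_map, map_sum, coeff_sum, mul_sum]
  refine sum_congr rfl fun Z hZ => ?_
  have h1 := coeff_partSum_formSeries (n := n) W.form (Sum.elim W.liftVec w) (fun _ => q ^ rProd D) (Z.map e) (h := h) (by
    intro g L hL hL0 N
    obtain ⟨L', -, rfl⟩ := subset_map_iff.1 hL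
    rw [← hmap]
    exact IsSymmAt.rescale ε (fun y _ => hε y) (hsym g L' (map_nonempty.1 hL0) N))
  rw [prod_const, card_map, (mem_powersetCard.1 hZ).2] at h1
  rw [partSum_map, partSum_congr fun L _ hL => hform L hL] at h1
  exact h1.symm

end Correlators

end Fibres

lemma LocalCoords.sInt_pos (hs : ∀ μ, 1 ≤ D.s μ) {μ : Γ.ramT} (h : D.s μ ≠ ⊤) : 1 ≤ D.sInt μ := by
  obtain ⟨m, hm⟩ := WithTop.ne_top_iff_exists.1 h
  have := hs μ
  rw [← hm] at this
  rw [LocalCoords.sInt, ← hm]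
  exact_mod_cast this

lemma LocalCoords.sInt_top {μ : Γ.ramT} (h : D.s μ = ⊤) : D.sInt μ = 0 := by
  rw [LocalCoords.sInt, h]; rfl

namespace BranchOrder

variable (o : BranchOrder D)

lemma mem_below {ν lam : Γ.ramT} : ν ∈ o.below lam ↔ o.prec ν lam := by
  classical
  simp [below]

lemma insert_below_subset [DecidableEq Γ.ramT] {ν lam : Γ.ramT} (h : o.prec ν lam) : insert ν (o.below ν) ⊆ o.below lam := fun κ hκ => by
  rw [o.mem_below]
  rcases mem_insert.1 hκ with rfl | h'
  · exact h
  · exact o.prec_trans _ _ _ (o.mem_below.1 h') h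

lemma rBelow_add_le {ν lam : Γ.ramT} (h : o.prec ν lam) : o.rBelow ν + D.r ν ≤ o.rBelow lam := by
  classical
  have := sum_le_sum_of_subset (f := D.r) (o.insert_below_subset h)
  rw [sum_insert fun h' => o.prec_irrefl _ (o.mem_below.1 h')] at this
  rw [rBelow, rBelow]
  omega

lemma exists_position (α : Γ.ram) {i : ℕ} (h1 : 1 ≤ i) (A : Finset Γ.ramT) (hA : A ⊆ Γ.above α)
    (hA' : ∀ ν ∈ A, o.below ν ⊆ A) (hi : i ≤ ∑ μ ∈ A, D.r μ) : ∃ lam ∈ Γ.above α, o.rBelow lam < i ∧ i ≤ o.rBelow lam + D.r lam := by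
  classical
  induction A using strongInduction with
  | H A ih =>
    obtain ⟨ν, hν, hmax⟩ := exists_max_image A o.rBelow (nonempty_iff_ne_empty.2 fun h => by rw [h, sum_empty] at hi; omega)
    have hAν : A ⊆ insert ν (o.below ν) := fun κ hκ => by
      by_cases h : κ = ν
      · exact mem_insert.2 (Or.inl h)
      refine mem_insert_of_mem (o.mem_below.2 ?_)
      refine (o.prec_total κ ν ((mem_above.1 (hA hκ)).trans (mem_above.1 (hA hν)).symm) h).resolve_right fun h' => ?_
      have h2 := o.rBelow_add_le h'
      have h3 := hmax κ hκ
      have h4 := D.r_pos ν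
      omega
    by_cases hlt : o.rBelow ν < i
    · refine ⟨ν, hA hν, hlt, hi.trans ((sum_le_sum_of_subset hAν).trans_eq ?_)⟩
      rw [sum_insert fun h' => o.prec_irrefl _ (o.mem_below.1 h'), add_comm]; rfl
    · refine ih (o.below ν) ⟨hA' ν hν, fun h => o.prec_irrefl _ (o.mem_below.1 (h hν))⟩ ((hA' ν hν).trans hA) (fun κ hκ => ?_) (not_lt.1 hlt)
      exact (subset_insert _ _).trans (o.insert_below_subset (o.mem_below.1 hκ))

lemma dExp_eq (α : Γ.ram) {i : ℕ} (h1 : 1 ≤ i) (hi : i ≤ D.rTot α) : ∃ lam ∈ Γ.above α, ∃ j : ℕ, j < D.r lam ∧ i = o.rBelow lam + j + 1 ∧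
      o.dExp α i = -(D.sInt lam * j / D.r lam) - o.sBelow lam + if j = 0 then 1 else 0 := by
  obtain ⟨lam, hlam, h2, h3⟩ := o.exists_position α h1 _ Subset.rfl (fun ν hν κ hκ => mem_above.2
    ((o.prec_above _ _ (o.mem_below.1 hκ)).trans (mem_above.1 hν))) hi
  refine ⟨lam, hlam, i - o.rBelow lam - 1, by omega, by omega, ?_⟩
  rw [dExp, sum_eq_single_of_mem lam hlam, if_pos ⟨h2, h3⟩]
  · have e : (D.sInt lam : ℚ) * ((i : ℚ) - o.rBelow lam - 1) / D.r lam = ((D.sInt lam * (i - o.rBelow lam - 1 : ℕ) : ℤ) : ℚ) / (D.r lam : ℕ) := by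
      rw [Nat.sub_sub, Int.cast_mul, Int.cast_natCast, Nat.cast_sub (by omega)]
      push_cast
      ring
    rw [e, Rat.floor_intCast_div_natCast]
    congr 1
    exact if_congr (by omega) rfl rfl
  · intro ν hν hne
    rw [if_neg]
    rintro ⟨h4, h5⟩
    rcases o.prec_total ν lam ((mem_above.1 hν).trans (mem_above.1 hlam).symm) hne with h | h
    · have := o.rBelow_add_le h; omega
    · have := o.rBelow_add_le h; omega

lemma rQuot_mul_sInt_le (hs : ∀ μ, 1 ≤ D.s μ) {ν lam : Γ.ramT} (h : o.prec ν lam) (hlam : D.s lam ≠ ⊤) :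
    D.s ν ≠ ⊤ ∧ rQuot D ν * D.sInt ν ≤ rQuot D lam * D.sInt lam := by
  have h1 := o.prec_ratio _ _ h
  have hl := LocalCoords.sInt_pos hs hlam
  have hrl := D.r_pos lam
  have hrν := D.r_pos ν
  rw [LocalCoords.ratio, LocalCoords.ratio] at h1
  have hfin : D.s ν ≠ ⊤ := fun h' => by
    rw [LocalCoords.sInt_top h', Int.cast_zero, div_zero] at h1
    exact absurd h1 (not_le.2 (div_pos (mod_cast hrl) (mod_cast hl)))
  refine ⟨hfin, ?_⟩
  have hν := LocalCoords.sInt_pos hs hfin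
  rw [div_le_div_iff₀ (mod_cast hl) (mod_cast hν)] at h1
  have h2 : (D.r lam : ℤ) * D.sInt ν ≤ D.r ν * D.sInt lam := mod_cast h1
  have e1 : (D.r ν : ℤ) * rQuot D ν = rProd D := mod_cast r_mul_rQuot D ν
  have e2 : (D.r lam : ℤ) * rQuot D lam = rProd D := mod_cast r_mul_rQuot D lam
  have hp : (0 : ℤ) < D.r ν * D.r lam := by positivity
  refine le_of_mul_le_mul_left ?_ hp
  have hN : (0 : ℤ) ≤ rProd D := by positivity
  calc (D.r ν * D.r lam : ℤ) * (rQuot D ν * D.sInt ν) = rProd D * (D.r lam * D.sInt ν) := by rw [← e1]; ring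
    _ ≤ rProd D * (D.r ν * D.sInt lam) := mul_le_mul_of_nonneg_left h2 hN
    _ = _ := by rw [← e2]; ring

lemma lt_sum_exponents (hs : ∀ μ, 1 ≤ D.s μ) (hD : D.NonDegenerate) (α : Γ.ram) {i : ℕ} (h1 : 1 ≤ i) (hi : i ≤ D.rTot α)
    {Z : Finset (Sheet D)} (hZ : Z ⊆ sheets D α) (hcard : #Z + 1 = i) (hfin : ∀ s ∈ Z, D.s s.1 ≠ ⊤) :
    -(rProd D * o.dExp α i) < ∑ s ∈ Z, (rQuot D s.1 : ℤ) * D.sInt s.1 := by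
  classical
  obtain ⟨lam, hlam, j, hj, rfl, hd⟩ := o.dExp_eq α h1 hi
  set e : Sheet D → ℤ := fun s => (rQuot D s.1 : ℤ) * D.sInt s.1 with he
  set bel : Finset (Sheet D) := (o.below lam).sigma fun _ => univ with hbel
  have hmem : ∀ s, s ∈ bel ↔ o.prec s.1 lam := fun s => by simp [hbel, mem_below]
  have hN : (1 : ℤ) ≤ rProd D := mod_cast rProd_pos D
  have hsum : ∑ s ∈ bel, e s = rProd D * o.sBelow lam := by
    rw [hbel, sum_sigma, sBelow, mul_sum]
    refine sum_congr rfl fun ν _ => ?_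
    change ∑ _m : Fin (D.r ν), (rQuot D ν * D.sInt ν : ℤ) = _
    rw [sum_const, card_univ, Fintype.card_fin, nsmul_eq_mul, ← r_mul_rQuot D ν]
    push_cast
    ring
  have hcb : #bel = o.rBelow lam := by simp [hbel, rBelow]
  have hrest : ∀ s ∈ Z, s ∉ bel → s.1 = lam ∨ o.prec lam s.1 := fun s hs hsb => by
    by_cases h : s.1 = lam
    · exact Or.inl h
    have hs1 : s.1 ∈ Γ.above α := by simpa [sheets] using hZ hs
    exact Or.inr ((o.prec_total _ _ ((mem_above.1 hs1).trans (mem_above.1 hlam).symm) h).resolve_left fun h' => hsb ((hmem s).2 h'))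
  have key : rProd D * o.sBelow lam + j * (rQuot D lam * D.sInt lam) ≤ ∑ s ∈ Z, e s := by
    by_cases hinf : D.s lam = ⊤
    · have hZb : Z ⊆ bel := fun s hsZ => by
        by_contra hsb
        rcases hrest s hsZ hsb with h | h
        · exact hfin s hsZ (h ▸ hinf)
        · have h2 := o.prec_ratio _ _ h
          have := LocalCoords.sInt_pos hs (hfin s hsZ)
          have hr := D.r_pos s.1
          rw [LocalCoords.ratio, LocalCoords.ratio, LocalCoords.sInt_top hinf, Int.cast_zero, div_zero] at h2
          exact absurd h2 (not_le.2 (div_pos (mod_cast hr) (mod_cast this)))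
      rw [eq_of_subset_of_card_le hZb (by omega), hsum, LocalCoords.sInt_top hinf, mul_zero, mul_zero, add_zero]
    · set τ : ℤ := rQuot D lam * D.sInt lam
      have h2 : ∑ s ∈ bel, (e s - τ) ≤ ∑ s ∈ Z, (e s - τ) := by
        rw [← sum_inter_add_sum_sdiff bel Z, ← sum_inter_add_sum_sdiff Z bel, inter_comm]
        refine add_le_add le_rfl ((sum_nonpos fun s hsb => ?_).trans (sum_nonneg fun s hsZ => ?_))
        · exact sub_nonpos.2 (o.rQuot_mul_sInt_le hs ((hmem s).1 (Finset.mem_sdiff.1 hsb).1) hinf).2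
        · obtain ⟨hsZ, hsb⟩ := Finset.mem_sdiff.1 hsZ
          rcases hrest s hsZ hsb with h | h
          · rw [he]; simp only [h]; exact (sub_self _).ge
          · exact sub_nonneg.2 (o.rQuot_mul_sInt_le hs h (hfin s hsZ)).2
      rw [sum_sub_distrib, sum_sub_distrib, sum_const, sum_const, hsum, hcb, show #Z = o.rBelow lam + j by omega] at h2
      simp only [nsmul_eq_mul] at h2
      push_cast at h2
      linarith
  refine lt_of_lt_of_le ?_ key
  rw [hd]
  by_cases hj0 : j = 0
  · subst hj0
    simp only [Nat.cast_zero, mul_zero, Int.zero_ediv, zero_mul, add_zero, if_true]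
    linarith
  have hinf : D.s lam ≠ ⊤ := fun h => by
    have : ¬ 1 < D.r lam := fun h' => hD.not_ii ⟨lam, h, h'⟩
    omega
  rw [if_neg hj0, ← r_mul_rQuot D lam]
  have hr : (0 : ℤ) < D.r lam := mod_cast D.r_pos lam
  have hq : (0 : ℤ) < rQuot D lam := mod_cast rQuot_pos D lam
  have hne : ¬ (D.r lam : ℤ) ∣ D.sInt lam * j := by
    intro h
    have hg : IsCoprime (D.r lam : ℤ) (D.sInt lam) := Int.isCoprime_iff_gcd_eq_one.2 (by
      have h2 : ¬ 1 < Int.gcd (D.r lam) (D.sInt lam) := fun h' => hD.not_iv ⟨lam, hinf, h'⟩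
      have h3 : Int.gcd (D.r lam) (D.sInt lam) ≠ 0 := fun h0 => hr.ne' (Int.gcd_eq_zero_iff.1 h0).1
      omega)
    have h4 := Int.le_of_dvd (by omega) (hg.dvd_of_dvd_mul_left h)
    omega
  have hlt : (D.r lam : ℤ) * (D.sInt lam * j / D.r lam) < D.sInt lam * j := by
    have h2 := Int.emod_add_mul_ediv (D.sInt lam * j) (D.r lam)
    have h3 := Int.emod_pos_of_not_dvd hne
    rcases h3 with h3 | h3
    · omega
    · omega
  have := mul_lt_mul_of_pos_left hlt hq
  push_cast
  linarith

end BranchOrder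

lemma AsympTo.isBigO {f : ℂ → ℂ} {φ : ℕ → ℂ → ℂ} (h : AsympTo f φ) {M : ℤ} (hφ : ∀ B, φ B =O[𝓝[≠] 0] fun q => q ^ M) :
    f =O[𝓝[≠] 0] fun q => q ^ M := by
  obtain ⟨C, -, h2⟩ := h
  obtain ⟨B, hB, hM⟩ := (h2.and (eventually_ge_atTop (M + C).toNat)).exists
  exact ((hB.trans (zpow_isBigO (by omega))).add (hφ B)).congr_left fun q => by ring

section PowerSeries

variable {κ R : Type*} [DecidableEq κ] [CommSemiring R]

lemma coeff_partSum_of_le_one {f : Finset κ → PowerSeries R} (hf : ∀ L, 2 ≤ #L → ∀ d ≤ 1, coeff d (f L) = 0)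
    (Z : Finset κ) {d : ℕ} (hd : d ≤ 1) : coeff d (partSum f Z) = coeff d (∏ s ∈ Z, f {s}) := by
  induction Z using Finset.induction_on generalizing d with
  | empty => rw [partSum_empty, prod_empty]
  | insert a Z ha ih =>
    rw [partSum_insert f ha, map_sum, sum_eq_single_of_mem ∅ (empty_mem_powerset Z), prod_insert ha, sdiff_empty,
      insert_empty_eq, PowerSeries.coeff_mul, PowerSeries.coeff_mul]
    · refine sum_congr rfl fun p hp => ?_
      rw [ih (by have := mem_antidiagonal.1 hp; omega)]
    · intro V hV hne
      have haV : a ∉ V := fun h => ha (mem_powerset.1 hV h)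
      have := card_pos.2 (nonempty_iff_ne_empty.2 hne)
      rw [PowerSeries.coeff_mul]
      refine sum_eq_zero fun p hp => ?_
      rw [hf _ (by rw [card_insert_of_notMem haV]; omega) _ (by have := mem_antidiagonal.1 hp; omega), zero_mul]

lemma coeff_one_prod (f : κ → PowerSeries R) (Z : Finset κ) : coeff 1 (∏ s ∈ Z, f s) =
    ∑ s ∈ Z, coeff 1 (f s) * ∏ s' ∈ Z.erase s, PowerSeries.constantCoeff (f s') := by
  induction Z using Finset.induction_on with
  | empty => simp [PowerSeries.coeff_one]
  | insert a Z ha ih =>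
    rw [prod_insert ha, PowerSeries.coeff_one_mul, ih, sum_insert ha, erase_insert ha, map_prod, sum_mul]
    congr 1
    refine sum_congr rfl fun s hs => ?_
    rw [erase_insert_of_ne (fun h : a = s => ha (h ▸ hs)), prod_insert fun h => ha (mem_of_mem_erase h)]
    ring

end PowerSeries

lemma sheetCoord_pow_isBigO (s : Sheet D) {k : ℕ} {m : ℤ} (h : m ≤ rQuot D s.1 * k) : (fun q => sheetCoord D q s ^ k) =O[𝓝[≠] 0] fun q => q ^ m := by
  refine ((zpow_isBigO h).const_mul_left (sheetRoot D s ^ k)).congr_left fun q => ?_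
  rw [sheetCoord, mul_pow, ← pow_mul, ← zpow_natCast q]
  push_cast
  rfl

lemma sum_sheetCoord_isBigO (s : Sheet D) (B : ℕ) {c : ℕ → ℂ} {m : ℤ} (h : ∀ k, c k = 0 ∨ m ≤ rQuot D s.1 * (k + 1)) :
    (fun q => ∑ k ∈ range B, 1 / (D.r s.1 : ℂ) * sheetCoord D q s ^ (k + 1) * c k) =O[𝓝[≠] 0] fun q => q ^ m := by
  refine Asymptotics.IsBigO.fun_sum fun k _ => ?_
  rcases h k with h | h
  · simp only [h, mul_zero]
    exact Asymptotics.isBigO_zero _ _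
  · refine ((sheetCoord_pow_isBigO s (k := k + 1) (by push_cast; exact h)).const_mul_left (1 / (D.r s.1 : ℂ) * c k)).congr_left
      fun q => by ring

lemma one_le_rQuot_mul (μ : Γ.ramT) (k : ℕ) : (1 : ℤ) ≤ rQuot D μ * (k + 1) := by
  have h1 : (1 : ℤ) ≤ rQuot D μ := mod_cast rQuot_pos D μ
  nlinarith [mul_nonneg (by omega : (0 : ℤ) ≤ rQuot D μ) (Nat.cast_nonneg k : (0 : ℤ) ≤ k)]

namespace Correlators

lemma form01_isBigO (hs : ∀ μ, 1 ≤ D.s μ) (s : Sheet D) {m : ℤ} (hm : D.s s.1 ≠ ⊤ → m ≤ rQuot D s.1 * D.sInt s.1) :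
    (fun q => W.sheetScale q s * ev (W.form 0 1) ![W.sheetPoint q s]) =O[𝓝[≠] 0] fun q => q ^ m := by
  refine ((hasSheetExpansions (W := W) hs).form01 s).isBigO fun B => sum_sheetCoord_isBigO s B fun k => ?_
  refine or_iff_not_imp_left.2 fun h => ?_
  have h1 := D.s_le s.1 h
  have h2 : D.s s.1 ≠ ⊤ := fun h' => by rw [h'] at h1; exact absurd h1 (by simp)
  refine (hm h2).trans (mul_le_mul_of_nonneg_left ?_ (by positivity))
  obtain ⟨j, hj⟩ := WithTop.ne_top_iff_exists.1 h2
  rw [← hj] at h1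
  rw [LocalCoords.sInt, ← hj]
  have : j ≤ ((k.succPNat : ℕ+) : ℤ) := mod_cast h1
  simpa using this

lemma constantCoeff_formSeries_singleton {n : ℕ} (w : Fin n → TB S) (q : ℂ) (s : Sheet D) :
    PowerSeries.constantCoeff (formSeries W.form (Sum.elim (W.sheetPoint q) w) (W.sheetScale q) {s}) =
      C (W.sheetScale q s * ev (W.form 0 1) ![W.sheetPoint q s]) := by
  rw [← PowerSeries.coeff_zero_eq_constantCoeff_apply, formSeries, PowerSeries.coeff_mk, sum_eq_single ∅]
  · have e : ({s} : Finset (Sheet D)).disjSum (∅ : Finset (Fin n)) = {Sum.inl s} := rfl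
    rw [if_pos (by simp), prod_singleton, e, evSet_singleton, sqf_empty]
    rfl
  · intro N _ hN
    have := card_pos.2 (nonempty_iff_ne_empty.2 hN)
    rw [card_singleton, if_neg (by omega), MvPolynomial.monomial_zero]
  · exact fun h => absurd (mem_univ _) h

lemma coeff_one_formSeries_singleton (hs : ∀ μ, 1 ≤ D.s μ) {n : ℕ} {w : Fin n → TB S} (hw : ∀ j, (w j).proj ∉ Γ.ramT) (s : Sheet D) :
    (fun q => (coeff 1 (formSeries W.form (Sum.elim (W.sheetPoint q) w) (W.sheetScale q) {s})).coeff (sqf univ) -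
      if n = 0 then 1 / (D.r s.1 : ℂ) * W.Q s.1 else 0) =O[𝓝[≠] 0] fun q => q ^ (1 : ℤ) := by
  have H := hasSheetExpansions (W := W) hs
  simp_rw [coeff_formSeries]
  rcases n with _ | _ | n
  · refine (((H.form11 s).add (AsympTo.const (-(1 / (D.r s.1 : ℂ) * W.Q s.1)))).isBigO fun B => ?_).congr_left fun q => ?_
    · refine (sum_sheetCoord_isBigO s B (c := fun k => W.F11 (s.1, k.succPNat)) fun k => Or.inr (one_le_rQuot_mul _ k)).congr_left
        fun q => ?_
      rw [approx11]; ring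
    · have e : ({s} : Finset (Sheet D)).disjSum (univ : Finset (Fin 0)) = {Sum.inl s} := rfl
      simp [e, evSet_singleton, sub_eq_add_neg]
  · refine ((H.form02_left s (w 0) (hw 0)).isBigO fun B => sum_sheetCoord_isBigO s B (c := fun k => (k + 1 : ℕ) * W.dxi (s.1, k.succPNat) (w 0))
      fun k => Or.inr (one_le_rQuot_mul _ k)).congr' ?_ EventuallyEq.rfl
    filter_upwards [H.isSymmAt hw] with q hq
    have e : ({s} : Finset (Sheet D)).disjSum ({0} : Finset (Fin 1)) = {Sum.inl s, Sum.inr 0} := by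
      ext (a | a) <;> simp
    have hq' := hq 0 {s} (singleton_nonempty s) {0}
    rw [e] at hq'
    simp [e, evSet_pair _ _ (by simp : (Sum.inl s : Sheet D ⊕ Fin 1) ≠ Sum.inr 0) hq']
  · simp [show ¬ 2 + (n + 1 + 1) ≤ 3 by omega, Asymptotics.isBigO_zero]

lemma isBigO_of_le_one (hs : ∀ μ, 1 ≤ D.s μ) (hD : D.NonDegenerate) (o : BranchOrder D) (α : Γ.ram) {i : ℕ} (h1 : 1 ≤ i)
    (hi : i ≤ D.rTot α) {n : ℕ} {w : Fin n → TB S} (hw : ∀ j, (w j).proj ∉ Γ.ramT) {d : ℕ} (hd : d ≤ 1) :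
    (fun q => (coeff d (∑ Z ∈ powersetCard i (sheets D α),
        partSum (formSeries W.form (Sum.elim (W.sheetPoint q) w) (W.sheetScale q)) Z)).coeff (sqf univ))
      =O[𝓝[≠] 0] fun q => q ^ (1 - rProd D * (o.dExp α i - if i = 1 then 1 else 0)) := by
  classical
  set f : ℂ → Sheet D → PowerSeries (MvPolynomial (Fin n) ℂ) := fun q s =>
    formSeries W.form (Sum.elim (W.sheetPoint q) w) (W.sheetScale q) {s} with hf
  have hone : ∀ s, (fun q => W.sheetScale q s * ev (W.form 0 1) ![W.sheetPoint q s]) =O[𝓝[≠] 0] fun q => q ^ (1 : ℤ) := fun s =>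
    W.form01_isBigO hs s fun h => by
      obtain ⟨k, hk⟩ := Int.eq_ofNat_of_zero_le (sub_nonneg.2 (LocalCoords.sInt_pos hs h))
      rw [show D.sInt s.1 = k + 1 by omega]
      exact one_le_rQuot_mul _ k
  have hc0 : ∀ q s, PowerSeries.constantCoeff (f q s) = C (W.sheetScale q s * ev (W.form 0 1) ![W.sheetPoint q s]) :=
    W.constantCoeff_formSeries_singleton w
  have hc1 := W.coeff_one_formSeries_singleton hs hw
  have hred : ∀ q, ∀ Z : Finset (Sheet D), coeff d (partSum (formSeries W.form (Sum.elim (W.sheetPoint q) w)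
      (W.sheetScale q)) Z) = coeff d (∏ s ∈ Z, f q s) := fun q Z =>
    coeff_partSum_of_le_one (fun L hL d hd => by
      rw [formSeries, PowerSeries.coeff_mk]
      exact sum_eq_zero fun N _ => by rw [if_neg (by omega), MvPolynomial.monomial_zero]) Z hd
  simp_rw [map_sum, hred, coeff_sum]
  have hC : ∀ a : ℂ, ∀ m : Fin n →₀ ℕ, (C a).coeff m = a * if 0 = m then 1 else 0 := fun a m => by
    rw [MvPolynomial.coeff_C]; simp
  by_cases hi1 : i = 1
  · subst hi1
    obtain ⟨lam, -, j, -, hj, he⟩ := o.dExp_eq α h1 hi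
    have hr0 : o.rBelow lam = 0 := by omega
    obtain rfl : j = 0 := by omega
    have hb : o.below lam = ∅ := eq_empty_of_forall_notMem fun ν hν => Nat.ne_of_gt (D.r_pos ν) (sum_eq_zero_iff.1 hr0 ν hν)
    rw [he, BranchOrder.sBelow, hb]
    simp only [Nat.cast_zero, mul_zero, Int.zero_ediv, sum_empty, if_true, neg_zero, sub_zero, zero_add, sub_self,
      powersetCard_one, sum_map, Embedding.coeFn_mk, prod_singleton]
    obtain rfl | rfl : d = 0 ∨ d = 1 := by omega
    · refine Asymptotics.IsBigO.fun_sum fun s _ => ?_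
      simp_rw [PowerSeries.coeff_zero_eq_constantCoeff_apply, hc0, hC]
      exact ((hone s).const_mul_left (if 0 = sqf (univ : Finset (Fin n)) then (1 : ℂ) else 0)).congr_left fun q => mul_comm _ _
    · refine (Asymptotics.IsBigO.fun_sum (s := sheets D α) fun s _ => hc1 s).congr_left fun q => ?_
      rw [sum_sub_distrib, sub_eq_self]
      by_cases hn : n = 0
      · simp_rw [if_pos hn, sheets]
        rw [sum_sigma, ← W.form11_residue α]
        refine sum_congr rfl fun μ _ => ?_
        change ∑ _m : Fin (D.r μ), 1 / (D.r μ : ℂ) * W.Q μ = _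
        have : (D.r μ : ℂ) ≠ 0 := mod_cast Nat.ne_of_gt (D.r_pos μ)
        rw [sum_const, card_univ, Fintype.card_fin, nsmul_eq_mul, Q]
        field_simp
      · simp [hn]
  rw [if_neg hi1, sub_zero]
  set m : ℤ := 1 - rProd D * o.dExp α i with hm
  have hprod : ∀ Z ⊆ sheets D α, #Z + 1 = i → (fun q => ∏ s ∈ Z, W.sheetScale q s * ev (W.form 0 1) ![W.sheetPoint q s])
      =O[𝓝[≠] 0] fun q => q ^ m := by
    intro Z hZ hcard
    set e : Sheet D → ℤ := fun s => if D.s s.1 = ⊤ then max 0 m else rQuot D s.1 * D.sInt s.1 with he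
    have hpos : ∀ s, 0 ≤ e s := fun s => by
      simp only [he]
      split_ifs with h
      · exact le_max_left _ _
      · exact mul_nonneg (by positivity) (by have := LocalCoords.sInt_pos hs h; omega)
    have h2 := Asymptotics.IsBigO.finsetProd (s := Z) fun s _ => W.form01_isBigO hs s (m := e s) fun h => by simp [he, h]
    refine (h2.congr' EventuallyEq.rfl ?_).trans (zpow_isBigO (a := ∑ s ∈ Z, e s) ?_)
    · filter_upwards [self_mem_nhdsWithin] with q hq
      exact Finset.induction_on Z (by simp) fun a Z ha h => by rw [prod_insert ha, sum_insert ha, h, zpow_add₀ hq]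
    · by_cases h : ∃ s ∈ Z, D.s s.1 = ⊤
      · obtain ⟨s, hsZ, h⟩ := h
        refine le_trans ?_ (single_le_sum (fun s _ => hpos s) hsZ)
        simp [he, h]
      · push Not at h
        rw [sum_congr rfl fun s hs' => if_neg (h s hs')]
        have := o.lt_sum_exponents hs hD α h1 hi hZ hcard h
        omega
  refine Asymptotics.IsBigO.fun_sum fun Z hZ => ?_
  obtain ⟨hZ, hcard⟩ := mem_powersetCard.1 hZ
  have herase : ∀ s ∈ Z, (fun q => ∏ s' ∈ Z.erase s, W.sheetScale q s' * ev (W.form 0 1) ![W.sheetPoint q s'])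
      =O[𝓝[≠] 0] fun q => q ^ m := fun s hsZ =>
    hprod _ ((erase_subset s Z).trans hZ) (by rw [card_erase_of_mem hsZ]; omega)
  obtain rfl | rfl : d = 0 ∨ d = 1 := by omega
  · obtain ⟨s, hsZ⟩ := card_pos.1 (show 0 < #Z by omega)
    simp_rw [PowerSeries.coeff_zero_eq_constantCoeff_apply, map_prod, hc0, ← map_prod, hC]
    refine ((isBigO_zpow_mul (hone s) (herase s hsZ) (c := m) (by omega)).const_mul_left (if 0 = sqf (univ : Finset (Fin n)) then (1 : ℂ) else 0)).congr_left
      fun q => ?_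
    rw [mul_prod_erase Z (fun s => W.sheetScale q s * ev (W.form 0 1) ![W.sheetPoint q s]) hsZ, mul_comm]
  · simp_rw [coeff_one_prod, hc0, ← map_prod, coeff_sum, mul_comm _ (C _), coeff_C_mul]
    refine Asymptotics.IsBigO.fun_sum fun s hsZ => isBigO_zpow_mul (a := m) (b := 0) (herase s hsZ) ?_ (by omega)
    refine (((hc1 s).trans (zpow_isBigO (b := 0) (by omega))).add ?_).congr_left fun q => sub_add_cancel _ _
    simpa using Asymptotics.isBigO_const_const (if n = 0 then 1 / (D.r s.1 : ℂ) * W.Q s.1 else 0) (one_ne_zero (α := ℂ)) (𝓝[≠] (0 : ℂ))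

end Correlators

lemma nhdsNE_le_map_pow {N : ℕ} (hN : 1 ≤ N) (a : ℂ) : 𝓝[≠] a ≤ map (fun q : ℂ => a + q ^ N) (𝓝[≠] 0) := by
  intro s hs
  obtain ⟨ε, hε, h⟩ := Metric.mem_nhdsWithin_iff.1 (Filter.mem_map.1 hs)
  refine Metric.mem_nhdsWithin_iff.2 ⟨ε ^ N, pow_pos hε N, fun x hx => ?_⟩
  obtain ⟨z, hz⟩ := IsAlgClosed.exists_pow_nat_eq (x - a) hN
  have hx1 : ‖x - a‖ < ε ^ N := by simpa [dist_eq_norm] using hx.1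
  rw [← hz, norm_pow] at hx1
  have h1 := h ⟨by simpa using lt_of_pow_lt_pow_left₀ N hε.le hx1, fun h0 : z = 0 => hx.2 (by
    rw [h0, zero_pow (Nat.ne_of_gt hN)] at hz
    exact sub_eq_zero.1 hz.symm)⟩
  simpa [hz] using h1

lemma tendsto_add_pow {N : ℕ} (hN : 1 ≤ N) (a : ℂ) : Tendsto (fun q : ℂ => a + q ^ N) (𝓝[≠] 0) (𝓝[≠] a) := by
  refine tendsto_nhdsWithin_iff.2 ⟨?_, eventually_nhdsWithin_of_forall fun q hq h => hq ?_⟩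
  · refine ((show Continuous fun q : ℂ => a + q ^ N by fun_prop).tendsto' 0 a ?_).mono_left nhdsWithin_le_nhds
    rw [zero_pow (Nat.ne_of_gt hN), add_zero]
  · simpa [Nat.ne_of_gt hN] using h

lemma isBigO_iff_comp_pow {N : ℕ} (hN : 1 ≤ N) (a : ℂ) (f : ℂ → ℂ) (e : ℤ) (i : ℕ) :
    (f =O[𝓝[≠] a] fun x => (x - a) ^ (e - i)) ↔ (fun q => (q ^ N) ^ i * f (a + q ^ N)) =O[𝓝[≠] 0] fun q => q ^ (N * e) := by
  have he : ∀ q : ℂ, q ^ (N * e) = (q ^ N) ^ e := fun q => by rw [zpow_mul, zpow_natCast]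
  constructor
  · intro h
    refine ((Asymptotics.isBigO_refl (fun q : ℂ => (q ^ N) ^ i) _).mul (h.comp_tendsto (tendsto_add_pow hN a))).congr'
      EventuallyEq.rfl ?_
    filter_upwards [self_mem_nhdsWithin] with q hq
    simp only [comp, add_sub_cancel_left]
    rw [he, ← zpow_natCast (q ^ N) i, ← zpow_add₀ (pow_ne_zero N hq), add_sub_cancel]
  · intro h
    refine Asymptotics.IsBigO.mono (Asymptotics.isBigO_map.2 ?_) (nhdsNE_le_map_pow hN a)
    refine ((Asymptotics.isBigO_refl (fun q : ℂ => (q ^ N) ^ (-(i : ℤ))) _).mul h).congr' ?_ ?_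
    · filter_upwards [self_mem_nhdsWithin] with q hq
      rw [← mul_assoc, ← zpow_natCast (q ^ N) i, ← zpow_add₀ (pow_ne_zero N hq), neg_add_cancel, zpow_zero, one_mul]
      rfl
    · filter_upwards [self_mem_nhdsWithin] with q hq
      simp only [comp, add_sub_cancel_left]
      rw [he, ← zpow_add₀ (pow_ne_zero N hq), neg_add_eq_sub]

lemma totalDegree_coeff_prod_le {V ι : Type*} (s : Finset ι) {f : ι → PowerSeries (MvPolynomial V ℂ)}
    (h : ∀ i ∈ s, ∀ l, (coeff l (f i)).totalDegree ≤ l) (l : ℕ) : (coeff l (∏ i ∈ s, f i)).totalDegree ≤ l := by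
  classical
  induction s using Finset.induction_on generalizing l with
  | empty =>
    rw [prod_empty, PowerSeries.coeff_one]
    split_ifs <;> simp
  | insert a s ha ih =>
    rw [prod_insert ha, PowerSeries.coeff_mul]
    refine MvPolynomial.totalDegree_finsetSum_le fun p hp => (MvPolynomial.totalDegree_mul _ _).trans ?_
    rw [← mem_antidiagonal.1 hp]
    exact add_le_add (h a (mem_insert_self _ _) _) (ih (fun i hi => h i (mem_insert_of_mem hi)) _)

lemma coeff_partSum_formSeries_eq_zero {κ : Type*} [DecidableEq κ] {n : ℕ} (η : ∀ _ n : ℕ, MultiForm S n)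
    (t : κ ⊕ Fin n → TB S) (m : κ → ℂ) (Z : Finset κ) {d : ℕ} (hd : d < n) : (coeff d (partSum (formSeries η t m) Z)).coeff (sqf univ) = 0 := by
  have hdeg : ∀ N : Finset (Fin n), ((sqf N).sum fun _ e => e) = #N := fun N => by
    rw [Finsupp.sum_fintype _ _ fun _ => rfl]
    simp_rw [sqf_apply]
    simp
  have h : (coeff d (partSum (formSeries η t m) Z)).totalDegree ≤ d := by
    rw [partSum, map_sum]
    refine MvPolynomial.totalDegree_finsetSum_le fun P _ => totalDegree_coeff_prod_le _ (fun L hL l => ?_) d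
    have := card_pos.2 (P.nonempty_of_mem_parts hL)
    rw [formSeries, PowerSeries.coeff_mk]
    refine MvPolynomial.totalDegree_finsetSum_le fun N _ => ?_
    split_ifs with hN
    · refine (MvPolynomial.totalDegree_monomial_le _ _).trans ?_
      exact (hdeg N).le.trans (by omega)
    · simp
  refine MvPolynomial.coeff_eq_zero_of_totalDegree_lt (h.trans_lt ?_)
  have := hdeg univ
  rw [card_univ, Fintype.card_fin] at this
  exact hd.trans_eq this.symm

namespace Correlators

lemma loopEquations_iff (hs : ∀ μ, 1 ≤ D.s μ) (hD : D.NonDegenerate) (o : BranchOrder D)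
    {F : Coefficients Γ} (hF : W.IsDecomposition F) (α : Γ.ram) {i : ℕ} (h1 : 1 ≤ i) (hi : i ≤ D.rTot α) :
    (∀ h n : ℕ, 2 < h + (n + 1) → ∀ w : Fin n → TB S, (∀ j, (w j).proj ∉ Γ.ramT) →
      (fun x₀ : ℂ => W.loopDifferential α i h x₀ w) =O[𝓝[≠] (finPart (Γ.x α))] fun x₀ : ℂ =>
        (x₀ - finPart (Γ.x α)) ^ (-(o.dExp α i - 1 - (if i = 1 then 1 else 0)) - (i : ℤ))) ↔
    ∀ k : ℤ, o.dExp α i - (if i = 1 then 1 else 0) ≤ k → fexp (-freeEnergy F) * act (W.H α i k) (fexp (freeEnergy F)) = 0 := by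
  classical
  have H := hasSheetExpansions (W := W) hs
  have hN := rProd_pos D
  set κ : ℤ := o.dExp α i - (if i = 1 then 1 else 0) with hκ
  rw [show -(o.dExp α i - 1 - (if i = 1 then 1 else 0)) = -(κ - 1) by rw [hκ]; ring]
  obtain ⟨v, hv⟩ : ∃ v : CSeries Γ, partSeries F * v = 1 := (isUnit_exp_subst (constantCoeff_freeSeries F) : IsUnit (partSeries F)).exists_right_inv
  set T : ℕ → ℤ → CSeries Γ := fun B k => twistedBox D W.K (mulLeft ℂ ((PowerSeries.X : CSeries Γ) ^ 2)) B α i k (partSeries F) with hT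
  choose B₀ hB₀ using fun (k : ℤ) (d : ℕ) => W.constraint_iff' H.symm F α i k d
  set T' : ℤ → CSeries Γ := fun k => PowerSeries.mk fun d => coeff d (T (B₀ k d) k) with hT'
  have hlim : ∀ k d, ∀ᶠ B in atTop, coeff d (T B k) = coeff d (T' k) := fun k d => by
    filter_upwards [eventually_ge_atTop (B₀ k d)] with B hB
    rw [hT', PowerSeries.coeff_mk]
    exact hB₀ k d B hB
  have hcon : ∀ k, fexp (-freeEnergy F) * act (W.H α i k) (fexp (freeEnergy F)) = 0 ↔ T' k * v = 0 := fun k => by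
    rw [W.constraint_iff H.symm, (IsUnit.of_mul_eq_one_right _ hv).mul_left_eq_zero, PowerSeries.ext_iff]
    refine forall_congr' fun d => ⟨fun ⟨B₁, hB₁⟩ => ?_, fun h => ?_⟩
    · obtain ⟨B, hB, hB'⟩ := ((hlim k d).and (eventually_ge_atTop B₁)).exists
      rw [← hB, map_zero]
      exact hB₁ B hB'
    · obtain ⟨B₁, hB₁⟩ := eventually_atTop.1 (hlim k d)
      exact ⟨B₁, fun B hB => (hB₁ B hB).trans (by rw [h, map_zero])⟩
  have hlim' : ∀ k d, ∀ᶠ B in atTop, coeff d (T B k * v) = coeff d (T' k * v) := fun k d => by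
    have := (Filter.eventually_all_finset (antidiagonal d)).2 fun p _ => hlim k p.1
    filter_upwards [this] with B hB
    rw [PowerSeries.coeff_mul, PowerSeries.coeff_mul]
    exact sum_congr rfl fun p hp => by rw [hB p hp]
  have hcard : 1 ≤ Fintype.card Γ.ramT := by
    obtain ⟨lam, -⟩ := o.dExp_eq α h1 hi
    exact Fintype.card_pos_iff.2 ⟨lam⟩
  have key : ∀ (d n : ℕ) (w : Fin n → TB S), (∀ j, (w j).proj ∉ Γ.ramT) → _ := fun d n w hw =>
    have h2 : AsympTo (fun q => (coeff d (∑ Z ∈ powersetCard i (sheets D α),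
          partSum (formSeries W.form (Sum.elim (W.sheetPoint q) w) (W.sheetScale q)) Z)).coeff (sqf univ))
        fun B q => (linSubst (fun b a => W.dxi a (w b)) (coeff d (W.blockSum H.symm F B q α i))).coeff (sqf univ) := by
      have h3 := AsympSeries.sum (powersetCard i (sheets D α)) fun Z _ => AsympSeries.partSum Z fun L _ hL => W.asympSeries_formSeries H hF hw hL
      refine (h3 _ le_rfl d).congr (.of_forall fun q => rfl) fun B => .of_forall fun q => ?_
      have e : PowerSeries.map (linSubst fun b a => W.dxi a (w b)).toRingHom (W.blockSum H.symm F B q α i) = _ :=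
        (map_sum _ _ _).trans (sum_congr rfl fun Z _ => map_partSum _ _ Z)
      refine (congrArg (fun p => (coeff d p).coeff (sqf univ)) e.symm).trans ?_
      rw [PowerSeries.coeff_map]
      rfl
    h2.isBigO_iff hN (m := fun B => Fintype.card Γ.ramT * B) (c := fun B k => if k ∈ box (Fintype.card Γ.ramT * B) then
        (linSubst (fun b a => W.dxi a (w b)) (coeff d (T B k * v))).coeff (sqf univ) else 0)
      (c' := fun k => (linSubst (fun b a => W.dxi a (w b)) (coeff d (T' k * v))).coeff (sqf univ))
      (fun B q hq => by
        have h3 : W.blockSum H.symm F B q α i = ∑ k ∈ box (Fintype.card Γ.ramT * B), (q ^ rProd D) ^ (-k) • (T B k * v) := by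
          have h4 := congrArg (· * v) (W.sum_twistedBox_partSeries H.symm B F hq α i)
          simp only [sum_mul, smul_mul_assoc] at h4
          rw [h4, mul_assoc, hv, mul_one]
        rw [h3, map_sum, map_sum, coeff_sum]
        refine sum_congr rfl fun k hk => ?_
        rw [if_pos hk, PowerSeries.coeff_smul, map_smul, MvPolynomial.coeff_smul, smul_eq_mul])
      (fun B k hk => if_neg hk) (fun k => by
        filter_upwards [hlim' k d, eventually_ge_atTop k.natAbs] with B hB hB'
        have : B ≤ Fintype.card Γ.ramT * B := Nat.le_mul_of_pos_left B hcard
        rw [if_pos (mem_Icc.2 (by omega)), hB]) κ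
  constructor
  · intro hloop k hk
    rw [hcon]
    ext d : 1
    refine W.eq_zero_of_linSubst fun n w hw => (key d n w hw).2 (1 - rProd D * κ) (by omega) ?_ k hk
    by_cases hd : d ≤ 1
    · exact W.isBigO_of_le_one hs hD o α h1 hi hw hd
    by_cases hn : n ≤ d
    · have h2 := (isBigO_iff_comp_pow hN _ _ _ _).1 (hloop (d - n) n (by omega) w hw)
      refine (h2.trans (zpow_isBigO ?_)).congr' ?_ EventuallyEq.rfl
      · have : (1 : ℤ) ≤ rProd D := mod_cast hN
        nlinarith
      · filter_upwards [W.loopDifferential_eq hs α i (d - n) hw] with q hq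
        rw [hq, Nat.sub_add_cancel hn]
    · simp_rw [map_sum, coeff_sum, coeff_partSum_formSeries_eq_zero _ _ _ _ (not_le.1 hn), sum_const_zero]
      exact Asymptotics.isBigO_zero _ _
  · intro hcons h n hn w hw
    refine (isBigO_iff_comp_pow hN _ _ _ _).2 (((key (h + n) n w hw).1 fun k hk => ?_).congr' ?_ ?_)
    · rw [(hcon k).1 (hcons k hk), map_zero, map_zero, coeff_zero]
    · filter_upwards [W.loopDifferential_eq hs α i h hw] with q hq
      rw [hq]
    · exact .of_forall fun q => by simp only [mul_neg]

end Correlators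

/-- Functions in a finite-dimensional space are determined by their values at finitely many points. -/
lemma exists_interpolation {T : Type*} (V : Submodule ℂ (T → ℂ)) [FiniteDimensional ℂ V] :
    ∃ (X : Finset T) (φ : T → T → ℂ), (∀ x, φ x ∈ V) ∧ ∀ v ∈ V, ∀ t, v t = ∑ x ∈ X, φ x t * v x := by
  classical
  let E : T → Module.Dual ℂ V := fun t => LinearMap.proj t ∘ₗ V.subtype
  have htop : Submodule.span ℂ (Set.range E) = ⊤ := Submodule.span_eq_top_of_ne_zero fun z hz => by
    obtain ⟨t, ht⟩ := ne_iff.1 (Subtype.coe_injective.ne hz)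
    exact ⟨E t, ⟨t, rfl⟩, ht⟩
  let b := Module.finBasis ℂ V
  choose c hc using fun j => Finsupp.mem_span_range_iff_exists_finsupp.1 (htop ▸ Submodule.mem_top : b.coord j ∈ Submodule.span ℂ (Set.range E))
  refine ⟨univ.biUnion fun j => (c j).support, fun x => ∑ j, c j x • (b j : T → ℂ), fun x => V.sum_mem fun j _ => V.smul_mem _ (b j).2,
    fun v hv t => ?_⟩
  have h1 : ∀ j, b.repr ⟨v, hv⟩ j = ∑ x ∈ univ.biUnion fun j => (c j).support, c j x * v x := fun j => by
    rw [← Module.Basis.coord_apply, ← hc j, Finsupp.sum_of_support_subset _ (subset_biUnion_of_mem (fun j => (c j).support) (mem_univ j)) _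
      fun x _ => zero_smul ℂ (E x), LinearMap.sum_apply]
    rfl
  have h2 := congrArg (fun v : V => (v : T → ℂ) t) (b.sum_repr ⟨v, hv⟩)
  simp only [Submodule.coe_sum, Submodule.coe_smul, Finset.sum_apply, Pi.smul_apply, smul_eq_mul, h1] at h2
  rw [← h2]
  simp_rw [Finset.sum_apply, Pi.smul_apply, smul_eq_mul, sum_mul]
  rw [sum_comm]
  exact sum_congr rfl fun x _ => sum_congr rfl fun j _ => by ring

lemma eventually_update {n : ℕ} {p : (Fin n → ℂ) → Prop} (h : ∀ᶠ w in 𝓝 0, p w) (i : Fin n) :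
    ∀ᶠ w in 𝓝 (0 : Fin n → ℂ), ∀ᶠ u in 𝓝 (0 : ℂ), p (update w i u) := by
  have : Tendsto (fun x : (Fin n → ℂ) × ℂ => update x.1 i x.2) (𝓝 (0, 0)) (𝓝 0) :=
    (continuous_fst.update i continuous_snd).tendsto' _ _ (update_eq_self i 0)
  exact (this.eventually h).curry_nhds

/-- The tangent vectors at the points which are not in `𝔞̃`. -/
abbrev GenericVec (Γ : SpectralCurve S Y) := {t : TB S // t.proj ∉ Γ.ramT}

variable (D)

/-- The family of the tangent vectors `t j` for `j ∈ U`, and of coordinate vectors close to `𝔞̃` for `j ∉ U`. -/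
def mixedVec {n : ℕ} (U : Finset (Fin n)) (t : Fin n → GenericVec Γ) (μ : Fin n → Γ.ramT) (w : Fin n → ℂ) (j : Fin n) : TB S :=
  if j ∈ U then t j else coordVec (D.ζ (μ j)) (w j)

variable {D} {n : ℕ}

lemma update_mixedVec {U : Finset (Fin n)} {i : Fin n} (hi : i ∉ U) (t : Fin n → GenericVec Γ) (μ : Fin n → Γ.ramT) (w : Fin n → ℂ)
    (ν : Γ.ramT) (u : ℂ) : update (mixedVec D (insert i U) t μ w) i (coordVec (D.ζ ν) u) = mixedVec D U t (update μ i ν) (update w i u) := by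
  ext1 j
  by_cases h : j = i
  · subst h; simp [mixedVec, hi]
  · simp [mixedVec, h]

lemma mixedVec_update {U : Finset (Fin n)} {i : Fin n} (hi : i ∉ U) (t : Fin n → GenericVec Γ) (x : GenericVec Γ) (μ : Fin n → Γ.ramT)
    (w : Fin n → ℂ) : mixedVec D U (update t i x) μ w = mixedVec D U t μ w := by
  ext1 j
  by_cases h : j = i
  · subst h; simp [mixedVec, hi]
  · simp [mixedVec, h]

lemma eventually_mixedVec (μ : Fin n → Γ.ramT) : ∀ᶠ w in 𝓝 (0 : Fin n → ℂ), (∀ j, w j ≠ 0) → ∀ U t j, (mixedVec D U t μ w j).proj ∉ Γ.ramT := by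
  have h : ∀ᶠ w in 𝓝 (0 : Fin n → ℂ), ∀ j, w j ≠ 0 → (coordVec (D.ζ (μ j)) (w j)).proj ∉ Γ.ramT :=
    eventually_all.2 fun j => ((continuous_apply j).tendsto' (0 : Fin n → ℂ) 0 rfl).eventually
      (eventually_nhdsWithin_iff.1 (D.eventually_notMem (μ j)))
  filter_upwards [h] with w hw hw0 U t j
  rw [mixedVec]
  split_ifs
  · exact (t j).2
  · exact hw j (hw0 j)

lemma ev_mixedVec {η : MultiForm S n} (hη : IsMeromorphicForm Γ.ramT η) (U : Finset (Fin n)) (t : Fin n → GenericVec Γ)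
    (μ : Fin n → Γ.ramT) : ∃ (N : ℕ) (R : (Fin n → ℂ) → ℂ), AnalyticAt ℂ R 0 ∧
      ∀ᶠ w in 𝓝 0, (∀ j ∉ U, w j ≠ 0) → (∏ j ∈ Uᶜ, w j ^ N) * ev η (mixedVec D U t μ w) = R w := by
  classical
  let p : Fin n → S := fun j => if j ∈ U then (t j).1.proj else μ j
  let e : Fin n → OpenPartialHomeomorph S ℂ := fun j => if j ∈ U then chartAt ℂ (t j).1.proj else D.ζ (μ j)
  have he : ∀ j, e j ∈ coordinates S ∧ p j ∈ (e j).source := fun j => by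
    simp only [e, p]
    split_ifs
    · exact ⟨IsManifold.chart_mem_maximalAtlas _, mem_chart_source ℂ _⟩
    · exact ⟨D.ζ_mem _, D.mem_source _⟩
  have hp : ∀ j, p j ∈ Γ.ramT ↔ j ∉ U := fun j => by
    simp only [p]
    split_ifs with h
    · simp [h, (t j).2]
    · simp [h]
  have he0 : ∀ j ∉ U, e j (p j) = 0 := fun j hj => by simp only [e, p, if_neg hj]; exact D.ζ_center _
  obtain ⟨N, f, hf, h⟩ := hη p e he
  let X : (Fin n → ℂ) → Fin n → ℂ := fun w j => if j ∈ U then e j (p j) else w j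
  have hX0 : X 0 = fun j => e j (p j) := by
    ext j
    by_cases hj : j ∈ U
    · simp [X, hj]
    · simp [X, hj, he0 j hj]
  have hX : AnalyticAt ℂ X 0 := AnalyticAt.pi fun j => by
    by_cases hj : j ∈ U
    · simp only [X, if_pos hj]; exact analyticAt_const
    · simp only [X, if_neg hj]; exact (ContinuousLinearMap.proj (R := ℂ) (φ := fun _ : Fin n => ℂ) j).analyticAt 0
  have hc : ∀ j, ∃ c : ℂ, ∀ w, mixedVec D U t μ w j = ⟨(coordVec (e j) (X w j)).proj, c • (coordVec (e j) (X w j)).2⟩ := fun j => by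
    by_cases hj : j ∈ U
    · obtain ⟨c, hc⟩ := exists_smul_coordVec (he j).1 (t j).1 (by have := (he j).2; simpa only [p, if_pos hj] using this)
      refine ⟨c, fun w => ?_⟩
      rw [show X w j = e j (t j).1.proj by simp only [X, p, if_pos hj], mixedVec, if_pos hj]
      exact hc
    · refine ⟨1, fun w => ?_⟩
      rw [show X w j = w j from if_neg hj, show e j = D.ζ (μ j) from if_neg hj, mixedVec, if_neg hj, one_smul]
  choose c hc using hc
  refine ⟨N, fun w => (∏ j, c j) * f (X w), analyticAt_const.mul (hf.comp_of_eq hX hX0), ?_⟩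
  have h' := (hX.continuousAt.tendsto.mono_right (by rw [hX0])).eventually h
  filter_upwards [h'] with w hw hw0
  rw [← hw fun j hj => by
      have hj := (hp j).1 hj
      rw [he0 j hj]
      simpa only [X, if_neg hj] using hw0 j hj,
    ev_smul η c fun j => hc j w, mul_left_comm]
  congr 2
  rw [← prod_subset (subset_univ Uᶜ) fun j _ hj => if_neg fun h' => hj (mem_compl.2 ((hp j).1 h'))]
  refine prod_congr rfl fun j hj => ?_
  have hj := mem_compl.1 hj
  rw [if_pos ((hp j).2 hj), he0 j hj, sub_zero]
  simp only [X, if_neg hj]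

namespace Correlators

/-- The differentials `dξ^μ_{-k}` with `k ≤ K`. -/
def dxiSpan (K : ℕ) : Submodule ℂ (GenericVec Γ → ℂ) :=
  Submodule.span ℂ (Set.range fun a : Γ.ramT × Fin K => fun t => W.dxi (a.1, (a.2 : ℕ).succPNat) t)

lemma dxi_mem_dxiSpan (ν : Γ.ramT) {k K : ℕ} (h : k < K) : (fun t : GenericVec Γ => W.dxi (ν, k.succPNat) t) ∈ W.dxiSpan K :=
  Submodule.subset_span ⟨(ν, ⟨k, h⟩), rfl⟩

lemma dxiSpan_mono {K K' : ℕ} (h : K ≤ K') : W.dxiSpan K ≤ W.dxiSpan K' :=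
  Submodule.span_le.2 fun _ ⟨a, ha⟩ => ha ▸ W.dxi_mem_dxiSpan a.1 (a.2.2.trans_le h)

lemma hasRes_kernel_mul (ν : Γ.ramT) {F : ℂ → ℂ} (hF : AnalyticAt ℂ F 0) (K : ℕ) :
    ∃ v ∈ W.dxiSpan K, ∀ t : GenericVec Γ, HasRes (fun u => W.kernel ν t u * (F u * (u ^ K)⁻¹)) (v t) := by
  have hm : ∀ k : ℤ, HasRes (fun u => F u * u ^ k) (residue fun u => F u * u ^ k) := fun k =>
    MeromorphicAt.hasRes (hF.meromorphicAt.mul ((MeromorphicAt.id 0).zpow k))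
  refine ⟨∑ k ∈ range K, (residue fun u => F u * u ^ ((k : ℤ) + 1 - K)) • fun t : GenericVec Γ => W.dxi (ν, k.succPNat) t,
    Submodule.sum_mem _ fun k hk => Submodule.smul_mem _ _ (W.dxi_mem_dxiSpan ν (mem_range.1 hk)), fun t => ?_⟩
  have hk := (W.analyticAt_kernel ν (t := t) fun h => t.2 (h ▸ ν.2)).1
  obtain ⟨g, hg, h⟩ := AnalyticAt.taylor_eq hk (K + 1)
  have h0 : laurentCoeff (W.kernel ν t) 0 = 0 := by
    have h1 := h.self_of_nhds
    rw [sum_range_succ', sum_eq_zero fun k _ => by rw [pow_succ, mul_zero, mul_zero]] at h1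
    simpa [kernel] using h1.symm
  have h2 := (HasRes.sum (s := range K) fun k _ => (hm ((k : ℤ) + 1 - K)).const_mul (W.dxi (ν, k.succPNat) t)).add
    (HasRes.of_analyticAt ((analyticAt_id.mul hg).mul hF))
  rw [add_zero] at h2
  have e : (∑ k ∈ range K, (residue fun u => F u * u ^ ((k : ℤ) + 1 - K)) • fun t : GenericVec Γ => W.dxi (ν, k.succPNat) t) t =
      ∑ k ∈ range K, W.dxi (ν, k.succPNat) t * residue fun u => F u * u ^ ((k : ℤ) + 1 - K) := by
    rw [Finset.sum_apply]
    exact sum_congr rfl fun k _ => mul_comm _ _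
  rw [e]
  refine h2.congr ?_
  filter_upwards [h.filter_mono nhdsWithin_le_nhds, self_mem_nhdsWithin] with u hu hu0
  have hu0 : u ≠ 0 := hu0
  rw [hu, sum_range_succ', Nat.cast_zero, h0, zero_mul, add_zero, add_mul, sum_mul]
  congr 1
  · refine sum_congr rfl fun k _ => ?_
    rw [zpow_sub₀ hu0, zpow_natCast, show (k : ℤ) + 1 = ((k + 1 : ℕ) : ℤ) by push_cast; rfl, zpow_natCast, div_eq_mul_inv,
      show laurentCoeff (W.kernel ν t) ((k + 1 : ℕ) : ℤ) = W.dxi (ν, k.succPNat) t from rfl]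
    ring
  · rw [pow_succ]
    field_simp
    rfl

lemma hasRes_slice {η : MultiForm S n} (hη : IsMeromorphicForm Γ.ramT η) {U : Finset (Fin n)} {i : Fin n} (hi : i ∉ U)
    (x : Fin n → GenericVec Γ) (μ : Fin n → Γ.ramT) : ∃ K : ℕ, ∀ᶠ w in 𝓝 (0 : Fin n → ℂ), (∀ j, w j ≠ 0) → ∃ v ∈ W.dxiSpan K, ∀ t : GenericVec Γ,
        HasRes (fun u => W.kernel (μ i) t u * ev η (mixedVec D U x μ (update w i u))) (v t) := by
  classical
  obtain ⟨K, R, hR, h⟩ := ev_mixedVec (D := D) hη U x μ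
  refine ⟨K, ?_⟩
  filter_upwards [eventually_update (h.and hR.eventually_analyticAt) i] with w hw hw0
  obtain ⟨-, hRa⟩ := hw.self_of_nhds
  have hupd : AnalyticAt ℂ (fun u => update w i u) 0 := AnalyticAt.pi fun j => by
    by_cases hj : j = i
    · subst hj; simp only [update_self]; exact analyticAt_id
    · simp only [update_of_ne hj]; exact analyticAt_const
  obtain ⟨v, hv, hv'⟩ := W.hasRes_kernel_mul (μ i) (F := fun u => (∏ j ∈ Uᶜ.erase i, w j ^ K)⁻¹ * R (update w i u))
    (analyticAt_const.mul (hRa.comp_of_eq hupd rfl)) K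
  refine ⟨v, hv, fun t => (hv' t).congr ?_⟩
  filter_upwards [hw.filter_mono nhdsWithin_le_nhds, self_mem_nhdsWithin] with u hu hu0
  have hu0 : u ≠ 0 := hu0
  have h1 := hu.1 fun j hj => by
    by_cases hji : j = i
    · subst hji; rwa [update_self]
    · rw [update_of_ne hji]; exact hw0 j
  rw [← mul_prod_erase _ _ (mem_compl.2 hi), update_self, prod_congr rfl fun j hj => by
    rw [update_of_ne (ne_of_mem_erase hj)]] at h1
  have h2 : ∏ j ∈ Uᶜ.erase i, w j ^ K ≠ 0 := prod_ne_zero_iff.2 fun j _ => pow_ne_zero _ (hw0 j)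
  rw [← h1]
  field_simp

lemma projection_at (hW : W.ProjectionProperty) {h : ℕ} (hn : 1 ≤ n) (hst : 2 < h + n) (i : Fin n) {z : Fin n → TB S}
    (hz : ∀ j, (z j).proj ∉ Γ.ramT) : ev (W.form h n) z =
      ∑ ν, residue fun u => W.kernel ν (z i) u * ev (W.form h n) (update z i (coordVec (D.ζ ν) u)) := by
  obtain ⟨m, rfl⟩ := Nat.exists_eq_add_of_le' hn
  have hcons : ∀ x : TB S, update z i x ∘ Equiv.swap 0 i = Fin.cons x (Fin.tail (z ∘ Equiv.swap 0 i)) := fun x => by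
    ext1 j
    refine Fin.cases ?_ (fun j => ?_) j
    · simp
    · have : Equiv.swap 0 i j.succ ≠ i := fun h => Fin.succ_ne_zero j (by
        have := congrArg (Equiv.swap 0 i) h
        rwa [Equiv.swap_apply_self, Equiv.swap_apply_right] at this)
      simp [update_of_ne this, Fin.tail]
  have h0 := hcons (z i)
  rw [update_eq_self] at h0
  rw [← W.form_symm h (m + 1) hn hst z hz (Equiv.swap 0 i), h0, hW h m hst (z i) (Fin.tail (z ∘ Equiv.swap 0 i)) (hz i) fun j => hz _]
  refine sum_congr rfl fun ν _ => residue_congr ?_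
  filter_upwards [D.eventually_notMem ν] with u hu
  rw [← hcons, W.form_symm h (m + 1) hn hst]
  intro j
  by_cases hj : j = i
  · subst hj; rwa [update_self]
  · rw [update_of_ne hj]; exact hz j

/-- The products of the differentials `dξ` in the variables in `U`. -/
def dxiProducts (n : ℕ) (U : Finset (Fin n)) : Submodule ℂ ((Fin n → GenericVec Γ) → ℂ) :=
  Submodule.span ℂ (Set.range fun a : Fin n → Idx Γ => fun t => ∏ j ∈ U, W.dxi (a j) (t j))

lemma mul_mem_dxiProducts {U : Finset (Fin n)} {i : Fin n} (hi : i ∉ U) {Φ : (Fin n → GenericVec Γ) → ℂ} (hΦ : Φ ∈ W.dxiProducts n U)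
    {K : ℕ} {φ : GenericVec Γ → ℂ} (hφ : φ ∈ W.dxiSpan K) : (fun t => Φ t * φ (t i)) ∈ W.dxiProducts n (insert i U) := by
  have h : W.dxiProducts n U * (W.dxiSpan K).map (LinearMap.funLeft ℂ ℂ fun t => t i) ≤ W.dxiProducts n (insert i U) := by
    rw [dxiProducts, dxiSpan, Submodule.map_span, Submodule.span_mul_span, Submodule.span_le]
    rintro _ ⟨_, ⟨a, rfl⟩, _, ⟨_, ⟨b, rfl⟩, rfl⟩, rfl⟩
    refine Submodule.subset_span ⟨update a i (b.1, (b.2 : ℕ).succPNat), funext fun t => ?_⟩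
    change ∏ j ∈ insert i U, W.dxi (update a i (b.1, (b.2 : ℕ).succPNat) j) (t j) =
      (∏ j ∈ U, W.dxi (a j) (t j)) * W.dxi (b.1, (b.2 : ℕ).succPNat) (t i)
    rw [prod_insert hi, update_self, mul_comm]
    exact congrArg (· * _) (prod_congr rfl fun j hj => by rw [update_of_ne fun h : j = i => hi (h ▸ hj)])
  exact h (Submodule.mul_mem_mul hΦ ⟨φ, hφ, rfl⟩)

end Correlators

namespace Correlators

lemma projection_mixedVec (hW : W.ProjectionProperty) {h n : ℕ} (hn : 1 ≤ n) (hst : 2 < h + n) {U : Finset (Fin n)} {i : Fin n}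
    (hi : i ∉ U) (t : Fin n → GenericVec Γ) (μ : Fin n → Γ.ramT) {w : Fin n → ℂ}
    (hw : ∀ j, (mixedVec D (insert i U) t μ w j).proj ∉ Γ.ramT) {v : Γ.ramT → GenericVec Γ → ℂ}
    (hv : ∀ ν, HasRes (fun u => W.kernel ν (t i) u * ev (W.form h n) (mixedVec D U t (update μ i ν) (update w i u))) (v ν (t i))) :
    ev (W.form h n) (mixedVec D (insert i U) t μ w) = ∑ ν, v ν (t i) := by
  rw [W.projection_at hW hn hst i hw]
  refine sum_congr rfl fun ν _ => ?_
  simp_rw [update_mixedVec hi]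
  rw [show mixedVec D (insert i U) t μ w i = t i from if_pos (mem_insert_self _ _)]
  exact (hv ν).residue_eq

lemma exists_sampling (hW : W.ProjectionProperty) {h n : ℕ} (hn : 1 ≤ n) (hst : 2 < h + n) (a₀ : Idx Γ) (t₀ : GenericVec Γ)
    (U : Finset (Fin n)) : ∃ (ι : Type) (_ : Fintype ι) (x : ι → Fin n → GenericVec Γ) (Φ : ι → (Fin n → GenericVec Γ) → ℂ),
      (∀ l, Φ l ∈ W.dxiProducts n U) ∧ ∀ μ, ∀ᶠ w in 𝓝 (0 : Fin n → ℂ), (∀ j, w j ≠ 0) → ∀ t,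
        ev (W.form h n) (mixedVec D U t μ w) = ∑ l, Φ l t * ev (W.form h n) (mixedVec D U (x l) μ w) := by
  classical
  induction U using Finset.induction_on with
  | empty =>
    refine ⟨Unit, inferInstance, fun _ _ => t₀, fun _ _ => 1, fun _ => Submodule.subset_span ⟨fun _ => a₀, by simp⟩, fun μ =>
      .of_forall fun w _ t => ?_⟩
    rw [Fintype.sum_unique, one_mul]
    rfl
  | insert i U hi ih =>
    obtain ⟨ι, _, x, Φ, hΦ, hev⟩ := ih
    choose K hK using fun l μ => W.hasRes_slice (W.form_meromorphic h n hn hst) hi (x l) μ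
    obtain ⟨K', hK'⟩ : ∃ K', ∀ l μ, K l μ ≤ K' := ⟨univ.sup fun p : ι × (Fin n → Γ.ramT) => K p.1 p.2,
      fun l μ => le_sup (f := fun p : ι × (Fin n → Γ.ramT) => K p.1 p.2) (mem_univ (l, μ))⟩
    have : FiniteDimensional ℂ (W.dxiSpan K') := FiniteDimensional.span_of_finite ℂ (Set.finite_range _)
    obtain ⟨X, φ, hφ, hX⟩ := exists_interpolation (W.dxiSpan K')
    refine ⟨ι × Fin #X, inferInstance, fun p => update (x p.1) i (X.equivFin.symm p.2),
      fun p t => Φ p.1 t * φ (X.equivFin.symm p.2) (t i), fun p => W.mul_mem_dxiProducts hi (hΦ p.1) (hφ _), fun μ => ?_⟩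
    filter_upwards [eventually_mixedVec (D := D) μ, eventually_all.2 fun l => eventually_all.2 fun ν => hK l (update μ i ν),
      eventually_all.2 fun ν => eventually_update (hev (update μ i ν)) i] with w hgen hsl hup hw t
    choose v hv hres using fun l ν => hsl l ν hw
    simp only [update_self] at hres
    have hval : ∀ l (y : GenericVec Γ), ev (W.form h n) (mixedVec D (insert i U) (update (x l) i y) μ w) = ∑ ν, v l ν y := by
      intro l y
      have := W.projection_mixedVec hW hn hst hi (update (x l) i y) μ (hgen hw _ _) (v := v l) (by
        simp only [update_self, mixedVec_update hi]
        exact fun ν => hres l ν y)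
      rwa [update_self] at this
    have hmem : ∀ l, (∑ ν, v l ν) ∈ W.dxiSpan K' := fun l => Submodule.sum_mem _ fun ν _ => W.dxiSpan_mono (hK' l _) (hv l ν)
    rw [W.projection_mixedVec hW hn hst hi t μ (hgen hw _ _) (v := fun ν y => ∑ l, Φ l t * v l ν y) fun ν =>
      (HasRes.sum (s := univ) fun l _ => (hres l ν (t i)).const_mul (Φ l t)).congr (by
        filter_upwards [(hup ν).filter_mono nhdsWithin_le_nhds, self_mem_nhdsWithin] with u hu hu0
        rw [hu (fun j => by
          by_cases hj : j = i
          · subst hj; rwa [update_self]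
          · rw [update_of_ne hj]; exact hw j) t, mul_sum]
        exact sum_congr rfl fun l _ => by ring), sum_comm, Fintype.sum_prod_type]
    refine sum_congr rfl fun l _ => ?_
    simp only [hval]
    have h1 := hX _ (hmem l) (t i)
    simp only [Finset.sum_apply] at h1
    rw [← mul_sum, h1, ← sum_coe_sort X, ← Equiv.sum_comp X.equivFin.symm, mul_sum]
    exact sum_congr rfl fun k _ => by ring

lemma exists_isDecomposition (hW : W.ProjectionProperty) : ∃ F : Coefficients Γ, W.IsDecomposition F := by
  classical
  suffices h : ∀ h n : ℕ, ∃ f : (Fin n → Idx Γ) →₀ ℂ, 1 ≤ n → 2 < h + n → ∀ t : Fin n → TB S, (∀ i, (t i).proj ∉ Γ.ramT) →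
      ev (W.form h n) t = f.sum fun a c => c * ∏ i, W.dxi (a i) (t i) by
    choose F hF using h
    exact ⟨F, hF⟩
  intro h n
  by_cases hne : 1 ≤ n ∧ 2 < h + n ∧ Nonempty (Idx Γ) ∧ Nonempty (GenericVec Γ)
  · obtain ⟨hn, hst, ⟨a₀⟩, ⟨t₀⟩⟩ := hne
    obtain ⟨ι, _, x, Φ, hΦ, hev⟩ := W.exists_sampling hW hn hst a₀ t₀ univ
    have htend : Tendsto (fun (u : ℂ) (_ : Fin n) => u) (𝓝[≠] 0) (𝓝 0) :=
      ((continuous_pi fun _ => continuous_id).tendsto' _ _ rfl).mono_left nhdsWithin_le_nhds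
    obtain ⟨u, hu, hu0⟩ := ((htend.eventually (hev fun _ => a₀.1)).and self_mem_nhdsWithin).exists
    have hmix : ∀ t : Fin n → GenericVec Γ, mixedVec D univ t (fun _ => a₀.1) (fun _ => u) = fun j => (t j : TB S) := fun t =>
      funext fun j => if_pos (mem_univ j)
    have hmem : (fun t : Fin n → GenericVec Γ => ev (W.form h n) fun j => (t j : TB S)) ∈ W.dxiProducts n univ := by
      have : (fun t : Fin n → GenericVec Γ => ev (W.form h n) fun j => (t j : TB S)) =
          ∑ l, (ev (W.form h n) fun j => (x l j : TB S)) • Φ l := funext fun t => by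
        rw [Finset.sum_apply, ← hmix t, hu (fun _ => hu0) t]
        simp only [hmix]
        exact sum_congr rfl fun l _ => mul_comm _ _
      rw [this]
      exact Submodule.sum_mem _ fun l _ => Submodule.smul_mem _ _ (hΦ l)
    obtain ⟨f, hf⟩ := Finsupp.mem_span_range_iff_exists_finsupp.1 hmem
    refine ⟨f, fun _ _ t ht => ?_⟩
    have := congrFun hf fun j => ⟨t j, ht j⟩
    rw [Finsupp.sum, Finset.sum_apply] at this
    exact this.symm
  · refine ⟨0, fun hn hst t ht => ?_⟩
    have hem : IsEmpty Γ.ramT := ⟨fun μ => hne ⟨hn, hst, ⟨(μ, 1)⟩, ⟨⟨t ⟨0, hn⟩, ht _⟩⟩⟩⟩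
    rw [W.projection_at hW hn hst ⟨0, hn⟩ ht, Fintype.sum_empty, Finsupp.sum_zero_index]

end Correlators

end WLoop

end

theorem mainTheorem5
    {S C : Type*} [TopologicalSpace S] [T2Space S] [ChartedSpace ℂ S] [IsManifold 𝓘(ℂ) ω S]
    [TopologicalSpace C] [T2Space C]
    (𝒞 : WLoop.SpectralCurve S C) (D : WLoop.LocalCoords 𝒞) (o : WLoop.BranchOrder D)
    (hs : ∀ μ, 1 ≤ D.s μ) (hD : D.NonDegenerate)
    (W : WLoop.Correlators D) (hW : W.ProjectionProperty) :
    (∃ F : ∀ _ n : ℕ, (Fin n → WLoop.Idx 𝒞) →₀ ℂ, W.IsDecomposition F) ∧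
    ∀ F : ∀ _ n : ℕ, (Fin n → WLoop.Idx 𝒞) →₀ ℂ, W.IsDecomposition F →
      (W.AbstractLoopEquations o ↔
        ∀ (α : 𝒞.ram) (i : ℕ) (k : ℤ), (α, i, k) ∈ o.modeSet →
          WLoop.fexp (-WLoop.freeEnergy F) *
            WLoop.act (W.H α i k) (WLoop.fexp (WLoop.freeEnergy F)) = 0) := by
  refine ⟨W.exists_isDecomposition hW, fun F hF => ⟨fun h α i k hk => ?_, fun h g n hn α i h1 hi => ?_⟩⟩
  · exact (W.loopEquations_iff hs hD o hF α hk.1 hk.2.1).1 (fun g n hn => h g n hn α i hk.1 hk.2.1) k hk.2.2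
  · exact (W.loopEquations_iff hs hD o hF α h1 hi).2 (fun k hk => h α i k ⟨h1, hi, hk⟩) g n hn
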